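/- Let $n,m\ge 0$ and let $(M,\widetilde{\mathcal O})$ be a complex supermanifold of dimension $n|m$: a topological space $M$ with a sheaf $\widetilde{\mathcal O}$ of supercommutative complex superalgebras such that $(M,\widetilde{\mathcal O})$ is locally isomorphic to the model superspace $(\mathbb C^n,\Lambda_{\mathcal O}[\xi_1,\dots,\xi_m])$, where $\mathcal O$ is the sheaf of holomorphic functions on $\mathbb C^n$ and the $\xi_i$ are odd. Let $\mathcal I\subset\widetilde{\mathcal O}$ be the sheaf of ideals generated by the odd elements (with $\mathcal I^r:=\widetilde{\mathcal O}$ for $r\le 0$), let $\operatorname{gr}\widetilde{\mathcal O}=\bigoplus_{p}\mathcal I^p/\mathcal I^{p+1}$ be the associated $\mathbb Z$-graded sheaf of superalgebras, with parity the degree modulo $2$, and let $\operatorname{Der}\widetilde{\mathcal O}$ be the sheaf of germs of $\mathbb C$-linear superderivations of $\widetilde{\mathcal O}$, with the supercommutator as bracket. Put $$\operatorname{Der}_{(-1)}\widetilde{\mathcal O}=\operatorname{Der}\widetilde{\mathcal O},\qquad \operatorname{Der}_{(p)}\widetilde{\mathcal O}=\{\delta\in\operatorname{Der}\widetilde{\mathcal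 O}\mid \delta\widetilde{\mathcal O}\subset\mathcal I^p,\ \delta\mathcal I\subset\mathcal I^{p+1}\}\quad(p\ge 0),$$ and $\operatorname{Der}_{(p)}\widetilde{\mathcal O}=\operatorname{Der}\widetilde{\mathcal O}$ for $p<-1$. Let $\operatorname{gr}\operatorname{Der}\widetilde{\mathcal O}=\bigoplus_p\operatorname{Der}_{(p)}\widetilde{\mathcal O}/\operatorname{Der}_{(p+1)}\widetilde{\mathcal O}$ be the associated graded sheaf, and grade $\operatorname{Der}\operatorname{gr}\widetilde{\mathcal O}$ by letting $\operatorname{Der}_p$ consist of the derivations that map $\operatorname{gr}_q\widetilde{\mathcal O}$ into $\operatorname{gr}_{q+p}\widetilde{\mathcal O}$ for all $q$. All $\mathbb Z$-gradings of Lie superalgebras are meant to be compatible with the parity (elements of degree $p$ have parity $p$ modulo $2$). 1. $\operatorname{Der}\widetilde{\mathcal O}$, with the subsheaves $\operatorname{Der}_{(p)}\widetilde{\mathcal O}$, is a sheaf of filtered Lie superalgebras; in particular $[\operatorname{Der}_{(p)}\widetilde{\mathcal O},\operatorname{Der}_{(q)}\widetilde{\mathcal O}]\subset\operatorname{Der}_{(p+q)}\widetilde{\mathcal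 O}$. 2. The sections of $\operatorname{gr}\operatorname{Der}\widetilde{\mathcal O}$ and of $\operatorname{Der}\operatorname{gr}\widetilde{\mathcal O}$ over every open set form graded Lie superalgebras. There is a unique isomorphism of sheaves of graded Lie superalgebras $\operatorname{gr}\operatorname{Der}\widetilde{\mathcal O}\to\operatorname{Der}\operatorname{gr}\widetilde{\mathcal O}$ that sends the class of $\delta\in\operatorname{Der}_{(p)}\widetilde{\mathcal O}$ to the derivation $\tilde\delta$ given by $\tilde\delta(a+\mathcal I^{r+1})=\delta a+\mathcal I^{r+p+1}$ for all $r$ and $a\in\mathcal I^r$. 3. The Lie superalgebra $\mathfrak d=\Gamma(M,\operatorname{Der}\widetilde{\mathcal O})$ is filtered by $\mathfrak d_{(p)}=\Gamma(M,\operatorname{Der}_{(p)}\widetilde{\mathcal O})$, and $\operatorname{gr}\mathfrak d=\bigoplus_p\mathfrak d_{(p)}/\mathfrak d_{(p+1)}$ is a graded Lie superalgebra. The map $\delta\mapsto\tilde\delta$ induces a well-defined injective homomorphism of graded Lie superalgebras $\operatorname{gr}\mathfrak d\to\Gamma(M,\operatorname{Der}\operatorname{gr}\widetilde{\mathcal O})$.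 4. If $M$ is compact, then $\dim_{\mathbb C}\mathfrak d<\infty$. -/

import Mathlib

open TopologicalSpace

universe u v

noncomputable section

namespace SuperGeom

/-! ### The associated graded object of a decreasing filtration -/

section Gr

variable {L L' N : Type*} [AddCommGroup L] [Module ℂ L] [AddCommGroup L'] [Module ℂ L']
  [AddCommGroup N] [Module ℂ N]

/-- Families of subspaces indexed by the integers. -/
abbrev Fil (L : Type*) [AddCommGroup L] [Module ℂ L] : Type _ := ℤ → Submodule ℂ L

/-- The `p`-th graded piece `F_p / F_{p+1}`. -/
abbrev GrPiece (F : Fil L) (p : ℤ) : Type _ :=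
  F p ⧸ (F (p + 1)).submoduleOf (F p)

/-- The associated graded space `⨁ p, F_p / F_{p+1}`. -/
def Gr (F : Fil L) : Type _ := DirectSum ℤ (GrPiece F)

instance (F : Fil L) : AddCommGroup (Gr F) :=
  inferInstanceAs (AddCommGroup (DirectSum ℤ (GrPiece F)))

instance (F : Fil L) : Module ℂ (Gr F) :=
  inferInstanceAs (Module ℂ (DirectSum ℤ (GrPiece F)))

namespace Gr

/-- The associated graded space is the direct sum of its pieces. -/
def equivSum (F : Fil L) : Gr F ≃ₗ[ℂ] DirectSum ℤ (GrPiece F) :=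
  LinearEquiv.refl ℂ _

/-- The class in `F_p / F_{p+1}` of an element of `F_p`, viewed in the associated graded space. -/
def cl (F : Fil L) (p : ℤ) : F p →ₗ[ℂ] Gr F :=
  (equivSum F).symm.toLinearMap ∘ₗ (DirectSum.lof ℂ ℤ (GrPiece F) p) ∘ₗ (Submodule.mkQ _)

/-- The homogeneous component of degree `p` of the associated graded space. -/
def deg (F : Fil L) (p : ℤ) : Submodule ℂ (Gr F) := LinearMap.range (cl F p)

theorem cl_eq_zero (F : Fil L) (p : ℤ) (x : F p) (hx : (x : L) ∈ F (p + 1)) :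
    cl F p x = 0 := by
  have : (Submodule.mkQ ((F (p + 1)).submoduleOf (F p))) x = 0 := by
    rw [Submodule.mkQ_apply, Submodule.Quotient.mk_eq_zero]; exact hx
  rw [cl, LinearMap.comp_apply, LinearMap.comp_apply, this, map_zero, map_zero]

theorem mem_of_cl_eq_zero (F : Fil L) (p : ℤ) (x : F p) (hx : cl F p x = 0) :
    (x : L) ∈ F (p + 1) := by
  rw [cl, LinearMap.comp_apply, LinearMap.comp_apply, LinearEquiv.coe_coe,
    LinearEquiv.map_eq_zero_iff] at hx
  have h := DirectSum.of_injective (β := GrPiece F) p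
    (hx.trans (map_zero (DirectSum.of (GrPiece F) p)).symm)
  rw [Submodule.mkQ_apply, Submodule.Quotient.mk_eq_zero] at h
  exact h

theorem cl_congr (F : Fil L) {p q : ℤ} (h : p = q) (x : F p) (y : F q)
    (hxy : (x : L) = y) : cl F p x = cl F q y := by
  subst h
  rw [Subtype.ext hxy]

/-- A linear map out of the associated graded space, given on classes. -/
def lift (F : Fil L) (f : ∀ p, F p →ₗ[ℂ] N)
    (hf : ∀ p (x : F p), (x : L) ∈ F (p + 1) → f p x = 0) : Gr F →ₗ[ℂ] N :=
  (DirectSum.toModule ℂ ℤ N fun p =>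
    Submodule.liftQ _ (f p) fun x hx => by
      rw [LinearMap.mem_ker]; exact hf p x hx) ∘ₗ (equivSum F).toLinearMap

@[simp] theorem lift_cl (F : Fil L) (f : ∀ p, F p →ₗ[ℂ] N)
    (hf : ∀ p (x : F p), (x : L) ∈ F (p + 1) → f p x = 0) (p : ℤ) (x : F p) :
    lift F f hf (cl F p x) = f p x := by
  rw [lift, cl, LinearMap.comp_apply, LinearMap.comp_apply, LinearMap.comp_apply,
    LinearEquiv.coe_coe, LinearEquiv.coe_coe, LinearEquiv.apply_symm_apply,
    DirectSum.toModule_lof, Submodule.mkQ_apply, Submodule.liftQ_apply]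

@[elab_as_elim]
theorem induction {F : Fil L} {P : Gr F → Prop} (t : Gr F) (zero : P 0)
    (cl : ∀ p x, P (cl F p x)) (add : ∀ s t, P s → P t → P (s + t)) : P t := by
  refine DirectSum.induction_on (motive := P) t zero (fun p x => ?_) add
  obtain ⟨x, rfl⟩ := Submodule.Quotient.mk_surjective _ x
  exact cl p x

theorem hom_ext {F : Fil L} {f g : Gr F →ₗ[ℂ] N}
    (h : ∀ p x, f (cl F p x) = g (cl F p x)) : f = g := by
  ext t
  induction t using induction with
  | zero => rw [map_zero, map_zero]
  | cl p x => exact h p x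
  | add s t hs ht => rw [map_add, map_add, hs, ht]

/-- The map of associated graded spaces induced by a filtered linear map. -/
def map {F : Fil L} {F' : Fil L'} (f : L →ₗ[ℂ] L')
    (hf : ∀ p, ∀ x ∈ F p, f x ∈ F' p) : Gr F →ₗ[ℂ] Gr F' :=
  lift F (fun p => cl F' p ∘ₗ f.restrict (hf p)) fun p x hx =>
    cl_eq_zero F' p _ (hf (p + 1) x hx)

@[simp] theorem map_cl {F : Fil L} {F' : Fil L'} (f : L →ₗ[ℂ] L')
    (hf : ∀ p, ∀ x ∈ F p, f x ∈ F' p) (p : ℤ) (x : F p) :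
    map f hf (cl F p x) = cl F' p ⟨f x, hf p x x.2⟩ := by
  rw [map, lift_cl]; rfl

/-- The bilinear operation on the associated graded space induced by a filtered bilinear
operation: `(cl_p x, cl_q y) ↦ cl_{p+q} (B x y)`. -/
def bil {F : Fil L} (B : L →ₗ[ℂ] L →ₗ[ℂ] L)
    (hB : ∀ p q, ∀ x ∈ F p, ∀ y ∈ F q, B x y ∈ F (p + q)) : Gr F →ₗ[ℂ] Gr F →ₗ[ℂ] Gr F :=
  lift F
    (fun p => LinearMap.mk₂ ℂ
      (fun (x : F p) t => lift F
        (fun q => cl F (p + q) ∘ₗ (B x).restrict (hB p q x x.2))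
        (fun q y hy => cl_eq_zero F _ _ (by
          have := hB p (q + 1) x x.2 y hy
          rwa [← add_assoc] at this)) t)
      (fun x x' t => by
        rw [← LinearMap.add_apply]
        refine LinearMap.congr_fun (hom_ext fun q y => ?_) t
        rw [LinearMap.add_apply, lift_cl, lift_cl, lift_cl, LinearMap.comp_apply,
          LinearMap.comp_apply, LinearMap.comp_apply, ← map_add]
        congr 1
        ext
        simp [LinearMap.restrict_apply])
      (fun c x t => by
        rw [← LinearMap.smul_apply]
        refine LinearMap.congr_fun (hom_ext fun q y => ?_) t
        rw [LinearMap.smul_apply, lift_cl, lift_cl, LinearMap.comp_apply,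
          LinearMap.comp_apply, ← map_smul]
        congr 1
        ext
        simp [LinearMap.restrict_apply])
      (fun x s t => by rw [map_add])
      (fun c x t => by rw [map_smul]))
    (fun p x hx => hom_ext fun q y => by
      rw [LinearMap.mk₂_apply, lift_cl, LinearMap.comp_apply, LinearMap.zero_apply]
      refine cl_eq_zero F _ _ ?_
      have := hB (p + 1) q x hx y y.2
      rwa [add_right_comm] at this)

@[simp] theorem bil_cl {F : Fil L} (B : L →ₗ[ℂ] L →ₗ[ℂ] L)
    (hB : ∀ p q, ∀ x ∈ F p, ∀ y ∈ F q, B x y ∈ F (p + q)) (p q : ℤ) (x : F p) (y : F q) :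
    bil B hB (cl F p x) (cl F q y) = cl F (p + q) ⟨B x y, hB p q x x.2 y y.2⟩ := by
  rw [bil, lift_cl, LinearMap.mk₂_apply, lift_cl]
  rfl

theorem map_bil {F : Fil L} {F' : Fil L'} (f : L →ₗ[ℂ] L')
    (hf : ∀ p, ∀ x ∈ F p, f x ∈ F' p) (B : L →ₗ[ℂ] L →ₗ[ℂ] L) (B' : L' →ₗ[ℂ] L' →ₗ[ℂ] L')
    (hB : ∀ p q, ∀ x ∈ F p, ∀ y ∈ F q, B x y ∈ F (p + q))
    (hB' : ∀ p q, ∀ x ∈ F' p, ∀ y ∈ F' q, B' x y ∈ F' (p + q))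
    (hfB : ∀ x y, f (B x y) = B' (f x) (f y)) (s t : Gr F) :
    map f hf (bil B hB s t) = bil B' hB' (map f hf s) (map f hf t) := by
  induction s using induction with
  | zero => simp
  | add s s' hs hs' => simp [hs, hs']
  | cl p x =>
    induction t using induction with
    | zero => simp
    | add t t' ht ht' => simp only [map_add, ht, ht']
    | cl q y =>
      simp only [bil_cl, map_cl]
      exact cl_congr _ rfl _ _ (hfB x y)

/-- The projection of the associated graded space onto its component of degree `p`. -/
def degProj (F : Fil L) (p : ℤ) : Gr F →ₗ[ℂ] Gr F :=
  lift F (fun q => if q = p then cl F q else 0) fun q x hx => by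
    split_ifs
    · exact cl_eq_zero F q x hx
    · rfl

theorem degProj_cl (F : Fil L) (p q : ℤ) (x : F q) :
    degProj F p (cl F q x) = if q = p then cl F q x else 0 := by
  rw [degProj, lift_cl]
  split_ifs <;> rfl

theorem degProj_mem (F : Fil L) (p : ℤ) (t : Gr F) :
    ∃ x : F p, degProj F p t = cl F p x := by
  induction t using induction with
  | zero => exact ⟨0, by simp⟩
  | add s t hs ht =>
    obtain ⟨x, hx⟩ := hs
    obtain ⟨y, hy⟩ := ht
    exact ⟨x + y, by rw [map_add, map_add, hx, hy]⟩
  | cl q x =>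
    rw [degProj_cl]
    split_ifs with h
    · subst h; exact ⟨x, rfl⟩
    · exact ⟨0, by simp⟩

theorem exists_eq_sum_degProj (F : Fil L) (t : Gr F) :
    ∃ S : Finset ℤ, ∀ S', S ⊆ S' → t = ∑ p ∈ S', degProj F p t := by
  classical
  induction t using induction with
  | zero => exact ⟨∅, fun S' _ => by simp⟩
  | add s t hs ht =>
    obtain ⟨S, hS⟩ := hs
    obtain ⟨T, hT⟩ := ht
    refine ⟨S ∪ T, fun S' h => ?_⟩
    simp only [map_add, Finset.sum_add_distrib]
    rw [← hS S' (Finset.union_subset_left h), ← hT S' (Finset.union_subset_right h)]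
  | cl q x =>
    refine ⟨{q}, fun S' h => ?_⟩
    simp only [degProj_cl, Finset.sum_ite_eq]
    rw [if_pos (Finset.singleton_subset_iff.1 h)]

theorem degProj_map {F : Fil L} {F' : Fil L'} (f : L →ₗ[ℂ] L')
    (hf : ∀ p, ∀ x ∈ F p, f x ∈ F' p) (p : ℤ) (t : Gr F) :
    degProj F' p (map f hf t) = map f hf (degProj F p t) := by
  induction t using induction with
  | zero => simp
  | add s t hs ht => simp only [map_add, hs, ht]
  | cl q x =>
    rw [map_cl, degProj_cl, degProj_cl]
    split_ifs
    · rw [map_cl]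
    · rw [map_zero]

/-- The projection of the associated graded space onto the sum of the components whose degree has
the parity `i`. -/
def parityProj (F : Fil L) (i : ZMod 2) : Gr F →ₗ[ℂ] Gr F :=
  lift F (fun p => if (p : ZMod 2) = i then cl F p else 0) fun p x hx => by
    split_ifs
    · exact cl_eq_zero F p x hx
    · rfl

theorem parityProj_cl (F : Fil L) (i : ZMod 2) (p : ℤ) (x : F p) :
    parityProj F i (cl F p x) = if (p : ZMod 2) = i then cl F p x else 0 := by
  rw [parityProj, lift_cl]
  split_ifs <;> rfl

/-- The part of the associated graded space spanned by the classes of elements of a subspace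
(applied to the even and to the odd part: the parity inherited by the associated graded space). -/
def inherited (F : Fil L) (P : Submodule ℂ L) : Submodule ℂ (Gr F) :=
  Submodule.span ℂ {t | ∃ p, ∃ x : F p, (x : L) ∈ P ∧ t = cl F p x}

end Gr

end Gr

/-! ### The associated graded algebra -/

section GrAlgebra

variable {A A' : Type*} [Ring A] [Algebra ℂ A] [Ring A'] [Algebra ℂ A']

/-- A decreasing filtration of an algebra, compatible with the multiplication. -/
class IsAlgFiltration (F : Fil A) : Prop where
  antitone : Antitone F
  one_mem : (1 : A) ∈ F 0
  mul_mem : ∀ p q, ∀ x ∈ F p, ∀ y ∈ F q, x * y ∈ F (p + q)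

namespace Gr

variable (F : Fil A) [IsAlgFiltration F]

/-- Multiplication of the associated graded algebra. -/
def mulHom : Gr F →ₗ[ℂ] Gr F →ₗ[ℂ] Gr F :=
  bil (LinearMap.mul ℂ A) (IsAlgFiltration.mul_mem (F := F))

instance : Mul (Gr F) := ⟨fun s t => mulHom F s t⟩

instance : One (Gr F) := ⟨cl F 0 ⟨1, IsAlgFiltration.one_mem⟩⟩

theorem mul_def (s t : Gr F) : s * t = mulHom F s t := rfl

theorem one_def : (1 : Gr F) = cl F 0 ⟨1, IsAlgFiltration.one_mem⟩ := rfl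

theorem cl_mul_cl (p q : ℤ) (x : F p) (y : F q) :
    cl F p x * cl F q y = cl F (p + q) ⟨x.1 * y.1, IsAlgFiltration.mul_mem (F := F) p q x x.2 y y.2⟩ :=
  bil_cl _ _ p q x y

instance : Ring (Gr F) :=
  { (inferInstance : AddCommGroup (Gr F)), (inferInstance : Mul (Gr F)),
    (inferInstance : One (Gr F)) with
    left_distrib := fun a b c => by simp only [mul_def, map_add]
    right_distrib := fun a b c => by simp only [mul_def, map_add, LinearMap.add_apply]
    zero_mul := fun a => by simp only [mul_def, map_zero, LinearMap.zero_apply]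
    mul_zero := fun a => by simp only [mul_def, map_zero]
    mul_assoc := fun a b c => by
      induction a using induction with
      | zero => simp only [mul_def, map_zero, LinearMap.zero_apply]
      | add s t hs ht =>
        simp only [mul_def, map_add, LinearMap.add_apply] at *
        rw [hs, ht]
      | cl p x =>
      induction b using induction with
      | zero => simp only [mul_def, map_zero, LinearMap.zero_apply]
      | add s t hs ht =>
        simp only [mul_def, map_add, LinearMap.add_apply] at *
        rw [hs, ht]
      | cl q y =>
      induction c using induction with
      | zero => simp only [mul_def, map_zero]
      | add s t hs ht =>
        simp only [mul_def, map_add] at *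
        rw [hs, ht]
      | cl r z =>
        simp only [cl_mul_cl]
        exact cl_congr F (add_assoc p q r) _ _ (mul_assoc _ _ _)
    one_mul := fun a => by
      induction a using induction with
      | zero => simp only [mul_def, map_zero]
      | add s t hs ht =>
        rw [mul_def, map_add, ← mul_def, ← mul_def, hs, ht]
      | cl p x =>
        rw [one_def, cl_mul_cl]
        exact cl_congr F (zero_add p) _ _ (one_mul _)
    mul_one := fun a => by
      induction a using induction with
      | zero => simp only [mul_def, map_zero, LinearMap.zero_apply]
      | add s t hs ht =>
        rw [mul_def, map_add, LinearMap.add_apply, ← mul_def, ← mul_def, hs, ht]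
      | cl p x =>
        rw [one_def, cl_mul_cl]
        exact cl_congr F (add_zero p) _ _ (mul_one _) }

instance : Algebra ℂ (Gr F) :=
  Algebra.ofModule
    (fun c s t => by simp only [mul_def, map_smul, LinearMap.smul_apply])
    (fun c s t => by simp only [mul_def, map_smul])

variable {F} {F' : Fil A'} [IsAlgFiltration F']

/-- The homomorphism of associated graded algebras induced by a filtered homomorphism. -/
def mapAlg (f : A →ₐ[ℂ] A') (hf : ∀ p, ∀ x ∈ F p, f x ∈ F' p) : Gr F →ₐ[ℂ] Gr F' :=
  AlgHom.ofLinearMap (map f.toLinearMap hf)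
    ((map_cl _ _ 0 _).trans (cl_congr F' rfl _ _ (map_one f)))
    (fun s t => map_bil f.toLinearMap hf _ _ _ _ (fun x y => map_mul f x y) s t)

@[simp] theorem mapAlg_cl (f : A →ₐ[ℂ] A') (hf : ∀ p, ∀ x ∈ F p, f x ∈ F' p) (p : ℤ) (x : F p) :
    mapAlg f hf (cl F p x) = cl F' p ⟨f x, hf p x x.2⟩ :=
  map_cl f.toLinearMap hf p x

variable (F)


/-- The parity of the associated graded algebra: the degree modulo `2`. -/
def parity (i : ZMod 2) : Submodule ℂ (Gr F) := ⨆ p : {p : ℤ // (p : ZMod 2) = i}, deg F p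

theorem cl_mem_parity (p : ℤ) (x : F p) : cl F p x ∈ parity F (p : ZMod 2) :=
  Submodule.mem_iSup_of_mem (p := fun p' : {p' : ℤ // (p' : ZMod 2) = (p : ZMod 2)} => deg F p')
    ⟨p, rfl⟩ ⟨x, rfl⟩

theorem parityProj_mem (i : ZMod 2) (t : Gr F) : parityProj F i t ∈ parity F i := by
  induction t using induction with
  | zero => rw [map_zero]; exact zero_mem _
  | add s t hs ht => rw [map_add]; exact add_mem hs ht
  | cl p x =>
    rw [parityProj_cl]
    split_ifs with h
    · subst h; exact cl_mem_parity F p x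
    · exact zero_mem _

theorem parityProj_eq (i : ZMod 2) (t : Gr F) (ht : t ∈ parity F i) : parityProj F i t = t := by
  refine Submodule.iSup_induction _ (motive := fun t => parityProj F i t = t) ht ?_ (map_zero _)
    fun s t hs ht => by rw [map_add, hs, ht]
  rintro ⟨p, hp⟩ _ ⟨x, rfl⟩
  rw [parityProj_cl, if_pos hp]

theorem parityProj_ne (i j : ZMod 2) (hij : i ≠ j) (t : Gr F) (ht : t ∈ parity F i) :
    parityProj F j t = 0 := by
  refine Submodule.iSup_induction _ (motive := fun t => parityProj F j t = 0) ht ?_ (map_zero _)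
    fun s t hs ht => by rw [map_add, hs, ht, add_zero]
  rintro ⟨p, hp⟩ _ ⟨x, rfl⟩
  rw [parityProj_cl, if_neg]
  rw [hp]; exact hij

theorem sum_parityProj (t : Gr F) : ∑ i, parityProj F i t = t := by
  induction t using induction with
  | zero => simp
  | add s t hs ht => simp only [map_add, Finset.sum_add_distrib, hs, ht]
  | cl p x => simp [parityProj_cl]

instance : SetLike.GradedMonoid (parity F) where
  one_mem := by
    have := cl_mem_parity F 0 ⟨1, IsAlgFiltration.one_mem⟩
    rwa [Int.cast_zero] at this
  mul_mem i j s t hs ht := by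
    refine Submodule.iSup_induction _ (motive := fun s => s * t ∈ parity F (i + j)) hs ?_
      (by rw [zero_mul]; exact zero_mem _) fun s s' hs hs' => by rw [add_mul]; exact add_mem hs hs'
    rintro ⟨p, rfl⟩ _ ⟨x, rfl⟩
    refine Submodule.iSup_induction _
      (motive := fun t => cl F p x * t ∈ parity F ((p : ZMod 2) + j)) ht ?_
      (by rw [mul_zero]; exact zero_mem _) fun s s' hs hs' => by rw [mul_add]; exact add_mem hs hs'
    rintro ⟨q, rfl⟩ _ ⟨y, rfl⟩
    rw [cl_mul_cl, ← Int.cast_add]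
    exact cl_mem_parity F _ _

instance : DirectSum.Decomposition (parity F) where
  decompose' t := ∑ i, DirectSum.of (fun i => parity F i) i ⟨parityProj F i t, parityProj_mem F i t⟩
  left_inv t := by
    simp only [map_sum, DirectSum.coeAddMonoidHom_of]
    exact sum_parityProj F t
  right_inv t := by
    induction t using DirectSum.induction_on with
    | zero =>
      refine Finset.sum_eq_zero fun i _ => ?_
      refine (congrArg (DirectSum.of (fun i => parity F i) i) (Subtype.ext ?_)).trans (map_zero _)
      exact (congrArg _ (map_zero _)).trans (map_zero (parityProj F i))
    | of i x =>
      rw [DirectSum.coeAddMonoidHom_of]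
      refine (Finset.sum_eq_single i ?_ ?_).trans ?_
      · intro j _ hj
        rw [← map_zero (DirectSum.of (fun i => parity F i) j)]
        congr 1
        exact Subtype.ext (parityProj_ne F i j hj.symm _ x.2)
      · simp
      · congr 1
        exact Subtype.ext (parityProj_eq F i _ x.2)
    | add s t hs ht =>
      nth_rw 2 [← hs, ← ht]
      refine Eq.trans (Finset.sum_congr rfl fun i _ => ?_) Finset.sum_add_distrib
      rw [← map_add]
      congr 1
      exact Subtype.ext ((congrArg _ (map_add _ _ _)).trans (map_add (parityProj F i) _ _))

instance : GradedAlgebra (parity F) where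

theorem proj_parity (i : ZMod 2) (t : Gr F) :
    GradedAlgebra.proj (parity F) i t = parityProj F i t := by
  rw [GradedAlgebra.proj_apply]
  conv_lhs => rw [← sum_parityProj F t]
  rw [DirectSum.decompose_sum, DFinsupp.finsetSum_apply, AddSubmonoidClass.coe_finsetSum,
    Finset.sum_eq_single i]
  · exact DirectSum.decompose_of_mem_same _ (parityProj_mem F i t)
  · intro j _ hj
    exact DirectSum.decompose_of_mem_ne _ (parityProj_mem F j t) hj
  · simp

theorem parityProj_map {F : Fil A} {F' : Fil A'} (f : A →ₗ[ℂ] A')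
    (hf : ∀ p, ∀ x ∈ F p, f x ∈ F' p) (i : ZMod 2) (t : Gr F) :
    parityProj F' i (map f hf t) = map f hf (parityProj F i t) := by
  induction t using induction with
  | zero => simp
  | add s t hs ht => simp only [map_add, hs, ht]
  | cl q x =>
    rw [map_cl, parityProj_cl, parityProj_cl]
    split_ifs
    · rw [map_cl]
    · rw [map_zero]

end Gr

end GrAlgebra

/-! ### Superalgebras and their superderivations -/

/-- The sign `(-1)^{ij}` for parities `i`, `j`. -/
def sgn (i j : ZMod 2) : ℂ := (-1) ^ (i.val * j.val)

theorem sgn_comm (i j : ZMod 2) : sgn i j = sgn j i := by rw [sgn, sgn, mul_comm]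

theorem sgn_add (i j k : ZMod 2) : sgn i (j + k) = sgn i j * sgn i k := by
  have h : ∀ i j k : ZMod 2, Even (i.val * (j + k).val + (i.val * j.val + i.val * k.val)) := by
    decide
  rw [sgn, sgn, sgn, ← pow_add]
  have h1 := (h i j k).neg_one_pow (α := ℂ)
  rw [pow_add] at h1
  rcases neg_one_pow_eq_or ℂ (i.val * (j + k).val) with h2 | h2 <;> rw [h2] at h1 ⊢
  · rw [one_mul] at h1; exact h1.symm
  · rw [neg_one_mul, neg_eq_iff_eq_neg] at h1; exact h1.symm

theorem sgn_mul_self (i j : ZMod 2) : sgn i j * sgn i j = 1 := by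
  fin_cases i <;> fin_cases j <;> simp [sgn, ZMod.val]

section Superalgebra

variable {A : Type*} [Ring A] [Algebra ℂ A] (𝒜 : ZMod 2 → Submodule ℂ A)

/-- The two-sided ideal generated by the odd elements of a superalgebra. -/
def oddIdeal : Submodule ℂ A := Submodule.span ℂ {x | ∃ a, ∃ b ∈ 𝒜 1, ∃ c, x = a * b * c}

/-- The powers of the ideal generated by the odd elements: `I ^ p` for `p > 0`, and the whole
algebra for `p ≤ 0`. -/
def oddPow : Fil A := fun p => if p ≤ 0 then ⊤ else oddIdeal 𝒜 ^ p.toNat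

/-- The superderivations of parity `i`:
`δ (a b) = δ a * b + (-1)^{i j} a * δ b` for `a` of parity `j`. -/
def homDer (i : ZMod 2) : Submodule ℂ (Module.End ℂ A) where
  carrier := {δ | (∀ j, ∀ a ∈ 𝒜 j, δ a ∈ 𝒜 (i + j)) ∧
    ∀ j, ∀ a ∈ 𝒜 j, ∀ b, δ (a * b) = δ a * b + sgn i j • (a * δ b)}
  zero_mem' := ⟨fun _ _ _ => zero_mem _, fun _ _ _ _ => by simp⟩
  add_mem' := by
    rintro δ η ⟨h1, h2⟩ ⟨h3, h4⟩
    refine ⟨fun j a ha => add_mem (h1 j a ha) (h3 j a ha), fun j a ha b => ?_⟩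
    simp only [LinearMap.add_apply, h2 j a ha b, h4 j a ha b, add_mul, mul_add, smul_add]
    abel
  smul_mem' := by
    rintro c δ ⟨h1, h2⟩
    refine ⟨fun j a ha => Submodule.smul_mem _ _ (h1 j a ha), fun j a ha b => ?_⟩
    simp only [LinearMap.smul_apply, h2 j a ha b, smul_add, smul_mul_assoc, mul_smul_comm,
      smul_comm c]

/-- The space of superderivations: sums of an even and an odd superderivation. -/
def superDer : Submodule ℂ (Module.End ℂ A) := homDer 𝒜 0 ⊔ homDer 𝒜 1

/-- The type of superderivations. -/
def SDer : Type _ := superDer 𝒜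

instance : AddCommGroup (SDer 𝒜) := inferInstanceAs (AddCommGroup (superDer 𝒜))

instance : Module ℂ (SDer 𝒜) := inferInstanceAs (Module ℂ (superDer 𝒜))

theorem SDer.add_val (δ η : SDer 𝒜) : (δ + η).1 = δ.1 + η.1 := rfl

theorem SDer.smul_val (c : ℂ) (δ : SDer 𝒜) : (c • δ).1 = c • δ.1 := rfl

theorem homDer_le (i : ZMod 2) : homDer 𝒜 i ≤ superDer 𝒜 := by
  fin_cases i
  · exact le_sup_left
  · exact le_sup_right

/-- The superderivations of parity `i`, inside the space of all superderivations. -/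
def sderPar (i : ZMod 2) : Submodule ℂ (SDer 𝒜) where
  carrier := {δ | δ.1 ∈ homDer 𝒜 i}
  zero_mem' := zero_mem (homDer 𝒜 i)
  add_mem' := fun h h' => Submodule.add_mem (homDer 𝒜 i) h h'
  smul_mem' := fun c _ h => Submodule.smul_mem (homDer 𝒜 i) c h

/-- The filtration of the superderivations: `δ` lies in the `p`-th term iff `δ A ⊆ I ^ p` and
`δ I ⊆ I ^ (p + 1)`. For `p ≤ -1` this is no condition. -/
def sderFil : Fil (SDer 𝒜) := fun p =>
  { carrier := {δ | (∀ a, δ.1 a ∈ oddPow 𝒜 p) ∧ ∀ a ∈ oddIdeal 𝒜, δ.1 a ∈ oddPow 𝒜 (p + 1)}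
    zero_mem' := ⟨fun _ => zero_mem _, fun _ _ => zero_mem _⟩
    add_mem' := fun h h' =>
      ⟨fun a => add_mem (h.1 a) (h'.1 a), fun a ha => add_mem (h.2 a ha) (h'.2 a ha)⟩
    smul_mem' := fun c _ h =>
      ⟨fun a => Submodule.smul_mem _ c (h.1 a), fun a ha => Submodule.smul_mem _ c (h.2 a ha)⟩ }

variable {𝒜} in
theorem oddPow_nonpos {p : ℤ} (hp : p ≤ 0) : oddPow 𝒜 p = ⊤ := if_pos hp

theorem oddPow_natCast_succ (k : ℕ) : oddPow 𝒜 ((k : ℤ) + 1) = oddIdeal 𝒜 ^ (k + 1) := by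
  rw [oddPow, if_neg (by omega)]
  congr 1

theorem mul_oddIdeal_mem (a x : A) (hx : x ∈ oddIdeal 𝒜) : a * x ∈ oddIdeal 𝒜 := by
  induction hx using Submodule.span_induction with
  | zero => rw [mul_zero]; exact zero_mem _
  | add x y _ _ hx hy => rw [mul_add]; exact add_mem hx hy
  | smul c x _ hx => rw [mul_smul_comm]; exact Submodule.smul_mem _ _ hx
  | mem x hx =>
    obtain ⟨b, c, hc, d, rfl⟩ := hx
    exact Submodule.subset_span ⟨a * b, c, hc, d, by simp only [mul_assoc]⟩

theorem oddIdeal_mul_mem (a x : A) (hx : x ∈ oddIdeal 𝒜) : x * a ∈ oddIdeal 𝒜 := by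
  induction hx using Submodule.span_induction with
  | zero => rw [zero_mul]; exact zero_mem _
  | add x y _ _ hx hy => rw [add_mul]; exact add_mem hx hy
  | smul c x _ hx => rw [smul_mul_assoc]; exact Submodule.smul_mem _ _ hx
  | mem x hx =>
    obtain ⟨b, c, hc, d, rfl⟩ := hx
    exact Submodule.subset_span ⟨b, c, hc, d * a, by simp only [mul_assoc]⟩

theorem top_mul_pow_le (k : ℕ) : ⊤ * oddIdeal 𝒜 ^ (k + 1) ≤ oddIdeal 𝒜 ^ (k + 1) := by
  rw [pow_succ', ← mul_assoc]
  refine mul_le_mul_left ?_ _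
  exact Submodule.mul_le.2 fun a _ x hx => mul_oddIdeal_mem 𝒜 a x hx

theorem pow_mul_top_le (k : ℕ) : oddIdeal 𝒜 ^ (k + 1) * ⊤ ≤ oddIdeal 𝒜 ^ (k + 1) := by
  rw [pow_succ, mul_assoc]
  refine mul_le_mul_right ?_ _
  exact Submodule.mul_le.2 fun x hx a _ => oddIdeal_mul_mem 𝒜 a x hx

theorem oddPow_antitone : Antitone (oddPow 𝒜) := by
  refine antitone_int_of_succ_le fun p => ?_
  rcases le_or_gt p 0 with hp | hp
  · rw [oddPow_nonpos hp]; exact le_top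
  · obtain ⟨k, rfl⟩ : ∃ k : ℕ, p = k + 1 := ⟨(p - 1).toNat, by omega⟩
    have h := oddPow_natCast_succ 𝒜 (k + 1)
    push_cast at h
    rw [h, oddPow_natCast_succ, pow_succ]
    refine le_trans (mul_le_mul_right le_top _) (pow_mul_top_le 𝒜 k)

theorem oddPow_mul_mem (p q : ℤ) (x : A) (hx : x ∈ oddPow 𝒜 p) (y : A) (hy : y ∈ oddPow 𝒜 q) :
    x * y ∈ oddPow 𝒜 (p + q) := by
  rcases le_or_gt p 0 with hp | hp
  · refine oddPow_antitone 𝒜 (show p + q ≤ q by omega) ?_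
    rcases le_or_gt q 0 with hq | hq
    · rw [oddPow_nonpos hq]; trivial
    · obtain ⟨k, rfl⟩ : ∃ k : ℕ, q = k + 1 := ⟨(q - 1).toNat, by omega⟩
      rw [oddPow_natCast_succ] at hy ⊢
      exact top_mul_pow_le 𝒜 k (Submodule.mul_mem_mul trivial hy)
  · obtain ⟨k, rfl⟩ : ∃ k : ℕ, p = k + 1 := ⟨(p - 1).toNat, by omega⟩
    rcases le_or_gt q 0 with hq | hq
    · refine oddPow_antitone 𝒜 (show (k : ℤ) + 1 + q ≤ k + 1 by omega) ?_
      rw [oddPow_natCast_succ] at hx ⊢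
      exact pow_mul_top_le 𝒜 k (Submodule.mul_mem_mul hx trivial)
    · obtain ⟨l, rfl⟩ : ∃ l : ℕ, q = l + 1 := ⟨(q - 1).toNat, by omega⟩
      have h := oddPow_natCast_succ 𝒜 (k + 1 + l)
      push_cast at h
      rw [show (k : ℤ) + 1 + (l + 1) = k + 1 + l + 1 by ring, h,
        show k + 1 + l + 1 = (k + 1) + (l + 1) by ring, pow_add]
      rw [oddPow_natCast_succ] at hx hy
      exact Submodule.mul_mem_mul hx hy

instance : IsAlgFiltration (oddPow 𝒜) where
  antitone := oddPow_antitone 𝒜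
  one_mem := by rw [oddPow_nonpos le_rfl]; trivial
  mul_mem := oddPow_mul_mem 𝒜

theorem sderFil_antitone : Antitone (sderFil 𝒜) := fun p q hpq _ hδ =>
  ⟨fun a => oddPow_antitone 𝒜 hpq (hδ.1 a),
    fun a ha => oddPow_antitone 𝒜 (by omega) (hδ.2 a ha)⟩

theorem oddIdeal_eq : oddIdeal 𝒜 = oddPow 𝒜 1 := by
  have := oddPow_natCast_succ 𝒜 0
  rw [zero_add, pow_one, Nat.cast_zero, zero_add] at this
  exact this.symm

variable [GradedAlgebra 𝒜]

theorem sum_proj (a : A) : ∑ i, GradedAlgebra.proj 𝒜 i a = a := by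
  conv_rhs => rw [← (DirectSum.decompose 𝒜).symm_apply_apply a]
  rw [← DirectSum.sum_univ_of (DirectSum.decompose 𝒜 a), DirectSum.decompose_symm_sum]
  refine Finset.sum_congr rfl fun i _ => ?_
  rw [DirectSum.decompose_symm_of, GradedAlgebra.proj_apply]

theorem proj_mem (i : ZMod 2) (a : A) : GradedAlgebra.proj 𝒜 i a ∈ 𝒜 i := by
  rw [GradedAlgebra.proj_apply]; exact SetLike.coe_mem _

theorem proj_same {i : ZMod 2} {a : A} (ha : a ∈ 𝒜 i) : GradedAlgebra.proj 𝒜 i a = a :=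
  DirectSum.decompose_of_mem_same 𝒜 ha

theorem proj_ne {i j : ZMod 2} {a : A} (ha : a ∈ 𝒜 i) (hij : i ≠ j) :
    GradedAlgebra.proj 𝒜 j a = 0 :=
  DirectSum.decompose_of_mem_ne 𝒜 ha hij

theorem proj_mul (j : ZMod 2) (x y : A) : GradedAlgebra.proj 𝒜 j (x * y) =
    ∑ i, GradedAlgebra.proj 𝒜 i x * GradedAlgebra.proj 𝒜 (j - i) y := by
  conv_lhs => rw [← sum_proj 𝒜 x, ← sum_proj 𝒜 y, Finset.sum_mul_sum, map_sum]
  refine Finset.sum_congr rfl fun i _ => ?_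
  rw [map_sum, Finset.sum_eq_single (j - i)]
  · refine proj_same 𝒜 ?_
    have := SetLike.mul_mem_graded (proj_mem 𝒜 i x) (proj_mem 𝒜 (j - i) y)
    rwa [add_sub_cancel] at this
  · intro l _ hl
    refine proj_ne 𝒜 (SetLike.mul_mem_graded (proj_mem 𝒜 i x) (proj_mem 𝒜 l y)) ?_
    intro h
    exact hl (by rw [← h, add_sub_cancel_left])
  · simp

/-- The component of parity `i` of a linear endomorphism of a superspace. -/
def endPart (i : ZMod 2) : Module.End ℂ A →ₗ[ℂ] Module.End ℂ A where
  toFun T := ∑ j, GradedAlgebra.proj 𝒜 (i + j) ∘ₗ T ∘ₗ GradedAlgebra.proj 𝒜 j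
  map_add' S T := by
    simp only [LinearMap.add_comp, LinearMap.comp_add, Finset.sum_add_distrib]
  map_smul' c S := by
    simp only [LinearMap.smul_comp, LinearMap.comp_smul, Finset.smul_sum, RingHom.id_apply]

theorem endPart_apply (i : ZMod 2) (T : Module.End ℂ A) (a : A) :
    endPart 𝒜 i T a = ∑ j, GradedAlgebra.proj 𝒜 (i + j) (T (GradedAlgebra.proj 𝒜 j a)) := by
  simp [endPart]

/-- The supercommutator of linear endomorphisms of a superspace:
`[S, T] = S T - (-1)^{ij} T S` for `S` of parity `i` and `T` of parity `j`. -/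
def superComm : Module.End ℂ A →ₗ[ℂ] Module.End ℂ A →ₗ[ℂ] Module.End ℂ A :=
  LinearMap.mk₂ ℂ
    (fun S T => ∑ i, ∑ j, (endPart 𝒜 i S * endPart 𝒜 j T
      - sgn i j • (endPart 𝒜 j T * endPart 𝒜 i S)))
    (fun S S' T => by
      simp only [map_add, add_mul, mul_add, smul_add, ← Finset.sum_add_distrib]
      refine Finset.sum_congr rfl fun i _ => Finset.sum_congr rfl fun j _ => by abel)
    (fun c S T => by
      simp only [map_smul, smul_mul_assoc, mul_smul_comm, Finset.smul_sum, smul_sub,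
        smul_comm c])
    (fun S T T' => by
      simp only [map_add, add_mul, mul_add, smul_add, ← Finset.sum_add_distrib]
      refine Finset.sum_congr rfl fun i _ => Finset.sum_congr rfl fun j _ => by abel)
    (fun c S T => by
      simp only [map_smul, smul_mul_assoc, mul_smul_comm, Finset.smul_sum, smul_sub,
        smul_comm c])

theorem superComm_apply (S T : Module.End ℂ A) : superComm 𝒜 S T =
    ∑ i, ∑ j, (endPart 𝒜 i S * endPart 𝒜 j T - sgn i j • (endPart 𝒜 j T * endPart 𝒜 i S)) := rfl

theorem endPart_same {i : ZMod 2} {δ : Module.End ℂ A} (h : δ ∈ homDer 𝒜 i) :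
    endPart 𝒜 i δ = δ := by
  ext a
  rw [endPart_apply]
  conv_rhs => rw [← sum_proj 𝒜 a, map_sum]
  exact Finset.sum_congr rfl fun j _ => proj_same 𝒜 (h.1 j _ (proj_mem 𝒜 j a))

theorem endPart_ne {i j : ZMod 2} {δ : Module.End ℂ A} (h : δ ∈ homDer 𝒜 i) (hij : i ≠ j) :
    endPart 𝒜 j δ = 0 := by
  ext a
  rw [endPart_apply]
  refine Finset.sum_eq_zero fun k _ => proj_ne 𝒜 (h.1 k _ (proj_mem 𝒜 k a)) ?_
  simpa using hij

theorem superComm_hom {i j : ZMod 2} {δ η : Module.End ℂ A} (hδ : δ ∈ homDer 𝒜 i)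
    (hη : η ∈ homDer 𝒜 j) : superComm 𝒜 δ η = δ * η - sgn i j • (η * δ) := by
  rw [superComm_apply, Finset.sum_eq_single i, Finset.sum_eq_single j, endPart_same 𝒜 hδ,
    endPart_same 𝒜 hη]
  · intro k _ hk; simp [endPart_ne 𝒜 hη hk.symm]
  · simp
  · intro k _ hk; simp [endPart_ne 𝒜 hδ hk.symm]
  · simp

theorem superComm_hom_mem {i j : ZMod 2} {δ η : Module.End ℂ A} (hδ : δ ∈ homDer 𝒜 i)
    (hη : η ∈ homDer 𝒜 j) : superComm 𝒜 δ η ∈ homDer 𝒜 (i + j) := by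
  rw [superComm_hom 𝒜 hδ hη]
  refine ⟨fun k a ha => ?_, fun k a ha b => ?_⟩
  · refine sub_mem ?_ (Submodule.smul_mem _ _ ?_)
    · rw [add_assoc]; exact hδ.1 _ _ (hη.1 _ _ ha)
    · rw [add_comm i j, add_assoc]; exact hη.1 _ _ (hδ.1 _ _ ha)
  · have e := sgn_mul_self i j
    simp only [LinearMap.sub_apply, LinearMap.smul_apply, Module.End.mul_apply, hη.2 k a ha,
      hδ.2 k a ha, map_add, map_smul, hδ.2 _ _ (hη.1 _ _ ha) b, hη.2 _ _ (hδ.1 _ _ ha) b]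
    rw [show sgn (i + j) k = sgn i k * sgn j k by
      rw [sgn_comm, sgn_add, sgn_comm k i, sgn_comm k j], sgn_add, sgn_add, sgn_comm j i]
    simp only [sub_mul, mul_sub, smul_add, smul_sub, smul_smul, mul_smul_comm, smul_mul_assoc]
    rw [show sgn i j * (sgn i j * sgn j k) = sgn j k by rw [← mul_assoc, e, one_mul]]
    module

theorem superComm_mem {δ η : Module.End ℂ A} (hδ : δ ∈ superDer 𝒜) (hη : η ∈ superDer 𝒜) :
    superComm 𝒜 δ η ∈ superDer 𝒜 := by
  obtain ⟨δ₀, h0, δ₁, h1, rfl⟩ := Submodule.mem_sup.1 hδ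
  obtain ⟨η₀, k0, η₁, k1, rfl⟩ := Submodule.mem_sup.1 hη
  simp only [map_add, LinearMap.add_apply]
  exact add_mem
    (add_mem (homDer_le 𝒜 _ (superComm_hom_mem 𝒜 h0 k0))
      (homDer_le 𝒜 _ (superComm_hom_mem 𝒜 h1 k0)))
    (add_mem (homDer_le 𝒜 _ (superComm_hom_mem 𝒜 h0 k1))
      (homDer_le 𝒜 _ (superComm_hom_mem 𝒜 h1 k1)))

/-- The bracket of superderivations. -/
def sderBr : SDer 𝒜 →ₗ[ℂ] SDer 𝒜 →ₗ[ℂ] SDer 𝒜 :=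
  LinearMap.mk₂ ℂ
    (fun δ η => (⟨superComm 𝒜 δ.1 η.1, superComm_mem 𝒜 δ.2 η.2⟩ : superDer 𝒜))
    (fun δ δ' η => Subtype.ext (LinearMap.map_add₂ (superComm 𝒜) δ.1 δ'.1 η.1))
    (fun c δ η => Subtype.ext (LinearMap.map_smul₂ (superComm 𝒜) c δ.1 η.1))
    (fun δ η η' => Subtype.ext (map_add (superComm 𝒜 δ.1) η.1 η'.1))
    (fun c δ η => Subtype.ext (map_smul (superComm 𝒜 δ.1) c η.1))

theorem sderBr_val (δ η : SDer 𝒜) : (sderBr 𝒜 δ η).1 = superComm 𝒜 δ.1 η.1 := rfl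

theorem proj_oddIdeal (j : ZMod 2) (x : A) (hx : x ∈ oddIdeal 𝒜) :
    GradedAlgebra.proj 𝒜 j x ∈ oddIdeal 𝒜 := by
  induction hx using Submodule.span_induction with
  | zero => rw [map_zero]; exact zero_mem _
  | add x y _ _ hx hy => rw [map_add]; exact add_mem hx hy
  | smul c x _ hx => rw [map_smul]; exact Submodule.smul_mem _ _ hx
  | mem x hx =>
    obtain ⟨a, b, hb, c, rfl⟩ := hx
    rw [proj_mul]
    refine sum_mem fun i _ => oddIdeal_mul_mem 𝒜 _ _ ?_
    rw [proj_mul]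
    refine sum_mem fun k _ => mul_oddIdeal_mem 𝒜 _ _ ?_
    by_cases h : (1 : ZMod 2) = i - k
    · rw [← h, proj_same 𝒜 hb]
      exact Submodule.subset_span ⟨1, b, hb, 1, by simp⟩
    · rw [proj_ne 𝒜 hb h]; exact zero_mem _

theorem proj_oddPow (j : ZMod 2) (p : ℤ) (x : A) (hx : x ∈ oddPow 𝒜 p) :
    GradedAlgebra.proj 𝒜 j x ∈ oddPow 𝒜 p := by
  rcases le_or_gt p 0 with hp | hp
  · rw [oddPow_nonpos hp]; trivial
  · obtain ⟨k, rfl⟩ : ∃ k : ℕ, p = k + 1 := ⟨(p - 1).toNat, by omega⟩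
    rw [oddPow_natCast_succ] at hx ⊢
    clear hp
    induction k generalizing j x with
    | zero => rw [zero_add, pow_one] at *; exact proj_oddIdeal 𝒜 j x hx
    | succ k ih =>
      rw [pow_succ] at hx ⊢
      induction hx using Submodule.mul_induction_on' with
      | mem_mul_mem x hx y hy =>
        rw [proj_mul]
        exact sum_mem fun i _ => Submodule.mul_mem_mul (ih i x hx) (proj_oddIdeal 𝒜 _ y hy)
      | add x _ y _ hx hy => rw [map_add]; exact add_mem hx hy

theorem endPart_mem (i : ZMod 2) {δ : Module.End ℂ A} (hδ : δ ∈ superDer 𝒜) :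
    endPart 𝒜 i δ ∈ homDer 𝒜 i := by
  obtain ⟨δ₀, h0, δ₁, h1, rfl⟩ := Submodule.mem_sup.1 hδ
  rw [map_add]
  refine add_mem ?_ ?_
  · by_cases h : (0 : ZMod 2) = i
    · subst h; rw [endPart_same 𝒜 h0]; exact h0
    · rw [endPart_ne 𝒜 h0 h]; exact zero_mem _
  · by_cases h : (1 : ZMod 2) = i
    · subst h; rw [endPart_same 𝒜 h1]; exact h1
    · rw [endPart_ne 𝒜 h1 h]; exact zero_mem _

theorem sum_endPart (δ : Module.End ℂ A) : ∑ i, endPart 𝒜 i δ = δ := by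
  ext a
  rw [LinearMap.sum_apply]
  simp only [endPart_apply]
  rw [Finset.sum_comm]
  conv_rhs => rw [← sum_proj 𝒜 a, map_sum]
  refine Finset.sum_congr rfl fun j _ => ?_
  conv_rhs => rw [← sum_proj 𝒜 (δ _)]
  exact Fintype.sum_equiv (Equiv.addRight j) _ _ fun i => rfl

theorem endPart_fil (i : ZMod 2) {p : ℤ} {δ : SDer 𝒜} (hδ : δ ∈ sderFil 𝒜 p) :
    (Subtype.mk (endPart 𝒜 i δ.1) (homDer_le 𝒜 i (endPart_mem 𝒜 i δ.2)) : SDer 𝒜) ∈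
      sderFil 𝒜 p := by
  refine ⟨fun a => ?_, fun a ha => ?_⟩
  · change endPart 𝒜 i δ.1 a ∈ _
    rw [endPart_apply]
    exact sum_mem fun j _ => proj_oddPow 𝒜 _ _ _ (hδ.1 _)
  · change endPart 𝒜 i δ.1 a ∈ _
    rw [endPart_apply]
    exact sum_mem fun j _ => proj_oddPow 𝒜 _ _ _ (hδ.2 _ (proj_oddIdeal 𝒜 j a ha))

/-- A superderivation in the `p`-th term of the filtration maps `I ^ r` into `I ^ (r + p)`. -/
theorem sderFil_oddPow {p : ℤ} {δ : SDer 𝒜} (hδ : δ ∈ sderFil 𝒜 p) (r : ℤ) (a : A)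
    (ha : a ∈ oddPow 𝒜 r) : δ.1 a ∈ oddPow 𝒜 (r + p) := by
  rcases le_or_gt r 0 with hr | hr
  · exact oddPow_antitone 𝒜 (show r + p ≤ p by omega) (hδ.1 a)
  obtain ⟨k, rfl⟩ : ∃ k : ℕ, r = k + 1 := ⟨(r - 1).toNat, by omega⟩
  clear hr
  suffices H : ∀ i, endPart 𝒜 i δ.1 a ∈ oddPow 𝒜 (k + 1 + p) by
    rw [← sum_endPart 𝒜 δ.1, LinearMap.sum_apply]
    exact sum_mem fun i _ => H i
  intro i
  have h1 := endPart_mem 𝒜 i δ.2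
  have h2 := endPart_fil 𝒜 i hδ
  rw [oddPow_natCast_succ] at ha
  obtain ⟨η, hη⟩ : ∃ η, η = endPart 𝒜 i δ.1 := ⟨_, rfl⟩
  have h3 : ∀ x ∈ oddIdeal 𝒜, η x ∈ oddPow 𝒜 (p + 1) := by rw [hη]; exact h2.2
  rw [← hη] at h1 ⊢
  clear h2 hη
  clear hδ
  induction k generalizing a with
  | zero =>
    rw [zero_add, pow_one] at ha
    have := h3 a ha
    push_cast
    simpa [add_comm] using this
  | succ k ih =>
    rw [pow_succ] at ha
    induction ha using Submodule.mul_induction_on' with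
    | add x _ y _ hx hy => rw [map_add]; exact add_mem hx hy
    | mem_mul_mem x hx y hy =>
      rw [← sum_proj 𝒜 x, Finset.sum_mul, map_sum]
      refine sum_mem fun j _ => ?_
      rw [← oddPow_natCast_succ] at hx
      have hxj := proj_oddPow 𝒜 j _ x hx
      rw [h1.2 j _ (proj_mem 𝒜 j x) y]
      have hy1 : y ∈ oddPow 𝒜 1 := by
        have := oddPow_natCast_succ 𝒜 0
        rw [zero_add, pow_one, Nat.cast_zero, zero_add] at this
        rwa [this]
      refine add_mem ?_ (Submodule.smul_mem _ _ ?_)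
      · have h4 := ih _ (by rw [← oddPow_natCast_succ]; exact hxj)
        have := oddPow_mul_mem 𝒜 _ _ _ h4 _ hy1
        push_cast
        convert this using 2
        ring
      · have := oddPow_mul_mem 𝒜 _ _ _ hxj _ (h3 y hy)
        push_cast
        convert this using 2
        ring

theorem sderBr_fil (p q : ℤ) (δ : SDer 𝒜) (hδ : δ ∈ sderFil 𝒜 p) (η : SDer 𝒜)
    (hη : η ∈ sderFil 𝒜 q) : sderBr 𝒜 δ η ∈ sderFil 𝒜 (p + q) := by
  have key : ∀ (r : ℤ) (a : A), a ∈ oddPow 𝒜 r →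
      superComm 𝒜 δ.1 η.1 a ∈ oddPow 𝒜 (r + (p + q)) := by
    intro r a ha
    rw [superComm_apply, LinearMap.sum_apply]
    refine sum_mem fun i _ => ?_
    rw [LinearMap.sum_apply]
    refine sum_mem fun j _ => sub_mem ?_ (Submodule.smul_mem _ _ ?_)
    · have := sderFil_oddPow 𝒜 (endPart_fil 𝒜 i hδ) _ _
        (sderFil_oddPow 𝒜 (endPart_fil 𝒜 j hη) r a ha)
      rwa [add_assoc, add_comm q p] at this
    · have := sderFil_oddPow 𝒜 (endPart_fil 𝒜 j hη) _ _
        (sderFil_oddPow 𝒜 (endPart_fil 𝒜 i hδ) r a ha)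
      rwa [add_assoc] at this
  refine ⟨fun a => ?_, fun a ha => ?_⟩
  · have := key 0 a (by rw [oddPow_nonpos le_rfl]; trivial)
    rwa [zero_add] at this
  · rw [oddIdeal_eq] at ha
    have := key 1 a ha
    rwa [add_comm 1] at this

end Superalgebra

/-! ### Sheaves

A sheaf is presented as a sheaf of germs: by its stalks and, for every open set `U`, the set of its
sections over `U`, each section being identified with the family of its germs at the points of
`U`. Restriction of sections is restriction of families. -/

section Sheaves

variable {M : Type u} [TopologicalSpace M]

/-- Restriction of families indexed by the points of an open set. -/
def restr {S : M → Type*} {U V : Opens M} (h : V ≤ U) (s : ∀ x : U, S x) : ∀ x : V, S x :=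
  fun x => s ⟨x, h x.2⟩

/-- A sheaf of complex vector spaces whose sections over `U` are families of elements of given
vector spaces `S x`, `x ∈ U`. -/
structure SectionSheaf (S : M → Type*) [∀ x, AddCommGroup (S x)] [∀ x, Module ℂ (S x)] where
  /-- the sections over an open set -/
  sec : ∀ U : Opens M, Submodule ℂ (∀ x : U, S x)
  res_mem : ∀ (U V : Opens M) (h : V ≤ U), ∀ s ∈ sec U, restr h s ∈ sec V
  glue : ∀ (U : Opens M) (s : ∀ x : U, S x),
    (∀ x : U, ∃ (V : Opens M) (h : V ≤ U), x.1 ∈ V ∧ restr h s ∈ sec V) → s ∈ sec U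

namespace SectionSheaf

variable {S : M → Type*} [∀ x, AddCommGroup (S x)] [∀ x, Module ℂ (S x)] (F : SectionSheaf S)

/-- The space of sections over an open set. -/
def Sections (U : Opens M) : Type _ := F.sec U

instance (U : Opens M) : AddCommGroup (F.Sections U) := inferInstanceAs (AddCommGroup (F.sec U))

instance (U : Opens M) : Module ℂ (F.Sections U) := inferInstanceAs (Module ℂ (F.sec U))

variable {F}

theorem ext {U : Opens M} {s t : F.Sections U} (h : ∀ x, s.1 x = t.1 x) : s = t :=
  Subtype.ext (funext h)

/-- Restriction of sections. -/
def res (F : SectionSheaf S) {U V : Opens M} (h : V ≤ U) : F.Sections U →ₗ[ℂ] F.Sections V where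
  toFun s := (⟨restr h s.1, F.res_mem U V h s.1 s.2⟩ : F.sec V)
  map_add' _ _ := rfl
  map_smul' _ _ := rfl

/-- The germ of a section at a point. -/
def germ (F : SectionSheaf S) (U : Opens M) (x : U) : F.Sections U →ₗ[ℂ] S x where
  toFun s := s.1 x
  map_add' _ _ := rfl
  map_smul' _ _ := rfl

/-- The space of sections over `U` whose germs lie in given subspaces of the stalks. -/
def stalkwise (F : SectionSheaf S) (P : ∀ x, Submodule ℂ (S x)) (U : Opens M) :
    Submodule ℂ (F.Sections U) where
  carrier := {s | ∀ x : U, s.1 x ∈ P x}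
  zero_mem' := fun _ => zero_mem _
  add_mem' := fun hs ht x => add_mem (hs x) (ht x)
  smul_mem' := fun c _ hs x => Submodule.smul_mem _ c (hs x)

end SectionSheaf

variable (M) in
/-- A sheaf of complex superalgebras (associative, with unit) on a topological space. -/
structure SuperSheaf where
  /-- the stalks -/
  stalk : M → Type v
  [ring : ∀ x, Ring (stalk x)]
  [algebra : ∀ x, Algebra ℂ (stalk x)]
  /-- the even and the odd part of the stalks -/
  par : ∀ x, ZMod 2 → Submodule ℂ (stalk x)
  [graded : ∀ x, GradedAlgebra (par x)]
  /-- the sections over an open set -/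
  sec : ∀ U : Opens M, Subalgebra ℂ (∀ x : U, stalk x)
  proj_mem : ∀ (U : Opens M) (i : ZMod 2), ∀ s ∈ sec U,
    (fun x : U => GradedAlgebra.proj (par x) i (s x)) ∈ sec U
  res_mem : ∀ (U V : Opens M) (h : V ≤ U), ∀ s ∈ sec U, restr h s ∈ sec V
  glue : ∀ (U : Opens M) (s : ∀ x : U, stalk x),
    (∀ x : U, ∃ (V : Opens M) (h : V ≤ U), x.1 ∈ V ∧ restr h s ∈ sec V) → s ∈ sec U
  /-- every element of a stalk is the germ of a section -/
  germ_surj : ∀ (x : M) (a : stalk x), ∃ (U : Opens M) (hx : x ∈ U), ∃ s ∈ sec U, s ⟨x, hx⟩ = a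
  /-- a section whose germ at a point vanishes is zero near this point -/
  germ_zero : ∀ (U : Opens M) (x : U), ∀ s ∈ sec U, s x = 0 →
    ∃ (V : Opens M) (h : V ≤ U), x.1 ∈ V ∧ restr h s = 0

attribute [instance] SuperSheaf.ring SuperSheaf.algebra SuperSheaf.graded

namespace SuperSheaf

variable (𝒪 : SuperSheaf.{u, v} M)

/-- The algebra of sections over an open set. -/
def Sections (U : Opens M) : Type _ := 𝒪.sec U

instance (U : Opens M) : Ring (𝒪.Sections U) := inferInstanceAs (Ring (𝒪.sec U))

instance (U : Opens M) : Algebra ℂ (𝒪.Sections U) := inferInstanceAs (Algebra ℂ (𝒪.sec U))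

/-- Restriction of sections. -/
def res {U V : Opens M} (h : V ≤ U) : 𝒪.Sections U →ₐ[ℂ] 𝒪.Sections V where
  toFun s := (⟨restr h s.1, 𝒪.res_mem U V h s.1 s.2⟩ : 𝒪.sec V)
  map_one' := rfl
  map_mul' _ _ := rfl
  map_zero' := rfl
  map_add' _ _ := rfl
  commutes' _ := rfl

/-- The germ of a section at a point. -/
def germ (U : Opens M) (x : U) : 𝒪.Sections U →ₐ[ℂ] 𝒪.stalk x where
  toFun s := s.1 x
  map_one' := rfl
  map_mul' _ _ := rfl
  map_zero' := rfl
  map_add' _ _ := rfl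
  commutes' _ := rfl

/-- The sections of parity `i`. -/
def secPar (U : Opens M) (i : ZMod 2) : Submodule ℂ (𝒪.Sections U) where
  carrier := {s | ∀ x : U, s.1 x ∈ 𝒪.par x i}
  zero_mem' := fun _ => zero_mem _
  add_mem' := fun h h' x => add_mem (h x) (h' x)
  smul_mem' := fun c _ h x => Submodule.smul_mem _ c (h x)

/-- The sections of the `p`-th power of the sheaf of ideals generated by the odd elements. -/
def secPow (U : Opens M) : Fil (𝒪.Sections U) := fun p =>
  { carrier := {s | ∀ x : U, s.1 x ∈ oddPow (𝒪.par x) p}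
    zero_mem' := fun _ => zero_mem _
    add_mem' := fun h h' x => add_mem (h x) (h' x)
    smul_mem' := fun c _ h x => Submodule.smul_mem _ c (h x) }

theorem secPow_germ {U : Opens M} {p : ℤ} (s : 𝒪.secPow U p) (x : U) :
    s.1.1 x ∈ oddPow (𝒪.par x) p := s.2 x

instance (U : Opens M) : IsAlgFiltration (𝒪.secPow U) where
  antitone _ _ hpq _ hs x := oddPow_antitone _ hpq (hs x)
  one_mem := fun x => IsAlgFiltration.one_mem (F := oddPow (𝒪.par x))
  mul_mem p q _ hs _ ht x := oddPow_mul_mem _ p q _ (hs x) _ (ht x)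

/-! #### The associated graded sheaf -/

/-- The map from `⨁ p, I ^ p (U) / I ^ (p + 1) (U)` to the associated graded algebra of the
stalk. -/
def grGerm (U : Opens M) (x : U) : Gr (𝒪.secPow U) →ₐ[ℂ] Gr (oddPow (𝒪.par x)) :=
  Gr.mapAlg (𝒪.germ U x) fun _ _ hs => hs x

/-- The restriction of `⨁ p, I ^ p (U) / I ^ (p + 1) (U)` to a smaller open set. -/
def grRes {U V : Opens M} (h : V ≤ U) : Gr (𝒪.secPow U) →ₐ[ℂ] Gr (𝒪.secPow V) :=
  Gr.mapAlg (𝒪.res h) fun _ _ hs x => hs ⟨x, h x.2⟩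

theorem grGerm_cl (U : Opens M) (x : U) (p : ℤ) (s : 𝒪.secPow U p) :
    𝒪.grGerm U x (Gr.cl _ p s) = Gr.cl (oddPow (𝒪.par x)) p ⟨s.1.1 x, secPow_germ 𝒪 s x⟩ :=
  Gr.mapAlg_cl _ _ p s

theorem grRes_cl {U V : Opens M} (h : V ≤ U) (p : ℤ) (s : 𝒪.secPow U p) :
    𝒪.grRes h (Gr.cl _ p s) =
      Gr.cl (𝒪.secPow V) p ⟨𝒪.res h s.1, fun x => secPow_germ 𝒪 s ⟨x, h x.2⟩⟩ :=
  Gr.mapAlg_cl _ _ p s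

theorem grGerm_grRes {U V : Opens M} (h : V ≤ U) (x : V) (t : Gr (𝒪.secPow U)) :
    𝒪.grGerm V x (𝒪.grRes h t) = 𝒪.grGerm U ⟨x, h x.2⟩ t := by
  induction t using Gr.induction with
  | zero => simp only [map_zero]
  | add s t hs ht => simp only [map_add, hs, ht]
  | cl p s =>
    rw [grRes_cl, grGerm_cl, grGerm_cl]
    rfl

/-- A family of elements of the associated graded algebras of the stalks is a section of the
associated graded sheaf iff it is locally induced by an element of
`⨁ p, I ^ p (V) / I ^ (p + 1) (V)`. -/
def IsGrSection (U : Opens M) (s : ∀ x : U, Gr (oddPow (𝒪.par x))) : Prop :=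
  ∀ x : U, ∃ (V : Opens M) (h : V ≤ U), x.1 ∈ V ∧
    ∃ t : Gr (𝒪.secPow V), ∀ y : V, s ⟨y, h y.2⟩ = 𝒪.grGerm V y t

theorem isGrSection_common {U : Opens M} {s t : ∀ x : U, Gr (oddPow (𝒪.par x))}
    (hs : 𝒪.IsGrSection U s) (ht : 𝒪.IsGrSection U t) (x : U) :
    ∃ (V : Opens M) (h : V ≤ U), x.1 ∈ V ∧ ∃ a b : Gr (𝒪.secPow V), ∀ y : V,
      s ⟨y, h y.2⟩ = 𝒪.grGerm V y a ∧ t ⟨y, h y.2⟩ = 𝒪.grGerm V y b := by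
  obtain ⟨V, hV, hxV, a, ha⟩ := hs x
  obtain ⟨W, hW, hxW, b, hb⟩ := ht x
  refine ⟨V ⊓ W, inf_le_left.trans hV, ⟨hxV, hxW⟩,
    𝒪.grRes inf_le_left a, 𝒪.grRes inf_le_right b, fun y => ⟨?_, ?_⟩⟩
  · exact (ha ⟨y, y.2.1⟩).trans (𝒪.grGerm_grRes inf_le_left y a).symm
  · exact (hb ⟨y, y.2.2⟩).trans (𝒪.grGerm_grRes inf_le_right y b).symm

/-- The sections of the associated graded sheaf over an open set. -/
def grSec (U : Opens M) : Subalgebra ℂ (∀ x : U, Gr (oddPow (𝒪.par x))) where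
  carrier := {s | 𝒪.IsGrSection U s}
  mul_mem' := fun {s t} hs ht x => by
    obtain ⟨V, h, hx, a, b, hab⟩ := 𝒪.isGrSection_common hs ht x
    refine ⟨V, h, hx, a * b, fun y => ?_⟩
    rw [map_mul, ← (hab y).1, ← (hab y).2]
    rfl
  add_mem' := fun {s t} hs ht x => by
    obtain ⟨V, h, hx, a, b, hab⟩ := 𝒪.isGrSection_common hs ht x
    refine ⟨V, h, hx, a + b, fun y => ?_⟩
    rw [map_add, ← (hab y).1, ← (hab y).2]
    rfl
  algebraMap_mem' := fun c x => ⟨U, le_rfl, x.2, algebraMap ℂ _ c, fun y => by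
    rw [AlgHom.commutes]; rfl⟩

theorem exists_secPow (x : M) (p : ℤ) (a : 𝒪.stalk x) (ha : a ∈ oddPow (𝒪.par x) p) :
    ∃ (U : Opens M) (hx : x ∈ U) (s : 𝒪.secPow U p), s.1.1 ⟨x, hx⟩ = a := by
  -- germs of the sections of a power of the ideal form a subspace
  have hadd : ∀ (q : ℤ) (a b : 𝒪.stalk x),
      (∃ (U : Opens M) (hx : x ∈ U) (s : 𝒪.secPow U q), s.1.1 ⟨x, hx⟩ = a) →
      (∃ (U : Opens M) (hx : x ∈ U) (s : 𝒪.secPow U q), s.1.1 ⟨x, hx⟩ = b) →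
      (∃ (U : Opens M) (hx : x ∈ U) (s : 𝒪.secPow U q), s.1.1 ⟨x, hx⟩ = a + b) := by
    rintro q _ _ ⟨U, hU, s, rfl⟩ ⟨V, hV, t, rfl⟩
    exact ⟨U ⊓ V, ⟨hU, hV⟩, ⟨𝒪.res inf_le_left s.1 + 𝒪.res inf_le_right t.1,
      fun y => add_mem (secPow_germ 𝒪 s ⟨y, y.2.1⟩) (secPow_germ 𝒪 t ⟨y, y.2.2⟩)⟩, rfl⟩
  have hmul : ∀ (q r : ℤ) (a b : 𝒪.stalk x),
      (∃ (U : Opens M) (hx : x ∈ U) (s : 𝒪.secPow U q), s.1.1 ⟨x, hx⟩ = a) →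
      (∃ (U : Opens M) (hx : x ∈ U) (s : 𝒪.secPow U r), s.1.1 ⟨x, hx⟩ = b) →
      (∃ (U : Opens M) (hx : x ∈ U) (s : 𝒪.secPow U (q + r)), s.1.1 ⟨x, hx⟩ = a * b) := by
    rintro q r _ _ ⟨U, hU, s, rfl⟩ ⟨V, hV, t, rfl⟩
    exact ⟨U ⊓ V, ⟨hU, hV⟩, ⟨𝒪.res inf_le_left s.1 * 𝒪.res inf_le_right t.1,
      fun y => oddPow_mul_mem _ _ _ _ (secPow_germ 𝒪 s ⟨y, y.2.1⟩) _ (secPow_germ 𝒪 t ⟨y, y.2.2⟩)⟩, rfl⟩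
  have hzero : ∀ a : 𝒪.stalk x,
      (∃ (U : Opens M) (hx : x ∈ U) (s : 𝒪.secPow U 0), s.1.1 ⟨x, hx⟩ = a) := by
    intro a
    obtain ⟨U, hx, s, hs, rfl⟩ := 𝒪.germ_surj x a
    exact ⟨U, hx, ⟨Subtype.mk s hs, fun y => by rw [oddPow_nonpos le_rfl]; trivial⟩, rfl⟩
  have hone : ∀ a ∈ oddIdeal (𝒪.par x),
      (∃ (U : Opens M) (hx : x ∈ U) (s : 𝒪.secPow U 1), s.1.1 ⟨x, hx⟩ = a) := by
    intro a ha
    induction ha using Submodule.span_induction with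
    | zero => exact ⟨⊤, trivial, 0, rfl⟩
    | add a b _ _ h1 h2 => exact hadd 1 a b h1 h2
    | smul c a _ h1 =>
      obtain ⟨U, hU, s, rfl⟩ := h1
      exact ⟨U, hU, c • s, rfl⟩
    | mem a ha =>
      obtain ⟨b, c, hc, d, rfl⟩ := ha
      have hc' : (∃ (U : Opens M) (hx : x ∈ U) (s : 𝒪.secPow U 1), s.1.1 ⟨x, hx⟩ = c) := by
        obtain ⟨U, hx, s, hs, rfl⟩ := 𝒪.germ_surj x c
        refine ⟨U, hx, ⟨Subtype.mk _ (𝒪.proj_mem U 1 s hs), fun y => ?_⟩, proj_same _ hc⟩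
        rw [← oddIdeal_eq]
        exact Submodule.subset_span ⟨1, _, SuperGeom.proj_mem _ 1 (s y), 1, by simp⟩
      have := hmul (0 + 1) 0 _ d (hmul 0 1 b c (hzero b) hc') (hzero d)
      simpa using this
  rcases le_or_gt p 0 with hp | hp
  · obtain ⟨U, hx, s, hs⟩ := hzero a
    exact ⟨U, hx, ⟨s.1, fun y => by rw [oddPow_nonpos hp]; trivial⟩, hs⟩
  · obtain ⟨k, rfl⟩ : ∃ k : ℕ, p = k + 1 := ⟨(p - 1).toNat, by omega⟩
    rw [oddPow_natCast_succ] at ha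
    clear hp
    induction k generalizing a with
    | zero => rw [zero_add, pow_one] at ha; simpa using hone a ha
    | succ k ih =>
      rw [pow_succ] at ha
      push_cast
      induction ha using Submodule.mul_induction_on' with
      | mem_mul_mem a ha b hb => exact hmul _ _ a b (ih a ha) (hone b hb)
      | add a _ b _ h1 h2 => exact hadd _ a b h1 h2

theorem grGerm_zero (U : Opens M) (x : U) (t : Gr (𝒪.secPow U)) (ht : 𝒪.grGerm U x t = 0) :
    ∃ (V : Opens M) (h : V ≤ U), x.1 ∈ V ∧ ∀ y : V, 𝒪.grGerm U ⟨y, h y.2⟩ t = 0 := by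
  classical
  have step : ∀ p : ℤ, ∃ (V : Opens M) (h : V ≤ U), x.1 ∈ V ∧
      ∀ y : V, 𝒪.grGerm U ⟨y, h y.2⟩ (Gr.degProj _ p t) = 0 := by
    intro p
    obtain ⟨s, hs⟩ := Gr.degProj_mem _ p t
    have h0 : 𝒪.grGerm U x (Gr.degProj _ p t) = 0 :=
      (Gr.degProj_map _ _ p t).symm.trans ((congrArg (Gr.degProj _ p) ht).trans (map_zero _))
    rw [hs, grGerm_cl] at h0
    obtain ⟨V, hxV, r, hr⟩ := 𝒪.exists_secPow x (p + 1) _ (Gr.mem_of_cl_eq_zero _ _ _ h0)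
    obtain ⟨W, hW, hxW, hz⟩ := 𝒪.germ_zero (U ⊓ V) ⟨x, x.2, hxV⟩
      (𝒪.res inf_le_left s.1 - 𝒪.res inf_le_right r.1).1 (Subtype.prop _)
      (sub_eq_zero.2 hr.symm)
    refine ⟨W, hW.trans inf_le_left, hxW, fun y => ?_⟩
    rw [hs, grGerm_cl]
    refine Gr.cl_eq_zero _ _ _ ?_
    have h1 : s.1.1 ⟨y, (hW y.2).1⟩ = r.1.1 ⟨y, (hW y.2).2⟩ := sub_eq_zero.1 (congrFun hz y)
    change s.1.1 ⟨y, (hW y.2).1⟩ ∈ _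
    rw [h1]
    exact secPow_germ 𝒪 r ⟨y, (hW y.2).2⟩
  obtain ⟨S, hS⟩ := Gr.exists_eq_sum_degProj _ t
  have fin : ∀ T : Finset ℤ, ∃ (V : Opens M) (h : V ≤ U), x.1 ∈ V ∧
      ∀ y : V, 𝒪.grGerm U ⟨y, h y.2⟩ (∑ p ∈ T, Gr.degProj _ p t) = 0 := by
    intro T
    induction T using Finset.induction_on with
    | empty => exact ⟨U, le_rfl, x.2, fun y => by simp⟩
    | insert p T hp ih =>
      obtain ⟨V, hV, hxV, h1⟩ := ih
      obtain ⟨W, hW, hxW, h2⟩ := step p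
      refine ⟨V ⊓ W, inf_le_left.trans hV, ⟨hxV, hxW⟩, fun y => ?_⟩
      rw [Finset.sum_insert hp, map_add]
      have e1 := h1 ⟨y, y.2.1⟩
      have e2 := h2 ⟨y, y.2.2⟩
      exact (congrArg₂ (· + ·) e2 e1).trans (add_zero _)
  obtain ⟨V, hV, hxV, h⟩ := fin S
  refine ⟨V, hV, hxV, fun y => ?_⟩
  rw [hS S subset_rfl]
  exact h y

theorem grSec_proj_mem (U : Opens M) (i : ZMod 2) (s : ∀ x : U, Gr (oddPow (𝒪.par x)))
    (hs : s ∈ 𝒪.grSec U) :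
    (fun x : U => GradedAlgebra.proj (Gr.parity (oddPow (𝒪.par x))) i (s x)) ∈ 𝒪.grSec U := by
  intro x
  obtain ⟨V, h, hx, t, ht⟩ := hs x
  refine ⟨V, h, hx, Gr.parityProj _ i t, fun y => ?_⟩
  refine (Gr.proj_parity _ i _).trans ?_
  rw [ht y]
  exact Gr.parityProj_map _ _ i t

theorem grSec_res_mem (U V : Opens M) (h : V ≤ U) (s : ∀ x : U, Gr (oddPow (𝒪.par x)))
    (hs : s ∈ 𝒪.grSec U) : restr (S := fun x => Gr (oddPow (𝒪.par x))) h s ∈ 𝒪.grSec V := by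
  intro x
  obtain ⟨W, hW, hx, t, ht⟩ := hs ⟨x, h x.2⟩
  refine ⟨V ⊓ W, inf_le_left, ⟨x.2, hx⟩, 𝒪.grRes inf_le_right t, fun y => ?_⟩
  rw [grGerm_grRes]
  exact ht ⟨y, y.2.2⟩

theorem grSec_glue (U : Opens M) (s : ∀ x : U, Gr (oddPow (𝒪.par x)))
    (hs : ∀ x : U, ∃ (V : Opens M) (h : V ≤ U), x.1 ∈ V ∧
      restr (S := fun x => Gr (oddPow (𝒪.par x))) h s ∈ 𝒪.grSec V) : s ∈ 𝒪.grSec U := by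
  intro x
  obtain ⟨V, h, hx, hV⟩ := hs x
  obtain ⟨W, hW, hxW, t, ht⟩ := hV ⟨x, hx⟩
  exact ⟨W, hW.trans h, hxW, t, ht⟩

theorem grSec_germ_surj (x : M) (a : Gr (oddPow (𝒪.par x))) :
    ∃ (U : Opens M) (hx : x ∈ U), ∃ s ∈ 𝒪.grSec U, s ⟨x, hx⟩ = a := by
  induction a using Gr.induction with
  | zero => exact ⟨⊤, trivial, 0, zero_mem _, rfl⟩
  | add a b ha hb =>
    obtain ⟨U, hU, s, hs, hsa⟩ := ha
    obtain ⟨V, hV, t, ht, htb⟩ := hb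
    refine ⟨U ⊓ V, ⟨hU, hV⟩, _, add_mem (𝒪.grSec_res_mem U (U ⊓ V) inf_le_left s hs)
      (𝒪.grSec_res_mem V (U ⊓ V) inf_le_right t ht), ?_⟩
    rw [← hsa, ← htb]
    rfl
  | cl p a =>
    obtain ⟨U, hx, s, hs⟩ := 𝒪.exists_secPow x p a.1 a.2
    refine ⟨U, hx, fun y => 𝒪.grGerm U y (Gr.cl _ p s),
      fun y => ⟨U, le_rfl, y.2, Gr.cl _ p s, fun _ => rfl⟩, ?_⟩
    exact (𝒪.grGerm_cl U ⟨x, hx⟩ p s).trans (Gr.cl_congr _ rfl _ _ hs)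

theorem grSec_germ_zero (U : Opens M) (x : U) (s : ∀ x : U, Gr (oddPow (𝒪.par x)))
    (hs : s ∈ 𝒪.grSec U) (hx : s x = 0) : ∃ (V : Opens M) (h : V ≤ U), x.1 ∈ V ∧
      restr (S := fun x => Gr (oddPow (𝒪.par x))) h s = 0 := by
  obtain ⟨V, h, hxV, t, ht⟩ := hs x
  obtain ⟨W, hW, hxW, hz⟩ := 𝒪.grGerm_zero V ⟨x, hxV⟩ t ((ht ⟨x, hxV⟩).symm.trans hx)
  exact ⟨W, hW.trans h, hxW, funext fun y => (ht ⟨y, hW y.2⟩).trans (hz y)⟩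

/-- The associated graded sheaf of superalgebras: the sheaf associated with the presheaf
`U ↦ ⨁ p, I ^ p (U) / I ^ (p + 1) (U)`, where `I` is the sheaf of ideals generated by the odd
elements; its stalks are the algebras `⨁ p, I_x ^ p / I_x ^ (p + 1)`. The parity is the degree
modulo `2`. -/
@[reducible] def gr : SuperSheaf.{u, v} M where
  stalk x := Gr (oddPow (𝒪.par x))
  par x := Gr.parity (oddPow (𝒪.par x))
  sec := 𝒪.grSec
  proj_mem := 𝒪.grSec_proj_mem
  res_mem := 𝒪.grSec_res_mem
  glue := 𝒪.grSec_glue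
  germ_surj := 𝒪.grSec_germ_surj
  germ_zero := 𝒪.grSec_germ_zero

end SuperSheaf

end Sheaves

/-! ### Complex supermanifolds -/

section Supermanifold

open scoped TensorProduct

/-- The algebra of holomorphic functions on an open subset of `ℂⁿ`. -/
def Holo {n : ℕ} (W : Opens (Fin n → ℂ)) : Subalgebra ℂ (W → ℂ) where
  carrier := {f | ∃ g : (Fin n → ℂ) → ℂ, DifferentiableOn ℂ g W ∧ ∀ z : W, f z = g z}
  mul_mem' := by
    rintro f f' ⟨g, hg, h⟩ ⟨g', hg', h'⟩
    exact ⟨g * g', hg.mul hg', fun z => by simp [h, h']⟩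
  add_mem' := by
    rintro f f' ⟨g, hg, h⟩ ⟨g', hg', h'⟩
    exact ⟨g + g', hg.add hg', fun z => by simp [h, h']⟩
  algebraMap_mem' c := ⟨fun _ => c, differentiableOn_const c, fun _ => rfl⟩

/-- Restriction of holomorphic functions. -/
def Holo.res {n : ℕ} {W W' : Opens (Fin n → ℂ)} (h : W' ≤ W) : Holo W →ₐ[ℂ] Holo W' where
  toFun f := ⟨fun z => f.1 ⟨z, h z.2⟩, by
    obtain ⟨g, hg, hf⟩ := f.2
    exact ⟨g, hg.mono h, fun z => hf _⟩⟩
  map_one' := rfl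
  map_mul' _ _ := rfl
  map_zero' := rfl
  map_add' _ _ := rfl
  commutes' _ := rfl

/-- The sections over `W` of the structure sheaf of the model superspace of dimension `n|m`:
the Grassmann algebra in `m` odd variables over the holomorphic functions on `W`. -/
abbrev ModelSec (n m : ℕ) (W : Opens (Fin n → ℂ)) : Type :=
  Holo W ⊗[ℂ] ExteriorAlgebra ℂ (Fin m → ℂ)

/-- Restriction of sections of the model superspace. -/
def ModelSec.res {n : ℕ} (m : ℕ) {W W' : Opens (Fin n → ℂ)} (h : W' ≤ W) :
    ModelSec n m W →ₐ[ℂ] ModelSec n m W' :=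
  Algebra.TensorProduct.map (Holo.res h) (AlgHom.id ℂ _)

/-- The sections of parity `i` of the model superspace: the holomorphic functions are even and the
Grassmann variables are odd. -/
def ModelSec.par (n m : ℕ) (W : Opens (Fin n → ℂ)) (i : ZMod 2) : Submodule ℂ (ModelSec n m W) :=
  Submodule.span ℂ {s | ∃ f : Holo W,
    ∃ ω ∈ CliffordAlgebra.evenOdd (0 : QuadraticForm ℂ (Fin m → ℂ)) i, s = f ⊗ₜ[ℂ] ω}

variable {M : Type u} [TopologicalSpace M]

/-- The open subset of `M` corresponding to an open set `W` in a chart. -/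
def chartPreimage {n : ℕ} (φ : OpenPartialHomeomorph M (Fin n → ℂ)) (W : Opens (Fin n → ℂ)) :
    Opens M :=
  ⟨φ.source ∩ φ ⁻¹' W, φ.isOpen_inter_preimage W.isOpen⟩

theorem chartPreimage_mono {n : ℕ} (φ : OpenPartialHomeomorph M (Fin n → ℂ))
    {W W' : Opens (Fin n → ℂ)} (h : W' ≤ W) : chartPreimage φ W' ≤ chartPreimage φ W :=
  fun _ hx => ⟨hx.1, h hx.2⟩

/-- An isomorphism, over a chart `φ`, of the restriction of a sheaf of superalgebras to the domain
of the chart with the restriction of the model superspace to its target. -/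
structure LocalModelIso (𝒪 : SuperSheaf.{u, v} M) (n m : ℕ)
    (φ : OpenPartialHomeomorph M (Fin n → ℂ)) where
  /-- the isomorphisms of the algebras of sections -/
  iso : ∀ W : Opens (Fin n → ℂ), (W : Set (Fin n → ℂ)) ⊆ φ.target →
    𝒪.Sections (chartPreimage φ W) ≃ₐ[ℂ] ModelSec n m W
  iso_res : ∀ (W W' : Opens (Fin n → ℂ)) (hW : (W : Set (Fin n → ℂ)) ⊆ φ.target) (h : W' ≤ W)
    (s : 𝒪.Sections (chartPreimage φ W)),
    iso W' (Set.Subset.trans h hW) (𝒪.res (chartPreimage_mono φ h) s) =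
      ModelSec.res m h (iso W hW s)
  iso_par : ∀ (W : Opens (Fin n → ℂ)) (hW : (W : Set (Fin n → ℂ)) ⊆ φ.target) (i : ZMod 2)
    (s : 𝒪.Sections (chartPreimage φ W)),
    s ∈ 𝒪.secPar _ i ↔ iso W hW s ∈ ModelSec.par n m W i

/-- `(M, 𝒪)` is a complex supermanifold of dimension `n|m`: `𝒪` is supercommutative, and `(M, 𝒪)`
is locally isomorphic to the model superspace of dimension `n|m`. -/
structure IsComplexSupermanifold (𝒪 : SuperSheaf.{u, v} M) (n m : ℕ) : Prop where
  supercommutative : ∀ (x : M) (i j : ZMod 2), ∀ a ∈ 𝒪.par x i, ∀ b ∈ 𝒪.par x j,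
    a * b = sgn i j • (b * a)
  locally_model : ∀ x : M, ∃ φ : OpenPartialHomeomorph M (Fin n → ℂ), x ∈ φ.source ∧
    Nonempty (LocalModelIso 𝒪 n m φ)

end Supermanifold

/-! ### The sheaf of vector fields and the associated graded sheaf -/

section VectorFields

variable {M : Type u} [TopologicalSpace M] (𝒪 : SuperSheaf.{u, v} M)

/-- The sheaf of germs of superderivations of `𝒪` over `ℂ`. A section over `U` is a family of
superderivations of the stalks `𝒪_x`, `x ∈ U`, that maps sections of `𝒪` to sections of `𝒪`. -/
def derSheaf : SectionSheaf (fun x => SDer (𝒪.par x)) where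
  sec U :=
    { carrier := {δ | ∀ (V : Opens M) (h : V ≤ U), ∀ f ∈ 𝒪.sec V,
        (fun y : V => (δ ⟨y, h y.2⟩).1 (f y)) ∈ 𝒪.sec V}
      zero_mem' := fun V _ _ _ => zero_mem (𝒪.sec V)
      add_mem' := fun hδ hη V h f hf => add_mem (hδ V h f hf) (hη V h f hf)
      smul_mem' := fun c _ hδ V h f hf => Subalgebra.smul_mem _ (hδ V h f hf) c }
  res_mem U V h s hs W hW f hf := hs W (hW.trans h) f hf
  glue U s hs V h f hf := 𝒪.glue V _ fun x => by
    obtain ⟨W, hW, hxW, hsW⟩ := hs ⟨x, h x.2⟩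
    exact ⟨V ⊓ W, inf_le_left, ⟨x.2, hxW⟩,
      hsW (V ⊓ W) inf_le_right _ (𝒪.res_mem V (V ⊓ W) inf_le_left f hf)⟩

/-- The vector fields on `U`. -/
abbrev Der (U : Opens M) : Type _ := (derSheaf 𝒪).Sections U

/-- The subsheaf `Der_(p)` of those derivations `δ` for which `δ 𝒪 ⊆ I ^ p` and
`δ I ⊆ I ^ (p + 1)`, where `I` is the sheaf of ideals generated by the odd elements. For `p ≤ -1`
it is the whole sheaf of derivations. -/
def derFilSheaf (p : ℤ) : SectionSheaf (fun x => SDer (𝒪.par x)) where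
  sec U :=
    { carrier := {δ | δ ∈ (derSheaf 𝒪).sec U ∧ ∀ x : U, δ x ∈ sderFil (𝒪.par x) p}
      zero_mem' := ⟨zero_mem _, fun _ => zero_mem _⟩
      add_mem' := fun hδ hη => ⟨add_mem hδ.1 hη.1, fun x => add_mem (hδ.2 x) (hη.2 x)⟩
      smul_mem' := fun c _ hδ =>
        ⟨Submodule.smul_mem _ c hδ.1, fun x => Submodule.smul_mem _ c (hδ.2 x)⟩ }
  res_mem U V h s hs := ⟨(derSheaf 𝒪).res_mem U V h s hs.1, fun x => hs.2 ⟨x, h x.2⟩⟩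
  glue U s hs := by
    refine ⟨(derSheaf 𝒪).glue U s fun x => ?_, fun x => ?_⟩
    · obtain ⟨V, h, hx, hV⟩ := hs x
      exact ⟨V, h, hx, hV.1⟩
    · obtain ⟨V, h, hx, hV⟩ := hs x
      exact hV.2 ⟨x, hx⟩

/-- The filtration of the vector fields on `U` by the sections of the sheaves `Der_(p)`. -/
def derFil (U : Opens M) : Fil (Der 𝒪 U) := fun p =>
  { carrier := {δ | δ.1 ∈ (derFilSheaf 𝒪 p).sec U}
    zero_mem' := zero_mem ((derFilSheaf 𝒪 p).sec U)
    add_mem' := fun h h' => Submodule.add_mem ((derFilSheaf 𝒪 p).sec U) h h'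
    smul_mem' := fun c _ h => Submodule.smul_mem ((derFilSheaf 𝒪 p).sec U) c h }

theorem derFil_germ {U : Opens M} {p : ℤ} {δ : Der 𝒪 U} (hδ : δ ∈ derFil 𝒪 U p) (x : U) :
    (derSheaf 𝒪).germ U x δ ∈ sderFil (𝒪.par x) p := And.right hδ x

/-- The vector fields of parity `i`. -/
def derPar (U : Opens M) (i : ZMod 2) : Submodule ℂ (Der 𝒪 U) :=
  (derSheaf 𝒪).stalkwise (fun x => sderPar (𝒪.par x) i) U

theorem endPart_sec {U : Opens M} (i : ZMod 2) (δ : Der 𝒪 U) (V : Opens M) (h : V ≤ U)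
    (f : ∀ y : V, 𝒪.stalk y) (hf : f ∈ 𝒪.sec V) :
    (fun y : V => endPart (𝒪.par y) i (δ.1 ⟨y, h y.2⟩).1 (f y)) ∈ 𝒪.sec V := by
  have : (fun y : V => endPart (𝒪.par y) i (δ.1 ⟨y, h y.2⟩).1 (f y)) =
      ∑ j, fun y : V => GradedAlgebra.proj (𝒪.par y) (i + j)
        ((δ.1 ⟨y, h y.2⟩).1 (GradedAlgebra.proj (𝒪.par y) j (f y))) := by
    funext y
    rw [Finset.sum_apply]
    exact endPart_apply _ _ _ _
  rw [this]
  exact sum_mem fun j _ => 𝒪.proj_mem V _ _ (δ.2 V h _ (𝒪.proj_mem V j f hf))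

theorem derBr_sec {U : Opens M} (δ η : Der 𝒪 U) :
    (fun x : U => sderBr (𝒪.par x) (δ.1 x) (η.1 x)) ∈ (derSheaf 𝒪).sec U := by
  intro V h f hf
  have : (fun y : V => (sderBr (𝒪.par y) (δ.1 ⟨y, h y.2⟩) (η.1 ⟨y, h y.2⟩)).1 (f y)) =
      ∑ i, ∑ j, ((fun y : V => endPart (𝒪.par y) i (δ.1 ⟨y, h y.2⟩).1
          (endPart (𝒪.par y) j (η.1 ⟨y, h y.2⟩).1 (f y)))
        - sgn i j • fun y : V => endPart (𝒪.par y) j (η.1 ⟨y, h y.2⟩).1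
          (endPart (𝒪.par y) i (δ.1 ⟨y, h y.2⟩).1 (f y))) := by
    funext y
    rw [sderBr_val, superComm_apply]
    simp [LinearMap.sum_apply, Finset.sum_apply]
  exact this ▸ sum_mem fun i _ => sum_mem fun j _ => sub_mem
    (endPart_sec 𝒪 i δ V h _ (endPart_sec 𝒪 j η V h f hf))
    (Subalgebra.smul_mem _ (endPart_sec 𝒪 j η V h _ (endPart_sec 𝒪 i δ V h f hf)) _)

/-- The bracket of vector fields: the supercommutator on each stalk. -/
def derBr (U : Opens M) : Der 𝒪 U →ₗ[ℂ] Der 𝒪 U →ₗ[ℂ] Der 𝒪 U :=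
  LinearMap.mk₂ ℂ
    (fun δ η => (⟨fun x => sderBr (𝒪.par x) (δ.1 x) (η.1 x), derBr_sec 𝒪 δ η⟩ :
      (derSheaf 𝒪).sec U))
    (fun _ _ _ => Subtype.ext (funext fun x => LinearMap.map_add₂ (sderBr (𝒪.par x)) _ _ _))
    (fun _ _ _ => Subtype.ext (funext fun x => LinearMap.map_smul₂ (sderBr (𝒪.par x)) _ _ _))
    (fun _ _ _ => Subtype.ext (funext fun x => map_add (sderBr (𝒪.par x) _) _ _))
    (fun _ _ _ => Subtype.ext (funext fun x => map_smul (sderBr (𝒪.par x) _) _ _))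

theorem derBr_fil (U : Opens M) (p q : ℤ) (δ : Der 𝒪 U) (hδ : δ ∈ derFil 𝒪 U p) (η : Der 𝒪 U)
    (hη : η ∈ derFil 𝒪 U q) : derBr 𝒪 U δ η ∈ derFil 𝒪 U (p + q) :=
  ⟨(derBr 𝒪 U δ η).2, fun x => sderBr_fil _ p q _ (derFil_germ 𝒪 hδ x) _ (derFil_germ 𝒪 hη x)⟩

/-- The graded Lie superalgebra `⨁ p, Der_(p)(U) / Der_(p+1)(U)` associated with the filtered Lie
superalgebra of vector fields on `U`. For `U = M` this is `gr 𝔡`. -/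
abbrev GrOfDer (U : Opens M) : Type _ := Gr (derFil 𝒪 U)

/-- The parity of `⨁ p, Der_(p)(U) / Der_(p+1)(U)`, induced by the parity of vector fields. -/
def grOfDerPar (U : Opens M) (i : ZMod 2) : Submodule ℂ (GrOfDer 𝒪 U) :=
  Gr.inherited (derFil 𝒪 U) (derPar 𝒪 U i)

/-- The bracket of `⨁ p, Der_(p)(U) / Der_(p+1)(U)`, induced by the bracket of vector fields. -/
def grOfDerBr (U : Opens M) : GrOfDer 𝒪 U →ₗ[ℂ] GrOfDer 𝒪 U →ₗ[ℂ] GrOfDer 𝒪 U :=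
  Gr.bil (derBr 𝒪 U) (derBr_fil 𝒪 U)

/-- The grading of `⨁ p, Der_(p)(U) / Der_(p+1)(U)`. -/
abbrev grOfDerDeg (U : Opens M) (p : ℤ) : Submodule ℂ (GrOfDer 𝒪 U) := Gr.deg (derFil 𝒪 U) p

/-- The restriction of `⨁ p, Der_(p)(U) / Der_(p+1)(U)` to a smaller open set. -/
def grOfDerRes {U V : Opens M} (h : V ≤ U) : GrOfDer 𝒪 U →ₗ[ℂ] GrOfDer 𝒪 V :=
  Gr.map ((derSheaf 𝒪).res h) fun p δ hδ => (derFilSheaf 𝒪 p).res_mem U V h δ.1 hδ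

/-- The map from `⨁ p, Der_(p)(U) / Der_(p+1)(U)` to the associated graded Lie superalgebra of the
superderivations of the stalk at a point of `U`. -/
def grOfDerGerm (U : Opens M) (x : U) : GrOfDer 𝒪 U →ₗ[ℂ] Gr (sderFil (𝒪.par x)) :=
  Gr.map ((derSheaf 𝒪).germ U x) fun _ _ hδ => derFil_germ 𝒪 hδ x

theorem grOfDerRes_cl {U V : Opens M} (h : V ≤ U) (p : ℤ) (s : derFil 𝒪 U p) :
    grOfDerRes 𝒪 h (Gr.cl _ p s) = Gr.cl (derFil 𝒪 V) p
      ⟨(derSheaf 𝒪).res h s.1, (derFilSheaf 𝒪 p).res_mem U V h s.1.1 s.2⟩ :=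
  Gr.map_cl _ _ p s

theorem grOfDerGerm_cl (U : Opens M) (x : U) (p : ℤ) (s : derFil 𝒪 U p) :
    grOfDerGerm 𝒪 U x (Gr.cl _ p s) = Gr.cl (sderFil (𝒪.par x)) p
      ⟨(derSheaf 𝒪).germ U x s.1, derFil_germ 𝒪 s.2 x⟩ :=
  Gr.map_cl _ _ p s

theorem grOfDerGerm_res {U V : Opens M} (h : V ≤ U) (x : V) (t : GrOfDer 𝒪 U) :
    grOfDerGerm 𝒪 V x (grOfDerRes 𝒪 h t) = grOfDerGerm 𝒪 U ⟨x, h x.2⟩ t := by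
  induction t using Gr.induction with
  | zero => simp only [map_zero]
  | add s t hs ht => simp only [map_add, hs, ht]
  | cl p s =>
    rw [grOfDerRes_cl, grOfDerGerm_cl, grOfDerGerm_cl]
    rfl

/-- A family of elements of the associated graded spaces of the stalks is a section of `gr Der` iff
it is locally induced by an element of `⨁ p, Der_(p)(V) / Der_(p+1)(V)`. -/
def IsGrDerSection (U : Opens M) (s : ∀ x : U, Gr (sderFil (𝒪.par x))) : Prop :=
  ∀ x : U, ∃ (V : Opens M) (h : V ≤ U), x.1 ∈ V ∧
    ∃ t : GrOfDer 𝒪 V, ∀ y : V, s ⟨y, h y.2⟩ = grOfDerGerm 𝒪 V y t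

theorem isGrDerSection_common {U : Opens M} {s t : ∀ x : U, Gr (sderFil (𝒪.par x))}
    (hs : IsGrDerSection 𝒪 U s) (ht : IsGrDerSection 𝒪 U t) (x : U) :
    ∃ (V : Opens M) (h : V ≤ U), x.1 ∈ V ∧ ∃ a b : GrOfDer 𝒪 V, ∀ y : V,
      s ⟨y, h y.2⟩ = grOfDerGerm 𝒪 V y a ∧ t ⟨y, h y.2⟩ = grOfDerGerm 𝒪 V y b := by
  obtain ⟨V, hV, hxV, a, ha⟩ := hs x
  obtain ⟨W, hW, hxW, b, hb⟩ := ht x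
  refine ⟨V ⊓ W, inf_le_left.trans hV, ⟨hxV, hxW⟩,
    grOfDerRes 𝒪 inf_le_left a, grOfDerRes 𝒪 inf_le_right b, fun y => ⟨?_, ?_⟩⟩
  · exact (ha ⟨y, y.2.1⟩).trans (grOfDerGerm_res 𝒪 inf_le_left y a).symm
  · exact (hb ⟨y, y.2.2⟩).trans (grOfDerGerm_res 𝒪 inf_le_right y b).symm

/-- The sheaf `gr Der`, associated with the presheaf `U ↦ ⨁ p, Der_(p)(U) / Der_(p+1)(U)`. -/
def grDerSheaf : SectionSheaf (fun x => Gr (sderFil (𝒪.par x))) where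
  sec U :=
    { carrier := {s | IsGrDerSection 𝒪 U s}
      zero_mem' := fun x => ⟨U, le_rfl, x.2, 0, fun y => (map_zero _).symm⟩
      add_mem' := fun hs ht x => by
        obtain ⟨V, h, hx, a, b, hab⟩ := isGrDerSection_common 𝒪 hs ht x
        refine ⟨V, h, hx, a + b, fun y => ?_⟩
        rw [map_add, ← (hab y).1, ← (hab y).2]
        rfl
      smul_mem' := fun c s hs x => by
        obtain ⟨V, h, hx, a, ha⟩ := hs x
        refine ⟨V, h, hx, c • a, fun y => ?_⟩
        rw [map_smul, ← ha y]
        rfl }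
  res_mem U V h s hs x := by
    obtain ⟨W, hW, hx, t, ht⟩ := hs ⟨x, h x.2⟩
    exact ⟨V ⊓ W, inf_le_left, ⟨x.2, hx⟩, grOfDerRes 𝒪 inf_le_right t, fun y =>
      (ht ⟨y, y.2.2⟩).trans (grOfDerGerm_res 𝒪 inf_le_right y t).symm⟩
  glue U s hs x := by
    obtain ⟨V, h, hx, hV⟩ := hs x
    obtain ⟨W, hW, hxW, t, ht⟩ := hV ⟨x, hx⟩
    exact ⟨W, hW.trans h, hxW, t, ht⟩

/-- The sections of `gr Der` over `U`. -/
abbrev GrDer (U : Opens M) : Type _ := (grDerSheaf 𝒪).Sections U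

/-- The canonical map from `⨁ p, Der_(p)(U) / Der_(p+1)(U)` to the sections of `gr Der`. -/
def toGrDer (U : Opens M) : GrOfDer 𝒪 U →ₗ[ℂ] GrDer 𝒪 U where
  toFun t := (⟨fun x => grOfDerGerm 𝒪 U x t, fun x => ⟨U, le_rfl, x.2, t, fun _ => rfl⟩⟩ :
    (grDerSheaf 𝒪).sec U)
  map_add' _ _ := Subtype.ext (funext fun x => map_add (grOfDerGerm 𝒪 U x) _ _)
  map_smul' _ _ := Subtype.ext (funext fun x => map_smul (grOfDerGerm 𝒪 U x) _ _)

/-- The homogeneous sections of `gr Der` of degree `p`. -/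
def grDerDeg (U : Opens M) (p : ℤ) : Submodule ℂ (GrDer 𝒪 U) :=
  (grDerSheaf 𝒪).stalkwise (fun x => Gr.deg (sderFil (𝒪.par x)) p) U

/-- The sections of `gr Der` of parity `i`. -/
def grDerPar (U : Opens M) (i : ZMod 2) : Submodule ℂ (GrDer 𝒪 U) :=
  (grDerSheaf 𝒪).stalkwise (fun x => Gr.inherited (sderFil (𝒪.par x)) (sderPar (𝒪.par x) i)) U

theorem grDerBr_sec {U : Opens M} (s t : GrDer 𝒪 U) :
    (fun x : U => Gr.bil (sderBr (𝒪.par x)) (sderBr_fil (𝒪.par x)) (s.1 x) (t.1 x)) ∈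
      (grDerSheaf 𝒪).sec U := by
  intro x
  obtain ⟨V, h, hx, a, b, hab⟩ := isGrDerSection_common 𝒪 s.2 t.2 x
  refine ⟨V, h, hx, grOfDerBr 𝒪 V a b, fun y => ?_⟩
  refine Eq.trans ?_ (Gr.map_bil ((derSheaf 𝒪).germ V y) (fun _ _ hδ => derFil_germ 𝒪 hδ y) (derBr 𝒪 V)
    (sderBr (𝒪.par y)) (derBr_fil 𝒪 V) (sderBr_fil (𝒪.par y)) (fun _ _ => rfl) a b).symm
  exact congrArg₂ (fun a b => Gr.bil (sderBr (𝒪.par y)) (sderBr_fil (𝒪.par y)) a b)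
    (hab y).1 (hab y).2

/-- The bracket of sections of `gr Der`, induced by the bracket of derivations. -/
def grDerBr (U : Opens M) : GrDer 𝒪 U →ₗ[ℂ] GrDer 𝒪 U →ₗ[ℂ] GrDer 𝒪 U :=
  LinearMap.mk₂ ℂ
    (fun s t => (⟨fun x => Gr.bil (sderBr (𝒪.par x)) (sderBr_fil (𝒪.par x)) (s.1 x) (t.1 x),
      grDerBr_sec 𝒪 s t⟩ : (grDerSheaf 𝒪).sec U))
    (fun _ _ _ => Subtype.ext (funext fun _ => LinearMap.map_add₂ (Gr.bil _ _) _ _ _))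
    (fun _ _ _ => Subtype.ext (funext fun _ => LinearMap.map_smul₂ (Gr.bil _ _) _ _ _))
    (fun _ _ _ => Subtype.ext (funext fun _ => map_add (Gr.bil _ _ _) _ _))
    (fun _ _ _ => Subtype.ext (funext fun _ => map_smul (Gr.bil _ _ _) _ _))

/-- The homogeneous derivations of degree `p` of the graded sheaf `gr 𝒪`: those mapping `gr_q 𝒪`
into `gr_{q+p} 𝒪` for all `q`. -/
def derGrDeg (U : Opens M) (p : ℤ) : Submodule ℂ (Der 𝒪.gr U) where
  carrier := {δ | ∀ (x : U) (q : ℤ), ∀ a ∈ Gr.deg (oddPow (𝒪.par x)) q,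
    (δ.1 x).1 a ∈ Gr.deg (oddPow (𝒪.par x)) (q + p)}
  zero_mem' := fun _ _ _ _ => zero_mem _
  add_mem' := fun hs ht x q a ha => add_mem (hs x q a ha) (ht x q a ha)
  smul_mem' := fun c _ hs x q a ha => Submodule.smul_mem _ c (hs x q a ha)

end VectorFields

/-! ### Lie superalgebras -/

section LieSuperalgebras

variable {L L' : Type*} [AddCommGroup L] [Module ℂ L] [AddCommGroup L'] [Module ℂ L']

/-- A complex vector space with even part `par 0`, odd part `par 1` and bracket `br` is a Lie
superalgebra. -/
structure IsLieSuperalgebra (par : ZMod 2 → Submodule ℂ L) (br : L →ₗ[ℂ] L →ₗ[ℂ] L) : Prop where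
  internal : DirectSum.IsInternal par
  br_mem : ∀ i j, ∀ x ∈ par i, ∀ y ∈ par j, br x y ∈ par (i + j)
  skew : ∀ i j, ∀ x ∈ par i, ∀ y ∈ par j, br x y = -(sgn i j • br y x)
  jacobi : ∀ i j, ∀ x ∈ par i, ∀ y ∈ par j, ∀ z,
    br x (br y z) = br (br x y) z + sgn i j • br y (br x z)

/-- A Lie superalgebra with a decreasing filtration `L = F (-1) ⊇ F 0 ⊇ F 1 ⊇ ⋯` (where `F p = L`
for `p ≤ -1`) by subspaces compatible with the parity, such that `[F p, F q] ⊆ F (p + q)`. -/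
structure IsFilteredLieSuperalgebra (par : ZMod 2 → Submodule ℂ L) (br : L →ₗ[ℂ] L →ₗ[ℂ] L)
    (F : ℤ → Submodule ℂ L) : Prop extends IsLieSuperalgebra par br where
  antitone : Antitone F
  eq_top : F (-1) = ⊤
  fil_par : ∀ p, F p = ⨆ i, F p ⊓ par i
  br_fil : ∀ p q, ∀ x ∈ F p, ∀ y ∈ F q, br x y ∈ F (p + q)

/-- A Lie superalgebra with a `ℤ`-grading compatible with the parity. -/
structure IsGradedLieSuperalgebra (par : ZMod 2 → Submodule ℂ L) (br : L →ₗ[ℂ] L →ₗ[ℂ] L)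
    (G : ℤ → Submodule ℂ L) : Prop extends IsLieSuperalgebra par br where
  deg_internal : DirectSum.IsInternal G
  deg_par : ∀ p : ℤ, G p ≤ par (p : ZMod 2)
  br_deg : ∀ p q, ∀ x ∈ G p, ∀ y ∈ G q, br x y ∈ G (p + q)

/-- A linear map is a homomorphism of graded Lie superalgebras: it preserves the parity, the degree
and the bracket. -/
structure IsGradedLieHom (par : ZMod 2 → Submodule ℂ L) (br : L →ₗ[ℂ] L →ₗ[ℂ] L)
    (G : ℤ → Submodule ℂ L) (par' : ZMod 2 → Submodule ℂ L') (br' : L' →ₗ[ℂ] L' →ₗ[ℂ] L')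
    (G' : ℤ → Submodule ℂ L') (f : L →ₗ[ℂ] L') : Prop where
  map_par : ∀ i, ∀ x ∈ par i, f x ∈ par' i
  map_deg : ∀ p, ∀ x ∈ G p, f x ∈ G' p
  map_br : ∀ x y, f (br x y) = br' (f x) (f y)

end LieSuperalgebras

/-- The derivation `D` of `gr 𝒪` over `U` is induced by the vector field `δ` in `Der_(p)(U)`:
at each point of `U`, it maps the class of `a ∈ I ^ r` in `I ^ r / I ^ (r + 1)` to the class of
`δ a` in `I ^ (r + p) / I ^ (r + p + 1)`. -/
def IsInducedBy {M : Type u} [TopologicalSpace M] (𝒪 : SuperSheaf.{u, v} M) (U : Opens M) (p : ℤ)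
    (δ : Der 𝒪 U) (D : Der 𝒪.gr U) : Prop :=
  ∀ (x : U) (r : ℤ) (a : oddPow (𝒪.par x) r),
    ∃ h : (δ.1 x).1 a.1 ∈ oddPow (𝒪.par x) (r + p),
      (D.1 x).1 (Gr.cl (oddPow (𝒪.par x)) r a) =
        Gr.cl (oddPow (𝒪.par x)) (r + p) ⟨(δ.1 x).1 a.1, h⟩

end SuperGeom

end

open SuperGeom

/-! The statements on brackets and filtrations are stalkwise and hold for every sheaf of
superalgebras: a derivation in the `p`-th term of the filtration shifts every power of the odd ideal
`I` by `p`, so a supercommutator of terms of order `p` and `q` has order `p + q`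
(`isFilteredLieSuperalgebra_sder`, `isFilteredLieSuperalgebra_der`).

The comparison of `gr Der` with `Der gr` rests on one local fact. In a chart the structure sheaf is
(holomorphic functions) ⊗ (Grassmann algebra), and the Grassmann degree is a multiplicative
`ℤ`-grading of the stalks that splits the filtration by powers of `I`: this is `Splitting`, provided
by `IsComplexSupermanifold.locallySplit`. It has three consequences. First, an element of `I ^ p` of
parity `p + 1` lies in `I ^ (p + 1)` (`ParityAdapted`), so degree and parity match on the associated
graded objects. Second, `I ^ (m + 1) = 0`, so only finitely many degrees occur. Third, the algebra
is locally isomorphic to its associated graded algebra, so a derivation of degree `p` of the latter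
lifts to one of order `p` (`Splitting.ind_lift`). On the other hand the kernel of `δ ↦ δ̃` on order
`p` is exactly order `p + 1`, as one sees by testing on degrees `0` and `1` (`ind_eq_zero_iff`).
This gives injectivity on stalks, and then surjectivity on sections: local lifts exist, and their
classes agree because they are unique. For global vector fields no sheafification takes place, and
membership in a term of the filtration is a condition on germs, so `gr 𝔡` embeds
(`toGrDer_injective`).

Finite-dimensionality is the Montel argument. By Hadamard's lemma a superderivation of a stalk is
determined by its values on the coordinates (`superDer_eq_sum`), so a vector field on a compact `M`
is encoded by finitely many bounded holomorphic coefficients on finitely many balls (`derCoefs`).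
Using balls of radius `R` and `R / 2` gives two Banach norms; restriction from one to the other is
compact by Montel's theorem (`exists_isCompact_restrict`). If both images are closed, the two norms
are equivalent by Banach's theorem, a ball is compact, and Riesz's theorem applies
(`finiteDimensional_of_isCompact`).

The delicate point is closedness (`isClosed_range_derCoefs`). The limit coefficients define vector
fields on the separate balls, and these must agree on overlaps, although the chart isomorphisms are
purely algebraic and come with no formula for a change of coordinates. The comparison uses linear
functionals on the stalk that vanish on a power of the intersection of the kernels of all
characters. This condition refers only to the algebra, not to a chart. In every chart such
functionals are bounded by the sup norms of the coefficients (`exists_functional_bound`), and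
together they separate germs (`eq_zero_of_functional_eq_zero`). Both local limits therefore have the
same values under all of them and coincide. -/

noncomputable section
namespace SuperGeom

/-! ### Direct sum decompositions from projections -/

section Internal

variable {L ι : Type*} [AddCommGroup L] [Module ℂ L] [DecidableEq ι]

/-- A family of subspaces is a direct sum decomposition if it admits a family of projections. -/
theorem isInternal_of_proj (G : ι → Submodule ℂ L) (P : ι → L →ₗ[ℂ] L)
    (hmem : ∀ i x, P i x ∈ G i) (hsame : ∀ i, ∀ x ∈ G i, P i x = x)
    (hne : ∀ i j, i ≠ j → ∀ x ∈ G i, P j x = 0)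
    (hsum : ∀ x, ∃ S : Finset ι, x = ∑ i ∈ S, P i x) : DirectSum.IsInternal G := by
  rw [DirectSum.isInternal_submodule_iff_iSupIndep_and_iSup_eq_top]
  refine ⟨?_, ?_⟩
  · intro i
    rw [disjoint_iff_inf_le]
    rintro x ⟨hx, hx'⟩
    have h0 : P i x = 0 := by
      have : (⨆ j, ⨆ (_ : j ≠ i), G j) ≤ LinearMap.ker (P i) :=
        iSup_le fun j => iSup_le fun hj y hy => hne j i hj y hy
      exact this hx'
    rw [hsame i x hx] at h0
    exact h0
  · rw [eq_top_iff]
    intro x _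
    obtain ⟨S, hS⟩ := hsum x
    rw [hS]
    exact sum_mem fun i _ => Submodule.mem_iSup_of_mem i (hmem i x)

theorem zmod_two_ne {i j : ZMod 2} (h : i ≠ j) : j = i + 1 := by
  revert i j; decide

theorem mem_iSup_inf_of_proj {L : Type*} [AddCommGroup L] [Module ℂ L] (F : Submodule ℂ L)
    (G : ZMod 2 → Submodule ℂ L) (P : ZMod 2 → L →ₗ[ℂ] L)
    (hmem : ∀ i x, P i x ∈ G i) (hF : ∀ i, ∀ x ∈ F, P i x ∈ F)
    (hsum : ∀ x, ∑ i, P i x = x) : F = ⨆ i, F ⊓ G i := by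
  refine le_antisymm (fun x hx => ?_) (iSup_le fun i => inf_le_left)
  rw [← hsum x]
  exact sum_mem fun i _ => Submodule.mem_iSup_of_mem i ⟨hF i x hx, hmem i x⟩

end Internal

/-! ### The filtered Lie superalgebra of superderivations of one superalgebra -/

section Superalgebra

variable {A : Type*} [Ring A] [Algebra ℂ A] (𝒜 : ZMod 2 → Submodule ℂ A) [GradedAlgebra 𝒜]

theorem superComm_skew {i j : ZMod 2} {δ η : Module.End ℂ A} (hδ : δ ∈ homDer 𝒜 i)
    (hη : η ∈ homDer 𝒜 j) : superComm 𝒜 δ η = -(sgn i j • superComm 𝒜 η δ) := by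
  rw [superComm_hom 𝒜 hδ hη, superComm_hom 𝒜 hη hδ, smul_sub, smul_smul, sgn_comm j i,
    sgn_mul_self, one_smul, neg_sub]

/-- Expanding all brackets leaves an identity between products in the associative algebra of
endomorphisms. The signs are bimultiplicative in the parities, and the only further relation needed
is that `sgn i j` squares to one. -/
theorem superComm_jacobi_hom {i j k : ZMod 2} {δ η ζ : Module.End ℂ A} (hδ : δ ∈ homDer 𝒜 i)
    (hη : η ∈ homDer 𝒜 j) (hζ : ζ ∈ homDer 𝒜 k) :
    superComm 𝒜 δ (superComm 𝒜 η ζ) =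
      superComm 𝒜 (superComm 𝒜 δ η) ζ + sgn i j • superComm 𝒜 η (superComm 𝒜 δ ζ) := by
  rw [superComm_hom 𝒜 hδ (superComm_hom_mem 𝒜 hη hζ),
    superComm_hom 𝒜 (superComm_hom_mem 𝒜 hδ hη) hζ,
    superComm_hom 𝒜 hη (superComm_hom_mem 𝒜 hδ hζ), superComm_hom 𝒜 hη hζ,
    superComm_hom 𝒜 hδ hη, superComm_hom 𝒜 hδ hζ]
  have e := sgn_mul_self i j
  rw [show sgn (i + j) k = sgn i k * sgn j k by
      rw [sgn_comm, sgn_add, sgn_comm k i, sgn_comm k j], sgn_add, sgn_add, sgn_comm j i]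
  simp only [mul_sub, sub_mul, smul_sub, smul_smul, mul_smul_comm, smul_mul_assoc, mul_assoc]
  rw [show sgn i j * (sgn i j * sgn j k) = sgn j k by rw [← mul_assoc, e, one_mul],
    show sgn i j * (sgn i j * (sgn j k * sgn i k)) = sgn j k * sgn i k by
      rw [← mul_assoc, e, one_mul]]
  module

theorem superComm_jacobi {i j : ZMod 2} {δ η ζ : Module.End ℂ A} (hδ : δ ∈ homDer 𝒜 i)
    (hη : η ∈ homDer 𝒜 j) (hζ : ζ ∈ superDer 𝒜) :
    superComm 𝒜 δ (superComm 𝒜 η ζ) =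
      superComm 𝒜 (superComm 𝒜 δ η) ζ + sgn i j • superComm 𝒜 η (superComm 𝒜 δ ζ) := by
  obtain ⟨ζ₀, h0, ζ₁, h1, rfl⟩ := Submodule.mem_sup.1 hζ
  simp only [map_add, superComm_jacobi_hom 𝒜 hδ hη h0, superComm_jacobi_hom 𝒜 hδ hη h1, smul_add]
  abel

/-- The linear endomorphism underlying a superderivation. -/
def SDer.toEnd : SDer 𝒜 →ₗ[ℂ] Module.End ℂ A := (superDer 𝒜).subtype

/-- The component of parity `i` of a superderivation. -/
def sderPart (i : ZMod 2) : SDer 𝒜 →ₗ[ℂ] SDer 𝒜 where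
  toFun δ := (⟨endPart 𝒜 i δ.1, homDer_le 𝒜 i (endPart_mem 𝒜 i δ.2)⟩ : superDer 𝒜)
  map_add' δ η := Subtype.ext (map_add (endPart 𝒜 i) δ.1 η.1)
  map_smul' c δ := Subtype.ext (map_smul (endPart 𝒜 i) c δ.1)

theorem sderPart_mem (i : ZMod 2) (δ : SDer 𝒜) : sderPart 𝒜 i δ ∈ sderPar 𝒜 i :=
  endPart_mem 𝒜 i δ.2

theorem sderPart_same {i : ZMod 2} {δ : SDer 𝒜} (h : δ ∈ sderPar 𝒜 i) : sderPart 𝒜 i δ = δ :=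
  Subtype.ext (endPart_same 𝒜 h)

theorem sderPart_ne {i j : ZMod 2} {δ : SDer 𝒜} (h : δ ∈ sderPar 𝒜 i) (hij : i ≠ j) :
    sderPart 𝒜 j δ = 0 :=
  Subtype.ext (endPart_ne 𝒜 h hij)

theorem sum_sderPart (δ : SDer 𝒜) : ∑ i, sderPart 𝒜 i δ = δ := by
  refine Subtype.ext ?_
  change SDer.toEnd 𝒜 (∑ i, sderPart 𝒜 i δ) = _
  rw [map_sum]
  exact sum_endPart 𝒜 δ.1

theorem sderPart_fil (i : ZMod 2) {p : ℤ} {δ : SDer 𝒜} (hδ : δ ∈ sderFil 𝒜 p) :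
    sderPart 𝒜 i δ ∈ sderFil 𝒜 p := endPart_fil 𝒜 i hδ

theorem isFilteredLieSuperalgebra_sder :
    IsFilteredLieSuperalgebra (sderPar 𝒜) (sderBr 𝒜) (sderFil 𝒜) where
  internal := isInternal_of_proj _ (sderPart 𝒜) (sderPart_mem 𝒜)
    (fun _ _ h => sderPart_same 𝒜 h) (fun _ _ hij _ h => sderPart_ne 𝒜 h hij)
    fun δ => ⟨Finset.univ, (sum_sderPart 𝒜 δ).symm⟩
  br_mem _ _ _ hx _ hy := superComm_hom_mem 𝒜 hx hy
  skew _ _ _ hx _ hy := Subtype.ext (superComm_skew 𝒜 hx hy)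
  jacobi _ _ _ hx _ hy z := Subtype.ext (superComm_jacobi 𝒜 hx hy z.2)
  antitone := sderFil_antitone 𝒜
  eq_top := by
    rw [eq_top_iff]
    intro δ _
    -- At `p = -1` the two conditions concern the exponents `-1` and `0`, for which the power of the
    -- ideal is the whole algebra.
    refine ⟨fun a => ?_, fun a _ => ?_⟩
    · rw [oddPow_nonpos (by norm_num)]; trivial
    · rw [oddPow_nonpos (by norm_num)]; trivial
  fil_par p := mem_iSup_inf_of_proj _ _ (sderPart 𝒜) (sderPart_mem 𝒜)
    (fun i _ h => sderPart_fil 𝒜 i h) (sum_sderPart 𝒜)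
  br_fil := sderBr_fil 𝒜

end Superalgebra

/-! ### The filtered Lie superalgebra of vector fields on an open set -/

section Sheaf

variable {M : Type u} [TopologicalSpace M] (𝒪 : SuperSheaf.{u, v} M)

theorem sderPart_sec {U : Opens M} (i : ZMod 2) (δ : Der 𝒪 U) :
    (fun x : U => sderPart (𝒪.par x) i (δ.1 x)) ∈ (derSheaf 𝒪).sec U :=
  fun V h f hf => endPart_sec 𝒪 i δ V h f hf

/-- The component of parity `i` of a vector field. -/
def derPart (U : Opens M) (i : ZMod 2) : Der 𝒪 U →ₗ[ℂ] Der 𝒪 U where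
  toFun δ := (⟨fun x => sderPart (𝒪.par x) i (δ.1 x), sderPart_sec 𝒪 i δ⟩ : (derSheaf 𝒪).sec U)
  map_add' _ _ := Subtype.ext (funext fun x => map_add (sderPart (𝒪.par x) i) _ _)
  map_smul' _ _ := Subtype.ext (funext fun x => map_smul (sderPart (𝒪.par x) i) _ _)

theorem derPart_mem (U : Opens M) (i : ZMod 2) (δ : Der 𝒪 U) : derPart 𝒪 U i δ ∈ derPar 𝒪 U i :=
  fun x => sderPart_mem _ i (δ.1 x)

theorem sum_derPart (U : Opens M) (δ : Der 𝒪 U) : ∑ i, derPart 𝒪 U i δ = δ := by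
  refine SectionSheaf.ext fun x => ?_
  change (derSheaf 𝒪).germ U x (∑ i, derPart 𝒪 U i δ) = _
  rw [map_sum]
  exact sum_sderPart (𝒪.par x) (δ.1 x)

theorem derPart_fil (U : Opens M) (i : ZMod 2) {p : ℤ} {δ : Der 𝒪 U} (h : δ ∈ derFil 𝒪 U p) :
    derPart 𝒪 U i δ ∈ derFil 𝒪 U p :=
  ⟨sderPart_sec 𝒪 i δ, fun x => sderPart_fil _ i (derFil_germ 𝒪 h x)⟩

/-- A vector field is a family of derivations of stalks, so every identity is checked at points. The
one fact about sections that enters is that the even and odd components of a vector field are again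
vector fields. -/
theorem isFilteredLieSuperalgebra_der (U : Opens M) :
    IsFilteredLieSuperalgebra (derPar 𝒪 U) (derBr 𝒪 U) (derFil 𝒪 U) where
  internal := isInternal_of_proj _ (derPart 𝒪 U) (derPart_mem 𝒪 U)
    (fun _ _ h => SectionSheaf.ext fun x => sderPart_same _ (h x))
    (fun _ _ hij _ h => SectionSheaf.ext fun x => sderPart_ne _ (h x) hij)
    fun δ => ⟨Finset.univ, (sum_derPart 𝒪 U δ).symm⟩
  br_mem i j δ hx η hy := fun x =>
    (isFilteredLieSuperalgebra_sder (𝒪.par x)).br_mem i j _ (hx x) _ (hy x)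
  skew i j δ hx η hy := SectionSheaf.ext fun x =>
    (isFilteredLieSuperalgebra_sder (𝒪.par x)).skew i j _ (hx x) _ (hy x)
  jacobi i j δ hx η hy ζ := SectionSheaf.ext fun x =>
    (isFilteredLieSuperalgebra_sder (𝒪.par x)).jacobi i j _ (hx x) _ (hy x) (ζ.1 x)
  antitone _ _ hpq δ hδ := ⟨hδ.1, fun x => sderFil_antitone _ hpq (derFil_germ 𝒪 hδ x)⟩
  eq_top := by
    rw [eq_top_iff]
    refine fun δ _ => ⟨δ.2, fun x => ?_⟩
    rw [(isFilteredLieSuperalgebra_sder (𝒪.par x)).eq_top]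
    trivial
  fil_par p := mem_iSup_inf_of_proj _ _ (derPart 𝒪 U) (derPart_mem 𝒪 U)
    (fun i _ h => derPart_fil 𝒪 U i h) (sum_derPart 𝒪 U)
  br_fil := derBr_fil 𝒪 U

theorem der_res (U V : Opens M) (h : V ≤ U) :
    (∀ i, ∀ δ ∈ derPar 𝒪 U i, (derSheaf 𝒪).res h δ ∈ derPar 𝒪 V i) ∧
    (∀ p, ∀ δ ∈ derFil 𝒪 U p, (derSheaf 𝒪).res h δ ∈ derFil 𝒪 V p) ∧
    ∀ δ η, (derSheaf 𝒪).res h (derBr 𝒪 U δ η) =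
      derBr 𝒪 V ((derSheaf 𝒪).res h δ) ((derSheaf 𝒪).res h η) :=
  ⟨fun _ _ hδ x => hδ ⟨x, h x.2⟩,
    fun p δ hδ => (derFilSheaf 𝒪 p).res_mem U V h δ.1 hδ, fun _ _ => rfl⟩

end Sheaf

/-! ### The graded Lie superalgebra associated with a filtered Lie superalgebra -/

section GrLie

variable {L : Type*} [AddCommGroup L] [Module ℂ L] {par : ZMod 2 → Submodule ℂ L}
  {br : L →ₗ[ℂ] L →ₗ[ℂ] L} {F : Fil L}

namespace Gr

theorem degProj_mem_deg (F : Fil L) (p : ℤ) (t : Gr F) : degProj F p t ∈ deg F p := by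
  obtain ⟨x, hx⟩ := degProj_mem F p t
  exact ⟨x, hx.symm⟩

theorem degProj_same (F : Fil L) (p : ℤ) (t : Gr F) (ht : t ∈ deg F p) : degProj F p t = t := by
  obtain ⟨x, rfl⟩ := ht
  rw [degProj_cl, if_pos rfl]

theorem degProj_ne (F : Fil L) (p q : ℤ) (h : p ≠ q) (t : Gr F) (ht : t ∈ deg F p) :
    degProj F q t = 0 := by
  obtain ⟨x, rfl⟩ := ht
  rw [degProj_cl, if_neg h]

theorem deg_internal (F : Fil L) : DirectSum.IsInternal (deg F) :=
  isInternal_of_proj _ (degProj F) (degProj_mem_deg F) (degProj_same F)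
    (fun i j h t ht => degProj_ne F i j h t ht) fun t => by
      obtain ⟨S, hS⟩ := exists_eq_sum_degProj F t
      exact ⟨S, hS S subset_rfl⟩

theorem sum_parityProj' (F : Fil L) (t : Gr F) : ∑ i, parityProj F i t = t := by
  induction t using induction with
  | zero => simp
  | add s t hs ht => simp only [map_add, Finset.sum_add_distrib, hs, ht]
  | cl p x => simp [parityProj_cl]

theorem map_parityProj {L' : Type*} [AddCommGroup L'] [Module ℂ L'] {F : Fil L} {F' : Fil L'}
    (f : L →ₗ[ℂ] L') (hf : ∀ p, ∀ x ∈ F p, f x ∈ F' p) (i : ZMod 2) (t : Gr F) :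
    parityProj F' i (map f hf t) = map f hf (parityProj F i t) := by
  induction t using induction with
  | zero => simp
  | add s t hs ht => simp only [map_add, hs, ht]
  | cl q x =>
    rw [map_cl, parityProj_cl, parityProj_cl]
    split_ifs
    · rw [map_cl]
    · rw [map_zero]

end Gr

/-- The filtration is adapted to the parity: the classes of degree `p` are those of the elements
of parity `p`. -/
def ParityAdapted (par : ZMod 2 → Submodule ℂ L) (F : Fil L) : Prop :=
  ∀ p : ℤ, F p ⊓ par ((p : ZMod 2) + 1) ≤ F (p + 1)

/-- Of the two parity components of `x`, the one of the wrong parity lies in `F (p + 1)` and so has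
class zero. Signs, which are defined by parity upstairs and by degree downstairs, can therefore be
matched by a good choice of representatives. -/
theorem cl_mem_inherited (hp : ∀ p, F p = ⨆ i, F p ⊓ par i) (hF : ParityAdapted par F) (p : ℤ)
    (x : F p) : ∃ y : F p, (y : L) ∈ par p ∧ Gr.cl F p x = Gr.cl F p y := by
  obtain ⟨x, hx⟩ := x
  have hx' := hx
  rw [hp p] at hx'
  refine Submodule.iSup_induction' _
    (motive := fun x _ => ∀ hx : x ∈ F p, ∃ y : F p, (y : L) ∈ par p ∧
      Gr.cl F p ⟨x, hx⟩ = Gr.cl F p y) ?_ ?_ ?_ hx' hx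
  · rintro i x ⟨h1, h2⟩ h
    by_cases hi : i = (p : ZMod 2)
    · subst hi; exact ⟨⟨x, h⟩, h2, rfl⟩
    · refine ⟨0, zero_mem _, ?_⟩
      rw [map_zero]
      refine Gr.cl_eq_zero F p _ (hF p ⟨h1, ?_⟩)
      rwa [← zmod_two_ne (Ne.symm hi)]
  · exact fun h => ⟨0, zero_mem _, rfl⟩
  · intro x y hx hy h1 h2 h
    rw [← hp p] at hx hy
    obtain ⟨x', hx', ex⟩ := h1 hx
    obtain ⟨y', hy', ey⟩ := h2 hy
    exact ⟨x' + y', add_mem hx' hy', by rw [map_add, ← ex, ← ey, ← map_add]; rfl⟩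

theorem deg_le_inherited (hp : ∀ p, F p = ⨆ i, F p ⊓ par i) (hF : ParityAdapted par F) (p : ℤ) :
    Gr.deg F p ≤ Gr.inherited F (par p) := by
  rintro _ ⟨x, rfl⟩
  obtain ⟨y, hy, h⟩ := cl_mem_inherited hp hF p x
  rw [h]
  exact Submodule.subset_span ⟨p, y, hy, rfl⟩

/-- Nonzero classes of elements of parity `i` have a degree of parity `i`. -/
theorem cl_eq_zero_of_par (hF : ParityAdapted par F) {i : ZMod 2} {p : ℤ} (x : F p)
    (hx : (x : L) ∈ par i) (hi : (p : ZMod 2) ≠ i) : Gr.cl F p x = 0 := by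
  refine Gr.cl_eq_zero F p x (hF p ⟨x.2, ?_⟩)
  rwa [← zmod_two_ne hi]

theorem parityProj_inherited_same (hF : ParityAdapted par F) {i : ZMod 2} {t : Gr F}
    (ht : t ∈ Gr.inherited F (par i)) : Gr.parityProj F i t = t := by
  induction ht using Submodule.span_induction with
  | zero => rw [map_zero]
  | add x y _ _ hx hy => rw [map_add, hx, hy]
  | smul c x _ hx => rw [map_smul, hx]
  | mem x hx =>
    obtain ⟨p, x, hx, rfl⟩ := hx
    by_cases h : (p : ZMod 2) = i
    · rw [Gr.parityProj_cl, if_pos h]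
    · rw [cl_eq_zero_of_par hF x hx h, map_zero]

theorem parityProj_inherited_ne (hF : ParityAdapted par F) {i j : ZMod 2} (hij : i ≠ j) {t : Gr F}
    (ht : t ∈ Gr.inherited F (par i)) : Gr.parityProj F j t = 0 := by
  induction ht using Submodule.span_induction with
  | zero => rw [map_zero]
  | add x y _ _ hx hy => rw [map_add, hx, hy, add_zero]
  | smul c x _ hx => rw [map_smul, hx, smul_zero]
  | mem x hx =>
    obtain ⟨p, x, hx, rfl⟩ := hx
    by_cases h : (p : ZMod 2) = i
    · rw [Gr.parityProj_cl, if_neg (by rwa [h])]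
    · rw [cl_eq_zero_of_par hF x hx h, map_zero]

theorem parityProj_mem_inherited (hp : ∀ p, F p = ⨆ i, F p ⊓ par i) (hF : ParityAdapted par F)
    (i : ZMod 2) (t : Gr F) : Gr.parityProj F i t ∈ Gr.inherited F (par i) := by
  induction t using Gr.induction with
  | zero => rw [map_zero]; exact zero_mem _
  | add s t hs ht => rw [map_add]; exact add_mem hs ht
  | cl p x =>
    rw [Gr.parityProj_cl]
    split_ifs with h
    · subst h; exact deg_le_inherited hp hF p ⟨x, rfl⟩
    · exact zero_mem _

/-- The graded Lie superalgebra associated with a filtered Lie superalgebra. -/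
theorem IsFilteredLieSuperalgebra.gr (h : IsFilteredLieSuperalgebra par br F)
    (hF : ParityAdapted par F) :
    IsGradedLieSuperalgebra (fun i => Gr.inherited F (par i)) (Gr.bil br h.br_fil) (Gr.deg F) where
  internal := isInternal_of_proj _ (Gr.parityProj F) (parityProj_mem_inherited h.fil_par hF)
    (fun _ _ ht => parityProj_inherited_same hF ht)
    (fun _ _ hij _ ht => parityProj_inherited_ne hF hij ht)
    fun t => ⟨Finset.univ, (Gr.sum_parityProj' F t).symm⟩
  br_mem i j s hs t ht := by
    induction hs using Submodule.span_induction with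
    | zero => simp
    | add x y _ _ hx hy => rw [map_add, LinearMap.add_apply]; exact add_mem hx hy
    | smul c x _ hx => rw [map_smul, LinearMap.smul_apply]; exact Submodule.smul_mem _ _ hx
    | mem x hx =>
    obtain ⟨p, x, hx, rfl⟩ := hx
    induction ht using Submodule.span_induction with
    | zero => simp
    | add x y _ _ hx hy => rw [map_add]; exact add_mem hx hy
    | smul c x _ hx => rw [map_smul]; exact Submodule.smul_mem _ _ hx
    | mem y hy =>
    obtain ⟨q, y, hy, rfl⟩ := hy
    rw [Gr.bil_cl]
    exact Submodule.subset_span ⟨p + q, _, h.br_mem i j _ hx _ hy, rfl⟩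
  skew i j s hs t ht := by
    induction hs using Submodule.span_induction with
    | zero => simp
    | add x y _ _ hx hy => rw [map_add, LinearMap.add_apply, hx, hy, map_add, smul_add, neg_add]
    | smul c x _ hx =>
      rw [map_smul, LinearMap.smul_apply, hx, map_smul, smul_neg, smul_comm]
    | mem x hx =>
    obtain ⟨p, x, hx, rfl⟩ := hx
    induction ht using Submodule.span_induction with
    | zero => simp
    | add x y _ _ hx hy => rw [map_add, hx, hy, map_add, LinearMap.add_apply, smul_add, neg_add]
    | smul c x _ hx =>
      rw [map_smul, hx, map_smul, LinearMap.smul_apply, smul_neg, smul_comm]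
    | mem y hy =>
    obtain ⟨q, y, hy, rfl⟩ := hy
    rw [Gr.bil_cl, Gr.bil_cl, ← map_smul, ← map_neg]
    exact Gr.cl_congr F (add_comm p q) _ _ (h.skew i j _ hx _ hy)
  jacobi i j s hs t ht z := by
    induction hs using Submodule.span_induction with
    | zero => simp
    | add x y _ _ hx hy =>
      simp only [map_add, LinearMap.add_apply, smul_add] at hx hy ⊢
      rw [hx, hy]; abel
    | smul c x _ hx =>
      simp only [map_smul, LinearMap.smul_apply] at hx ⊢
      rw [hx, smul_add, smul_comm c]
    | mem x hx =>
    obtain ⟨p, x, hx, rfl⟩ := hx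
    induction ht using Submodule.span_induction with
    | zero => simp
    | add x y _ _ hx hy =>
      simp only [map_add, LinearMap.add_apply, smul_add] at hx hy ⊢
      rw [hx, hy]; abel
    | smul c x _ hx =>
      simp only [map_smul, LinearMap.smul_apply] at hx ⊢
      rw [hx, smul_add, smul_comm c]
    | mem y hy =>
    obtain ⟨q, y, hy, rfl⟩ := hy
    induction z using Gr.induction with
    | zero => simp
    | add x y hx hy =>
      simp only [map_add, smul_add] at hx hy ⊢
      rw [hx, hy]; abel
    | cl r z =>
    -- The terms of the Jacobi identity carry the degrees `p + (q + r)`, `p + q + r` and `q + (p +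
    -- r)`. These are equal integers but different index expressions, so the representative is moved
    -- along the equality before the classes are added.
    have e : (⟨br y (br x z), h.br_fil q (p + r) _ y.2 _ (h.br_fil p r _ x.2 _ z.2)⟩ :
        F (q + (p + r))).1 ∈ F (p + q + r) := by
      convert h.br_fil q (p + r) _ y.2 _ (h.br_fil p r _ x.2 _ z.2) using 2; ring
    rw [Gr.bil_cl, Gr.bil_cl, Gr.bil_cl, Gr.bil_cl, Gr.bil_cl, Gr.bil_cl,
      Gr.cl_congr F (show q + (p + r) = p + q + r by ring) _ ⟨_, e⟩ rfl, ← map_smul, ← map_add]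
    exact Gr.cl_congr F (add_assoc p q r).symm _ _ (h.jacobi i j _ hx _ hy z)
  deg_internal := Gr.deg_internal F
  deg_par := deg_le_inherited h.fil_par hF
  br_deg p q s hs t ht := by
    obtain ⟨x, rfl⟩ := hs
    obtain ⟨y, rfl⟩ := ht
    rw [Gr.bil_cl]
    exact ⟨_, rfl⟩

end GrLie

end SuperGeom

end

noncomputable section
namespace SuperGeom

set_option linter.unusedSectionVars false

/-! ### The map from `gr Der` to `Der gr` on one stalk -/

section StalkGr

variable {A : Type*} [Ring A] [Algebra ℂ A] (𝒜 : ZMod 2 → Submodule ℂ A) [GradedAlgebra 𝒜]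

theorem oddPow_fil_par (p : ℤ) : oddPow 𝒜 p = ⨆ i, oddPow 𝒜 p ⊓ 𝒜 i :=
  mem_iSup_inf_of_proj _ _ (fun i => GradedAlgebra.proj 𝒜 i) (proj_mem 𝒜)
    (fun i x hx => proj_oddPow 𝒜 i p x hx) (sum_proj 𝒜)

-- Write `a = a₀ + a₁` by parity, with `a₁` in the ideal, and let `δ` have order `p` and parity `p +
-- 1`. Then `δ a₀` lies in `I ^ p` with parity `p + 1`, hence in `I ^ (p + 1)`, where `δ a₁` lies
-- anyway. If `a` is in `I`, then `a₀` is even in `I ^ 1`, hence in `I ^ 2`, and `δ a₁` gains one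
-- power because its parity `p + 2` is not that of the exponent `p + 1`.
variable {𝒜} in
theorem sderFil_adapted (hK : ParityAdapted 𝒜 (oddPow 𝒜)) :
    ParityAdapted (sderPar 𝒜) (sderFil 𝒜) := by
  rintro p δ ⟨hδ, hpar⟩
  have h01 : ∀ a : A, a = GradedAlgebra.proj 𝒜 0 a + GradedAlgebra.proj 𝒜 1 a := fun a =>
    (sum_proj 𝒜 a).symm.trans (Fin.sum_univ_two fun i : Fin 2 => GradedAlgebra.proj 𝒜 i a)
  have hodd : ∀ a, GradedAlgebra.proj 𝒜 1 a ∈ oddIdeal 𝒜 := fun a =>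
    Submodule.subset_span ⟨1, _, proj_mem 𝒜 1 a, 1, by simp⟩
  refine ⟨fun a => ?_, fun a ha => ?_⟩
  · rw [h01 a, map_add]
    refine add_mem (hK p ⟨hδ.1 _, ?_⟩) (hδ.2 _ (hodd a))
    have := hpar.1 0 _ (proj_mem 𝒜 0 a)
    rwa [add_zero] at this
  · rw [h01 a, map_add]
    refine add_mem ?_ (hK (p + 1) ⟨hδ.2 _ (hodd a), ?_⟩)
    · have h2 : GradedAlgebra.proj 𝒜 0 a ∈ oddPow 𝒜 (1 + 1) := by
        refine hK 1 ⟨proj_oddPow 𝒜 0 1 a (by rwa [← oddIdeal_eq]), ?_⟩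
        have : ((1 : ℤ) : ZMod 2) + 1 = 0 := by decide
        rw [this]
        exact proj_mem 𝒜 0 a
      have := sderFil_oddPow 𝒜 hδ _ _ h2
      convert this using 2
      ring
    · have := hpar.1 1 _ (proj_mem 𝒜 1 a)
      push_cast
      exact this

variable {𝒜} in
/-- The linear endomorphism of the associated graded algebra induced by a superderivation in
the `p`-th term of the filtration. -/
def indAux {p : ℤ} (δ : sderFil 𝒜 p) : Module.End ℂ (Gr (oddPow 𝒜)) :=
  Gr.lift (oddPow 𝒜)
    (fun r => Gr.cl (oddPow 𝒜) (r + p) ∘ₗ δ.1.1.restrict (sderFil_oddPow 𝒜 δ.2 r))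
    fun r x hx => Gr.cl_eq_zero _ _ _ (by
      have := sderFil_oddPow 𝒜 δ.2 (r + 1) x hx
      rwa [add_right_comm] at this)

theorem indAux_cl {p : ℤ} (δ : sderFil 𝒜 p) (r : ℤ) (x : oddPow 𝒜 r) :
    indAux δ (Gr.cl _ r x) = Gr.cl _ (r + p) ⟨δ.1.1 x, sderFil_oddPow 𝒜 δ.2 r x x.2⟩ :=
  Gr.lift_cl _ _ _ r x

/-- The map `indAux` as a linear map. -/
def indEnd (p : ℤ) : sderFil 𝒜 p →ₗ[ℂ] Module.End ℂ (Gr (oddPow 𝒜)) where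
  toFun := indAux
  map_add' δ η := Gr.hom_ext fun r x => by
    rw [LinearMap.add_apply, indAux_cl, indAux_cl, indAux_cl, ← map_add]
    exact Gr.cl_congr _ rfl _ _ rfl
  map_smul' c δ := Gr.hom_ext fun r x => by
    rw [LinearMap.smul_apply, indAux_cl, indAux_cl, RingHom.id_apply, ← map_smul]
    exact Gr.cl_congr _ rfl _ _ rfl

theorem indEnd_cl (p : ℤ) (δ : sderFil 𝒜 p) (r : ℤ) (x : oddPow 𝒜 r) :
    indEnd 𝒜 p δ (Gr.cl _ r x) = Gr.cl _ (r + p) ⟨δ.1.1 x, sderFil_oddPow 𝒜 δ.2 r x x.2⟩ :=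
  indAux_cl 𝒜 δ r x

/-- Vanishing on classes of degree `0` says that `δ A ⊆ I ^ (p + 1)`, and on classes of degree `1`
that `δ I ⊆ I ^ (p + 2)`. These are precisely the two conditions defining the next term of the
filtration, and they control all higher powers by the Leibniz rule. -/
theorem indEnd_eq_zero_iff (p : ℤ) (δ : sderFil 𝒜 p) :
    indEnd 𝒜 p δ = 0 ↔ (δ : SDer 𝒜) ∈ sderFil 𝒜 (p + 1) := by
  refine ⟨fun h => ⟨fun a => ?_, fun a ha => ?_⟩, fun h => Gr.hom_ext fun r x => ?_⟩
  · have h1 := LinearMap.congr_fun h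
      (Gr.cl (oddPow 𝒜) 0 ⟨a, by rw [oddPow_nonpos le_rfl]; trivial⟩)
    rw [indEnd_cl] at h1
    have : δ.1.1 a ∈ oddPow 𝒜 (0 + p + 1) := Gr.mem_of_cl_eq_zero _ _ _ h1
    rwa [zero_add] at this
  · have h1 := LinearMap.congr_fun h (Gr.cl (oddPow 𝒜) 1 ⟨a, by rwa [← oddIdeal_eq]⟩)
    rw [indEnd_cl] at h1
    have : δ.1.1 a ∈ oddPow 𝒜 (1 + p + 1) := Gr.mem_of_cl_eq_zero _ _ _ h1
    rwa [add_comm 1] at this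
  · rw [indEnd_cl]
    refine Gr.cl_eq_zero _ _ _ ?_
    have := sderFil_oddPow 𝒜 h r x x.2
    rwa [← add_assoc] at this

namespace Gr

theorem deg_le_parity (p : ℤ) : deg (oddPow 𝒜) p ≤ parity (oddPow 𝒜) (p : ZMod 2) := by
  rintro _ ⟨x, rfl⟩
  exact cl_mem_parity _ p x

theorem degProj_parity {i : ZMod 2} (p : ℤ) {t : Gr (oddPow 𝒜)}
    (ht : t ∈ parity (oddPow 𝒜) i) : degProj (oddPow 𝒜) p t ∈ parity (oddPow 𝒜) i := by
  refine Submodule.iSup_induction _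
    (motive := fun t => degProj (oddPow 𝒜) p t ∈ parity (oddPow 𝒜) i) ht ?_
    (by rw [map_zero]; exact zero_mem _) fun s t hs ht => by rw [map_add]; exact add_mem hs ht
  rintro ⟨q, rfl⟩ _ ⟨x, rfl⟩
  rw [degProj_cl]
  split_ifs
  · exact cl_mem_parity _ q x
  · exact zero_mem _

theorem degProj_mul_cl (s r : ℤ) (t : Gr (oddPow 𝒜)) (y : oddPow 𝒜 r) :
    degProj (oddPow 𝒜) (s + r) (t * cl _ r y) = degProj (oddPow 𝒜) s t * cl _ r y := by
  induction t using induction with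
  | zero => simp
  | add s t hs ht => simp only [map_add, add_mul, hs, ht]
  | cl q x =>
    rw [cl_mul_cl, degProj_cl, degProj_cl]
    by_cases h : q = s
    · rw [if_pos h, if_pos (by omega), cl_mul_cl]
    · rw [if_neg h, if_neg (by omega), zero_mul]

theorem degProj_cl_mul (s r : ℤ) (t : Gr (oddPow 𝒜)) (y : oddPow 𝒜 r) :
    degProj (oddPow 𝒜) (r + s) (cl _ r y * t) = cl _ r y * degProj (oddPow 𝒜) s t := by
  induction t using induction with
  | zero => simp
  | add s t hs ht => simp only [map_add, mul_add, hs, ht]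
  | cl q x =>
    rw [cl_mul_cl, degProj_cl, degProj_cl]
    by_cases h : q = s
    · rw [if_pos h, if_pos (by omega), cl_mul_cl]
    · rw [if_neg h, if_neg (by omega), mul_zero]

end Gr

/-- An endomorphism of the associated graded algebra that shifts the degree by `p` shifts the
parity by `p`. -/
theorem map_parity_of_deg {p : ℤ} {T : Module.End ℂ (Gr (oddPow 𝒜))}
    (hT : ∀ q, ∀ a ∈ Gr.deg (oddPow 𝒜) q, T a ∈ Gr.deg (oddPow 𝒜) (q + p)) (j : ZMod 2)
    (a : Gr (oddPow 𝒜)) (ha : a ∈ Gr.parity (oddPow 𝒜) j) :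
    T a ∈ Gr.parity (oddPow 𝒜) ((p : ZMod 2) + j) := by
  refine Submodule.iSup_induction _
    (motive := fun a => T a ∈ Gr.parity (oddPow 𝒜) ((p : ZMod 2) + j)) ha ?_
    (by rw [map_zero]; exact zero_mem _) fun s t hs ht => by rw [map_add]; exact add_mem hs ht
  rintro ⟨q, rfl⟩ a ha
  have := Gr.deg_le_parity 𝒜 _ (hT q a ha)
  rwa [Int.cast_add, add_comm] at this

theorem indEnd_deg (p : ℤ) (δ : sderFil 𝒜 p) (q : ℤ) (a : Gr (oddPow 𝒜))
    (ha : a ∈ Gr.deg (oddPow 𝒜) q) : indEnd 𝒜 p δ a ∈ Gr.deg (oddPow 𝒜) (q + p) := by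
  obtain ⟨x, rfl⟩ := ha
  rw [indEnd_cl]
  exact ⟨_, rfl⟩

variable {𝒜} in
theorem indEnd_homDer (hK : ParityAdapted 𝒜 (oddPow 𝒜)) (p : ℤ) (δ : sderFil 𝒜 p)
    (hδ : (δ : SDer 𝒜) ∈ sderPar 𝒜 p) :
    indEnd 𝒜 p δ ∈ homDer (Gr.parity (oddPow 𝒜)) p := by
  refine ⟨map_parity_of_deg 𝒜 (indEnd_deg 𝒜 p δ), fun j a ha b => ?_⟩
  refine Submodule.iSup_induction _
    (motive := fun a => indEnd 𝒜 p δ (a * b) = indEnd 𝒜 p δ a * b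
      + sgn p j • (a * indEnd 𝒜 p δ b)) ha ?_ (by simp) fun s t hs ht => by
        rw [add_mul, map_add, hs, ht, map_add, add_mul, add_mul, smul_add]; abel
  rintro ⟨q, rfl⟩ _ ⟨x, rfl⟩
  -- The Leibniz sign upstairs is that of the parity of the representative, the sign downstairs that
  -- of the degree `q`. A representative of parity `q` makes them equal.
  obtain ⟨x', hx', e⟩ := cl_mem_inherited (oddPow_fil_par 𝒜) hK q x
  rw [e]
  induction b using Gr.induction with
  | zero => simp
  | add s t hs ht => rw [mul_add, map_add, hs, ht, map_add, mul_add, mul_add, smul_add]; abel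
  | cl r y =>
    rw [Gr.cl_mul_cl, indEnd_cl, indEnd_cl, indEnd_cl, Gr.cl_mul_cl, Gr.cl_mul_cl, ← map_smul]
    have e1 : x'.1 * δ.1.1 y ∈ oddPow 𝒜 (q + p + r) := by
      convert oddPow_mul_mem 𝒜 q (r + p) _ x'.2 _ (sderFil_oddPow 𝒜 δ.2 r y y.2) using 2
      ring
    rw [Gr.cl_congr _ (show q + (r + p) = q + p + r by ring)
      (sgn (p : ZMod 2) (q : ZMod 2) • _) (sgn (p : ZMod 2) (q : ZMod 2) • ⟨_, e1⟩) rfl, ← map_add]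
    exact Gr.cl_congr _ (by ring) _ _ (hδ.2 q _ hx' y)

-- The induced map depends only on the class of `δ`, and this class has a representative of parity
-- `p`, to which `indEnd_homDer` applies.
variable {𝒜} in
theorem indEnd_mem (hK : ParityAdapted 𝒜 (oddPow 𝒜)) (p : ℤ) (δ : sderFil 𝒜 p) :
    indEnd 𝒜 p δ ∈ homDer (Gr.parity (oddPow 𝒜)) p := by
  obtain ⟨δ', h, e⟩ := cl_mem_inherited (isFilteredLieSuperalgebra_sder 𝒜).fil_par
    (sderFil_adapted hK) p δ
  have : indEnd 𝒜 p δ = indEnd 𝒜 p δ' := by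
    rw [← sub_eq_zero, ← map_sub, indEnd_eq_zero_iff]
    exact Gr.mem_of_cl_eq_zero _ _ _ (by rw [map_sub, e, sub_self])
  rw [this]
  exact indEnd_homDer hK p δ' h

/-- The superderivations of degree `p` of the associated graded algebra. -/
def sderDeg (p : ℤ) : Submodule ℂ (SDer (Gr.parity (oddPow 𝒜))) where
  carrier := {δ | ∀ q : ℤ, ∀ a ∈ Gr.deg (oddPow 𝒜) q, δ.1 a ∈ Gr.deg (oddPow 𝒜) (q + p)}
  zero_mem' := fun _ _ _ => zero_mem _
  add_mem' := fun hs ht q a ha => add_mem (hs q a ha) (ht q a ha)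
  smul_mem' := fun c _ hs q a ha => Submodule.smul_mem _ c (hs q a ha)

/-- A map of degree `p` sends parity `j` to parity `p + j`, so its component of the other parity is
zero. -/
theorem sderDeg_le_sderPar (p : ℤ) : sderDeg 𝒜 p ≤ sderPar (Gr.parity (oddPow 𝒜)) p := by
  intro D hD
  have h : sderPart (Gr.parity (oddPow 𝒜)) p D = D := by
    conv_rhs => rw [← sum_sderPart _ D]
    symm
    refine Finset.sum_eq_single _ (fun i _ hi => ?_) fun h => absurd (Finset.mem_univ _) h
    refine Subtype.ext (LinearMap.ext fun a => ?_)
    refine (endPart_apply _ i D.1 a).trans (Finset.sum_eq_zero fun j _ => ?_)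
    refine proj_ne _ (map_parity_of_deg 𝒜 hD j _ (proj_mem _ j a)) ?_
    intro h
    exact hi (add_right_cancel h).symm
  rw [← h]
  exact sderPart_mem _ _ D

/-- The superderivation of the associated graded algebra induced by a superderivation in
the `p`-th term of the filtration. -/
def ind (hK : ParityAdapted 𝒜 (oddPow 𝒜)) (p : ℤ) :
    sderFil 𝒜 p →ₗ[ℂ] SDer (Gr.parity (oddPow 𝒜)) where
  toFun δ := (⟨indEnd 𝒜 p δ, homDer_le _ _ (indEnd_mem hK p δ)⟩ :
    superDer (Gr.parity (oddPow 𝒜)))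
  map_add' δ η := Subtype.ext (map_add (indEnd 𝒜 p) δ η)
  map_smul' c δ := Subtype.ext (map_smul (indEnd 𝒜 p) c δ)

variable {𝒜} (hK : ParityAdapted 𝒜 (oddPow 𝒜))

theorem ind_val (p : ℤ) (δ : sderFil 𝒜 p) : (ind 𝒜 hK p δ).1 = indEnd 𝒜 p δ := rfl

theorem ind_mem_deg (p : ℤ) (δ : sderFil 𝒜 p) : ind 𝒜 hK p δ ∈ sderDeg 𝒜 p := indEnd_deg 𝒜 p δ

theorem ind_eq_zero_iff (p : ℤ) (δ : sderFil 𝒜 p) :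
    ind 𝒜 hK p δ = 0 ↔ (δ : SDer 𝒜) ∈ sderFil 𝒜 (p + 1) := by
  rw [← indEnd_eq_zero_iff, ← ind_val hK]
  exact ⟨fun h => by rw [h]; rfl, fun h => Subtype.ext h⟩

/-- The map from the associated graded space of the superderivations to the superderivations of
the associated graded algebra. -/
def grInd : Gr (sderFil 𝒜) →ₗ[ℂ] SDer (Gr.parity (oddPow 𝒜)) :=
  Gr.lift (sderFil 𝒜) (ind 𝒜 hK) fun p δ h => (ind_eq_zero_iff hK p δ).2 h

theorem grInd_cl (p : ℤ) (δ : sderFil 𝒜 p) : grInd hK (Gr.cl _ p δ) = ind 𝒜 hK p δ :=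
  Gr.lift_cl _ _ _ p δ

theorem grInd_deg (p : ℤ) (t : Gr (sderFil 𝒜)) (ht : t ∈ Gr.deg (sderFil 𝒜) p) :
    grInd hK t ∈ sderDeg 𝒜 p := by
  obtain ⟨δ, rfl⟩ := ht
  rw [grInd_cl]
  exact ind_mem_deg hK p δ

theorem grInd_par (i : ZMod 2) (t : Gr (sderFil 𝒜))
    (ht : t ∈ Gr.inherited (sderFil 𝒜) (sderPar 𝒜 i)) :
    grInd hK t ∈ sderPar (Gr.parity (oddPow 𝒜)) i := by
  induction ht using Submodule.span_induction with
  | zero => rw [map_zero]; exact zero_mem _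
  | add x y _ _ hx hy => rw [map_add]; exact add_mem hx hy
  | smul c x _ hx => rw [map_smul]; exact Submodule.smul_mem _ _ hx
  | mem x hx =>
    obtain ⟨p, δ, hδ, rfl⟩ := hx
    by_cases h : (p : ZMod 2) = i
    · subst h
      rw [grInd_cl]
      exact sderDeg_le_sderPar 𝒜 p (ind_mem_deg hK p δ)
    · rw [cl_eq_zero_of_par (sderFil_adapted hK) δ hδ h, map_zero]
      exact zero_mem _

/-- With representatives of parity `p` and `q`, both supercommutators are given by the same formula
`δ η ∓ η δ` with the same sign, and they can be compared on classes. -/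
theorem grInd_br (s t : Gr (sderFil 𝒜)) :
    grInd hK (Gr.bil (sderBr 𝒜) (sderBr_fil 𝒜) s t) =
      sderBr (Gr.parity (oddPow 𝒜)) (grInd hK s) (grInd hK t) := by
  induction s using Gr.induction with
  | zero => simp
  | add x y hx hy => simp only [map_add, LinearMap.add_apply, hx, hy]
  | cl p δ =>
  induction t using Gr.induction with
  | zero => simp
  | add x y hx hy => simp only [map_add, hx, hy]
  | cl q η =>
  obtain ⟨δ', hδ, e⟩ := cl_mem_inherited (isFilteredLieSuperalgebra_sder 𝒜).fil_par
    (sderFil_adapted hK) p δ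
  obtain ⟨η', hη, e'⟩ := cl_mem_inherited (isFilteredLieSuperalgebra_sder 𝒜).fil_par
    (sderFil_adapted hK) q η
  rw [e, e', Gr.bil_cl, grInd_cl, grInd_cl, grInd_cl]
  have key : superComm (Gr.parity (oddPow 𝒜)) (indEnd 𝒜 p δ') (indEnd 𝒜 q η') = indEnd 𝒜 (p + q)
      ⟨sderBr 𝒜 δ' η', sderBr_fil 𝒜 p q _ δ'.2 _ η'.2⟩ := by
    rw [superComm_hom _ (indEnd_homDer hK p δ' hδ) (indEnd_homDer hK q η' hη)]
    refine Gr.hom_ext fun r x => ?_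
    rw [indEnd_cl, LinearMap.sub_apply, LinearMap.smul_apply, Module.End.mul_apply,
      Module.End.mul_apply, indEnd_cl, indEnd_cl, indEnd_cl, indEnd_cl]
    have e1 : η'.1.1 (δ'.1.1 x) ∈ oddPow 𝒜 (r + q + p) := by
      convert sderFil_oddPow 𝒜 η'.2 _ _ (sderFil_oddPow 𝒜 δ'.2 r x x.2) using 2
      ring
    rw [Gr.cl_congr _ (show r + p + q = r + q + p by ring) _ ⟨_, e1⟩ rfl, ← map_smul, ← map_sub]
    refine Gr.cl_congr _ (by ring) _ _ ?_
    exact (LinearMap.congr_fun (superComm_hom 𝒜 hδ hη) x.1).symm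
  have e1 : (sderBr (Gr.parity (oddPow 𝒜)) (ind 𝒜 hK p δ') (ind 𝒜 hK q η')).1 =
      superComm (Gr.parity (oddPow 𝒜)) (indEnd 𝒜 p δ') (indEnd 𝒜 q η') :=
    (sderBr_val (Gr.parity (oddPow 𝒜)) (ind 𝒜 hK p δ') (ind 𝒜 hK q η')).trans
      (congrArg₂ (fun S T => superComm (Gr.parity (oddPow 𝒜)) S T) (ind_val hK p δ')
        (ind_val hK q η'))
  exact Subtype.ext ((ind_val hK _ _).trans (key.symm.trans e1.symm))

/-! ### Homogeneous components of superderivations of the associated graded algebra -/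

/-- The component of degree `p` of an endomorphism of the associated graded algebra. -/
def compAux (p : ℤ) (T : Module.End ℂ (Gr (oddPow 𝒜))) : Module.End ℂ (Gr (oddPow 𝒜)) :=
  Gr.lift (oddPow 𝒜) (fun q => Gr.degProj _ (q + p) ∘ₗ T ∘ₗ Gr.cl _ q)
    fun q x hx => by
      rw [LinearMap.comp_apply, LinearMap.comp_apply, Gr.cl_eq_zero _ _ _ hx, map_zero, map_zero]

theorem compAux_cl (p : ℤ) (T : Module.End ℂ (Gr (oddPow 𝒜))) (q : ℤ) (x : oddPow 𝒜 q) :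
    compAux p T (Gr.cl _ q x) = Gr.degProj _ (q + p) (T (Gr.cl _ q x)) :=
  Gr.lift_cl _ _ _ q x

variable (𝒜) in
/-- The map `compAux` as a linear map. -/
def compEnd (p : ℤ) : Module.End ℂ (Gr (oddPow 𝒜)) →ₗ[ℂ] Module.End ℂ (Gr (oddPow 𝒜)) where
  toFun := compAux p
  map_add' S T := Gr.hom_ext fun q x => by
    rw [LinearMap.add_apply, compAux_cl, compAux_cl, compAux_cl, LinearMap.add_apply, map_add]
  map_smul' c T := Gr.hom_ext fun q x => by
    rw [LinearMap.smul_apply, compAux_cl, compAux_cl, LinearMap.smul_apply, map_smul,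
      RingHom.id_apply]

theorem compEnd_cl (p : ℤ) (T : Module.End ℂ (Gr (oddPow 𝒜))) (q : ℤ) (x : oddPow 𝒜 q) :
    compEnd 𝒜 p T (Gr.cl _ q x) = Gr.degProj _ (q + p) (T (Gr.cl _ q x)) :=
  compAux_cl p T q x

/-- On elements of degrees `q` and `r`, the projection of the Leibniz rule for `T` onto degree `q +
r + p` is the Leibniz rule for its component of degree `p`, since multiplication by a homogeneous
element shifts the degree projections. -/
theorem compEnd_homDer (p : ℤ) {i : ZMod 2} {T : Module.End ℂ (Gr (oddPow 𝒜))}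
    (hT : T ∈ homDer (Gr.parity (oddPow 𝒜)) i) :
    compEnd 𝒜 p T ∈ homDer (Gr.parity (oddPow 𝒜)) i := by
  refine ⟨fun j a ha => ?_, fun j a ha b => ?_⟩
  · refine Submodule.iSup_induction _
      (motive := fun a => compEnd 𝒜 p T a ∈ Gr.parity (oddPow 𝒜) (i + j)) ha ?_
      (by rw [map_zero]; exact zero_mem _) fun s t hs ht => by rw [map_add]; exact add_mem hs ht
    rintro ⟨q, rfl⟩ _ ⟨x, rfl⟩
    rw [compEnd_cl]
    exact Gr.degProj_parity 𝒜 _ (hT.1 _ _ (Gr.cl_mem_parity _ q x))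
  · refine Submodule.iSup_induction _
      (motive := fun a => compEnd 𝒜 p T (a * b) = compEnd 𝒜 p T a * b
        + sgn i j • (a * compEnd 𝒜 p T b)) ha ?_ (by simp) fun s t hs ht => by
          rw [add_mul, map_add, hs, ht, map_add, add_mul, add_mul, smul_add]; abel
    rintro ⟨q, rfl⟩ _ ⟨x, rfl⟩
    induction b using Gr.induction with
    | zero => simp
    | add s t hs ht => rw [mul_add, map_add, hs, ht, map_add, mul_add, mul_add, smul_add]; abel
    | cl r y =>
      rw [Gr.cl_mul_cl, compEnd_cl, compEnd_cl, compEnd_cl, ← Gr.cl_mul_cl,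
        hT.2 _ _ (Gr.cl_mem_parity _ q x), map_add, map_smul]
      rw [show q + r + p = (q + p) + r by ring, Gr.degProj_mul_cl,
        show q + p + r = q + (r + p) by ring, Gr.degProj_cl_mul]

theorem compEnd_superDer (p : ℤ) {T : Module.End ℂ (Gr (oddPow 𝒜))}
    (hT : T ∈ superDer (Gr.parity (oddPow 𝒜))) :
    compEnd 𝒜 p T ∈ superDer (Gr.parity (oddPow 𝒜)) := by
  obtain ⟨S, h0, S', h1, rfl⟩ := Submodule.mem_sup.1 hT
  rw [map_add]
  exact add_mem (homDer_le _ _ (compEnd_homDer p h0)) (homDer_le _ _ (compEnd_homDer p h1))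

variable (𝒜) in
/-- The component of degree `p` of a superderivation of the associated graded algebra. -/
def sderComp (p : ℤ) : SDer (Gr.parity (oddPow 𝒜)) →ₗ[ℂ] SDer (Gr.parity (oddPow 𝒜)) where
  toFun D := (⟨compEnd 𝒜 p D.1, compEnd_superDer p D.2⟩ : superDer (Gr.parity (oddPow 𝒜)))
  map_add' D E := Subtype.ext (map_add (compEnd 𝒜 p) D.1 E.1)
  map_smul' c D := Subtype.ext (map_smul (compEnd 𝒜 p) c D.1)

theorem sderComp_cl (p : ℤ) (D : SDer (Gr.parity (oddPow 𝒜))) (q : ℤ) (x : oddPow 𝒜 q) :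
    (sderComp 𝒜 p D).1 (Gr.cl _ q x) = Gr.degProj _ (q + p) (D.1 (Gr.cl _ q x)) :=
  compEnd_cl p D.1 q x

theorem sderComp_mem (p : ℤ) (D : SDer (Gr.parity (oddPow 𝒜))) :
    sderComp 𝒜 p D ∈ sderDeg 𝒜 p := by
  rintro q _ ⟨x, rfl⟩
  rw [sderComp_cl]
  exact Gr.degProj_mem_deg _ _ _

theorem sderComp_same (p : ℤ) (D : SDer (Gr.parity (oddPow 𝒜))) (hD : D ∈ sderDeg 𝒜 p) :
    sderComp 𝒜 p D = D := by
  refine Subtype.ext (Gr.hom_ext fun q x => ?_)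
  rw [sderComp_cl]
  exact Gr.degProj_same _ _ _ (hD q _ ⟨x, rfl⟩)

theorem sderComp_ne (p q : ℤ) (h : p ≠ q) (D : SDer (Gr.parity (oddPow 𝒜)))
    (hD : D ∈ sderDeg 𝒜 p) : sderComp 𝒜 q D = 0 := by
  refine Subtype.ext (Gr.hom_ext fun r x => ?_)
  rw [sderComp_cl]
  exact Gr.degProj_ne _ _ _ (by omega) _ (hD r _ ⟨x, rfl⟩)

theorem sderComp_grInd (p : ℤ) (t : Gr (sderFil 𝒜)) :
    sderComp 𝒜 p (grInd hK t) = grInd hK (Gr.degProj _ p t) := by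
  induction t using Gr.induction with
  | zero => simp
  | add s t hs ht => simp only [map_add, hs, ht]
  | cl q δ =>
    rw [Gr.degProj_cl]
    split_ifs with h
    · subst h
      exact sderComp_same q _ (grInd_deg hK q _ ⟨δ, rfl⟩)
    · rw [map_zero]
      exact sderComp_ne q p h _ (grInd_deg hK q _ ⟨δ, rfl⟩)

/-- Taking components of degree `p` commutes with the map, so it suffices to treat a single class,
where the kernel is known from `ind_eq_zero_iff`. -/
theorem grInd_injective : Function.Injective (grInd hK) := by
  rw [injective_iff_map_eq_zero]
  intro t ht
  obtain ⟨S, hS⟩ := Gr.exists_eq_sum_degProj _ t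
  rw [hS S subset_rfl]
  refine Finset.sum_eq_zero fun p _ => ?_
  have h := sderComp_grInd hK p t
  rw [ht, map_zero] at h
  obtain ⟨δ, hδ⟩ := Gr.degProj_mem _ p t
  rw [hδ] at h ⊢
  rw [grInd_cl] at h
  exact Gr.cl_eq_zero _ _ _ ((ind_eq_zero_iff hK p δ).1 h.symm)

/-! ### Bounded filtrations -/

section Bounded

variable {m : ℕ} (hm : oddPow 𝒜 ((m : ℤ) + 1) = ⊥)
include hm

-- For `q < 0` the next power, of exponent `q + 1 ≤ 0`, is still the whole algebra. For `q > m` the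
-- power itself is zero.
omit [GradedAlgebra 𝒜] in
theorem grOddPow_cl_eq_zero {q : ℤ} (hq : q ∉ Finset.Icc 0 (m : ℤ)) (x : oddPow 𝒜 q) :
    Gr.cl _ q x = 0 := by
  rw [Finset.mem_Icc, not_and_or, not_le, not_le] at hq
  rcases hq with h | h
  · refine Gr.cl_eq_zero _ _ _ ?_
    rw [oddPow_nonpos (by omega)]
    trivial
  · have hx := oddPow_antitone 𝒜 (show (m : ℤ) + 1 ≤ q by omega) x.2
    rw [hm] at hx
    rw [show x = 0 from Subtype.ext hx, map_zero]

theorem sum_degProj_oddPow (t : Gr (oddPow 𝒜)) :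
    ∑ q ∈ Finset.Icc 0 (m : ℤ), Gr.degProj _ q t = t := by
  induction t using Gr.induction with
  | zero => simp
  | add s t hs ht => simp only [map_add, Finset.sum_add_distrib, hs, ht]
  | cl q x =>
    simp only [Gr.degProj_cl, Finset.sum_ite_eq]
    split_ifs with h
    · rfl
    · exact (grOddPow_cl_eq_zero hm h x).symm

/-- Below `-1` the filtration is constant, and above `m` it is zero because a derivation with values
in `I ^ (m + 1)` vanishes. -/
theorem sum_degProj_sderFil (t : Gr (sderFil 𝒜)) :
    ∑ q ∈ Finset.Icc (-1) (m : ℤ), Gr.degProj _ q t = t := by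
  induction t using Gr.induction with
  | zero => simp
  | add s t hs ht => simp only [map_add, Finset.sum_add_distrib, hs, ht]
  | cl q δ =>
    simp only [Gr.degProj_cl, Finset.sum_ite_eq]
    split_ifs with h
    · rfl
    · rw [Finset.mem_Icc, not_and_or, not_le, not_le] at h
      refine (Gr.cl_eq_zero _ _ _ ?_).symm
      rcases h with h | h
      · refine sderFil_antitone 𝒜 (show q + 1 ≤ -1 by omega) ?_
        rw [(isFilteredLieSuperalgebra_sder 𝒜).eq_top]
        trivial
      · have : (δ : SDer 𝒜) = 0 := Subtype.ext (LinearMap.ext fun a => by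
          have hx := oddPow_antitone 𝒜 (show (m : ℤ) + 1 ≤ q by omega) (δ.2.1 a)
          rw [hm] at hx
          exact hx)
        rw [this]
        exact zero_mem _

theorem sum_sderComp (D : SDer (Gr.parity (oddPow 𝒜))) :
    ∑ p ∈ Finset.Icc (-m : ℤ) m, sderComp 𝒜 p D = D := by
  refine Subtype.ext ?_
  change SDer.toEnd _ (∑ p ∈ Finset.Icc (-m : ℤ) m, sderComp 𝒜 p D) = _
  rw [map_sum]
  refine Gr.hom_ext fun q x => ?_
  rw [LinearMap.sum_apply]
  by_cases hq : q ∈ Finset.Icc 0 (m : ℤ)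
  · conv_rhs => rw [← sum_degProj_oddPow hm (D.1 _)]
    have e : ∀ p, (SDer.toEnd (Gr.parity (oddPow 𝒜)) (sderComp 𝒜 p D)) (Gr.cl _ q x) =
        Gr.degProj _ (q + p) (D.1 (Gr.cl _ q x)) := fun p => sderComp_cl p D q x
    simp only [e]
    rw [Finset.mem_Icc] at hq
    -- Source and target degrees both lie in `[0, m]`, so their difference lies in `[-m, m]`. The
    -- shifted interval `q + [-m, m]` covers `[0, m]`, and the components of the other degrees are
    -- zero.
    refine (Finset.sum_subset (s₂ := (Finset.Icc (-m : ℤ) m).image (q + ·)) ?_ ?_).trans ?_ |>.symm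
    · intro s hs
      rw [Finset.mem_Icc] at hs
      rw [Finset.mem_image]
      exact ⟨s - q, by rw [Finset.mem_Icc]; omega, by ring⟩
    · intro s _ hs
      obtain ⟨y, hy⟩ := Gr.degProj_mem _ s (D.1 (Gr.cl _ q x))
      rw [hy]
      exact grOddPow_cl_eq_zero hm hs y
    · rw [Finset.sum_image fun a _ b _ h => add_left_cancel h]
  · rw [grOddPow_cl_eq_zero hm hq]
    simp

end Bounded

end StalkGr

/-! ### Splittings -/

section Splittings

variable {A : Type*} [Ring A] [Algebra ℂ A] (𝒜 : ZMod 2 → Submodule ℂ A)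

/-- A grading that splits the filtration of a superalgebra by the powers of the ideal generated
by the odd elements, given by the projections onto the homogeneous components. -/
structure Splitting (m : ℕ) where
  /-- the projections -/
  π : ℤ → Module.End ℂ A
  mem_pow : ∀ p a, π p a ∈ oddPow 𝒜 p
  vanish : ∀ p q a, a ∈ oddPow 𝒜 p → q < p → π q a = 0
  sum : ∀ a, ∑ q ∈ Finset.Icc 0 (m : ℤ), π q a = a
  orth : ∀ p q a, π p (π q a) = if p = q then π q a else 0
  par : ∀ (p : ℤ) a, π p a ∈ 𝒜 (p : ZMod 2)
  mul : ∀ p q a b, π (p + q) (π p a * π q b) = π p a * π q b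

variable {𝒜} {m : ℕ} (σ : Splitting 𝒜 m)

namespace Splitting

include σ in
theorem oddPow_eq_bot : oddPow 𝒜 ((m : ℤ) + 1) = ⊥ := by
  rw [eq_bot_iff]
  intro a ha
  rw [Submodule.mem_bot, ← σ.sum a]
  refine Finset.sum_eq_zero fun q hq => σ.vanish _ _ _ ha ?_
  rw [Finset.mem_Icc] at hq
  omega

/-- On `I ^ p` the components of degree below `p` vanish, and those of degree above `p` lie in `I ^
(p + 1)`. So the homogeneous component represents the same class (`cl_π`). -/
theorem sub_mem {p : ℤ} {a : A} (ha : a ∈ oddPow 𝒜 p) : a - σ.π p a ∈ oddPow 𝒜 (p + 1) := by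
  rcases lt_or_ge p 0 with hp | hp
  · rw [oddPow_nonpos (by omega)]; trivial
  have h : a - σ.π p a = ∑ q ∈ (Finset.Icc 0 (m : ℤ)).erase p, σ.π q a := by
    by_cases hm : p ∈ Finset.Icc 0 (m : ℤ)
    · rw [sub_eq_iff_eq_add, Finset.sum_erase_add _ _ hm, σ.sum]
    -- Here `p > m`. Nothing in the decomposition of `a` has degree `p`, and orthogonality makes the
    -- component zero.
    · have : σ.π p a = 0 := by
        conv_lhs => rw [← σ.sum a]
        rw [map_sum]
        refine Finset.sum_eq_zero fun q hq => ?_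
        rw [σ.orth, if_neg]
        rintro rfl
        exact hm hq
      rw [this, sub_zero, Finset.erase_eq_of_notMem hm, σ.sum]
  rw [h]
  refine sum_mem fun q hq => ?_
  rw [Finset.mem_erase] at hq
  rcases lt_or_gt_of_ne hq.1 with h | h
  · rw [σ.vanish _ _ _ ha h]; exact zero_mem _
  · exact oddPow_antitone 𝒜 (show p + 1 ≤ q by omega) (σ.mem_pow q a)

theorem cl_π (p : ℤ) (a : oddPow 𝒜 p) :
    Gr.cl (oddPow 𝒜) p a = Gr.cl _ p ⟨σ.π p a, σ.mem_pow p a⟩ := by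
  rw [← sub_eq_zero, ← map_sub]
  exact Gr.cl_eq_zero _ _ _ (σ.sub_mem a.2)

/-- The isomorphism with the associated graded algebra given by a splitting. -/
def toGr : A →ₗ[ℂ] Gr (oddPow 𝒜) :=
  ∑ q ∈ Finset.Icc 0 (m : ℤ), Gr.cl _ q ∘ₗ (σ.π q).codRestrict _ (σ.mem_pow q)

theorem toGr_apply (a : A) : σ.toGr a =
    ∑ q ∈ Finset.Icc 0 (m : ℤ), Gr.cl _ q ⟨σ.π q a, σ.mem_pow q a⟩ := by
  rw [toGr, LinearMap.sum_apply]
  rfl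

/-- The inverse of the isomorphism with the associated graded algebra given by a splitting. -/
def ofGr : Gr (oddPow 𝒜) →ₗ[ℂ] A :=
  Gr.lift _ (fun q => σ.π q ∘ₗ (oddPow 𝒜 q).subtype) fun q x hx => σ.vanish _ _ _ hx (by omega)

theorem ofGr_cl (q : ℤ) (x : oddPow 𝒜 q) : σ.ofGr (Gr.cl _ q x) = σ.π q x := by
  rw [ofGr, Gr.lift_cl]
  rfl

theorem ofGr_toGr (a : A) : σ.ofGr (σ.toGr a) = a := by
  rw [toGr_apply, map_sum]
  conv_rhs => rw [← σ.sum a]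
  refine Finset.sum_congr rfl fun q _ => ?_
  rw [ofGr_cl, σ.orth, if_pos rfl]

theorem toGr_ofGr (t : Gr (oddPow 𝒜)) : σ.toGr (σ.ofGr t) = t := by
  induction t using Gr.induction with
  | zero => simp
  | add s t hs ht => simp only [map_add, hs, ht]
  | cl q x =>
    rw [ofGr_cl, toGr_apply]
    have : ∀ r : ℤ, Gr.cl (oddPow 𝒜) r ⟨σ.π r (σ.π q x), σ.mem_pow r _⟩ =
        if r = q then Gr.cl _ q x else 0 := by
      intro r
      split_ifs with h
      · subst h
        rw [σ.cl_π r x]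
        exact Gr.cl_congr _ rfl _ _ ((σ.orth r r x).trans (if_pos rfl))
      · refine Gr.cl_eq_zero _ _ _ ?_
        change σ.π r (σ.π q x) ∈ _
        rw [σ.orth, if_neg h]
        exact zero_mem _
    simp only [this, Finset.sum_ite_eq']
    split_ifs with h
    · rfl
    · exact (grOddPow_cl_eq_zero σ.oddPow_eq_bot h x).symm

theorem ofGr_mul (s t : Gr (oddPow 𝒜)) : σ.ofGr (s * t) = σ.ofGr s * σ.ofGr t := by
  induction s using Gr.induction with
  | zero => simp
  | add x y hx hy => simp only [add_mul, map_add, hx, hy]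
  | cl p x =>
  induction t using Gr.induction with
  | zero => simp
  | add x y hx hy => simp only [mul_add, map_add, hx, hy]
  | cl q y =>
    rw [σ.cl_π p x, σ.cl_π q y, Gr.cl_mul_cl, ofGr_cl, ofGr_cl, ofGr_cl, σ.orth, σ.orth,
      if_pos rfl, if_pos rfl, σ.mul]

theorem toGr_mul (a b : A) : σ.toGr (a * b) = σ.toGr a * σ.toGr b := by
  rw [← σ.toGr_ofGr (σ.toGr a * σ.toGr b), ofGr_mul, ofGr_toGr, ofGr_toGr]

theorem ofGr_par (i : ZMod 2) (t : Gr (oddPow 𝒜)) (ht : t ∈ Gr.parity (oddPow 𝒜) i) :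
    σ.ofGr t ∈ 𝒜 i := by
  refine Submodule.iSup_induction _ (motive := fun t => σ.ofGr t ∈ 𝒜 i) ht ?_
    (by rw [map_zero]; exact zero_mem _) fun s t hs ht => by rw [map_add]; exact add_mem hs ht
  rintro ⟨q, rfl⟩ _ ⟨x, rfl⟩
  rw [ofGr_cl]
  exact σ.par q x

theorem ofGr_deg {q : ℤ} {t : Gr (oddPow 𝒜)} (ht : t ∈ Gr.deg (oddPow 𝒜) q) :
    σ.ofGr t ∈ oddPow 𝒜 q := by
  obtain ⟨x, rfl⟩ := ht
  rw [ofGr_cl]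
  exact σ.mem_pow q x

variable [GradedAlgebra 𝒜]

/-- The projection of `a` onto the parity of `q` is zero. It is also the sum of the components of
`a` whose degree has that parity, and `π q` isolates one of them. -/
theorem π_eq_zero_of_par {i : ZMod 2} {a : A} (ha : a ∈ 𝒜 i) {q : ℤ} (hq : (q : ZMod 2) ≠ i) :
    σ.π q a = 0 := by
  have h := proj_ne 𝒜 ha hq.symm
  rw [← σ.sum a, map_sum] at h
  have h2 := congrArg (σ.π q) h
  rw [map_sum, map_zero] at h2
  by_cases hm : q ∈ Finset.Icc 0 (m : ℤ)
  · rw [Finset.sum_eq_single q] at h2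
    · rwa [proj_same 𝒜 (σ.par q a), σ.orth, if_pos rfl] at h2
    · intro r _ hr
      by_cases hr' : (r : ZMod 2) = q
      · rw [← hr', proj_same 𝒜 (σ.par r a), σ.orth, if_neg hr.symm]
      · rw [proj_ne 𝒜 (σ.par r a) hr', map_zero]
    · exact fun h => absurd hm h
  · conv_lhs => rw [← σ.sum a]
    rw [map_sum]
    refine Finset.sum_eq_zero fun r hr => ?_
    rw [σ.orth, if_neg]
    rintro rfl
    exact hm hr

-- The component of degree `p` of an element of parity `p + 1` is zero, so the element equals its
-- remainder, which lies in `I ^ (p + 1)` by `sub_mem`.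
include σ in
theorem adapted : ParityAdapted 𝒜 (oddPow 𝒜) := by
  rintro p a ⟨h1, h2⟩
  have := σ.sub_mem h1
  rwa [σ.π_eq_zero_of_par h2, sub_zero] at this
  intro h
  exact one_ne_zero (left_eq_add.1 h)

theorem toGr_par (i : ZMod 2) (a : A) (ha : a ∈ 𝒜 i) : σ.toGr a ∈ Gr.parity (oddPow 𝒜) i := by
  rw [toGr_apply]
  refine sum_mem fun q _ => ?_
  by_cases h : (q : ZMod 2) = i
  · subst h; exact Gr.cl_mem_parity _ _ _
  · rw [Gr.cl_eq_zero]
    · exact zero_mem _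
    · change σ.π q a ∈ _
      rw [σ.π_eq_zero_of_par ha h]; exact zero_mem _

/-- The endomorphism corresponding to an endomorphism of the associated graded algebra. -/
def conj (T : Module.End ℂ (Gr (oddPow 𝒜))) : Module.End ℂ A := σ.ofGr ∘ₗ T ∘ₗ σ.toGr

omit [GradedAlgebra 𝒜] in
theorem conj_apply (T : Module.End ℂ (Gr (oddPow 𝒜))) (a : A) :
    σ.conj T a = σ.ofGr (T (σ.toGr a)) := rfl

theorem conj_homDer {i : ZMod 2} {T : Module.End ℂ (Gr (oddPow 𝒜))}
    (hT : T ∈ homDer (Gr.parity (oddPow 𝒜)) i) : σ.conj T ∈ homDer 𝒜 i := by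
  refine ⟨fun j a ha => σ.ofGr_par _ _ (hT.1 j _ (σ.toGr_par j a ha)), fun j a ha b => ?_⟩
  rw [conj_apply, toGr_mul, hT.2 j _ (σ.toGr_par j a ha), map_add, map_smul, ofGr_mul, ofGr_mul,
    ofGr_toGr, ofGr_toGr]
  rfl

/-- The superderivation corresponding to a superderivation of the associated graded algebra. -/
def lift (D : SDer (Gr.parity (oddPow 𝒜))) : SDer 𝒜 :=
  (⟨σ.conj D.1, by
    obtain ⟨T, h0, T', h1, h⟩ := Submodule.mem_sup.1 D.2
    rw [← h, show σ.conj (T + T') = σ.conj T + σ.conj T' from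
      LinearMap.ext fun a => map_add σ.ofGr _ _]
    exact add_mem (homDer_le _ _ (σ.conj_homDer h0)) (homDer_le _ _ (σ.conj_homDer h1))⟩ :
    superDer 𝒜)

theorem lift_apply (D : SDer (Gr.parity (oddPow 𝒜))) (a : A) :
    (σ.lift D).1 a = σ.ofGr (D.1 (σ.toGr a)) := rfl

/-- The image of an algebra element in the associated graded algebra has components of degree at
least `0`, and of degree at least `1` if the element is in the ideal. Applying `D` raises these
bounds by `p`. -/
theorem lift_fil {p : ℤ} {D : SDer (Gr.parity (oddPow 𝒜))} (hD : D ∈ sderDeg 𝒜 p) :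
    σ.lift D ∈ sderFil 𝒜 p := by
  have key : ∀ q (x : oddPow 𝒜 q), σ.ofGr (D.1 (Gr.cl _ q x)) ∈ oddPow 𝒜 (q + p) :=
    fun q x => σ.ofGr_deg (hD q _ ⟨x, rfl⟩)
  refine ⟨fun a => ?_, fun a ha => ?_⟩
  · rw [lift_apply, toGr_apply, map_sum, map_sum]
    refine sum_mem fun q hq => oddPow_antitone 𝒜 ?_ (key q _)
    rw [Finset.mem_Icc] at hq
    omega
  · rw [lift_apply, toGr_apply, map_sum, map_sum]
    refine sum_mem fun q hq => ?_
    rw [Finset.mem_Icc] at hq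
    rcases hq.1.eq_or_lt with h | h
    · subst h
      rw [Gr.cl_eq_zero]
      · simp
      · change σ.π 0 a ∈ _
        rw [σ.vanish 1 0 a (by rwa [← oddIdeal_eq]) (by norm_num)]
        exact zero_mem _
    · exact oddPow_antitone 𝒜 (by omega) (key q _)

/-- A splitting thus provides a right inverse of `δ ↦ δ̃`, which is the local source of
surjectivity. -/
theorem ind_lift {p : ℤ} {D : SDer (Gr.parity (oddPow 𝒜))} (hD : D ∈ sderDeg 𝒜 p) :
    ind 𝒜 σ.adapted p ⟨σ.lift D, σ.lift_fil hD⟩ = D := by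
  refine Subtype.ext (Gr.hom_ext fun r x => ?_)
  obtain ⟨y, hy⟩ := hD r _ ⟨x, rfl⟩
  rw [ind_val]
  conv_lhs => rw [σ.cl_π r x, indEnd_cl]
  have e : (σ.lift D).1 (σ.π r x) = σ.π (r + p) y := by
    rw [lift_apply, ← σ.ofGr_cl r x, toGr_ofGr, ← hy, ofGr_cl]
  rw [← hy, σ.cl_π (r + p) y]
  exact Gr.cl_congr _ rfl _ _ e

end Splitting

end Splittings

end SuperGeom

end

noncomputable section
namespace SuperGeom

/-! ### Lie superalgebras of sections -/

set_option linter.unusedSectionVars false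

theorem sderBr_deg {A : Type*} [Ring A] [Algebra ℂ A] {𝒜 : ZMod 2 → Submodule ℂ A}
    [GradedAlgebra 𝒜] {p q : ℤ} {D E : SDer (Gr.parity (oddPow 𝒜))} (hD : D ∈ sderDeg 𝒜 p)
    (hE : E ∈ sderDeg 𝒜 q) : sderBr (Gr.parity (oddPow 𝒜)) D E ∈ sderDeg 𝒜 (p + q) := by
  intro r a ha
  rw [sderBr_val, superComm_hom _ (sderDeg_le_sderPar _ p hD) (sderDeg_le_sderPar _ q hE)]
  refine sub_mem ?_ (Submodule.smul_mem _ _ ?_)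
  · have := hD _ _ (hE r a ha)
    rwa [add_assoc, add_comm q p] at this
  · have := hE _ _ (hD r a ha)
    rwa [add_assoc] at this

section SheafMaps

variable {M : Type u} [TopologicalSpace M]

/-- The endomorphism of the space of sections given by endomorphisms of the stalks. -/
def SectionSheaf.mapEnd {S : M → Type*} [∀ x, AddCommGroup (S x)] [∀ x, Module ℂ (S x)]
    (F : SectionSheaf S) (T : ∀ x, S x →ₗ[ℂ] S x) (U : Opens M)
    (hT : ∀ s ∈ F.sec U, (fun x : U => T x (s x)) ∈ F.sec U) : F.Sections U →ₗ[ℂ] F.Sections U where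
  toFun s := (⟨fun x => T x (s.1 x), hT s.1 s.2⟩ : F.sec U)
  map_add' _ _ := Subtype.ext (funext fun x => map_add (T x) _ _)
  map_smul' _ _ := Subtype.ext (funext fun x => map_smul (T x) _ _)

theorem SectionSheaf.sum_eq {S : M → Type*} [∀ x, AddCommGroup (S x)] [∀ x, Module ℂ (S x)]
    (F : SectionSheaf S) {U : Opens M} {ι : Type*} (I : Finset ι) (f : ι → F.Sections U)
    (s : F.Sections U) (h : ∀ x : U, ∑ i ∈ I, F.germ U x (f i) = s.1 x) : ∑ i ∈ I, f i = s := by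
  refine SectionSheaf.ext fun x => ?_
  change F.germ U x (∑ i ∈ I, f i) = _
  rw [map_sum]
  exact h x

variable (𝒪 : SuperSheaf.{u, v} M)

theorem derBr_apply (U : Opens M) (δ η : Der 𝒪 U) (x : U) :
    (derBr 𝒪 U δ η).1 x = sderBr (𝒪.par x) (δ.1 x) (η.1 x) := rfl

theorem grDerBr_apply (U : Opens M) (s t : GrDer 𝒪 U) (x : U) :
    (grDerBr 𝒪 U s t).1 x = Gr.bil (sderBr (𝒪.par x)) (sderBr_fil (𝒪.par x)) (s.1 x) (t.1 x) :=
  rfl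

/-- Splittings of the stalks over an open set that map sections to sections. -/
structure SheafSplitting (m : ℕ) (N : Opens M) where
  /-- the splittings of the stalks -/
  σ : ∀ y : N, Splitting (𝒪.par y) m
  sec : ∀ (V : Opens M) (h : V ≤ N) (q : ℤ), ∀ f ∈ 𝒪.sec V,
    (fun y : V => (σ ⟨y, h y.2⟩).π q (f y)) ∈ 𝒪.sec V

/-- The sheaf locally admits splittings. -/
def LocallySplit (m : ℕ) : Prop :=
  ∀ x : M, ∃ N : Opens M, x ∈ N ∧ Nonempty (SheafSplitting 𝒪 m N)

variable {𝒪} {m : ℕ} (h𝒪 : LocallySplit 𝒪 m)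
include h𝒪

theorem LocallySplit.adapted (x : M) : ParityAdapted (𝒪.par x) (oddPow (𝒪.par x)) := by
  obtain ⟨N, hx, ⟨σ⟩⟩ := h𝒪 x
  exact (σ.σ ⟨x, hx⟩).adapted

theorem LocallySplit.oddPow_eq_bot (x : M) : oddPow (𝒪.par x) ((m : ℤ) + 1) = ⊥ := by
  obtain ⟨N, hx, ⟨σ⟩⟩ := h𝒪 x
  exact (σ.σ ⟨x, hx⟩).oddPow_eq_bot

omit h𝒪 in
theorem grDer_map_sec {U : Opens M}
    (T : ∀ x, Gr (sderFil (𝒪.par x)) →ₗ[ℂ] Gr (sderFil (𝒪.par x)))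
    (T' : ∀ V : Opens M, GrOfDer 𝒪 V →ₗ[ℂ] GrOfDer 𝒪 V)
    (hT : ∀ (V : Opens M) (x : V) t, T x (grOfDerGerm 𝒪 V x t) = grOfDerGerm 𝒪 V x (T' V t))
    (s : ∀ x : U, Gr (sderFil (𝒪.par x))) (hs : s ∈ (grDerSheaf 𝒪).sec U) :
    (fun x : U => T x (s x)) ∈ (grDerSheaf 𝒪).sec U := by
  intro x
  obtain ⟨V, h, hx, t, ht⟩ := hs x
  refine ⟨V, h, hx, T' V t, fun y => ?_⟩
  rw [← hT, ← ht y]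

theorem isGradedLieSuperalgebra_grDer (U : Opens M) :
    IsGradedLieSuperalgebra (grDerPar 𝒪 U) (grDerBr 𝒪 U) (grDerDeg 𝒪 U) := by
  have G := fun x => (isFilteredLieSuperalgebra_sder (𝒪.par x)).gr
    (sderFil_adapted (h𝒪.adapted x))
  have hK := fun x => sderFil_adapted (h𝒪.adapted x)
  have hF := fun x => (isFilteredLieSuperalgebra_sder (𝒪.par x)).fil_par
  have hpar : ∀ i, ∀ s ∈ (grDerSheaf 𝒪).sec U,
      (fun x : U => Gr.parityProj (sderFil (𝒪.par x)) i (s x)) ∈ (grDerSheaf 𝒪).sec U :=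
    fun i => grDer_map_sec (fun x => Gr.parityProj (sderFil (𝒪.par x)) i)
      (fun V => Gr.parityProj (derFil 𝒪 V) i) fun V x t => Gr.map_parityProj _ _ i t
  have hdeg : ∀ p, ∀ s ∈ (grDerSheaf 𝒪).sec U,
      (fun x : U => Gr.degProj (sderFil (𝒪.par x)) p (s x)) ∈ (grDerSheaf 𝒪).sec U :=
    fun p => grDer_map_sec (fun x => Gr.degProj (sderFil (𝒪.par x)) p)
      (fun V => Gr.degProj (derFil 𝒪 V) p) fun V x t => Gr.degProj_map _ _ p t
  refine { internal := ?_, br_mem := ?_, skew := ?_, jacobi := ?_, deg_internal := ?_,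
           deg_par := ?_, br_deg := ?_ }
  · refine isInternal_of_proj _ (fun i => (grDerSheaf 𝒪).mapEnd
      (fun x => Gr.parityProj (sderFil (𝒪.par x)) i) U (hpar i)) ?_ ?_ ?_ ?_
    · exact fun i s x => parityProj_mem_inherited (hF x) (hK x) i (s.1 x)
    · exact fun i s hs => SectionSheaf.ext fun x => parityProj_inherited_same (hK x) (hs x)
    · exact fun i j hij s hs => SectionSheaf.ext fun x => parityProj_inherited_ne (hK x) hij (hs x)
    · exact fun s => ⟨Finset.univ, ((grDerSheaf 𝒪).sum_eq _ _ _ fun x =>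
        Gr.sum_parityProj' _ (s.1 x)).symm⟩
  · exact fun i j s hs t ht x => (G x).br_mem i j _ (hs x) _ (ht x)
  · exact fun i j s hs t ht => SectionSheaf.ext fun x => (G x).skew i j _ (hs x) _ (ht x)
  · exact fun i j s hs t ht z => SectionSheaf.ext fun x =>
      (G x).jacobi i j _ (hs x) _ (ht x) (z.1 x)
  · refine isInternal_of_proj _ (fun p => (grDerSheaf 𝒪).mapEnd
      (fun x => Gr.degProj (sderFil (𝒪.par x)) p) U (hdeg p)) ?_ ?_ ?_ ?_
    · exact fun p s x => Gr.degProj_mem_deg _ p (s.1 x)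
    · exact fun p s hs => SectionSheaf.ext fun x => Gr.degProj_same _ p _ (hs x)
    · exact fun p q hpq s hs => SectionSheaf.ext fun x => Gr.degProj_ne _ p q hpq _ (hs x)
    -- The range of degrees is the same at all points, so a section over any open set, and not only
    -- a germ, is a finite sum of homogeneous sections.
    · exact fun s => ⟨Finset.Icc (-1) (m : ℤ), ((grDerSheaf 𝒪).sum_eq _ _ _ fun x =>
        sum_degProj_sderFil (h𝒪.oddPow_eq_bot x) (s.1 x)).symm⟩
  · exact fun p s hs x => (G x).deg_par p (hs x)
  · exact fun p q s hs t ht x => (G x).br_deg p q _ (hs x) _ (ht x)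

omit h𝒪 in
theorem grSec_degProj_mem (U : Opens M) (p : ℤ) (s : ∀ x : U, Gr (oddPow (𝒪.par x)))
    (hs : s ∈ 𝒪.grSec U) : (fun x : U => Gr.degProj (oddPow (𝒪.par x)) p (s x)) ∈ 𝒪.grSec U := by
  intro x
  obtain ⟨V, h, hx, t, ht⟩ := hs x
  refine ⟨V, h, hx, Gr.degProj _ p t, fun y => ?_⟩
  dsimp only
  rw [ht y]
  exact Gr.degProj_map _ _ p t

omit h𝒪 in
theorem grGerm_mem_grSec (U : Opens M) (t : Gr (𝒪.secPow U)) :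
    (fun x : U => 𝒪.grGerm U x t) ∈ 𝒪.grSec U :=
  fun x => ⟨U, le_rfl, x.2, t, fun _ => rfl⟩

omit h𝒪 in
/-- A family of linear endomorphisms of the stalks of the associated graded sheaf maps sections to
sections if this holds for the classes of sections. -/
theorem grSec_map_mem {U : Opens M}
    (T : ∀ x : U, Gr (oddPow (𝒪.par x)) →ₗ[ℂ] Gr (oddPow (𝒪.par x)))
    (hT : ∀ (V : Opens M) (h : V ≤ U) (q : ℤ) (s : 𝒪.secPow V q),
      (fun x : V => T ⟨x, h x.2⟩ (𝒪.grGerm V x (Gr.cl _ q s))) ∈ 𝒪.grSec V)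
    {V : Opens M} (h : V ≤ U) (f : ∀ x : V, Gr (oddPow (𝒪.par x))) (hf : f ∈ 𝒪.grSec V) :
    (fun x : V => T ⟨x, h x.2⟩ (f x)) ∈ 𝒪.grSec V := by
  refine 𝒪.grSec_glue V _ fun x => ?_
  obtain ⟨W, hW, hx, t, ht⟩ := hf x
  refine ⟨W, hW, hx, ?_⟩
  have : restr (S := fun x => Gr (oddPow (𝒪.par x))) hW (fun x : V => T ⟨x, h x.2⟩ (f x)) =
      fun y : W => T ⟨y, h (hW y.2)⟩ (𝒪.grGerm W y t) := by
    funext y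
    rw [← ht y]
    rfl
  rw [this]
  clear this ht
  induction t using Gr.induction with
  | zero => simp only [map_zero]; exact zero_mem _
  | add s t hs ht => simp only [map_add]; exact add_mem hs ht
  | cl q s => exact hT W (hW.trans h) q s

omit h𝒪 in
theorem sderComp_sec {U : Opens M} (p : ℤ) (D : ∀ x : U, SDer (Gr.parity (oddPow (𝒪.par x))))
    (hD : D ∈ (derSheaf 𝒪.gr).sec U) :
    (fun x : U => sderComp (𝒪.par x) p (D x)) ∈ (derSheaf 𝒪.gr).sec U := by
  intro V h f hf
  refine grSec_map_mem (fun x : U => (sderComp (𝒪.par x) p (D x)).1) (fun W hW q s => ?_) h f hf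
  have e := grSec_degProj_mem W (q + p) _ (hD W hW _ (grGerm_mem_grSec W (Gr.cl _ q s)))
  refine cast (congrArg (· ∈ 𝒪.grSec W) (funext fun y => ?_)) e
  rw [𝒪.grGerm_cl]
  exact (sderComp_cl p _ q _).symm

omit h𝒪 in
theorem derBr_gr_apply {U : Opens M} (D E : Der 𝒪.gr U) (x : U) :
    (derBr 𝒪.gr U D E).1 x = sderBr (Gr.parity (oddPow (𝒪.par x))) (D.1 x) (E.1 x) :=
  derBr_apply _ _ _ _ _

omit h𝒪 in
theorem derBr_mem_derGrDeg {U : Opens M} {p q : ℤ} {D E : Der 𝒪.gr U} (hD : D ∈ derGrDeg 𝒪 U p)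
    (hE : E ∈ derGrDeg 𝒪 U q) : derBr 𝒪.gr U D E ∈ derGrDeg 𝒪 U (p + q) := by
  intro x
  have h1 : D.1 x ∈ sderDeg (𝒪.par x) p := hD x
  have h2 : E.1 x ∈ sderDeg (𝒪.par x) q := hE x
  have h3 := sderBr_deg h1 h2
  rw [derBr_gr_apply]
  exact h3

theorem isGradedLieSuperalgebra_derGr (U : Opens M) :
    IsGradedLieSuperalgebra (derPar 𝒪.gr U) (derBr 𝒪.gr U) (derGrDeg 𝒪 U) := by
  refine { (isFilteredLieSuperalgebra_der 𝒪.gr U).toIsLieSuperalgebra with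
           deg_internal := ?_, deg_par := ?_, br_deg := ?_ }
  · refine isInternal_of_proj _ (fun p => (derSheaf 𝒪.gr).mapEnd
      (fun x => sderComp (𝒪.par x) p) U (fun D hD => sderComp_sec p D hD)) ?_ ?_ ?_ ?_
    · exact fun p D x => sderComp_mem p (D.1 x)
    · exact fun p D hD => SectionSheaf.ext fun x => sderComp_same p _ (hD x)
    · exact fun p q hpq D hD => SectionSheaf.ext fun x => sderComp_ne p q hpq _ (hD x)
    · exact fun D => ⟨Finset.Icc (-m) (m : ℤ), ((derSheaf 𝒪.gr).sum_eq _ _ _ fun x =>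
        sum_sderComp (h𝒪.oddPow_eq_bot x) (D.1 x)).symm⟩
  · exact fun p D hD x => sderDeg_le_sderPar _ p (hD x)
  · exact fun p q D hD E hE => derBr_mem_derGrDeg hD hE

/-- The map from `gr Der` to `Der gr` preserves sections. -/
theorem grInd_sec {U : Opens M} (s : ∀ x : U, Gr (sderFil (𝒪.par x)))
    (hs : s ∈ (grDerSheaf 𝒪).sec U) :
    (fun x : U => grInd (h𝒪.adapted x) (s x)) ∈ (derSheaf 𝒪.gr).sec U := by
  refine (derSheaf 𝒪.gr).glue U _ fun x => ?_
  obtain ⟨W, hW, hx, t, ht⟩ := hs x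
  refine ⟨W, hW, hx, ?_⟩
  have : restr (S := fun x => SDer (Gr.parity (oddPow (𝒪.par x)))) hW
      (fun x : U => grInd (h𝒪.adapted x) (s x)) =
      fun y : W => grInd (h𝒪.adapted y) (grOfDerGerm 𝒪 W y t) := by
    funext y
    rw [← ht y]
    rfl
  rw [this]
  clear this ht
  induction t using Gr.induction with
  | zero => simp only [map_zero]; exact zero_mem ((derSheaf 𝒪.gr).sec W)
  | add s t hs ht =>
    simp only [map_add]; exact Submodule.add_mem ((derSheaf 𝒪.gr).sec W) hs ht
  | cl p δ =>
    intro V h f hf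
    refine grSec_map_mem (fun y : W => (grInd (h𝒪.adapted y)
      (grOfDerGerm 𝒪 W y (Gr.cl _ p δ))).1) (fun V hV q f => ?_) h f hf
    -- The class of a section `f` of `I ^ q` goes to the class of `δ f`, which is a section of `I ^
    -- (q + p)` over the same open set.
    have e := grGerm_mem_grSec V (Gr.cl (𝒪.secPow V) (q + p)
      ⟨⟨fun y => (δ.1.1 ⟨y, hV y.2⟩).1 (f.1.1 y), δ.1.2 V hV _ f.1.2⟩,
        fun y => sderFil_oddPow _ (derFil_germ 𝒪 δ.2 ⟨y, hV y.2⟩) q _ (f.2 y)⟩)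
    refine cast (congrArg (· ∈ 𝒪.grSec V) (funext fun y => ?_)) e
    rw [𝒪.grGerm_cl, 𝒪.grGerm_cl, grOfDerGerm_cl, grInd_cl, ind_val, indEnd_cl]
    rfl

/-- The map from the sections of `gr Der` to those of `Der gr`. -/
def grDerToDerGr (U : Opens M) : GrDer 𝒪 U →ₗ[ℂ] Der 𝒪.gr U where
  toFun s := (⟨fun x => grInd (h𝒪.adapted x) (s.1 x), grInd_sec h𝒪 s.1 s.2⟩ :
    (derSheaf 𝒪.gr).sec U)
  map_add' _ _ := Subtype.ext (funext fun x => map_add (grInd (h𝒪.adapted x)) _ _)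
  map_smul' _ _ := Subtype.ext (funext fun x => map_smul (grInd (h𝒪.adapted x)) _ _)

theorem grDerToDerGr_apply (U : Opens M) (s : GrDer 𝒪 U) (x : U) :
    (grDerToDerGr h𝒪 U s).1 x = grInd (h𝒪.adapted x) (s.1 x) := rfl

theorem grDerToDerGr_injective (U : Opens M) : Function.Injective (grDerToDerGr h𝒪 U) :=
  fun _ _ hst => SectionSheaf.ext fun x => grInd_injective (h𝒪.adapted x)
    (congrFun (congrArg Subtype.val hst) x)

omit h𝒪 in
theorem SheafSplitting.toGr_sec {N : Opens M} (σ : SheafSplitting 𝒪 m N) {V : Opens M} (h : V ≤ N)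
    (f : ∀ y : V, 𝒪.stalk y) (hf : f ∈ 𝒪.sec V) :
    (fun y : V => (σ.σ ⟨y, h y.2⟩).toGr (f y)) ∈ 𝒪.grSec V := by
  simp only [Splitting.toGr_apply]
  have : (fun y : V => ∑ q ∈ Finset.Icc 0 (m : ℤ), Gr.cl (oddPow (𝒪.par y)) q
      ⟨(σ.σ ⟨y, h y.2⟩).π q (f y), (σ.σ ⟨y, h y.2⟩).mem_pow q (f y)⟩) =
      ∑ q ∈ Finset.Icc 0 (m : ℤ), fun y : V => Gr.cl (oddPow (𝒪.par y)) q
      ⟨(σ.σ ⟨y, h y.2⟩).π q (f y), (σ.σ ⟨y, h y.2⟩).mem_pow q (f y)⟩ := by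
    funext y
    rw [Finset.sum_apply]
  rw [this]
  refine sum_mem fun q _ => ?_
  have e := grGerm_mem_grSec V (Gr.cl (𝒪.secPow V) q
    ⟨⟨fun y => (σ.σ ⟨y, h y.2⟩).π q (f y), σ.sec V h q f hf⟩,
      fun y => (σ.σ ⟨y, h y.2⟩).mem_pow q (f y)⟩)
  refine cast (congrArg (· ∈ 𝒪.grSec V) (funext fun y => ?_)) e
  rw [𝒪.grGerm_cl]

omit h𝒪 in
theorem SheafSplitting.ofGr_sec {N : Opens M} (σ : SheafSplitting 𝒪 m N) {V : Opens M} (h : V ≤ N)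
    (f : ∀ y : V, Gr (oddPow (𝒪.par y))) (hf : f ∈ 𝒪.grSec V) :
    (fun y : V => (σ.σ ⟨y, h y.2⟩).ofGr (f y)) ∈ 𝒪.sec V := by
  refine 𝒪.glue V _ fun x => ?_
  obtain ⟨W, hW, hx, t, ht⟩ := hf x
  refine ⟨W, hW, hx, ?_⟩
  have : restr hW (fun y : V => (σ.σ ⟨y, h y.2⟩).ofGr (f y)) =
      fun y : W => (σ.σ ⟨y, h (hW y.2)⟩).ofGr (𝒪.grGerm W y t) := by
    funext y
    rw [← ht y]
    rfl
  rw [this]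
  clear this ht
  induction t using Gr.induction with
  | zero => simp only [map_zero]; exact zero_mem (𝒪.sec W)
  | add s t hs ht => simp only [map_add]; exact add_mem hs ht
  | cl q s =>
    simp only [𝒪.grGerm_cl, Splitting.ofGr_cl]
    exact σ.sec W (hW.trans h) q _ s.1.2

omit h𝒪 in
theorem SheafSplitting.lift_sec {N : Opens M} (σ : SheafSplitting 𝒪 m N) {V : Opens M} (h : V ≤ N)
    (D : ∀ y : V, SDer (Gr.parity (oddPow (𝒪.par y)))) (hD : D ∈ (derSheaf 𝒪.gr).sec V) :
    (fun y : V => (σ.σ ⟨y, h y.2⟩).lift (D y)) ∈ (derSheaf 𝒪).sec V :=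
  fun W hW f hf => σ.ofGr_sec (hW.trans h) _ (hD W hW _ (σ.toGr_sec (hW.trans h) f hf))

/-- Every germ has exactly one preimage. By injectivity on stalks, the family of these preimages
agrees near each point with the classes of the lifts given by a local splitting, so it is a section.
-/
theorem grDerToDerGr_surjective (U : Opens M) : Function.Surjective (grDerToDerGr h𝒪 U) := by
  intro D
  have hex : ∀ x : U, ∃ s : Gr (sderFil (𝒪.par x)), grInd (h𝒪.adapted x) s = D.1 x := by
    intro x
    obtain ⟨N, hx, ⟨σ⟩⟩ := h𝒪 x
    -- The preimage is the sum of the classes of the lifts of the homogeneous components of the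
    -- given derivation.
    refine ⟨∑ p ∈ Finset.Icc (-m : ℤ) m, Gr.cl _ p
      ⟨(σ.σ ⟨x, hx⟩).lift (sderComp (𝒪.par x) p (D.1 x)), (σ.σ ⟨x, hx⟩).lift_fil (sderComp_mem p _)⟩,
      ?_⟩
    rw [map_sum, ← sum_sderComp (h𝒪.oddPow_eq_bot x) (D.1 x)]
    refine Finset.sum_congr rfl fun p _ => ?_
    rw [grInd_cl, sum_sderComp (h𝒪.oddPow_eq_bot x) (D.1 x)]
    exact (σ.σ ⟨x, hx⟩).ind_lift (sderComp_mem p _)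
  choose s hs using hex
  refine ⟨(⟨s, fun x => ?_⟩ : (grDerSheaf 𝒪).sec U), SectionSheaf.ext hs⟩
  obtain ⟨N, hx, ⟨σ⟩⟩ := h𝒪 x
  have hN : U ⊓ N ≤ N := inf_le_right
  have hU : U ⊓ N ≤ U := inf_le_left
  refine ⟨U ⊓ N, hU, ⟨x.2, hx⟩, ∑ p ∈ Finset.Icc (-m : ℤ) m, Gr.cl (derFil 𝒪 (U ⊓ N)) p
    ⟨⟨fun y => (σ.σ ⟨y, hN y.2⟩).lift (sderComp (𝒪.par y) p (D.1 ⟨y, hU y.2⟩)),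
      σ.lift_sec hN _ (sderComp_sec p _ ((derSheaf 𝒪.gr).res_mem U (U ⊓ N) hU D.1 D.2))⟩,
      σ.lift_sec hN _ (sderComp_sec p _ ((derSheaf 𝒪.gr).res_mem U (U ⊓ N) hU D.1 D.2)),
      fun y => (σ.σ ⟨y, hN y.2⟩).lift_fil (sderComp_mem p _)⟩, fun y => ?_⟩
  refine grInd_injective (h𝒪.adapted y) ((hs ⟨y, hU y.2⟩).trans ?_)
  rw [map_sum, map_sum]
  refine (sum_sderComp (h𝒪.oddPow_eq_bot y) _).symm.trans (Finset.sum_congr rfl fun p _ => ?_)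
  rw [grOfDerGerm_cl, grInd_cl]
  exact ((σ.σ ⟨y, hN y.2⟩).ind_lift (sderComp_mem p _)).symm

/-- The isomorphism from the sections of `gr Der` to those of `Der gr`. -/
def grDerEquiv (U : Opens M) : GrDer 𝒪 U ≃ₗ[ℂ] Der 𝒪.gr U :=
  LinearEquiv.ofBijective (grDerToDerGr h𝒪 U)
    ⟨grDerToDerGr_injective h𝒪 U, grDerToDerGr_surjective h𝒪 U⟩

theorem isGradedLieHom_grDerToDerGr (U : Opens M) :
    IsGradedLieHom (grDerPar 𝒪 U) (grDerBr 𝒪 U) (grDerDeg 𝒪 U)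
      (derPar 𝒪.gr U) (derBr 𝒪.gr U) (derGrDeg 𝒪 U) (grDerToDerGr h𝒪 U) where
  map_par i _ hs x := grInd_par (h𝒪.adapted x) i _ (hs x)
  map_deg p _ hs x := grInd_deg (h𝒪.adapted x) p _ (hs x)
  map_br s t := by
    refine SectionSheaf.ext fun x => ?_
    rw [derBr_apply, grDerToDerGr_apply, grDerToDerGr_apply, grDerToDerGr_apply, grDerBr_apply]
    exact grInd_br (h𝒪.adapted x) (s.1 x) (t.1 x)

theorem isInducedBy_grDerToDerGr (U : Opens M) (p : ℤ) (δ : derFil 𝒪 U p) :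
    IsInducedBy 𝒪 U p δ.1 (grDerToDerGr h𝒪 U (toGrDer 𝒪 U (Gr.cl _ p δ))) := by
  intro x r a
  refine ⟨sderFil_oddPow _ (derFil_germ 𝒪 δ.2 x) r a a.2, ?_⟩
  have e : (grDerToDerGr h𝒪 U (toGrDer 𝒪 U (Gr.cl _ p δ))).1 x =
      ind _ (h𝒪.adapted x) p ⟨(derSheaf 𝒪).germ U x δ.1, derFil_germ 𝒪 δ.2 x⟩ := by
    rw [grDerToDerGr_apply, ← grInd_cl, ← grOfDerGerm_cl]
    rfl
  rw [e]
  exact indEnd_cl _ p _ r a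

omit h𝒪 in
theorem IsInducedBy.unique {U : Opens M} {p : ℤ} {δ : Der 𝒪 U} {D D' : Der 𝒪.gr U}
    (h : IsInducedBy 𝒪 U p δ D) (h' : IsInducedBy 𝒪 U p δ D') : D = D' := by
  refine SectionSheaf.ext fun x => Subtype.ext (Gr.hom_ext fun r a => ?_)
  obtain ⟨_, e⟩ := h x r a
  obtain ⟨_, e'⟩ := h' x r a
  exact e.trans e'.symm

theorem existsUnique_grDerEquiv :
    ∃! Φ : ∀ U : Opens M, GrDer 𝒪 U ≃ₗ[ℂ] Der 𝒪.gr U,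
      (∀ (U V : Opens M) (h : V ≤ U) (s : GrDer 𝒪 U),
        Φ V ((grDerSheaf 𝒪).res h s) = (derSheaf 𝒪.gr).res h (Φ U s)) ∧
      (∀ U : Opens M, IsGradedLieHom (grDerPar 𝒪 U) (grDerBr 𝒪 U) (grDerDeg 𝒪 U)
        (derPar 𝒪.gr U) (derBr 𝒪.gr U) (derGrDeg 𝒪 U) (Φ U).toLinearMap) ∧
      (∀ (U : Opens M) (p : ℤ) (δ : derFil 𝒪 U p),
        IsInducedBy 𝒪 U p δ.1 (Φ U (toGrDer 𝒪 U (Gr.cl _ p δ)))) := by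
  refine ⟨grDerEquiv h𝒪, ⟨fun U V h s => rfl, isGradedLieHom_grDerToDerGr h𝒪,
    isInducedBy_grDerToDerGr h𝒪⟩, ?_⟩
  -- A section of `gr Der` is only locally a sum of classes of vector fields. Compatibility with
  -- restriction reduces to such a smaller open set, where the values on classes are prescribed.
  rintro Φ ⟨h1, -, h3⟩
  funext U
  refine LinearEquiv.ext fun s => SectionSheaf.ext fun x => ?_
  obtain ⟨V, h, hx, t, ht⟩ := s.2 x
  have hs : (grDerSheaf 𝒪).res h s = toGrDer 𝒪 V t := SectionSheaf.ext ht
  have e : Φ V (toGrDer 𝒪 V t) = grDerToDerGr h𝒪 V (toGrDer 𝒪 V t) := by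
    clear ht hs
    induction t using Gr.induction with
    | zero => rw [map_zero, map_zero, map_zero]
    | add s t hs ht => rw [map_add, map_add, map_add, hs, ht]
    | cl p δ => exact (h3 V p δ).unique (isInducedBy_grDerToDerGr h𝒪 V p δ)
  have e1 := h1 U V h s
  rw [hs, e] at e1
  have e2 := congrFun (congrArg Subtype.val e1) ⟨x, hx⟩
  refine Eq.trans (Eq.symm e2) ?_
  rw [← hs]
  rfl

theorem derFil_adapted (U : Opens M) : ParityAdapted (derPar 𝒪 U) (derFil 𝒪 U) :=
  fun p δ hδ => ⟨δ.2, fun x => sderFil_adapted (h𝒪.adapted x) p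
    ⟨derFil_germ 𝒪 hδ.1 x, hδ.2 x⟩⟩

theorem isGradedLieSuperalgebra_grOfDer (U : Opens M) :
    IsGradedLieSuperalgebra (grOfDerPar 𝒪 U) (grOfDerBr 𝒪 U) (grOfDerDeg 𝒪 U) :=
  (isFilteredLieSuperalgebra_der 𝒪 U).gr (derFil_adapted h𝒪 U)

-- Membership of a vector field in the term of index `p + 1` is a condition on its germs, so a
-- homogeneous class over `U` whose germs all vanish is zero. The homogeneous components of a
-- general element are treated separately.
omit h𝒪 in
theorem toGrDer_injective (U : Opens M) : Function.Injective (toGrDer 𝒪 U) := by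
  rw [injective_iff_map_eq_zero]
  intro t ht
  obtain ⟨S, hS⟩ := Gr.exists_eq_sum_degProj _ t
  rw [hS S subset_rfl]
  refine Finset.sum_eq_zero fun p _ => ?_
  obtain ⟨δ, hδ⟩ := Gr.degProj_mem _ p t
  rw [hδ]
  refine Gr.cl_eq_zero _ _ _ ⟨δ.1.2, fun x => ?_⟩
  have h0 : grOfDerGerm 𝒪 U x t = 0 := congrFun (congrArg Subtype.val ht) x
  have h1 : grOfDerGerm 𝒪 U x (Gr.degProj _ p t) = 0 :=
    (Gr.degProj_map _ _ p t).symm.trans ((congrArg (Gr.degProj _ p) h0).trans (map_zero _))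
  rw [hδ, grOfDerGerm_cl] at h1
  exact Gr.mem_of_cl_eq_zero _ _ _ h1

omit h𝒪 in
theorem isGradedLieHom_toGrDer (U : Opens M) :
    IsGradedLieHom (grOfDerPar 𝒪 U) (grOfDerBr 𝒪 U) (grOfDerDeg 𝒪 U)
      (grDerPar 𝒪 U) (grDerBr 𝒪 U) (grDerDeg 𝒪 U) (toGrDer 𝒪 U) where
  map_par i t ht := by
    induction ht using Submodule.span_induction with
    | zero => rw [map_zero]; exact zero_mem _
    | add x y _ _ hx hy => rw [map_add]; exact add_mem hx hy
    | smul c x _ hx => rw [map_smul]; exact Submodule.smul_mem _ _ hx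
    | mem t ht =>
      obtain ⟨p, δ, hδ, rfl⟩ := ht
      intro x
      change grOfDerGerm 𝒪 U x _ ∈ _
      rw [grOfDerGerm_cl]
      exact Submodule.subset_span ⟨p, _, hδ x, rfl⟩
  map_deg p t ht := by
    obtain ⟨δ, rfl⟩ := ht
    intro x
    change grOfDerGerm 𝒪 U x _ ∈ _
    rw [grOfDerGerm_cl]
    exact ⟨_, rfl⟩
  map_br s t := SectionSheaf.ext fun x =>
    Gr.map_bil ((derSheaf 𝒪).germ U x) (fun _ _ hδ => derFil_germ 𝒪 hδ x) (derBr 𝒪 U)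
      (sderBr (𝒪.par x)) (derBr_fil 𝒪 U) (sderBr_fil (𝒪.par x)) (fun _ _ => rfl) s t

theorem existsUnique_grOfDerHom (U : Opens M) :
    ∃! Ψ : GrOfDer 𝒪 U →ₗ[ℂ] Der 𝒪.gr U,
      Function.Injective Ψ ∧
      IsGradedLieHom (grOfDerPar 𝒪 U) (grOfDerBr 𝒪 U) (grOfDerDeg 𝒪 U)
        (derPar 𝒪.gr U) (derBr 𝒪.gr U) (derGrDeg 𝒪 U) Ψ ∧
      (∀ (p : ℤ) (δ : derFil 𝒪 U p), IsInducedBy 𝒪 U p δ.1 (Ψ (Gr.cl _ p δ))) := by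
  have h1 := isGradedLieHom_toGrDer (𝒪 := 𝒪) U
  have h2 := isGradedLieHom_grDerToDerGr h𝒪 U
  refine ⟨grDerToDerGr h𝒪 U ∘ₗ toGrDer 𝒪 U,
    ⟨(grDerToDerGr_injective h𝒪 U).comp (toGrDer_injective U), ⟨?_, ?_, ?_⟩,
      isInducedBy_grDerToDerGr h𝒪 U⟩, ?_⟩
  · exact fun i t ht => h2.map_par i _ (h1.map_par i t ht)
  · exact fun p t ht => h2.map_deg p _ (h1.map_deg p t ht)
  · intro s t
    rw [LinearMap.comp_apply, h1.map_br, h2.map_br]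
    rfl
  · rintro Ψ ⟨-, -, h⟩
    exact Gr.hom_ext fun p δ => (h p δ).unique (isInducedBy_grDerToDerGr h𝒪 U p δ)

end SheafMaps

end SuperGeom

end

noncomputable section
namespace SuperGeom

/-! ### Stalks of a complex supermanifold in a chart -/

open scoped TensorProduct

section LocalModel

variable {M : Type u} [TopologicalSpace M]

/-- The trace of an open set of `M` in a chart. -/
def chartNhd {n : ℕ} (φ : OpenPartialHomeomorph M (Fin n → ℂ)) (V : Opens M) :
    Opens (Fin n → ℂ) :=
  ⟨φ.target ∩ φ.symm ⁻¹' V, φ.isOpen_inter_preimage_symm V.isOpen⟩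

theorem chartPreimage_chartNhd_le {n : ℕ} (φ : OpenPartialHomeomorph M (Fin n → ℂ)) (V : Opens M) :
    chartPreimage φ (chartNhd φ V) ≤ V := fun y hy => by
  have := hy.2.2
  rwa [Set.mem_preimage, φ.left_inv hy.1] at this

theorem mem_chartPreimage {n : ℕ} {φ : OpenPartialHomeomorph M (Fin n → ℂ)}
    {W : Opens (Fin n → ℂ)} {x : M} (hx : x ∈ φ.source) (hW : φ x ∈ W) : x ∈ chartPreimage φ W :=
  ⟨hx, hW⟩

theorem mem_chartNhd {n : ℕ} (φ : OpenPartialHomeomorph M (Fin n → ℂ)) {V : Opens M} {x : M}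
    (hx : x ∈ φ.source) (hV : x ∈ V) : φ x ∈ chartNhd φ V :=
  ⟨φ.map_source hx, by rwa [Set.mem_preimage, φ.left_inv hx]⟩

theorem ModelSec.res_tmul {n m : ℕ} {W W' : Opens (Fin n → ℂ)} (h : W' ≤ W) (f : Holo W)
    (ω : ExteriorAlgebra ℂ (Fin m → ℂ)) :
    ModelSec.res m h (f ⊗ₜ ω) = Holo.res h f ⊗ₜ ω := rfl

theorem ModelSec.res_res {n m : ℕ} {W W' W'' : Opens (Fin n → ℂ)} (h : W' ≤ W) (h' : W'' ≤ W')
    (t : ModelSec n m W) : ModelSec.res m h' (ModelSec.res m h t) = ModelSec.res m (h'.trans h) t := by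
  induction t using TensorProduct.induction_on with
  | zero => simp only [map_zero]
  | add s t hs ht => simp only [map_add, hs, ht]
  | tmul f ω => rfl

instance {n m : ℕ} (W : Opens (Fin n → ℂ)) : Ring (ModelSec n m W) :=
  Algebra.TensorProduct.instRing

instance {n m : ℕ} (W : Opens (Fin n → ℂ)) : AddCommGroup (ModelSec n m W) :=
  Ring.toAddCommGroup

/-- The section given by a family of germs. -/
def SuperSheaf.mkSec (𝒪 : SuperSheaf.{u, v} M) {U : Opens M} (s : ∀ y : U, 𝒪.stalk y)
    (hs : s ∈ 𝒪.sec U) : 𝒪.Sections U := (⟨s, hs⟩ : 𝒪.sec U)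

namespace LocalModelIso

variable {𝒪 : SuperSheaf.{u, v} M} {n m : ℕ} {φ : OpenPartialHomeomorph M (Fin n → ℂ)}
  (L : LocalModelIso 𝒪 n m φ)

/-- The germ at a point of the section corresponding to a section of the model superspace. -/
def germ {W : Opens (Fin n → ℂ)} (hW : (W : Set (Fin n → ℂ)) ⊆ φ.target) {x : M}
    (hx : x ∈ chartPreimage φ W) : ModelSec n m W →ₐ[ℂ] 𝒪.stalk x :=
  (𝒪.germ (chartPreimage φ W) ⟨x, hx⟩).comp (L.iso W hW).symm.toAlgHom

theorem germ_apply {W : Opens (Fin n → ℂ)} (hW : (W : Set (Fin n → ℂ)) ⊆ φ.target) {x : M}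
    (hx : x ∈ chartPreimage φ W) (t : ModelSec n m W) :
    L.germ hW hx t = ((L.iso W hW).symm t).1 ⟨x, hx⟩ := rfl

theorem germ_sec {W : Opens (Fin n → ℂ)} (hW : (W : Set (Fin n → ℂ)) ⊆ φ.target)
    (t : ModelSec n m W) :
    (fun y : chartPreimage φ W => L.germ hW y.2 t) ∈ 𝒪.sec (chartPreimage φ W) :=
  ((L.iso W hW).symm t).2

theorem germ_iso {W : Opens (Fin n → ℂ)} (hW : (W : Set (Fin n → ℂ)) ⊆ φ.target) {x : M}
    (hx : x ∈ chartPreimage φ W) (s : 𝒪.Sections (chartPreimage φ W)) :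
    L.germ hW hx (L.iso W hW s) = s.1 ⟨x, hx⟩ := by
  rw [germ_apply, AlgEquiv.symm_apply_apply]

theorem germ_res {W W' : Opens (Fin n → ℂ)} (hW : (W : Set (Fin n → ℂ)) ⊆ φ.target) (h : W' ≤ W)
    {x : M} (hx : x ∈ chartPreimage φ W') (t : ModelSec n m W) :
    L.germ (Set.Subset.trans h hW) hx (ModelSec.res m h t) =
      L.germ hW (chartPreimage_mono φ h hx) t := by
  obtain ⟨s, rfl⟩ := (L.iso W hW).surjective t
  rw [← L.iso_res, germ_iso, germ_iso]
  rfl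

theorem exists_sec {V : Opens M} (f : ∀ y : V, 𝒪.stalk y) (hf : f ∈ 𝒪.sec V) (x : V)
    (hx : x.1 ∈ φ.source) {W₀ : Opens (Fin n → ℂ)} (hx₀ : φ x ∈ W₀) :
    ∃ (W : Opens (Fin n → ℂ)) (hW : (W : Set (Fin n → ℂ)) ⊆ φ.target) (hV : chartPreimage φ W ≤ V)
      (t : ModelSec n m W), W ≤ W₀ ∧ φ x ∈ W ∧
        ∀ y (hy : y ∈ chartPreimage φ W), f ⟨y, hV hy⟩ = L.germ hW hy t := by
  have hV : chartPreimage φ (chartNhd φ V ⊓ W₀) ≤ V :=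
    (chartPreimage_mono φ inf_le_left).trans (chartPreimage_chartNhd_le φ V)
  have hW : ((chartNhd φ V ⊓ W₀ : Opens (Fin n → ℂ)) : Set (Fin n → ℂ)) ⊆ φ.target :=
    fun _ h => h.1.1
  refine ⟨_, hW, hV, L.iso _ hW (𝒪.mkSec (restr hV f) (𝒪.res_mem _ _ hV f hf)), inf_le_right,
    ⟨mem_chartNhd φ hx x.2, hx₀⟩, fun y hy =>
      (L.germ_iso hW hy (𝒪.mkSec (restr hV f) (𝒪.res_mem _ _ hV f hf))).symm⟩

theorem exists_germ_eq {x : M} (hx : x ∈ φ.source) (a : 𝒪.stalk x) {W₀ : Opens (Fin n → ℂ)}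
    (hx₀ : φ x ∈ W₀) :
    ∃ (W : Opens (Fin n → ℂ)) (hW : (W : Set (Fin n → ℂ)) ⊆ φ.target) (hxW : φ x ∈ W)
      (t : ModelSec n m W), W ≤ W₀ ∧ L.germ hW (mem_chartPreimage hx hxW) t = a := by
  obtain ⟨V, hV, s, hs, rfl⟩ := 𝒪.germ_surj x a
  obtain ⟨W, hW, hWV, t, h0, hxW, h⟩ := L.exists_sec s hs ⟨x, hV⟩ hx hx₀
  exact ⟨W, hW, hxW, t, h0, (h x (mem_chartPreimage hx hxW)).symm⟩

/-- Together with `exists_germ_eq` this says that the stalk is the direct limit of the model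
sections over the neighbourhoods of `φ x`. Linear maps out of the stalk are constructed from this.
-/
theorem exists_res_eq_zero {W : Opens (Fin n → ℂ)} (hW : (W : Set (Fin n → ℂ)) ⊆ φ.target) {x : M}
    (hx : x ∈ chartPreimage φ W) {t : ModelSec n m W} (ht : L.germ hW hx t = 0) :
    ∃ (W' : Opens (Fin n → ℂ)) (h : W' ≤ W), φ x ∈ W' ∧ ModelSec.res m h t = 0 := by
  obtain ⟨V, hV, hxV, hs⟩ := 𝒪.germ_zero _ ⟨x, hx⟩ _ (L.germ_sec hW t) ht
  refine ⟨chartNhd φ V ⊓ W, inf_le_right, ⟨mem_chartNhd φ hx.1 hxV, hx.2⟩, ?_⟩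
  obtain ⟨s, rfl⟩ := (L.iso W hW).surjective t
  rw [← L.iso_res _ _ hW]
  refine (map_eq_zero_iff (L.iso _ _) (AlgEquiv.injective _)).2 (Subtype.ext (funext fun y => ?_))
  have hy : y.1 ∈ V := chartPreimage_chartNhd_le φ V (chartPreimage_mono φ inf_le_left y.2)
  have := congrFun hs ⟨y, hy⟩
  change L.germ hW _ (L.iso W hW s) = 0 at this
  rw [germ_iso] at this
  exact this

section Lift

variable {B : Type*} [AddCommGroup B] [Module ℂ B] {x : M} (hx : x ∈ φ.source)
  (T : ∀ W : Opens (Fin n → ℂ), (W : Set (Fin n → ℂ)) ⊆ φ.target → φ x ∈ W →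
    ModelSec n m W →ₗ[ℂ] B)
  (hT : ∀ W W' hW hx (h : W' ≤ W) (hx' : φ x ∈ W') t,
    T W' (Set.Subset.trans h hW) hx' (ModelSec.res m h t) = T W hW hx t)

/-- The value of a compatible family of maps on a germ. -/
def liftFun (a : 𝒪.stalk x) : B :=
  T _ (L.exists_germ_eq hx a (Opens.mem_top _)).choose_spec.choose
    (L.exists_germ_eq hx a (Opens.mem_top _)).choose_spec.choose_spec.choose
    (L.exists_germ_eq hx a (Opens.mem_top _)).choose_spec.choose_spec.choose_spec.choose

-- This is well-definedness on the direct limit: the difference of two representatives, restricted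
-- to the common domain, vanishes after further shrinking, and the family of maps is compatible with
-- restriction.
include hT in
theorem lift_aux {W W' : Opens (Fin n → ℂ)} (hW : (W : Set (Fin n → ℂ)) ⊆ φ.target)
    (hW' : (W' : Set (Fin n → ℂ)) ⊆ φ.target) (hxW : φ x ∈ W) (hxW' : φ x ∈ W')
    (t : ModelSec n m W) (t' : ModelSec n m W')
    (h : L.germ hW (mem_chartPreimage hx hxW) t = L.germ hW' (mem_chartPreimage hx hxW') t') : T W hW hxW t = T W' hW' hxW' t' := by
  have hW2 : ((W ⊓ W' : Opens (Fin n → ℂ)) : Set (Fin n → ℂ)) ⊆ φ.target := fun _ h => hW h.1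
  have h0 : L.germ hW2 (mem_chartPreimage hx (W := W ⊓ W') ⟨hxW, hxW'⟩)
      (ModelSec.res m inf_le_left t - ModelSec.res m inf_le_right t') = 0 := by
    refine (map_sub _ _ _).trans (sub_eq_zero.2 ?_)
    exact (L.germ_res hW inf_le_left _ t).trans (h.trans (L.germ_res hW' inf_le_right _ t').symm)
  obtain ⟨V, hV, hxV, hz⟩ := L.exists_res_eq_zero hW2 _ h0
  have h1 := hT _ _ hW2 ⟨hxW, hxW'⟩ hV hxV
    (ModelSec.res m inf_le_left t - ModelSec.res m inf_le_right t')
  rw [hz, map_zero, map_sub, eq_comm, sub_eq_zero] at h1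
  exact (hT _ _ hW hxW inf_le_left _ t).symm.trans (h1.trans (hT _ _ hW' hxW' inf_le_right _ t'))

include hT in
theorem liftFun_germ {W : Opens (Fin n → ℂ)} (hW : (W : Set (Fin n → ℂ)) ⊆ φ.target)
    (hxW : φ x ∈ W) (t : ModelSec n m W) :
    L.liftFun hx T (L.germ hW (mem_chartPreimage hx hxW) t) = T W hW hxW t :=
  L.lift_aux hx T hT _ hW _ hxW _ t
    (L.exists_germ_eq hx _ (Opens.mem_top _)).choose_spec.choose_spec.choose_spec.choose_spec.2

theorem exists_germ_eq₂ (a b : 𝒪.stalk x) {W₀ : Opens (Fin n → ℂ)} (hx₀ : φ x ∈ W₀) :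
    ∃ (W : Opens (Fin n → ℂ)) (hW : (W : Set (Fin n → ℂ)) ⊆ φ.target) (hxW : φ x ∈ W)
      (s t : ModelSec n m W), W ≤ W₀ ∧ L.germ hW (mem_chartPreimage hx hxW) s = a ∧ L.germ hW (mem_chartPreimage hx hxW) t = b := by
  obtain ⟨W, hW, hxW, s, h0, rfl⟩ := L.exists_germ_eq hx a hx₀
  obtain ⟨W', hW', hxW', t, h1, rfl⟩ := L.exists_germ_eq hx b hxW
  exact ⟨W', hW', hxW', ModelSec.res m h1 s, t, h1.trans h0, L.germ_res hW h1 _ s, rfl⟩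

/-- A linear map on a stalk given by a compatible family of linear maps on the sections of the
model superspace. -/
def lift : 𝒪.stalk x →ₗ[ℂ] B where
  toFun := L.liftFun hx T
  map_add' a b := by
    obtain ⟨W, hW, hxW, s, t, -, rfl, rfl⟩ := L.exists_germ_eq₂ hx a b (Opens.mem_top _)
    rw [← map_add, L.liftFun_germ hx T hT _ hxW, L.liftFun_germ hx T hT _ hxW, L.liftFun_germ hx T hT _ hxW, map_add]
  map_smul' c a := by
    obtain ⟨W, hW, hxW, s, -, rfl⟩ := L.exists_germ_eq hx a (Opens.mem_top _)
    rw [← map_smul, L.liftFun_germ hx T hT _ hxW, L.liftFun_germ hx T hT _ hxW, map_smul, RingHom.id_apply]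

theorem lift_germ {W : Opens (Fin n → ℂ)} (hW : (W : Set (Fin n → ℂ)) ⊆ φ.target)
    (hx' : x ∈ chartPreimage φ W) (t : ModelSec n m W) :
    L.lift hx T hT (L.germ hW hx' t) = T W hW hx'.2 t := L.liftFun_germ hx T hT hW hx'.2 t

end Lift

section Oper

/-- A family of operators on the sections of the model superspace compatible with restriction. -/
structure _root_.SuperGeom.ModelOper (n m : ℕ) where
  /-- the operators -/
  op : ∀ W : Opens (Fin n → ℂ), ModelSec n m W →ₗ[ℂ] ModelSec n m W
  op_res : ∀ (W W' : Opens (Fin n → ℂ)) (h : W' ≤ W) (t : ModelSec n m W),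
    op W' (ModelSec.res m h t) = ModelSec.res m h (op W t)

variable (T : ModelOper n m) {x : M} (hx : x ∈ φ.source)

/-- The operator on a stalk given by an operator on the model superspace. -/
def stalkOp : Module.End ℂ (𝒪.stalk x) :=
  L.lift hx (fun W hW hxW => (L.germ hW (mem_chartPreimage hx hxW)).toLinearMap ∘ₗ T.op W)
    fun W W' hW hxW h hxW' t => by
      rw [LinearMap.comp_apply, LinearMap.comp_apply, T.op_res]
      exact L.germ_res hW h _ _

theorem stalkOp_germ {W : Opens (Fin n → ℂ)} (hW : (W : Set (Fin n → ℂ)) ⊆ φ.target)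
    (hx' : x ∈ chartPreimage φ W) (t : ModelSec n m W) :
    L.stalkOp T hx (L.germ hW hx' t) = L.germ hW hx' (T.op W t) :=
  L.lift_germ hx _ _ hW hx' t

/-- Near each point the section comes from one model section `t`, and its image consists of the
germs of the operator applied to `t`. -/
theorem stalkOp_sec {V : Opens M} (hV : ∀ y ∈ V, y ∈ φ.source) (f : ∀ y : V, 𝒪.stalk y)
    (hf : f ∈ 𝒪.sec V) : (fun y : V => L.stalkOp T (hV y y.2) (f y)) ∈ 𝒪.sec V := by
  refine 𝒪.glue _ _ fun x => ?_
  obtain ⟨W, hW, hWV, t, -, hxW, h⟩ := L.exists_sec f hf x (hV x x.2) (Opens.mem_top _)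
  refine ⟨_, hWV, ⟨hV x x.2, hxW⟩, ?_⟩
  convert L.germ_sec hW (T.op W t) using 1
  funext y
  change L.stalkOp T _ (f ⟨y, hWV y.2⟩) = _
  rw [h y y.2]
  exact L.stalkOp_germ T y.2.1 hW y.2 t

end Oper

end LocalModelIso

end LocalModel

end SuperGeom

end

noncomputable section
namespace SuperGeom

/-! ### The splitting of the stalks in a chart -/

open scoped TensorProduct

section SplittingOfMul

variable {A : Type*} [Ring A] [Algebra ℂ A] (𝒜 : ZMod 2 → Submodule ℂ A) [GradedAlgebra 𝒜] {m : ℕ}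

theorem splitting_mul_eq_sum {π : ℤ → Module.End ℂ A}
    (sum : ∀ a, ∑ q ∈ Finset.Icc 0 (m : ℤ), π q a = a)
    (orth : ∀ p q a, π p (π q a) = if p = q then π q a else 0)
    (mul : ∀ p q a b, π (p + q) (π p a * π q b) = π p a * π q b) (s : ℤ) (a b : A) :
    π s (a * b) = ∑ q ∈ Finset.Icc 0 (m : ℤ), ∑ r ∈ Finset.Icc 0 (m : ℤ),
      if s = q + r then π q a * π r b else 0 := by
  conv_lhs => rw [← sum a, ← sum b, Finset.sum_mul_sum, map_sum]
  refine Finset.sum_congr rfl fun q _ => ?_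
  rw [map_sum]
  refine Finset.sum_congr rfl fun r _ => ?_
  rw [← mul, orth]

/-- A multiplicative grading whose components of degree `q` lie in the `q`-th power of the ideal
generated by the odd elements is a splitting. -/
def Splitting.ofMul (π : ℤ → Module.End ℂ A) (mem_pow : ∀ p a, π p a ∈ oddPow 𝒜 p)
    (sum : ∀ a, ∑ q ∈ Finset.Icc 0 (m : ℤ), π q a = a)
    (orth : ∀ p q a, π p (π q a) = if p = q then π q a else 0)
    (par : ∀ (p : ℤ) a, π p a ∈ 𝒜 (p : ZMod 2))
    (mul : ∀ p q a b, π (p + q) (π p a * π q b) = π p a * π q b)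
    (neg : ∀ q < 0, π q = 0) : Splitting 𝒜 m where
  π := π
  mem_pow := mem_pow
  sum := sum
  orth := orth
  par := par
  mul := mul
  -- Call the order of an element its lowest degree. Orders add under multiplication (`key`), and
  -- odd elements have order at least `1` because the component of degree `0` is even. Hence
  -- elements of the ideal have order at least `1`, and elements of its `p`-th power order at least
  -- `p`.
  vanish := by
    have hmul := splitting_mul_eq_sum sum orth mul
    have key : ∀ (p r : ℤ) (a b : A), (∀ q < p, π q a = 0) → (∀ q < r, π q b = 0) →
        ∀ q < p + r, π q (a * b) = 0 := by
      intro p r a b ha hb q hq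
      rw [hmul]
      refine Finset.sum_eq_zero fun s _ => Finset.sum_eq_zero fun t _ => ?_
      split_ifs with h
      · rcases lt_or_ge s p with h1 | h1
        · rw [ha s h1, zero_mul]
        · rw [hb t (by omega), mul_zero]
      · rfl
    have h0 : ∀ (a : A), ∀ q < (0 : ℤ), π q a = 0 := fun a q hq => by
      rw [neg q hq, LinearMap.zero_apply]
    have hodd : ∀ b ∈ 𝒜 1, ∀ q < (1 : ℤ), π q b = 0 := by
      intro b hb q hq
      rcases lt_or_ge q 0 with h | h
      · exact h0 b q h
      obtain rfl : q = 0 := by omega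
      -- the component of degree `0` of `b` is the even part of a sum of components
      have h1 := congrArg (GradedAlgebra.proj 𝒜 1) (sum b)
      have h2 : ∀ q, π 0 (GradedAlgebra.proj 𝒜 1 (π q b)) = 0 := by
        intro q
        by_cases hq : ((q : ℤ) : ZMod 2) = 1
        · rw [proj_same 𝒜 (hq ▸ par q b), orth, if_neg]
          rintro rfl
          exact absurd hq (by decide)
        · rw [proj_ne 𝒜 (par q b) hq, map_zero]
      rw [proj_same 𝒜 hb, map_sum] at h1
      rw [← h1, map_sum]
      exact Finset.sum_eq_zero fun q _ => h2 q
    have hI : ∀ a ∈ oddIdeal 𝒜, ∀ q < (1 : ℤ), π q a = 0 := by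
      intro a ha
      induction ha using Submodule.span_induction with
      | zero => intro q _; exact map_zero _
      | add a b _ _ h1 h2 => intro q hq; rw [map_add, h1 q hq, h2 q hq, add_zero]
      | smul c a _ h1 => intro q hq; rw [map_smul, h1 q hq, smul_zero]
      | mem a ha =>
        obtain ⟨b, c, hc, d, rfl⟩ := ha
        exact key (0 + 1) 0 _ _ (key 0 1 _ _ (h0 b) (hodd c hc)) (h0 d)
    intro p q a ha hq
    rcases le_or_gt p 0 with hp | hp
    · exact h0 a q (by omega)
    obtain ⟨k, rfl⟩ : ∃ k : ℕ, p = k + 1 := ⟨(p - 1).toNat, by omega⟩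
    rw [oddPow_natCast_succ] at ha
    clear hp
    induction k generalizing a q with
    | zero => rw [zero_add, pow_one] at ha; exact hI a ha q (by simpa using hq)
    | succ k ih =>
      rw [pow_succ] at ha
      push_cast at hq
      induction ha using Submodule.mul_induction_on' with
      | mem_mul_mem a ha b hb => exact key _ _ a b (fun q hq => ih q a ha hq) (hI b hb) q hq
      | add a _ b _ h1 h2 => rw [map_add, h1, h2, add_zero]

end SplittingOfMul

/-! ### The grading of the Grassmann algebra -/

section Grassmann

variable (m : ℕ)

/-- The Grassmann algebra in `m` variables. -/
abbrev Grass : Type := ExteriorAlgebra ℂ (Fin m → ℂ)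

/-- The projection of the Grassmann algebra onto its component of degree `q`. -/
def grassProj (q : ℤ) : Module.End ℂ (Grass m) :=
  if 0 ≤ q then GradedAlgebra.proj (fun i : ℕ => ⋀[ℂ]^i (Fin m → ℂ)) q.toNat else 0

theorem grassProj_neg {q : ℤ} (hq : q < 0) : grassProj m q = 0 := if_neg (by omega)

theorem grassProj_natCast (k : ℕ) :
    grassProj m k = GradedAlgebra.proj (fun i : ℕ => ⋀[ℂ]^i (Fin m → ℂ)) k :=
  if_pos (by omega)

theorem grassProj_natCast_mem (k : ℕ) (ω : Grass m) : grassProj m k ω ∈ ⋀[ℂ]^k (Fin m → ℂ) := by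
  rw [grassProj_natCast, GradedAlgebra.proj_apply]
  exact SetLike.coe_mem _

theorem grassProj_of_mem {k : ℕ} {ω : Grass m} (h : ω ∈ ⋀[ℂ]^k (Fin m → ℂ)) (q : ℤ) :
    grassProj m q ω = if q = k then ω else 0 := by
  rcases lt_or_ge q 0 with hq | hq
  · rw [grassProj_neg m hq, if_neg (by omega)]; rfl
  obtain ⟨l, rfl⟩ := Int.eq_ofNat_of_zero_le hq
  rw [grassProj_natCast, GradedAlgebra.proj_apply]
  split_ifs with h1
  · obtain rfl : l = k := by omega
    exact DirectSum.decompose_of_mem_same (fun i : ℕ => ⋀[ℂ]^i (Fin m → ℂ)) h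
  · exact DirectSum.decompose_of_mem_ne (fun i : ℕ => ⋀[ℂ]^i (Fin m → ℂ)) h (by omega)

theorem grassProj_orth (p q : ℤ) (ω : Grass m) :
    grassProj m p (grassProj m q ω) = if p = q then grassProj m q ω else 0 := by
  rcases lt_or_ge q 0 with hq | hq
  · simp [grassProj_neg m hq]
  obtain ⟨l, rfl⟩ := Int.eq_ofNat_of_zero_le hq
  exact grassProj_of_mem m (grassProj_natCast_mem m l ω) p

theorem grassProj_mul (p q : ℤ) (ω η : Grass m) :
    grassProj m (p + q) (grassProj m p ω * grassProj m q η) =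
      grassProj m p ω * grassProj m q η := by
  rcases lt_or_ge q 0 with hq | hq
  · simp [grassProj_neg m hq]
  rcases lt_or_ge p 0 with hp | hp
  · simp [grassProj_neg m hp]
  obtain ⟨l, rfl⟩ := Int.eq_ofNat_of_zero_le hq
  obtain ⟨k, rfl⟩ := Int.eq_ofNat_of_zero_le hp
  rw [grassProj_of_mem m (k := k + l), if_pos (by push_cast; rfl)]
  exact SetLike.mul_mem_graded (A := fun i : ℕ => ⋀[ℂ]^i (Fin m → ℂ))
    (grassProj_natCast_mem m k ω) (grassProj_natCast_mem m l η)

theorem exteriorPower_eq_zero {k : ℕ} (hk : m < k) {ω : Grass m} (h : ω ∈ ⋀[ℂ]^k (Fin m → ℂ)) :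
    ω = 0 := by
  have h1 : Module.finrank ℂ (⋀[ℂ]^k (Fin m → ℂ)) = 0 := by
    rw [exteriorPower.finrank_eq, Module.finrank_fin_fun, Nat.choose_eq_zero_of_lt hk]
  have := Module.finrank_zero_iff.1 h1
  exact congrArg Subtype.val (Subsingleton.elim (⟨ω, h⟩ : ⋀[ℂ]^k (Fin m → ℂ)) 0)

theorem sum_grassProj (ω : Grass m) : ∑ q ∈ Finset.Icc 0 (m : ℤ), grassProj m q ω = ω := by
  have h1 : ∀ ω ∈ ⨆ i : ℕ, ⋀[ℂ]^i (Fin m → ℂ),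
      ∑ q ∈ Finset.Icc 0 (m : ℤ), grassProj m q ω = ω := by
    intro ω h
    refine Submodule.iSup_induction _
      (motive := fun ω => ∑ q ∈ Finset.Icc 0 (m : ℤ), grassProj m q ω = ω) h ?_ (by simp)
      fun a b ha hb => by simp only [map_add, Finset.sum_add_distrib, ha, hb]
    intro k ω hω
    simp only [grassProj_of_mem m hω, Finset.sum_ite_eq']
    split_ifs with hk
    · rfl
    · exact (exteriorPower_eq_zero m (by simpa using hk) hω).symm
  refine h1 ω ?_
  have := CliffordAlgebra.iSup_ι_range_eq_top (0 : QuadraticForm ℂ (Fin m → ℂ))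
  exact this.symm ▸ Submodule.mem_top

theorem exteriorPower_le_evenOdd (k : ℕ) : ⋀[ℂ]^k (Fin m → ℂ) ≤
    CliffordAlgebra.evenOdd (0 : QuadraticForm ℂ (Fin m → ℂ)) (k : ZMod 2) :=
  le_iSup (fun j : { n : ℕ // (n : ZMod 2) = k } =>
    LinearMap.range (CliffordAlgebra.ι (0 : QuadraticForm ℂ (Fin m → ℂ))) ^ (j : ℕ)) ⟨k, rfl⟩

theorem grassProj_mem_evenOdd (q : ℤ) (ω : Grass m) : grassProj m q ω ∈
    CliffordAlgebra.evenOdd (0 : QuadraticForm ℂ (Fin m → ℂ)) (q : ZMod 2) := by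
  rcases lt_or_ge q 0 with hq | hq
  · rw [grassProj_neg m hq]; exact zero_mem _
  obtain ⟨l, rfl⟩ := Int.eq_ofNat_of_zero_le hq
  have := exteriorPower_le_evenOdd m l (grassProj_natCast_mem m l ω)
  exact_mod_cast this

end Grassmann

/-! ### Operators acting on the Grassmann factor -/

section ModelOper

variable {n m : ℕ}

/-- The operator on the model superspace given by an operator on the Grassmann algebra. -/
def ModelOper.ofGrass (n : ℕ) (B : Module.End ℂ (Grass m)) : ModelOper n m where
  op W := TensorProduct.map LinearMap.id B
  op_res W W' h t := by
    induction t using TensorProduct.induction_on with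
    | zero => simp only [map_zero]
    | add s t hs ht => simp only [map_add, hs, ht]
    | tmul f ω => rfl

theorem ModelOper.ofGrass_tmul (B : Module.End ℂ (Grass m)) (W : Opens (Fin n → ℂ)) (f : Holo W)
    (ω : Grass m) : (ModelOper.ofGrass n B).op W (f ⊗ₜ ω) = f ⊗ₜ B ω := rfl

end ModelOper

/-! ### The grading of a stalk by the Grassmann degree -/

namespace LocalModelIso

variable {M : Type u} [TopologicalSpace M] {𝒪 : SuperSheaf.{u, v} M} {n m : ℕ}
  {φ : OpenPartialHomeomorph M (Fin n → ℂ)} (L : LocalModelIso 𝒪 n m φ)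

theorem germ_par {W : Opens (Fin n → ℂ)} (hW : (W : Set (Fin n → ℂ)) ⊆ φ.target) {x : M}
    (hx : x ∈ chartPreimage φ W) {i : ZMod 2} {t : ModelSec n m W} (ht : t ∈ ModelSec.par n m W i) :
    L.germ hW hx t ∈ 𝒪.par x i :=
  (L.iso_par W hW i ((L.iso W hW).symm t)).2 (by rwa [AlgEquiv.apply_symm_apply]) ⟨x, hx⟩

theorem germ_tmul_par {W : Opens (Fin n → ℂ)} (hW : (W : Set (Fin n → ℂ)) ⊆ φ.target) {x : M}
    (hx : x ∈ chartPreimage φ W) {i : ZMod 2} (f : Holo W) {ω : Grass m}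
    (hω : ω ∈ CliffordAlgebra.evenOdd (0 : QuadraticForm ℂ (Fin m → ℂ)) i) :
    L.germ hW hx (f ⊗ₜ ω) ∈ 𝒪.par x i :=
  L.germ_par hW hx (Submodule.subset_span ⟨f, ω, hω, rfl⟩)

/-- The stalk at a point of a chart contains the Grassmann algebra. -/
def grassGerm {x : M} (hx : x ∈ φ.source) : Grass m →ₐ[ℂ] 𝒪.stalk x :=
  (L.germ (W := ⟨φ.target, φ.open_target⟩) Set.Subset.rfl
    (mem_chartPreimage hx (φ.map_source hx))).comp Algebra.TensorProduct.includeRight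

theorem grassGerm_eq {x : M} (hx : x ∈ φ.source) {W : Opens (Fin n → ℂ)}
    (hW : (W : Set (Fin n → ℂ)) ⊆ φ.target) (hx' : x ∈ chartPreimage φ W) (ω : Grass m) :
    L.grassGerm hx ω = L.germ hW hx' ((1 : Holo W) ⊗ₜ ω) := by
  have h : W ≤ ⟨φ.target, φ.open_target⟩ := hW
  exact (L.germ_res (W := ⟨φ.target, φ.open_target⟩) Set.Subset.rfl h
    hx' ((1 : Holo _) ⊗ₜ ω)).symm

/-- The `k`-th exterior power is the `k`-th power of the space of generators, and the germ of a
generator is odd. -/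
theorem grassGerm_mem_oddPow {x : M} (hx : x ∈ φ.source) {k : ℕ} {ω : Grass m}
    (hω : ω ∈ ⋀[ℂ]^k (Fin m → ℂ)) : L.grassGerm hx ω ∈ oddPow (𝒪.par x) k := by
  rcases Nat.eq_zero_or_pos k with rfl | hk
  · rw [oddPow_nonpos (by simp)]; trivial
  obtain ⟨k, rfl⟩ := Nat.exists_eq_succ_of_ne_zero hk.ne'
  have h1 : (LinearMap.range (ExteriorAlgebra.ι ℂ (M := Fin m → ℂ))).map
      (L.grassGerm hx).toLinearMap ≤ oddIdeal (𝒪.par x) := by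
    rintro _ ⟨_, ⟨v, rfl⟩, rfl⟩
    refine Submodule.subset_span ⟨1, _, ?_, 1, by rw [one_mul, mul_one]⟩
    exact L.germ_tmul_par _ _ _ (CliffordAlgebra.ι_mem_evenOdd_one _ v)
  have h2 := pow_le_pow_left' h1 (k + 1)
  rw [← Submodule.map_pow] at h2
  have := h2 (Submodule.mem_map_of_mem hω)
  rw [← oddPow_natCast_succ] at this
  exact_mod_cast this

theorem germ_tmul_eq {x : M} (hx : x ∈ φ.source) {W : Opens (Fin n → ℂ)}
    (hW : (W : Set (Fin n → ℂ)) ⊆ φ.target) (hx' : x ∈ chartPreimage φ W) (f : Holo W) (ω : Grass m) :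
    L.germ hW hx' (f ⊗ₜ ω) = L.germ hW hx' (f ⊗ₜ 1) * L.grassGerm hx ω := by
  rw [L.grassGerm_eq hx hW hx', ← map_mul, Algebra.TensorProduct.tmul_mul_tmul, mul_one, one_mul]

theorem mul_mem_oddPow' {x : M} (p : ℤ) (a b : 𝒪.stalk x) (hb : b ∈ oddPow (𝒪.par x) p) :
    a * b ∈ oddPow (𝒪.par x) p := by
  have := oddPow_mul_mem (𝒪.par x) 0 p a (by rw [oddPow_nonpos le_rfl]; trivial) b hb
  rwa [zero_add] at this

/-- The projection of the stalk onto the component of degree `q`. -/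
def proj (q : ℤ) {x : M} (hx : x ∈ φ.source) : Module.End ℂ (𝒪.stalk x) :=
  L.stalkOp (ModelOper.ofGrass n (grassProj m q)) hx

theorem proj_germ_tmul (q : ℤ) {x : M} (hx : x ∈ φ.source) {W : Opens (Fin n → ℂ)}
    (hW : (W : Set (Fin n → ℂ)) ⊆ φ.target) (hx' : x ∈ chartPreimage φ W) (f : Holo W) (ω : Grass m) :
    L.proj q hx (L.germ hW hx' (f ⊗ₜ ω)) = L.germ hW hx' (f ⊗ₜ grassProj m q ω) :=
  L.stalkOp_germ _ hx hW hx' _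

/-- Induction principle for the elements of a stalk. -/
@[elab_as_elim]
theorem stalk_induction {x : M} (hx : x ∈ φ.source) {P : 𝒪.stalk x → Prop} (a : 𝒪.stalk x)
    (tmul : ∀ (W : Opens (Fin n → ℂ)) (hW : (W : Set (Fin n → ℂ)) ⊆ φ.target) (hxW : φ x ∈ W)
      (f : Holo W) (ω : Grass m), P (L.germ hW (mem_chartPreimage hx hxW) (f ⊗ₜ ω)))
    (zero : P 0) (add : ∀ a b, P a → P b → P (a + b)) : P a := by
  obtain ⟨W, hW, hxW, t, -, rfl⟩ := L.exists_germ_eq hx a (Opens.mem_top _)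
  induction t using TensorProduct.induction_on with
  | zero => rw [map_zero]; exact zero
  | add s t hs ht => rw [map_add]; exact add _ _ hs ht
  | tmul f ω => exact tmul W hW hxW f ω

/-- The splitting of the stalk at a point of a chart. -/
def splitting {x : M} (hx : x ∈ φ.source) : Splitting (𝒪.par x) m :=
  Splitting.ofMul (𝒪.par x) (fun q => L.proj q hx)
    (fun q a => by
      induction a using L.stalk_induction hx with
      | zero => rw [map_zero]; exact zero_mem _
      | add a b ha hb => rw [map_add]; exact add_mem ha hb
      | tmul W hW hxW f ω =>
        rw [proj_germ_tmul, L.germ_tmul_eq hx]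
        refine mul_mem_oddPow' _ _ _ ?_
        rcases lt_or_ge q 0 with hq | hq
        · rw [grassProj_neg m hq, LinearMap.zero_apply, map_zero]; exact zero_mem _
        obtain ⟨l, rfl⟩ := Int.eq_ofNat_of_zero_le hq
        exact L.grassGerm_mem_oddPow hx (grassProj_natCast_mem m l ω))
    (fun a => by
      induction a using L.stalk_induction hx with
      | zero => simp
      | add a b ha hb => simp only [map_add, Finset.sum_add_distrib, ha, hb]
      | tmul W hW hxW f ω =>
        simp only [proj_germ_tmul]
        rw [← map_sum, ← TensorProduct.tmul_sum, sum_grassProj])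
    (fun p q a => by
      induction a using L.stalk_induction hx with
      | zero => simp
      | add a b ha hb => simp only [map_add, ha, hb]; split_ifs <;> simp
      | tmul W hW hxW f ω =>
        simp only [proj_germ_tmul, grassProj_orth]
        split_ifs
        · rfl
        · rw [TensorProduct.tmul_zero, map_zero])
    (fun q a => by
      induction a using L.stalk_induction hx with
      | zero => rw [map_zero]; exact zero_mem _
      | add a b ha hb => rw [map_add]; exact add_mem ha hb
      | tmul W hW hxW f ω =>
        rw [proj_germ_tmul]
        exact L.germ_tmul_par _ _ _ (grassProj_mem_evenOdd m q ω))
    (fun p q a b => by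
      obtain ⟨W, hW, hxW, s, t, -, rfl, rfl⟩ := L.exists_germ_eq₂ hx a b (Opens.mem_top _)
      induction s using TensorProduct.induction_on with
      | zero => rw [map_zero, map_zero, zero_mul, map_zero]
      | add s s' hs hs' => simp only [map_add, add_mul, hs, hs']
      | tmul f ω =>
        induction t using TensorProduct.induction_on with
        | zero => rw [map_zero, map_zero, mul_zero, map_zero]
        | add t t' ht ht' => simp only [map_add, mul_add, ht, ht']
        | tmul g η =>
          simp only [proj_germ_tmul]
          rw [← map_mul, Algebra.TensorProduct.tmul_mul_tmul, proj_germ_tmul, grassProj_mul])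
    (fun q hq => by
      ext a
      induction a using L.stalk_induction hx with
      | zero => simp
      | add a b ha hb => rw [map_add, map_add, ha, hb]
      | tmul W hW hxW f ω =>
        rw [proj_germ_tmul, grassProj_neg m hq, LinearMap.zero_apply, TensorProduct.tmul_zero,
          map_zero]
        rfl)

end LocalModelIso

/-- All results on associated graded objects use the local model only through this statement. -/
theorem IsComplexSupermanifold.locallySplit {M : Type u} [TopologicalSpace M]
    {𝒪 : SuperSheaf.{u, v} M} {n m : ℕ} (h : IsComplexSupermanifold 𝒪 n m) :
    LocallySplit 𝒪 m := by
  intro x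
  obtain ⟨φ, hx, ⟨L⟩⟩ := h.locally_model x
  refine ⟨⟨φ.source, φ.open_source⟩, hx, ⟨⟨fun y => L.splitting y.2, fun V hV q f hf => ?_⟩⟩⟩
  exact L.stalkOp_sec _ (fun y hy => hV hy) f hf

end SuperGeom

end

noncomputable section
namespace SuperGeom

/-! ### Holomorphic functions of several variables -/

open Filter Topology Metric

section Holomorphic

variable {E : Type*} [NormedAddCommGroup E] [NormedSpace ℂ E]

/-- The Schwarz lemma, applied to values in the closed ball of radius `2 * B` around `f a`. -/
theorem norm_sub_le_of_bound {f : E → ℂ} {a z : E} {R B : ℝ} (hf : DifferentiableOn ℂ f (ball a R))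
    (hB : ∀ z ∈ ball a R, ‖f z‖ ≤ B) (hz : z ∈ ball a R) :
    ‖f z - f a‖ ≤ 2 * B / R * ‖z - a‖ := by
  have h := Complex.dist_le_div_mul_dist_of_mapsTo_ball (R₂ := 2 * B) hf (fun w hw => ?_) hz
  · rwa [dist_eq_norm, dist_eq_norm] at h
  · rw [mem_closedBall, dist_eq_norm]
    have hR : 0 < R := nonempty_ball.1 ⟨z, hz⟩
    have := norm_sub_le (f w) (f a)
    linarith [hB w hw, hB a (mem_ball_self hR)]

theorem norm_fderiv_le_of_bound {f : E → ℂ} {a : E} {R B : ℝ} (hR : 0 < R)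
    (hf : DifferentiableOn ℂ f (ball a R)) (hB : ∀ z ∈ ball a R, ‖f z‖ ≤ B) :
    ‖fderiv ℂ f a‖ ≤ 2 * B / R := by
  refine Complex.norm_fderiv_le_div_of_mapsTo_ball hf (fun w hw => ?_) hR
  rw [mem_closedBall, dist_eq_norm]
  have := norm_sub_le (f w) (f a)
  linarith [hB w hw, hB a (mem_ball_self hR)]

omit [NormedSpace ℂ E] in
theorem ball_subset_ball_of_mem {a z : E} {R : ℝ} (hz : z ∈ ball a (R / 2)) :
    ball z (R / 2) ⊆ ball a R := ball_subset_ball' (by rw [mem_ball] at hz; linarith)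

/-- The Cauchy estimate on the ball of radius `R / 2` around `z`, which still lies in the given
ball. It yields `2 * B / (R / 2)`. -/
theorem norm_fderiv_le_of_mem_half {f : E → ℂ} {a z : E} {R B : ℝ}
    (hf : DifferentiableOn ℂ f (ball a R)) (hB : ∀ z ∈ ball a R, ‖f z‖ ≤ B)
    (hz : z ∈ ball a (R / 2)) : ‖fderiv ℂ f z‖ ≤ 4 * B / R := by
  have hR : 0 < R / 2 := nonempty_ball.1 ⟨z, hz⟩
  have hs := ball_subset_ball_of_mem hz
  refine (norm_fderiv_le_of_bound hR (hf.mono hs) fun w hw => hB w (hs hw)).trans_eq ?_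
  field_simp
  ring

/-- A locally uniform limit of holomorphic functions is holomorphic. -/
theorem differentiableOn_of_tendstoUniformlyOn {ι : Type*} {l : Filter ι} [l.NeBot]
    {f : ι → E → ℂ} {g : E → ℂ} {U : Set E} (hU : IsOpen U)
    (hf : ∀ n, DifferentiableOn ℂ (f n) U) (h : TendstoUniformlyOn f g l U) :
    DifferentiableOn ℂ g U := by
  intro z₀ hz₀
  obtain ⟨R, hR, hRU⟩ := Metric.isOpen_iff.1 hU z₀ hz₀
  -- By the Cauchy estimate the differentials inherit uniform convergence on half the ball.
  -- Functions closer than `ε * R / 8` have differentials within `4 * (ε * R / 8) / R = ε / 2`.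
  have hc : UniformCauchySeqOn (fun n z => fderiv ℂ (f n) z) l (ball z₀ (R / 2)) := by
    intro u hu
    obtain ⟨ε, hε, hu⟩ := Metric.mem_uniformity_dist.1 hu
    filter_upwards [h.uniformCauchySeqOn _ (Metric.dist_mem_uniformity
      (show 0 < ε * R / 8 by positivity))] with k hk z hz
    refine hu ?_
    have hzU : U ∈ 𝓝 z := hU.mem_nhds (hRU (ball_subset_ball (by linarith) hz))
    have h1 : ∀ n, DifferentiableAt ℂ (f n) z := fun n => (hf n).differentiableAt hzU
    rw [dist_eq_norm, ← fderiv_sub (h1 _) (h1 _)]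
    refine (norm_fderiv_le_of_mem_half (B := ε * R / 8) (((hf k.1).sub (hf k.2)).mono hRU)
      (fun w hw => ?_) hz).trans_lt ?_
    · have := hk w (hRU hw)
      exact (dist_eq_norm (f k.1 w) (f k.2 w)).symm.trans_le (le_of_lt this)
    · rw [div_lt_iff₀ hR]
      nlinarith [mul_pos hε hR]
  have hlim : ∀ z, ∃ y, z ∈ ball z₀ (R / 2) → Tendsto (fun n => fderiv ℂ (f n) z) l (𝓝 y) := by
    intro z
    by_cases hz : z ∈ ball z₀ (R / 2)
    · obtain ⟨y, hy⟩ := CompleteSpace.complete (hc.cauchy_map hz)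
      exact ⟨y, fun _ => hy⟩
    · exact ⟨0, fun h => absurd h hz⟩
  choose g' hg' using hlim
  have hmem : ∀ z ∈ ball z₀ (R / 2), z ∈ U := fun z hz => hRU (ball_subset_ball (by linarith) hz)
  exact (hasFDerivAt_of_tendstoUniformlyOn isOpen_ball (hc.tendstoUniformlyOn_of_tendsto hg')
    (fun n z hz => ((hf n).differentiableAt (hU.mem_nhds (hmem z hz))).hasFDerivAt)
    (fun z hz => h.tendsto_at (hmem z hz))
    (mem_ball_self (by positivity))).differentiableAt.differentiableWithinAt

/-- The Schwarz lemma to second order for the Taylor remainder. Its bound `4 * B` on the ball is `2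
* B` from `f z - f a` and `2 * B` from the linear term. -/
theorem norm_sub_sub_fderiv_le {f : E → ℂ} {a z : E} {R B : ℝ}
    (hf : DifferentiableOn ℂ f (ball a R)) (hB : ∀ z ∈ ball a R, ‖f z‖ ≤ B) (hz : z ∈ ball a R) :
    ‖f z - f a - fderiv ℂ f a (z - a)‖ ≤ 4 * B * (‖z - a‖ / R) ^ 2 := by
  have hR : 0 < R := nonempty_ball.1 ⟨z, hz⟩
  have hda : DifferentiableAt ℂ f a := hf.differentiableAt (isOpen_ball.mem_nhds (mem_ball_self hR))
  have h := Complex.dist_le_mul_div_pow_of_mapsTo_ball_of_isLittleO (n := 1) (R₂ := 4 * B)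
    (f := fun w => f w - f a - fderiv ℂ f a (w - a)) (c := a)
    ((hf.sub (differentiableOn_const _)).sub (by fun_prop)) (fun w hw => ?_) ?_ hz
  · rw [dist_eq_norm, dist_eq_norm] at h
    simpa using h
  · rw [mem_closedBall, dist_eq_norm]
    simp only [sub_self, map_zero, sub_zero]
    refine (norm_sub_le _ _).trans ?_
    have h1 := norm_sub_le (f w) (f a)
    have h2 := (fderiv ℂ f a).le_of_opNorm_le_of_le (norm_fderiv_le_of_bound hR hf hB)
      (show ‖w - a‖ ≤ R by rw [mem_ball, dist_eq_norm] at hw; exact hw.le)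
    rw [div_mul_cancel₀ _ hR.ne'] at h2
    linarith [hB w hw, hB a (mem_ball_self hR)]
  · have := hda.hasFDerivAt.isLittleO
    simpa using this.norm_right

theorem exists_ball_bound {f : E → ℂ} {U : Set E} (hU : IsOpen U) (hf : DifferentiableOn ℂ f U)
    {a : E} (ha : a ∈ U) : ∃ R > 0, ∃ B, 0 ≤ B ∧ ball a R ⊆ U ∧ ∀ z ∈ ball a R, ‖f z‖ ≤ B := by
  have hc : ContinuousAt f a := hf.continuousOn.continuousAt (hU.mem_nhds ha)
  have h := (hc.norm.eventually_lt continuousAt_const (lt_add_one ‖f a‖)).and (hU.mem_nhds ha)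
  obtain ⟨R, hR, hR'⟩ := Metric.eventually_nhds_iff_ball.1 h
  exact ⟨R, hR, ‖f a‖ + 1, by positivity, fun z hz => (hR' z hz).2, fun z hz => (hR' z hz).1.le⟩

/-- The partial derivatives of a holomorphic function are holomorphic. -/
theorem differentiableOn_fderiv_apply {f : E → ℂ} {U : Set E} (hU : IsOpen U)
    (hf : DifferentiableOn ℂ f U) (v : E) : DifferentiableOn ℂ (fun z => fderiv ℂ f z v) U := by
  intro z₀ hz₀
  obtain ⟨R, hR, B, hB0, hRU, hB⟩ := exists_ball_bound hU hf hz₀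
  -- Step sizes tending to zero, so small that moving by `t k • v` from the half ball stays inside
  -- the ball. The derivative is the limit of the difference quotients with these steps.
  obtain ⟨t, ht⟩ : ∃ t : ℕ → ℝ, t = fun k : ℕ => R / 2 / (‖v‖ + 1) * (1 / ((k : ℝ) + 1)) := ⟨_, rfl⟩
  have ht0 : ∀ k, 0 < t k := fun k => by rw [ht]; positivity
  have htv : ∀ k, ‖(t k : ℂ) • v‖ < R / 2 := fun k => by
    rw [norm_smul, Complex.norm_real, Real.norm_of_nonneg (ht0 k).le, ht]
    have h1 : (1 : ℝ) / ((k : ℝ) + 1) ≤ 1 := by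
      rw [div_le_one (by positivity)]; linarith [(Nat.cast_nonneg k : (0 : ℝ) ≤ k)]
    calc R / 2 / (‖v‖ + 1) * (1 / ((k : ℝ) + 1)) * ‖v‖ ≤ R / 2 / (‖v‖ + 1) * 1 * ‖v‖ := by gcongr
      _ < R / 2 := by
        rw [mul_one, div_mul_eq_mul_div, div_lt_iff₀ (by positivity)]
        nlinarith [norm_nonneg v]
  have htend : Tendsto t atTop (𝓝 0) := by
    rw [ht]
    simpa using (tendsto_one_div_add_atTop_nhds_zero_nat (𝕜 := ℝ)).const_mul (R / 2 / (‖v‖ + 1))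
  have hmem : ∀ k, ∀ z ∈ ball z₀ (R / 2), z + (t k : ℂ) • v ∈ ball z₀ R := fun k z hz => by
    refine ball_subset_ball_of_mem hz ?_
    rw [mem_ball, dist_eq_norm, add_sub_cancel_left]
    exact htv k
  have hsub : ball z₀ (R / 2) ⊆ ball z₀ R := ball_subset_ball (by linarith)
  have hfR := hf.mono hRU
  refine DifferentiableOn.differentiableAt (s := ball z₀ (R / 2))
    (differentiableOn_of_tendstoUniformlyOn (l := atTop)
    (f := fun (k : ℕ) z => (t k : ℂ)⁻¹ * (f (z + (t k : ℂ) • v) - f z)) isOpen_ball (fun k => ?_) ?_)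
    (isOpen_ball.mem_nhds (mem_ball_self (by positivity))) |>.differentiableWithinAt
  · exact ((hfR.comp (by fun_prop) (hmem k)).sub (hfR.mono hsub)).const_mul _
  · rw [Metric.tendstoUniformlyOn_iff]
    intro ε hε
    -- The Taylor remainder is quadratic in `t k` with a constant independent of `z`. Divided by `t
    -- k` it tends to zero uniformly.
    have h2 : Tendsto (fun k => t k * (4 * B * (‖v‖ / (R / 2)) ^ 2)) atTop (𝓝 0) := by
      simpa using htend.mul_const (4 * B * (‖v‖ / (R / 2)) ^ 2)
    filter_upwards [h2.eventually (gt_mem_nhds hε)] with k hk z hz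
    have hs := ball_subset_ball_of_mem hz
    have h3 := norm_sub_sub_fderiv_le (z := z + (t k : ℂ) • v) (hfR.mono hs)
      (fun w hw => hB w (hs hw)) (by rw [mem_ball, dist_eq_norm, add_sub_cancel_left]; exact htv k)
    refine lt_of_le_of_lt ?_ hk
    have htk : (t k : ℂ) ≠ 0 := by exact_mod_cast (ht0 k).ne'
    rw [dist_comm, dist_eq_norm]
    rw [add_sub_cancel_left, map_smul, smul_eq_mul] at h3
    have h4 : (t k : ℂ)⁻¹ * (f (z + (t k : ℂ) • v) - f z) - fderiv ℂ f z v =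
        (t k : ℂ)⁻¹ * (f (z + (t k : ℂ) • v) - f z - t k * fderiv ℂ f z v) := by
      field_simp
    rw [h4, norm_mul, norm_inv, Complex.norm_real, Real.norm_of_nonneg (ht0 k).le,
      inv_mul_le_iff₀ (ht0 k)]
    refine h3.trans_eq ?_
    rw [norm_smul, Complex.norm_real, Real.norm_of_nonneg (ht0 k).le]
    ring

/-- A holomorphic function vanishing to infinite order at a point vanishes near this point. -/
theorem eq_zero_of_isBigO {f : E → ℂ} {a : E} {R B : ℝ} (hf : DifferentiableOn ℂ f (ball a R))
    (hB : ∀ z ∈ ball a R, ‖f z‖ ≤ B)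
    (hO : ∀ k : ℕ, f =O[𝓝 a] fun z => ‖z - a‖ ^ k) : ∀ z ∈ ball a R, f z = 0 := by
  intro z hz
  have hR : 0 < R := nonempty_ball.1 ⟨z, hz⟩
  have ha : f a = 0 := by
    have := (hO 1).eq_zero_of_norm_pow one_ne_zero
    simpa using this
  have hlt : dist z a / R < 1 := (div_lt_one hR).2 hz
  -- The Schwarz lemma of order `k + 1` gives this geometric bound for every `k`, and its ratio is
  -- less than one.
  have h1 : ∀ k : ℕ, ‖f z‖ ≤ B * (dist z a / R) ^ (k + 1) := by
    intro k
    have h := Complex.dist_le_mul_div_pow_of_mapsTo_ball_of_isLittleO (n := k) (R₂ := B) hf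
      (fun w hw => by rw [ha, mem_closedBall, dist_zero_right]; exact hB w hw) ?_ hz
    · rwa [ha, dist_zero_right] at h
    · simp only [ha, sub_zero]
      refine (hO (k + 1)).trans_isLittleO ?_
      simp only [pow_succ]
      have h0 : (fun w : E => ‖w - a‖) =o[𝓝 a] fun _ => (1 : ℝ) := by
        rw [Asymptotics.isLittleO_one_iff]
        have : Continuous fun w : E => ‖w - a‖ := by fun_prop
        simpa using this.tendsto a
      simpa using (Asymptotics.isBigO_refl (fun w : E => ‖w - a‖ ^ k) (𝓝 a)).mul_isLittleO h0
  have h2 : Tendsto (fun k : ℕ => B * (dist z a / R) ^ (k + 1)) atTop (𝓝 0) := by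
    have := (tendsto_pow_atTop_nhds_zero_of_lt_one (by positivity) hlt).comp (tendsto_add_atTop_nat 1)
    simpa using this.const_mul B
  exact norm_le_zero_iff.1 (ge_of_tendsto' h2 h1)

end Holomorphic

/-! ### Hadamard's lemma with bounds -/

section Hadamard

variable {n : ℕ}

/-- The average over the segment from `a` to `z` of a partial derivative. -/
def hadamardQuot (f : (Fin n → ℂ) → ℂ) (a : Fin n → ℂ) (i : Fin n) (z : Fin n → ℂ) : ℂ :=
  ∫ t in (0 : ℝ)..1, fderiv ℂ f (a + (t : ℂ) • (z - a)) (Pi.single i 1)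

variable {f : (Fin n → ℂ) → ℂ} {a : Fin n → ℂ} {R B : ℝ} (hf : DifferentiableOn ℂ f (ball a R))
  (hB : ∀ z ∈ ball a R, ‖f z‖ ≤ B)

theorem norm_single_one_le (i : Fin n) : ‖(Pi.single i 1 : Fin n → ℂ)‖ ≤ 1 := by
  rw [pi_norm_le_iff_of_nonneg zero_le_one]
  intro j
  by_cases h : j = i
  · subst h; simp
  · simp [Pi.single_eq_of_ne h]

theorem segment_mem_ball {E : Type*} [NormedAddCommGroup E] [NormedSpace ℂ E] {a z : E} {R : ℝ}
    (hz : z ∈ ball a R) {t : ℝ} (ht : t ∈ Set.Icc (0 : ℝ) 1) : a + (t : ℂ) • (z - a) ∈ ball a R := by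
  rw [mem_ball, dist_eq_norm] at *
  rw [add_sub_cancel_left, norm_smul, Complex.norm_real, Real.norm_of_nonneg ht.1]
  nlinarith [ht.2, norm_nonneg (z - a)]

include hf in
theorem continuousOn_partial_segment {z : Fin n → ℂ} (hz : z ∈ ball a R) (i : Fin n) :
    ContinuousOn (fun t : ℝ => fderiv ℂ f (a + (t : ℂ) • (z - a)) (Pi.single i 1))
      (Set.Icc 0 1) :=
  (differentiableOn_fderiv_apply isOpen_ball hf _).continuousOn.comp (by fun_prop)
    fun _ ht => segment_mem_ball hz ht

include hf in
theorem intervalIntegrable_partial_segment {z : Fin n → ℂ} (hz : z ∈ ball a R) (i : Fin n) :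
    IntervalIntegrable (fun t : ℝ => fderiv ℂ f (a + (t : ℂ) • (z - a)) (Pi.single i 1))
      MeasureTheory.volume 0 1 := by
  refine ContinuousOn.intervalIntegrable ?_
  rw [Set.uIcc_of_le zero_le_one]
  exact continuousOn_partial_segment hf hz i

-- The fundamental theorem of calculus along the segment from `a` to `z`, with the derivative along
-- `z - a` expanded in the coordinates.
include hf in
theorem hadamard {z : Fin n → ℂ} (hz : z ∈ ball a R) :
    f z = f a + ∑ i, (z i - a i) * hadamardQuot f a i z := by
  have h1 : ∀ t ∈ Set.uIcc (0 : ℝ) 1, HasDerivAt (fun t : ℝ => f (a + (t : ℂ) • (z - a)))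
      (∑ i, (z i - a i) * fderiv ℂ f (a + (t : ℂ) • (z - a)) (Pi.single i 1)) t := by
    intro t ht
    rw [Set.uIcc_of_le zero_le_one] at ht
    have hd := (hf.differentiableAt (isOpen_ball.mem_nhds (segment_mem_ball hz ht))).hasFDerivAt
    have hl : HasDerivAt (fun t : ℝ => a + (t : ℂ) • (z - a)) (z - a) t := by
      have := ((Complex.ofRealCLM.hasDerivAt (x := t)).smul_const (z - a)).const_add a
      simpa using this
    have := (hd.restrictScalars ℝ).comp_hasDerivAt t hl
    refine this.congr_deriv ?_
    rw [ContinuousLinearMap.coe_restrictScalars']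
    refine (congrArg (fderiv ℂ f (a + (t : ℂ) • (z - a)))
      (Finset.univ_sum_single (z - a)).symm).trans ?_
    rw [map_sum]
    refine Finset.sum_congr rfl fun i _ => ?_
    rw [show (Pi.single i ((z - a) i) : Fin n → ℂ) = (z i - a i) • Pi.single i (1 : ℂ) by
      rw [← Pi.single_smul]; simp, map_smul, smul_eq_mul]
  have h2 := intervalIntegral.integral_eq_sub_of_hasDerivAt h1 (by
    have := IntervalIntegrable.sum Finset.univ fun i _ =>
      (intervalIntegrable_partial_segment hf hz i).const_mul (z i - a i)
    rwa [Finset.sum_fn] at this)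
  rw [intervalIntegral.integral_finsetSum fun i _ =>
    (intervalIntegrable_partial_segment hf hz i).const_mul _] at h2
  simp only [intervalIntegral.integral_const_mul] at h2
  simp only [Complex.ofReal_one, one_smul, Complex.ofReal_zero, zero_smul, add_zero,
    add_sub_cancel] at h2
  exact (eq_add_of_sub_eq' h2.symm)

include hf hB in
theorem norm_hadamardQuot_le {z : Fin n → ℂ} (hz : z ∈ ball a (R / 2)) (i : Fin n) :
    ‖hadamardQuot f a i z‖ ≤ 4 * B / R := by
  have := intervalIntegral.norm_integral_le_of_norm_le_const (a := (0 : ℝ)) (b := 1)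
    (f := fun t : ℝ => fderiv ℂ f (a + (t : ℂ) • (z - a)) (Pi.single i 1)) (C := 4 * B / R)
    fun t ht => ?_
  · simpa [hadamardQuot] using this
  · rw [Set.uIoc_of_le zero_le_one] at ht
    have h := (fderiv ℂ f (a + (t : ℂ) • (z - a))).le_of_opNorm_le_of_le
      (norm_fderiv_le_of_mem_half hf hB (segment_mem_ball hz ⟨ht.1.le, ht.2⟩))
      (norm_single_one_le i)
    rwa [mul_one] at h

-- Differentiation under the integral sign. The partial derivative of `f` is bounded by `4 * B / R`
-- on the ball of radius `R / 2`; a second Cauchy estimate bounds its differential on the ball of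
-- radius `R / 4`, and this constant dominates the integrand.
include hf hB in
theorem differentiableOn_hadamardQuot (i : Fin n) :
    DifferentiableOn ℂ (hadamardQuot f a i) (ball a (R / 4)) := by
  intro z₀ hz₀
  have hR : 0 < R / 4 := nonempty_ball.1 ⟨z₀, hz₀⟩
  have hpart := differentiableOn_fderiv_apply isOpen_ball hf (Pi.single i 1)
  have hb : ∀ w ∈ ball a (R / 2), ‖fderiv ℂ f w (Pi.single i 1)‖ ≤ 4 * B / R := fun w hw => by
    have h := (fderiv ℂ f w).le_of_opNorm_le_of_le (norm_fderiv_le_of_mem_half hf hB hw)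
      (norm_single_one_le i)
    rwa [mul_one] at h
  have hsub : ball a (R / 2) ⊆ ball a R := ball_subset_ball (by linarith)
  have hsub' : ball a (R / 4) ⊆ ball a R := ball_subset_ball (by linarith)
  obtain ⟨g, hg⟩ : ∃ g : (Fin n → ℂ) → ℂ, g = fun w => fderiv ℂ f w (Pi.single i 1) := ⟨_, rfl⟩
  rw [← hg] at hpart
  refine (intervalIntegral.hasFDerivAt_integral_of_dominated_of_fderiv_le (𝕜 := ℂ)
    (s := ball a (R / 4)) (F := fun z t => g (a + (t : ℂ) • (z - a)))
    (F' := fun z t => (t : ℂ) • fderiv ℂ g (a + (t : ℂ) • (z - a)))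
    (bound := fun _ => 4 * (4 * B / R) / (R / 2))
    (isOpen_ball.mem_nhds hz₀) ?_ ?_ ?_ ?_ ?_ ?_).differentiableAt.differentiableWithinAt.congr
    (fun z hz => by rw [hadamardQuot, hg]) (by rw [hadamardQuot, hg])
  · filter_upwards [isOpen_ball.mem_nhds hz₀] with z hz
    rw [hg]
    exact (intervalIntegrable_iff.1
      (intervalIntegrable_partial_segment hf (hsub' hz) i)).aestronglyMeasurable
  · rw [hg]
    exact intervalIntegrable_partial_segment hf (hsub' hz₀) i
  · refine Measurable.aestronglyMeasurable ?_
    have h1 : Measurable fun t : ℝ => a + (t : ℂ) • (z₀ - a) := by fun_prop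
    exact (Complex.measurable_ofReal).smul ((measurable_fderiv ℂ g).comp h1)
  · refine Filter.Eventually.of_forall fun t ht z hz => ?_
    rw [Set.uIoc_of_le zero_le_one] at ht
    rw [norm_smul, Complex.norm_real, Real.norm_of_nonneg ht.1.le]
    have h := norm_fderiv_le_of_mem_half (hpart.mono hsub)
      (fun w hw => by rw [hg]; exact hb w hw)
      (segment_mem_ball (by rwa [show R / 2 / 2 = R / 4 by ring]) ⟨ht.1.le, ht.2⟩)
    refine (mul_le_of_le_one_left (norm_nonneg _) ht.2).trans h
  · exact intervalIntegrable_const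
  · refine Filter.Eventually.of_forall fun t ht z hz => ?_
    rw [Set.uIoc_of_le zero_le_one] at ht
    have hd := (hpart.differentiableAt (isOpen_ball.mem_nhds
      (segment_mem_ball (hsub' hz) ⟨ht.1.le, ht.2⟩))).hasFDerivAt
    have hl : HasFDerivAt (fun z : Fin n → ℂ => a + (t : ℂ) • (z - a))
        ((t : ℂ) • ContinuousLinearMap.id ℂ (Fin n → ℂ)) z :=
      (((hasFDerivAt_id z).sub_const a).const_smul (t : ℂ)).const_add a
    refine (hd.comp z hl).congr_fderiv ?_
    ext v
    simp

end Hadamard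

/-! ### Compactness of bounded families of holomorphic functions -/

section Montel

variable {n : ℕ}

open scoped BoundedContinuousFunction in
/-- **Montel's theorem**: the restrictions to a smaller closed ball of the holomorphic functions on
a ball that are bounded by `1` form a relatively compact set. -/
theorem exists_isCompact_restrict (a : Fin n → ℂ) {R : ℝ} (hR : 0 < R) :
    ∃ K : Set (closedBall a (R / 2) →ᵇ ℂ), IsCompact K ∧ ∀ f : closedBall a (R / 2) →ᵇ ℂ,
      (∃ g : (Fin n → ℂ) → ℂ, DifferentiableOn ℂ g (ball a R) ∧ (∀ z ∈ ball a R, ‖g z‖ ≤ 1) ∧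
        ∀ z : closedBall a (R / 2), f z = g z) → f ∈ K := by
  refine ⟨closure {f | ∃ g : (Fin n → ℂ) → ℂ, DifferentiableOn ℂ g (ball a R) ∧
    (∀ z ∈ ball a R, ‖g z‖ ≤ 1) ∧ ∀ z : closedBall a (R / 2), f z = g z}, ?_,
    fun f hf => subset_closure hf⟩
  have hsub : closedBall a (R / 2) ⊆ ball a R := closedBall_subset_ball (by linarith)
  refine BoundedContinuousFunction.arzela_ascoli (closedBall (0 : ℂ) 1) (isCompact_closedBall _ _)
    _ ?_ ?_
  · rintro f x ⟨g, -, hg, hfg⟩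
    rw [mem_closedBall, dist_zero_right, hfg]
    exact hg _ (hsub x.2)
  · intro x₀
    -- A point of the smaller closed ball has distance at least `R / 2` from the boundary of the
    -- large ball, so the Schwarz estimate there gives the same modulus of continuity for the whole
    -- family.
    refine Metric.equicontinuousAt_of_continuity_modulus
      (fun x : closedBall a (R / 2) => 2 * 1 / (R / 2) * ‖x.1 - x₀.1‖) ?_ _ ?_
    · have : Continuous fun x : closedBall a (R / 2) => 2 * 1 / (R / 2) * ‖x.1 - x₀.1‖ := by
        fun_prop
      simpa using this.tendsto x₀
    · filter_upwards [ball_mem_nhds x₀ (half_pos hR)] with x hx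
      rintro ⟨f, g, hg, hg1, hfg⟩
      have hs : ball x₀.1 (R / 2) ⊆ ball a R :=
        ball_subset_ball' (by linarith [mem_closedBall.1 x₀.2])
      rw [dist_comm, dist_eq_norm]
      change ‖f x - f x₀‖ ≤ _
      rw [hfg, hfg]
      exact norm_sub_le_of_bound (hg.mono hs) (fun w hw => hg1 w (hs hw)) hx

end Montel

end SuperGeom

end

noncomputable section
namespace SuperGeom

/-! ### Partial derivatives on the model superspace -/

open Filter Topology
open scoped TensorProduct

section Holo

variable {n : ℕ} {W W' : Opens (Fin n → ℂ)}

/-- The holomorphic function on `W` given by a function that is holomorphic on `W`. -/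
def Holo.of (g : (Fin n → ℂ) → ℂ) (hg : DifferentiableOn ℂ g W) : Holo W :=
  ⟨fun z => g z, g, hg, fun _ => rfl⟩

open Classical in
/-- Extension by zero of a holomorphic function. -/
def Holo.extend (f : Holo W) (z : Fin n → ℂ) : ℂ := if h : z ∈ W then f.1 ⟨z, h⟩ else 0

theorem Holo.extend_of_mem (f : Holo W) {z : Fin n → ℂ} (h : z ∈ W) : (Holo.extend f) z = f.1 ⟨z, h⟩ :=
  dif_pos h

theorem Holo.extend_of (g : (Fin n → ℂ) → ℂ) (hg : DifferentiableOn ℂ g W) {z : Fin n → ℂ}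
    (h : z ∈ W) : (Holo.extend (Holo.of g hg)) z = g z := Holo.extend_of_mem _ h

theorem Holo.differentiableOn (f : Holo W) : DifferentiableOn ℂ (Holo.extend f) W := by
  obtain ⟨g, hg, hf⟩ := f.2
  exact hg.congr fun z hz => (Holo.extend_of_mem f hz).trans (hf ⟨z, hz⟩)

theorem Holo.differentiableAt (f : Holo W) {z : Fin n → ℂ} (h : z ∈ W) :
    DifferentiableAt ℂ (Holo.extend f) z := (Holo.differentiableOn f).differentiableAt (W.isOpen.mem_nhds h)

theorem Holo.ext_extend {f g : Holo W} (h : ∀ z ∈ W, (Holo.extend f) z = (Holo.extend g) z) : f = g := by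
  refine Subtype.ext (funext fun z => ?_)
  rw [← Holo.extend_of_mem f z.2, ← Holo.extend_of_mem g z.2, h z z.2]

theorem Holo.extend_add (f g : Holo W) : (Holo.extend (f + g)) = (Holo.extend f) + (Holo.extend g) := by
  ext z
  by_cases h : z ∈ W
  · rw [Pi.add_apply, extend_of_mem _ h, extend_of_mem _ h, extend_of_mem _ h]; rfl
  · simp [extend, h]

theorem Holo.extend_smul (c : ℂ) (f : Holo W) : (Holo.extend (c • f)) = c • (Holo.extend f) := by
  ext z
  by_cases h : z ∈ W
  · rw [Pi.smul_apply, extend_of_mem _ h, extend_of_mem _ h]; rfl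
  · simp [extend, h]

theorem Holo.extend_mul (f g : Holo W) : (Holo.extend (f * g)) = (Holo.extend f) * (Holo.extend g) := by
  ext z
  by_cases h : z ∈ W
  · rw [Pi.mul_apply, extend_of_mem _ h, extend_of_mem _ h, extend_of_mem _ h]; rfl
  · simp [extend, h]

theorem Holo.extend_res (h : W' ≤ W) (f : Holo W) {z : Fin n → ℂ} (hz : z ∈ W') :
    (Holo.extend (Holo.res h f)) z = (Holo.extend f) z := by
  rw [extend_of_mem _ hz, extend_of_mem _ (h hz)]; rfl

theorem Holo.extend_res_eventuallyEq (h : W' ≤ W) (f : Holo W) {z : Fin n → ℂ} (hz : z ∈ W') :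
    (Holo.extend (Holo.res h f)) =ᶠ[𝓝 z] (Holo.extend f) := by
  filter_upwards [W'.isOpen.mem_nhds hz] with w hw using extend_res h f hw

/-- The partial derivatives of holomorphic functions. -/
def Holo.pd (i : Fin n) (W : Opens (Fin n → ℂ)) : Holo W →ₗ[ℂ] Holo W where
  toFun f := Holo.of (fun z => fderiv ℂ (Holo.extend f) z (Pi.single i 1))
    (differentiableOn_fderiv_apply W.isOpen (Holo.differentiableOn f) _)
  map_add' f g := by
    refine Subtype.ext (funext fun z => ?_)
    change fderiv ℂ (Holo.extend (f + g)) z _ = fderiv ℂ (Holo.extend f) z _ + fderiv ℂ (Holo.extend g) z _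
    rw [extend_add, fderiv_add (Holo.differentiableAt f z.2) (Holo.differentiableAt g z.2)]
    rfl
  map_smul' c f := by
    refine Subtype.ext (funext fun z => ?_)
    change fderiv ℂ (Holo.extend (c • f)) z _ = c • fderiv ℂ (Holo.extend f) z _
    rw [extend_smul, fderiv_const_smul (Holo.differentiableAt f z.2)]
    rfl

theorem Holo.pd_val (i : Fin n) (f : Holo W) (z : W) :
    (Holo.pd i W f).1 z = fderiv ℂ (Holo.extend f) z (Pi.single i 1) := rfl

theorem Holo.pd_mul (i : Fin n) (f g : Holo W) :
    Holo.pd i W (f * g) = Holo.pd i W f * g + f * Holo.pd i W g := by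
  refine Subtype.ext (funext fun z => ?_)
  change fderiv ℂ (Holo.extend (f * g)) z _ =
    fderiv ℂ (Holo.extend f) z _ * g.1 z + f.1 z * fderiv ℂ (Holo.extend g) z _
  rw [extend_mul, fderiv_mul (Holo.differentiableAt f z.2) (Holo.differentiableAt g z.2), Holo.extend_of_mem f z.2,
    Holo.extend_of_mem g z.2]
  simp
  ring

theorem Holo.pd_res (i : Fin n) (h : W' ≤ W) (f : Holo W) :
    Holo.pd i W' (Holo.res h f) = Holo.res h (Holo.pd i W f) := by
  refine Subtype.ext (funext fun z => ?_)
  change fderiv ℂ (Holo.extend (Holo.res h f)) z _ = fderiv ℂ (Holo.extend f) z _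
  rw [(extend_res_eventuallyEq h f z.2).fderiv_eq]

/-- The coordinate functions. -/
def Holo.coord (i : Fin n) (W : Opens (Fin n → ℂ)) : Holo W :=
  Holo.of (fun z => z i) (by fun_prop)

theorem Holo.pd_coord (i j : Fin n) : Holo.pd i W (Holo.coord j W) = if i = j then 1 else 0 := by
  refine Subtype.ext (funext fun z => ?_)
  rw [pd_val]
  have h1 : (Holo.extend (Holo.coord j W)) =ᶠ[𝓝 z.1] fun w => w j := by
    filter_upwards [W.isOpen.mem_nhds z.2] with w hw using extend_of _ _ hw
  rw [h1.fderiv_eq, show (fun w : Fin n → ℂ => w j) =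
    (ContinuousLinearMap.proj j : (Fin n → ℂ) →L[ℂ] ℂ) from rfl, ContinuousLinearMap.fderiv]
  rcases eq_or_ne i j with rfl | hij
  · simp
  · simp [hij, hij.symm]

theorem Holo.pd_one (i : Fin n) : Holo.pd i W 1 = 0 := by
  have h := Holo.pd_mul i (1 : Holo W) 1
  rw [mul_one, mul_one, one_mul] at h
  simpa using h

end Holo

/-! ### The even and odd partial derivatives as superderivations -/

section ModelDer

variable {n m : ℕ}

/-- The partial derivatives of the model superspace in the even coordinates. -/
def ModelOper.pd (m : ℕ) (i : Fin n) : ModelOper n m where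
  op W := TensorProduct.map (Holo.pd i W) LinearMap.id
  op_res W W' h t := by
    induction t using TensorProduct.induction_on with
    | zero => simp only [map_zero]
    | add s t hs ht => simp only [map_add, hs, ht]
    | tmul f ω =>
      rw [ModelSec.res_tmul, TensorProduct.map_tmul, TensorProduct.map_tmul, Holo.pd_res]
      rfl

theorem ModelOper.pd_tmul (i : Fin n) (W : Opens (Fin n → ℂ)) (f : Holo W) (ω : Grass m) :
    (ModelOper.pd m i).op W (f ⊗ₜ ω) = Holo.pd i W f ⊗ₜ ω := rfl

/-- The derivations of the Grassmann algebra. -/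
def grassDer (m : ℕ) (j : Fin m) : Module.End ℂ (Grass m) :=
  CliffordAlgebra.contractLeft (Q := (0 : QuadraticForm ℂ (Fin m → ℂ))) (LinearMap.proj j)

theorem grassDer_ι_mul (j : Fin m) (v : Fin m → ℂ) (ω : Grass m) :
    grassDer m j (ExteriorAlgebra.ι ℂ v * ω) = v j • ω - ExteriorAlgebra.ι ℂ v * grassDer m j ω :=
  CliffordAlgebra.contractLeft_ι_mul _ _ _

theorem grassDer_one (j : Fin m) : grassDer m j 1 = 0 := CliffordAlgebra.contractLeft_one (Q := (0 : QuadraticForm ℂ (Fin m → ℂ)))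
    (LinearMap.proj j)

theorem grassDer_ι (j : Fin m) (v : Fin m → ℂ) :
    grassDer m j (ExteriorAlgebra.ι ℂ v) = algebraMap ℂ _ (v j) := by
  have := grassDer_ι_mul j v 1
  rwa [grassDer_one, mul_zero, sub_zero, mul_one, ← Algebra.algebraMap_eq_smul_one] at this

/-- Induction on `ω` by left multiplication with generators, where the rule for contractions
applies. The grade involution records the sign without requiring `ω` to be homogeneous. -/
theorem grassDer_mul (j : Fin m) (ω η : Grass m) : grassDer m j (ω * η) =
    grassDer m j ω * η + CliffordAlgebra.involute (Q := (0 : QuadraticForm ℂ (Fin m → ℂ))) ω *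
      grassDer m j η := by
  induction ω using CliffordAlgebra.left_induction generalizing η with
  | algebraMap r =>
    rw [AlgHom.commutes, ← Algebra.smul_def, map_smul, ← Algebra.smul_def,
      Algebra.algebraMap_eq_smul_one, map_smul]
    erw [grassDer_one]
    rw [smul_zero, zero_mul, zero_add]
  | add a b ha hb => 
    rw [add_mul, map_add, ha, hb, map_add, map_add, add_mul, add_mul]; abel
  | ι_mul a v ha =>
    rw [mul_assoc]
    erw [grassDer_ι_mul, ha, grassDer_ι_mul]
    rw [map_mul, CliffordAlgebra.involute_ι, sub_mul, mul_add, smul_mul_assoc]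
    simp only [neg_mul, mul_assoc]
    rw [sub_add_eq_sub_sub, sub_eq_add_neg _ (_ * (_ * grassDer m j η))]

theorem involute_of_mem {i : ZMod 2} {ω : Grass m}
    (hω : ω ∈ CliffordAlgebra.evenOdd (0 : QuadraticForm ℂ (Fin m → ℂ)) i) :
    CliffordAlgebra.involute (Q := (0 : QuadraticForm ℂ (Fin m → ℂ))) ω = sgn 1 i • ω := by
  fin_cases i
  · rw [CliffordAlgebra.involute_eq_of_mem_even hω]
    change ω = sgn 1 0 • ω
    simp [sgn]
  · rw [CliffordAlgebra.involute_eq_of_mem_odd hω]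
    change -ω = sgn 1 1 • ω
    simp [sgn, ZMod.val_one]

theorem grassDer_evenOdd (j : Fin m) {i : ZMod 2} {ω : Grass m}
    (hω : ω ∈ CliffordAlgebra.evenOdd (0 : QuadraticForm ℂ (Fin m → ℂ)) i) :
    grassDer m j ω ∈ CliffordAlgebra.evenOdd (0 : QuadraticForm ℂ (Fin m → ℂ)) (1 + i) := by
  have key : ∀ (k : ℕ), ∀ ω ∈ ⋀[ℂ]^k (Fin m → ℂ), grassDer m j ω ∈
      CliffordAlgebra.evenOdd (0 : QuadraticForm ℂ (Fin m → ℂ)) (1 + k) := by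
    intro k ω hω
    induction hω using Submodule.pow_induction_on_left' with
    | algebraMap r =>
      rw [Algebra.algebraMap_eq_smul_one, map_smul, grassDer_one, smul_zero]
      exact zero_mem _
    | add x y i _ _ hx hy => rw [map_add]; exact add_mem hx hy
    | mem_mul x hx i y hy ih =>
      obtain ⟨v, rfl⟩ := hx
      rw [grassDer_ι_mul]
      refine sub_mem (Submodule.smul_mem _ _ ?_) ?_
      -- Contraction lowers the degree by one. Modulo `2` this is the same as adding one.
      · have h2 : (1 + ((i + 1 : ℕ) : ZMod 2)) = i := by
          push_cast
          rw [add_left_comm, show (1 : ZMod 2) + 1 = 0 from rfl, add_zero]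
        rw [h2]
        exact exteriorPower_le_evenOdd m i hy
      · have h2 : (1 + ((i + 1 : ℕ) : ZMod 2)) = 1 + (1 + i) := by push_cast; ring
        rw [h2]
        exact SetLike.mul_mem_graded (A := CliffordAlgebra.evenOdd (0 : QuadraticForm ℂ (Fin m → ℂ)))
          (CliffordAlgebra.ι_mem_evenOdd_one _ v) ih
  refine Submodule.iSup_induction _ (motive := fun ω => grassDer m j ω ∈
    CliffordAlgebra.evenOdd (0 : QuadraticForm ℂ (Fin m → ℂ)) (1 + i)) hω ?_
    (by rw [map_zero]; exact zero_mem _) fun a b ha hb => by rw [map_add]; exact add_mem ha hb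
  rintro ⟨k, rfl⟩ ω hω
  exact key k ω hω

theorem ModelSec.par_le_map {W : Opens (Fin n → ℂ)} {i j : ZMod 2}
    (T : ModelSec n m W →ₗ[ℂ] ModelSec n m W)
    (hT : ∀ f, ∀ ω ∈ CliffordAlgebra.evenOdd (0 : QuadraticForm ℂ (Fin m → ℂ)) i,
      T (f ⊗ₜ ω) ∈ ModelSec.par n m W j) {t : ModelSec n m W} (ht : t ∈ ModelSec.par n m W i) :
    T t ∈ ModelSec.par n m W j := by
  induction ht using Submodule.span_induction with
  | zero => rw [map_zero]; exact zero_mem _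
  | add a b _ _ ha hb => rw [map_add]; exact add_mem ha hb
  | smul c a _ ha => rw [map_smul]; exact Submodule.smul_mem _ _ ha
  | mem a ha =>
    obtain ⟨f, ω, hω, rfl⟩ := ha
    exact hT f ω hω

/-- A superderivation of parity `i` of the model superspace. -/
structure ModelOper.IsDer (T : ModelOper n m) (i : ZMod 2) : Prop where
  par : ∀ W j, ∀ t ∈ ModelSec.par n m W j, T.op W t ∈ ModelSec.par n m W (i + j)
  mul : ∀ W j, ∀ s ∈ ModelSec.par n m W j, ∀ t,
    T.op W (s * t) = T.op W s * t + sgn i j • (s * T.op W t)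

theorem ModelOper.IsDer.of_tmul {T : ModelOper n m} {i : ZMod 2}
    (par : ∀ W j f, ∀ ω ∈ CliffordAlgebra.evenOdd (0 : QuadraticForm ℂ (Fin m → ℂ)) j,
      T.op W (f ⊗ₜ ω) ∈ ModelSec.par n m W (i + j))
    (mul : ∀ W j f, ∀ ω ∈ CliffordAlgebra.evenOdd (0 : QuadraticForm ℂ (Fin m → ℂ)) j, ∀ g η,
      T.op W ((f * g) ⊗ₜ (ω * η)) =
        T.op W (f ⊗ₜ ω) * (g ⊗ₜ η) + sgn i j • ((f ⊗ₜ ω) * T.op W (g ⊗ₜ η))) : T.IsDer i where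
  par W j t ht := ModelSec.par_le_map _ (par W j) ht
  mul W j s hs t := by
    induction hs using Submodule.span_induction with
    | zero => simp
    | add a b _ _ ha hb => simp only [add_mul, map_add, ha, hb, smul_add]; abel
    | smul c a _ ha => simp only [smul_mul_assoc, map_smul, ha, smul_add, smul_comm c]
    | mem a ha =>
      obtain ⟨f, ω, hω, rfl⟩ := ha
      induction t using TensorProduct.induction_on with
      | zero => simp
      | add s t hs ht => simp only [mul_add, map_add, hs, ht, smul_add]; abel
      | tmul g η => rw [Algebra.TensorProduct.tmul_mul_tmul]; exact mul W j f ω hω g η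

theorem ModelOper.pd_isDer (i : Fin n) : (ModelOper.pd m i).IsDer 0 :=
  .of_tmul (fun W j f ω hω => by
      rw [zero_add]; exact Submodule.subset_span ⟨_, ω, hω, rfl⟩)
    fun W j f ω hω g η => by
      rw [pd_tmul, pd_tmul, pd_tmul, Holo.pd_mul, TensorProduct.add_tmul,
        Algebra.TensorProduct.tmul_mul_tmul, Algebra.TensorProduct.tmul_mul_tmul]
      simp [sgn]

theorem ModelOper.grassDer_isDer (j : Fin m) : (ModelOper.ofGrass n (grassDer m j)).IsDer 1 :=
  .of_tmul (fun W j f ω hω => Submodule.subset_span ⟨_, _, grassDer_evenOdd _ hω, rfl⟩)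
    fun W i f ω hω g η => by
      rw [ofGrass_tmul, ofGrass_tmul, ofGrass_tmul, grassDer_mul, involute_of_mem hω,
        TensorProduct.tmul_add, Algebra.TensorProduct.tmul_mul_tmul,
        Algebra.TensorProduct.tmul_mul_tmul, smul_mul_assoc, TensorProduct.tmul_smul]

end ModelDer

end SuperGeom

end

noncomputable section
namespace SuperGeom

/-! ### Coordinates, derivations and orders of vanishing on the stalks -/

open Filter Topology
open scoped TensorProduct

/-! ### Multiplying superderivations by functions -/

section MulLeft

variable {A : Type*} [Ring A] [Algebra ℂ A] {𝒜 : ZMod 2 → Submodule ℂ A} [GradedAlgebra 𝒜]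
  (hcomm : ∀ i j : ZMod 2, ∀ a ∈ 𝒜 i, ∀ b ∈ 𝒜 j, a * b = sgn i j • (b * a))

-- In the Leibniz rule for `a δ` the factor `a` has to be moved past `b`. Supercommutativity
-- supplies exactly the sign `sgn i k` missing from `sgn j k`.
include hcomm in
theorem mulLeft_mem_homDer {i j : ZMod 2} {a : A} (ha : a ∈ 𝒜 i) {δ : Module.End ℂ A}
    (hδ : δ ∈ homDer 𝒜 j) : LinearMap.mulLeft ℂ a ∘ₗ δ ∈ homDer 𝒜 (i + j) := by
  refine ⟨fun k b hb => ?_, fun k b hb c => ?_⟩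
  · rw [add_assoc]
    exact SetLike.mul_mem_graded ha (hδ.1 k b hb)
  · rw [LinearMap.comp_apply, LinearMap.comp_apply, LinearMap.comp_apply, LinearMap.mulLeft_apply,
      LinearMap.mulLeft_apply, LinearMap.mulLeft_apply, hδ.2 k b hb c, mul_add, mul_smul_comm,
      ← mul_assoc, ← mul_assoc, hcomm i k a ha b hb, sgn_comm (i + j) k, sgn_add, sgn_comm k i,
      sgn_comm k j, smul_mul_assoc, smul_smul, mul_assoc b, mul_comm (sgn j k)]

include hcomm in
theorem mulLeft_mem_superDer (a : A) {δ : Module.End ℂ A} (hδ : δ ∈ superDer 𝒜) :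
    LinearMap.mulLeft ℂ a ∘ₗ δ ∈ superDer 𝒜 := by
  have h : LinearMap.mulLeft ℂ a ∘ₗ δ = ∑ i, ∑ j,
      LinearMap.mulLeft ℂ (GradedAlgebra.proj 𝒜 i a) ∘ₗ endPart 𝒜 j δ := by
    ext b
    conv_lhs => rw [← sum_proj 𝒜 a, ← sum_endPart 𝒜 δ]
    simp only [LinearMap.comp_apply, LinearMap.mulLeft_apply, LinearMap.sum_apply, Finset.sum_mul,
      Finset.mul_sum]
    exact Finset.sum_comm
  rw [h]
  exact sum_mem fun i _ => sum_mem fun j _ => homDer_le 𝒜 _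
    (mulLeft_mem_homDer hcomm (proj_mem 𝒜 i a) (endPart_mem 𝒜 j hδ))

theorem endPart_apply_of_mem (i : ZMod 2) {j : ZMod 2} (δ : Module.End ℂ A) {a : A} (ha : a ∈ 𝒜 j) :
    endPart 𝒜 i δ a = GradedAlgebra.proj 𝒜 (i + j) (δ a) := by
  rw [endPart_apply, Finset.sum_eq_single j]
  · rw [proj_same 𝒜 ha]
  · intro k _ hk
    rw [proj_ne 𝒜 ha hk.symm, map_zero, map_zero]
  · simp

end MulLeft

/-! ### Coordinates and coefficients on the model superspace -/

section Coordinates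

variable {n m : ℕ}

/-- The parity of the coordinates. -/
def crdPar : Fin n ⊕ Fin m → ZMod 2 := Sum.elim (fun _ => 0) fun _ => 1

/-- The coordinates of the model superspace. -/
def ModelSec.crd (W : Opens (Fin n → ℂ)) : Fin n ⊕ Fin m → ModelSec n m W :=
  Sum.elim (fun i => Holo.coord i W ⊗ₜ 1) fun j => 1 ⊗ₜ ExteriorAlgebra.ι ℂ (Pi.single j 1)

theorem ModelSec.crd_res {W W' : Opens (Fin n → ℂ)} (h : W' ≤ W) (c : Fin n ⊕ Fin m) :
    ModelSec.res m h (ModelSec.crd W c) = ModelSec.crd W' c := by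
  rcases c with i | j <;> rfl

theorem ModelSec.crd_mem_par (W : Opens (Fin n → ℂ)) (c : Fin n ⊕ Fin m) :
    ModelSec.crd W c ∈ ModelSec.par n m W (crdPar c) := by
  rcases c with i | j
  · exact Submodule.subset_span ⟨_, 1, Submodule.one_le.1 (CliffordAlgebra.one_le_evenOdd_zero _), rfl⟩
  · exact Submodule.subset_span ⟨_, _, CliffordAlgebra.ι_mem_evenOdd_one _ _, rfl⟩

/-- The partial derivatives of the model superspace. -/
def ModelOper.der : Fin n ⊕ Fin m → ModelOper n m :=
  Sum.elim (fun i => ModelOper.pd m i) fun j => ModelOper.ofGrass n (grassDer m j)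

theorem ModelOper.der_isDer (c : Fin n ⊕ Fin m) : (ModelOper.der c).IsDer (crdPar c) := by
  rcases c with i | j
  · exact ModelOper.pd_isDer i
  · exact ModelOper.grassDer_isDer j

theorem ModelOper.der_crd (W : Opens (Fin n → ℂ)) (c c' : Fin n ⊕ Fin m) :
    (ModelOper.der c).op W (ModelSec.crd W c') = if c = c' then 1 else 0 := by
  rcases c with i | j <;> rcases c' with i' | j'
  · change Holo.pd i W (Holo.coord i' W) ⊗ₜ[ℂ] (1 : Grass m) = _
    rw [Holo.pd_coord]
    by_cases h : i = i'
    · simp [h]; rfl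
    · simp [h]
  · change Holo.pd i W 1 ⊗ₜ[ℂ] ExteriorAlgebra.ι ℂ (Pi.single j' 1) = _
    rw [Holo.pd_one]
    simp
  · change Holo.coord i' W ⊗ₜ[ℂ] grassDer m j 1 = _
    rw [grassDer_one]
    simp
  · change (1 : Holo W) ⊗ₜ[ℂ] grassDer m j (ExteriorAlgebra.ι ℂ (Pi.single j' 1)) = _
    rw [grassDer_ι]
    by_cases h : j = j'
    · subst h; simp; rfl
    · simp [h]

theorem ModelSec.res_par {W W' : Opens (Fin n → ℂ)} (h : W' ≤ W) {i : ZMod 2} {t : ModelSec n m W}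
    (ht : t ∈ ModelSec.par n m W i) : ModelSec.res m h t ∈ ModelSec.par n m W' i := by
  induction ht using Submodule.span_induction with
  | zero => rw [map_zero]; exact zero_mem _
  | add a b _ _ ha hb => rw [map_add]; exact add_mem ha hb
  | smul c a _ ha => rw [map_smul]; exact Submodule.smul_mem _ _ ha
  | mem a ha =>
    obtain ⟨f, ω, hω, rfl⟩ := ha
    exact Submodule.subset_span ⟨_, ω, hω, rfl⟩

/-- The basis of the Grassmann algebra. -/
def grassBasis (m : ℕ) : Module.Basis (Finset (Fin m)) ℂ (Grass m) :=
  (Pi.basisFun ℂ (Fin m)).ExteriorAlgebra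

/-- The coefficients of a section of the model superspace. -/
def ModelSec.coef (W : Opens (Fin n → ℂ)) (I : Finset (Fin m)) : ModelSec n m W →ₗ[ℂ] Holo W :=
  (TensorProduct.rid ℂ (Holo W)).toLinearMap ∘ₗ
    TensorProduct.map LinearMap.id ((grassBasis m).coord I)

theorem ModelSec.coef_tmul (W : Opens (Fin n → ℂ)) (I : Finset (Fin m)) (f : Holo W) (ω : Grass m) :
    ModelSec.coef W I (f ⊗ₜ ω) = (grassBasis m).coord I ω • f := by
  simp [coef]

theorem ModelSec.sum_coef {W : Opens (Fin n → ℂ)} (t : ModelSec n m W) :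
    ∑ I, ModelSec.coef W I t ⊗ₜ[ℂ] grassBasis m I = t := by
  induction t using TensorProduct.induction_on with
  | zero => simp
  | add s t hs ht => simp only [map_add, TensorProduct.add_tmul, Finset.sum_add_distrib, hs, ht]
  | tmul f ω =>
    simp only [coef_tmul, TensorProduct.smul_tmul, ← TensorProduct.tmul_sum]
    congr 1
    exact (grassBasis m).sum_repr ω

theorem ModelSec.coef_res {W W' : Opens (Fin n → ℂ)} (h : W' ≤ W) (I : Finset (Fin m))
    (t : ModelSec n m W) :
    ModelSec.coef W' I (ModelSec.res m h t) = Holo.res h (ModelSec.coef W I t) := by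
  induction t using TensorProduct.induction_on with
  | zero => simp
  | add s t hs ht => simp only [map_add, hs, ht]
  | tmul f ω => rw [res_tmul, coef_tmul, coef_tmul, map_smul]

end Coordinates

/-! ### Partial derivatives and orders of vanishing on a stalk -/

namespace LocalModelIso

variable {M : Type u} [TopologicalSpace M] {𝒪 : SuperSheaf.{u, v} M} {n m : ℕ}
  {φ : OpenPartialHomeomorph M (Fin n → ℂ)} (L : LocalModelIso 𝒪 n m φ) {x : M} (hx : x ∈ φ.source)

theorem exists_germ_eq_par {i : ZMod 2} {a : 𝒪.stalk x} (ha : a ∈ 𝒪.par x i)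
    {W₀ : Opens (Fin n → ℂ)} (hx₀ : φ x ∈ W₀) :
    ∃ (W : Opens (Fin n → ℂ)) (hW : (W : Set (Fin n → ℂ)) ⊆ φ.target) (hxW : φ x ∈ W)
      (t : ModelSec n m W), W ≤ W₀ ∧ t ∈ ModelSec.par n m W i ∧
        L.germ hW (mem_chartPreimage hx hxW) t = a := by
  obtain ⟨W, hW, hxW, t, h0, rfl⟩ := L.exists_germ_eq hx a hx₀
  let P : ZMod 2 → ModelOper n m := fun j => ModelOper.ofGrass n
    (GradedAlgebra.proj (CliffordAlgebra.evenOdd (0 : QuadraticForm ℂ (Fin m → ℂ))) j)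
  have hP : ∀ j, ∀ t : ModelSec n m W, (P j).op W t ∈ ModelSec.par n m W j := by
    intro j t
    induction t using TensorProduct.induction_on with
    | zero => rw [map_zero]; exact zero_mem _
    | add s t hs ht => rw [map_add]; exact add_mem hs ht
    | tmul f ω => exact Submodule.subset_span ⟨f, _, proj_mem _ j ω, rfl⟩
  have hsum : ∑ j, (P j).op W t = t := by
    clear ha
    induction t using TensorProduct.induction_on with
    | zero => simp
    | add s t hs ht =>
      simp only [map_add, Finset.sum_add_distrib]
      exact congrArg₂ (· + ·) hs ht
    | tmul f ω =>
      refine (TensorProduct.tmul_sum f _ _).symm.trans ?_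
      congr 1
      exact sum_proj _ ω
  refine ⟨W, hW, hxW, (P i).op W t, h0, hP i t, ?_⟩
  -- The germs of the parity components of `t` are homogeneous and add up to `a`, so the germ of the
  -- `i`-th one is the component of parity `i` of `a`, which is `a` itself.
  rw [← proj_same (𝒪.par x) ha]
  conv_rhs => rw [← hsum, map_sum, map_sum]
  rw [Finset.sum_eq_single i]
  · exact (proj_same (𝒪.par x) (L.germ_par _ _ (hP i t))).symm
  · intro j _ hj
    exact proj_ne (𝒪.par x) (L.germ_par _ _ (hP j t)) hj
  · simp

theorem stalkOp_homDer {T : ModelOper n m} {i : ZMod 2} (hT : T.IsDer i) :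
    L.stalkOp T hx ∈ homDer (𝒪.par x) i := by
  refine ⟨fun j a ha => ?_, fun j a ha b => ?_⟩
  · obtain ⟨W, hW, hxW, t, -, ht, rfl⟩ := L.exists_germ_eq_par hx ha (Opens.mem_top _)
    rw [stalkOp_germ]
    exact L.germ_par _ _ (hT.par W j t ht)
  · obtain ⟨W, hW, hxW, s, -, hs, rfl⟩ := L.exists_germ_eq_par hx ha (Opens.mem_top _)
    obtain ⟨W', hW', hxW', t, h', rfl⟩ := L.exists_germ_eq hx b hxW
    rw [← L.germ_res hW h' (mem_chartPreimage hx hxW'), ← map_mul, stalkOp_germ, stalkOp_germ,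
      stalkOp_germ, hT.mul W' j _ (ModelSec.res_par h' hs), map_add, map_smul, map_mul, map_mul]

/-- The germs of the coordinates. -/
def crd (c : Fin n ⊕ Fin m) : 𝒪.stalk x :=
  L.germ (W := ⟨φ.target, φ.open_target⟩) Set.Subset.rfl
    (mem_chartPreimage hx (φ.map_source hx)) (ModelSec.crd _ c)

theorem germ_crd {W : Opens (Fin n → ℂ)} (hW : (W : Set (Fin n → ℂ)) ⊆ φ.target)
    (hx' : x ∈ chartPreimage φ W) (c : Fin n ⊕ Fin m) :
    L.germ hW hx' (ModelSec.crd W c) = L.crd hx c := by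
  have h : W ≤ ⟨φ.target, φ.open_target⟩ := hW
  rw [← ModelSec.crd_res h c]
  exact L.germ_res (W := ⟨φ.target, φ.open_target⟩) Set.Subset.rfl h hx' _

theorem crd_mem_par (c : Fin n ⊕ Fin m) : L.crd hx c ∈ 𝒪.par x (crdPar c) :=
  L.germ_par _ _ (ModelSec.crd_mem_par _ c)

/-- The partial derivatives on the stalks. -/
def der (c : Fin n ⊕ Fin m) : Module.End ℂ (𝒪.stalk x) := L.stalkOp (ModelOper.der c) hx

theorem der_mem_homDer (c : Fin n ⊕ Fin m) : L.der hx c ∈ homDer (𝒪.par x) (crdPar c) :=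
  L.stalkOp_homDer hx (ModelOper.der_isDer c)

theorem der_crd (c c' : Fin n ⊕ Fin m) : L.der hx c (L.crd hx c') = if c = c' then 1 else 0 := by
  rw [der, crd, stalkOp_germ, ModelOper.der_crd]
  split_ifs <;> simp

/-- The germs at `x` that are sums of germs `f ω`, where the holomorphic function `f` vanishes to
order `k` at `x`. -/
def vanFil (k : ℕ) : Submodule ℂ (𝒪.stalk x) :=
  Submodule.span ℂ {s | ∃ (W : Opens (Fin n → ℂ)) (hW : (W : Set (Fin n → ℂ)) ⊆ φ.target)
    (hx' : x ∈ chartPreimage φ W) (f : Holo W) (ω : Grass m),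
    (Holo.extend f =O[𝓝 (φ x)] fun z => ‖z - φ x‖ ^ k) ∧ L.germ hW hx' (f ⊗ₜ ω) = s}

theorem germ_mem_vanFil {k : ℕ} {W : Opens (Fin n → ℂ)} (hW : (W : Set (Fin n → ℂ)) ⊆ φ.target)
    (hx' : x ∈ chartPreimage φ W) {f : Holo W} (ω : Grass m)
    (hf : Holo.extend f =O[𝓝 (φ x)] fun z => ‖z - φ x‖ ^ k) :
    L.germ hW hx' (f ⊗ₜ ω) ∈ L.vanFil (x := x) k :=
  Submodule.subset_span ⟨W, hW, hx', f, ω, hf, rfl⟩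

include hx in
theorem vanFil_zero : L.vanFil (x := x) 0 = ⊤ := by
  rw [eq_top_iff]
  rintro a -
  induction a using L.stalk_induction hx with
  | zero => exact zero_mem _
  | add a b ha hb => exact add_mem ha hb
  | tmul W hW hxW f ω =>
    refine L.germ_mem_vanFil hW _ ω ?_
    simp only [pow_zero]
    exact ((Holo.differentiableAt f hxW).continuousAt.isBigO_one ℝ)

theorem vanFil_mul (i j : ℕ) :
    L.vanFil (x := x) i * L.vanFil (x := x) j ≤ L.vanFil (x := x) (i + j) := by
  rw [vanFil, vanFil, Submodule.span_mul_span, Submodule.span_le]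
  rintro _ ⟨_, ⟨W, hW, hx, f, ω, hf, rfl⟩, _, ⟨W', hW', hx', g, η, hg, rfl⟩, rfl⟩
  have hW2 : ((W ⊓ W' : Opens (Fin n → ℂ)) : Set (Fin n → ℂ)) ⊆ φ.target := fun _ h => hW h.1
  have hx2 : x ∈ chartPreimage φ (W ⊓ W') :=
    mem_chartPreimage (W := W ⊓ W') hx.1 ⟨hx.2, hx'.2⟩
  have e1 := L.germ_res hW (inf_le_left : W ⊓ W' ≤ W) hx2 (f ⊗ₜ ω)
  have e2 := L.germ_res hW' (inf_le_right : W ⊓ W' ≤ W') hx2 (g ⊗ₜ η)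
  change L.germ hW hx (f ⊗ₜ ω) * L.germ hW' hx' (g ⊗ₜ η) ∈ L.vanFil (i + j)
  have e3 := congrArg₂ (· * ·) e1 e2
  refine e3 ▸ ?_
  change L.germ hW2 hx2 _ * L.germ hW2 hx2 _ ∈ _
  rw [← map_mul, ModelSec.res_tmul, ModelSec.res_tmul, Algebra.TensorProduct.tmul_mul_tmul]
  refine L.germ_mem_vanFil hW2 hx2 _ ?_
  rw [Holo.extend_mul]
  refine (Asymptotics.IsBigO.mul ?_ ?_).congr_right fun z => (pow_add _ i j).symm
  · exact (Holo.extend_res_eventuallyEq (W' := W ⊓ W') _ f ⟨hx.2, hx'.2⟩).trans_isBigO hf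
  · exact (Holo.extend_res_eventuallyEq (W' := W ⊓ W') _ g ⟨hx.2, hx'.2⟩).trans_isBigO hg

/-- Two representatives of a germ agree on a smaller neighbourhood, and coefficients commute with
restriction. Thus the orders of vanishing of the coefficients depend on the germ alone. -/
theorem coef_eventuallyEq {W W' : Opens (Fin n → ℂ)} (hW : (W : Set (Fin n → ℂ)) ⊆ φ.target)
    (hW' : (W' : Set (Fin n → ℂ)) ⊆ φ.target) (hx : x ∈ chartPreimage φ W)
    (hx' : x ∈ chartPreimage φ W') {t : ModelSec n m W} {t' : ModelSec n m W'}
    (h : L.germ hW hx t = L.germ hW' hx' t') (I : Finset (Fin m)) :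
    Holo.extend (ModelSec.coef W I t) =ᶠ[𝓝 (φ x)] Holo.extend (ModelSec.coef W' I t') := by
  have hW2 : ((W ⊓ W' : Opens (Fin n → ℂ)) : Set (Fin n → ℂ)) ⊆ φ.target := fun _ h => hW h.1
  have hx2 : x ∈ chartPreimage φ (W ⊓ W') :=
    mem_chartPreimage (W := W ⊓ W') hx.1 ⟨hx.2, hx'.2⟩
  have h0 : L.germ hW2 hx2
      (ModelSec.res m inf_le_left t - ModelSec.res m inf_le_right t') = 0 := by
    refine (map_sub _ _ _).trans (sub_eq_zero.2 ?_)
    exact (L.germ_res hW inf_le_left _ t).trans (h.trans (L.germ_res hW' inf_le_right _ t').symm)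
  obtain ⟨V, hV, hxV, hz⟩ := L.exists_res_eq_zero hW2 _ h0
  have h1 : ModelSec.coef V I (ModelSec.res m (hV.trans inf_le_left) t) =
      ModelSec.coef V I (ModelSec.res m (hV.trans inf_le_right) t') := by
    rw [map_sub, sub_eq_zero, ModelSec.res_res, ModelSec.res_res] at hz
    rw [hz]
  rw [ModelSec.coef_res, ModelSec.coef_res] at h1
  have e1 := Holo.extend_res_eventuallyEq (hV.trans inf_le_left) (ModelSec.coef W I t) hxV
  have e2 := Holo.extend_res_eventuallyEq (hV.trans inf_le_right) (ModelSec.coef W' I t') hxV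
  rw [h1] at e1
  exact e1.symm.trans e2

/-- The span defining `vanFil` uses arbitrary decompositions `∑ f ω`. Passing to basis coefficients
makes the condition testable on one representative. -/
theorem exists_of_mem_vanFil {k : ℕ} {a : 𝒪.stalk x} (ha : a ∈ L.vanFil k) (hx : x ∈ φ.source) :
    ∃ (W : Opens (Fin n → ℂ)) (hW : (W : Set (Fin n → ℂ)) ⊆ φ.target)
      (hx' : x ∈ chartPreimage φ W) (t : ModelSec n m W), L.germ hW hx' t = a ∧
      ∀ I, Holo.extend (ModelSec.coef W I t) =O[𝓝 (φ x)] fun z => ‖z - φ x‖ ^ k := by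
  induction ha using Submodule.span_induction with
  | zero =>
    refine ⟨⟨φ.target, φ.open_target⟩, Set.Subset.rfl, mem_chartPreimage hx (φ.map_source hx), 0,
      map_zero _, fun I => ?_⟩
    have : Holo.extend (0 : Holo (⟨φ.target, φ.open_target⟩ : Opens (Fin n → ℂ))) = 0 := by
      have := Holo.extend_smul 0 (0 : Holo (⟨φ.target, φ.open_target⟩ : Opens (Fin n → ℂ)))
      rwa [zero_smul, zero_smul] at this
    rw [map_zero, this]
    exact Asymptotics.isBigO_zero _ _
  | add a b _ _ ha hb =>
    obtain ⟨W, hW, hxW, s, rfl, hs⟩ := ha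
    obtain ⟨W', hW', hxW', t, rfl, ht⟩ := hb
    have hW2 : ((W ⊓ W' : Opens (Fin n → ℂ)) : Set (Fin n → ℂ)) ⊆ φ.target := fun _ h => hW h.1
    have hx2 : x ∈ chartPreimage φ (W ⊓ W') :=
      mem_chartPreimage (W := W ⊓ W') hx ⟨hxW.2, hxW'.2⟩
    refine ⟨W ⊓ W', hW2, hx2, ModelSec.res m inf_le_left s + ModelSec.res m inf_le_right t, ?_,
      fun I => ?_⟩
    · rw [map_add]
      exact congrArg₂ (· + ·) (L.germ_res hW inf_le_left hx2 s) (L.germ_res hW' inf_le_right hx2 t)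
    · rw [map_add, Holo.extend_add, ModelSec.coef_res, ModelSec.coef_res]
      refine Asymptotics.IsBigO.add ?_ ?_
      · exact (Holo.extend_res_eventuallyEq (W' := W ⊓ W') _ _ ⟨hxW.2, hxW'.2⟩).trans_isBigO (hs I)
      · exact (Holo.extend_res_eventuallyEq (W' := W ⊓ W') _ _ ⟨hxW.2, hxW'.2⟩).trans_isBigO (ht I)
  | smul c a _ ha =>
    obtain ⟨W, hW, hxW, s, rfl, hs⟩ := ha
    refine ⟨W, hW, hxW, c • s, map_smul _ _ _, fun I => ?_⟩
    rw [map_smul, Holo.extend_smul]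
    exact (hs I).const_smul_left c
  | mem a ha =>
    obtain ⟨W, hW, hxW, f, ω, hf, rfl⟩ := ha
    refine ⟨W, hW, hxW, f ⊗ₜ ω, rfl, fun I => ?_⟩
    rw [ModelSec.coef_tmul, Holo.extend_smul]
    exact hf.const_smul_left _

include hx in
/-- A germ vanishing to infinite order is zero. -/
theorem eq_zero_of_mem_vanFil {a : 𝒪.stalk x} (ha : ∀ k, a ∈ L.vanFil k) : a = 0 := by
  obtain ⟨W, hW, hxW, t, -, rfl⟩ := L.exists_germ_eq hx a (Opens.mem_top _)
  have h1 : ∀ I, ∀ᶠ z in 𝓝 (φ x), Holo.extend (ModelSec.coef W I t) z = 0 := by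
    intro I
    -- A ball that lies in `W` and carries a bound for the coefficient. There, vanishing to infinite
    -- order at the centre forces vanishing on the whole ball.
    obtain ⟨R, hR, B, -, -, hB⟩ := exists_ball_bound W.isOpen
      (Holo.differentiableOn (ModelSec.coef W I t)) hxW
    obtain ⟨R', hR', hRW⟩ := Metric.isOpen_iff.1 W.isOpen _ hxW
    have hm : Metric.ball (φ x) (min R R') ⊆ W := (Metric.ball_subset_ball (min_le_right _ _)).trans hRW
    filter_upwards [Metric.ball_mem_nhds (φ x) (lt_min hR hR')] with z hz
    refine eq_zero_of_isBigO ((Holo.differentiableOn _).mono hm)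
      (fun w hw => hB w (Metric.ball_subset_ball (min_le_left _ _) hw)) (fun k => ?_) z hz
    obtain ⟨W', hW', hx', t', ht', ho⟩ := L.exists_of_mem_vanFil (ha k) hx
    exact (L.coef_eventuallyEq hW' hW hx' _ ht' I).symm.trans_isBigO (ho I)
  -- There are finitely many coefficients, so all of them vanish on one common neighbourhood.
  obtain ⟨V, hV, hVo, hxV⟩ := eventually_nhds_iff.1 (eventually_all.2 h1)
  have hVW : (⟨V, hVo⟩ ⊓ W : Opens (Fin n → ℂ)) ≤ W := inf_le_right
  have hx2 : x ∈ chartPreimage φ (⟨V, hVo⟩ ⊓ W) :=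
    mem_chartPreimage (W := ⟨V, hVo⟩ ⊓ W) hx ⟨hxV, hxW⟩
  have h2 : ModelSec.res m hVW t = 0 := by
    rw [← ModelSec.sum_coef (ModelSec.res m hVW t)]
    refine Finset.sum_eq_zero fun I _ => ?_
    have : ModelSec.coef _ I (ModelSec.res m hVW t) = 0 := by
      refine Subtype.ext (funext fun z => ?_)
      rw [ModelSec.coef_res]
      have := hV z z.2.1 I
      rwa [Holo.extend_of_mem _ z.2.2] at this
    rw [this, TensorProduct.zero_tmul]
  have h3 := L.germ_res hW hVW hx2 t
  rw [h2, map_zero] at h3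
  exact h3.symm

end LocalModelIso

end SuperGeom

end

noncomputable section
namespace SuperGeom

/-! ### Superderivations in coordinates -/

open Filter Topology
open scoped TensorProduct

/-! ### A filtration of an algebra defined by its characters, independent of charts -/

section CharIdeal

variable (A : Type*) [Ring A] [Algebra ℂ A]

/-- The intersection of the kernels of the characters of an algebra. -/
def charIdeal : Submodule ℂ A := ⨅ χ : A →ₐ[ℂ] ℂ, LinearMap.ker χ.toLinearMap

/-- The right ideals generated by the powers of the intersection of the kernels of the
characters. -/
def charPow (k : ℕ) : Submodule ℂ A := charIdeal A ^ k * ⊤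

variable {A}

theorem mem_charIdeal {a : A} : a ∈ charIdeal A ↔ ∀ χ : A →ₐ[ℂ] ℂ, χ a = 0 := by
  simp [charIdeal]

theorem charPow_zero : charPow A 0 = ⊤ := by rw [charPow, pow_zero, one_mul]

theorem mul_mem_charPow_succ {k : ℕ} {a b : A} (ha : a ∈ charIdeal A) (hb : b ∈ charPow A k) :
    a * b ∈ charPow A (k + 1) := by
  rw [charPow, pow_succ', mul_assoc]
  exact Submodule.mul_mem_mul ha hb

/-- The two sides of a product play different roles: factors of the ideal enter on the left and
raise the power (`mul_mem_charPow_succ`), while arbitrary factors, such as derivatives of a germ,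
may stand on the right. -/
theorem mul_mem_charPow {k : ℕ} {b : A} (hb : b ∈ charPow A k) (c : A) : b * c ∈ charPow A k := by
  have h : charPow A k * ⊤ ≤ charPow A k := by
    rw [charPow, mul_assoc]
    exact mul_le_mul_right le_top _
  exact h (Submodule.mul_mem_mul hb trivial)

end CharIdeal

/-! ### Hadamard's lemma for sections -/

section HadamardHolo

variable {n : ℕ}

/-- An open ball. -/
def ballOpens (a : Fin n → ℂ) (R : ℝ) : Opens (Fin n → ℂ) := ⟨Metric.ball a R, Metric.isOpen_ball⟩

theorem hadamard_holo {a : Fin n → ℂ} {R B : ℝ} (hR : 0 < R) {W : Opens (Fin n → ℂ)}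
    (hW : ballOpens a R ≤ W) (f : Holo W) (hB : ∀ z ∈ ballOpens a R, ‖Holo.extend f z‖ ≤ B) :
    ∃ (h : ballOpens a (R / 4) ≤ W) (g : Fin n → Holo (ballOpens a (R / 4))),
      (∀ i, ∀ z ∈ ballOpens a (R / 4), ‖Holo.extend (g i) z‖ ≤ 4 * B / R) ∧
      Holo.res h f = algebraMap ℂ _ (Holo.extend f a) +
        ∑ i, (Holo.coord i _ - algebraMap ℂ _ (a i)) * g i := by
  have hf : DifferentiableOn ℂ (Holo.extend f) (Metric.ball a R) :=
    (Holo.differentiableOn f).mono hW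
  have h4 : ballOpens a (R / 4) ≤ ballOpens a R := Metric.ball_subset_ball (by linarith)
  refine ⟨h4.trans hW, fun i => Holo.of _ (differentiableOn_hadamardQuot hf hB i),
    fun i z hz => ?_, ?_⟩
  · exact (congrArg norm (Holo.extend_of _ (differentiableOn_hadamardQuot hf hB i) hz)).trans_le
      (norm_hadamardQuot_le hf hB (Metric.ball_subset_ball (by linarith) hz) i)
  · refine Subtype.ext (funext fun z => ?_)
    have h1 := hadamard hf (h4 z.2)
    rw [Holo.extend_of_mem _ (hW (h4 z.2))] at h1
    refine h1.trans ?_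
    simp only [Subalgebra.coe_add, Subalgebra.coe_algebraMap, Pi.add_apply]
    congr 1
    rw [← Subalgebra.coe_val, map_sum, Finset.sum_apply]
    rfl

end HadamardHolo

/-! ### Superderivations are determined by the coordinates -/

namespace LocalModelIso

variable {M : Type u} [TopologicalSpace M] {𝒪 : SuperSheaf.{u, v} M} {n m : ℕ}
  {φ : OpenPartialHomeomorph M (Fin n → ℂ)} (L : LocalModelIso 𝒪 n m φ) {x : M} (hx : x ∈ φ.source)

/-- The germ of a coordinate function vanishing at `x`. -/
def cent (i : Fin n) : 𝒪.stalk x := L.crd hx (Sum.inl i) - algebraMap ℂ _ (φ x i)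

theorem germ_cent {W : Opens (Fin n → ℂ)} (hW : (W : Set (Fin n → ℂ)) ⊆ φ.target)
    (hx' : x ∈ chartPreimage φ W) (i : Fin n) :
    L.germ hW hx' ((Holo.coord i W - algebraMap ℂ _ (φ x i)) ⊗ₜ 1) = L.cent hx i := by
  rw [TensorProduct.sub_tmul, map_sub, cent, ← L.germ_crd hx hW hx']
  congr 1
  exact AlgHom.commutes (L.germ hW hx') _

theorem germ_hadamard {R B : ℝ} (hR : 0 < R) {W : Opens (Fin n → ℂ)}
    (hW : (W : Set (Fin n → ℂ)) ⊆ φ.target) (hx' : x ∈ chartPreimage φ W)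
    (hWR : ballOpens (φ x) R ≤ W) (f : Holo W)
    (hB : ∀ z ∈ ballOpens (φ x) R, ‖Holo.extend f z‖ ≤ B) :
    ∃ (h4 : ((ballOpens (φ x) (R / 4) : Opens (Fin n → ℂ)) : Set (Fin n → ℂ)) ⊆ φ.target)
      (hx4 : x ∈ chartPreimage φ (ballOpens (φ x) (R / 4)))
      (g : Fin n → Holo (ballOpens (φ x) (R / 4))),
      (∀ i, ∀ z ∈ ballOpens (φ x) (R / 4), ‖Holo.extend (g i) z‖ ≤ 4 * B / R) ∧
      ∀ ω, L.germ hW hx' (f ⊗ₜ ω) = Holo.extend f (φ x) • L.grassGerm hx ω +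
        ∑ i, L.cent hx i * L.germ h4 hx4 (g i ⊗ₜ ω) := by
  obtain ⟨h, g, hg, hf⟩ := hadamard_holo hR hWR f hB
  have h4 : ((ballOpens (φ x) (R / 4) : Opens (Fin n → ℂ)) : Set (Fin n → ℂ)) ⊆ φ.target :=
    Set.Subset.trans h hW
  have hx4 : x ∈ chartPreimage φ (ballOpens (φ x) (R / 4)) :=
    mem_chartPreimage hx'.1 (Metric.mem_ball_self (by linarith))
  refine ⟨h4, hx4, g, hg, fun ω => ?_⟩
  rw [← L.germ_res hW h hx4, ModelSec.res_tmul, hf, TensorProduct.add_tmul, map_add,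
    TensorProduct.sum_tmul, map_sum]
  congr 1
  · rw [L.grassGerm_eq hx h4 hx4, ← map_smul, Algebra.algebraMap_eq_smul_one,
      TensorProduct.smul_tmul']
  · refine Finset.sum_congr rfl fun i _ => ?_
    rw [← L.germ_cent hx h4 hx4 i, ← map_mul, Algebra.TensorProduct.tmul_mul_tmul, one_mul]

theorem cent_mem_vanFil (i : Fin n) : L.cent hx i ∈ L.vanFil 1 := by
  have hx' := mem_chartPreimage (W := ⟨φ.target, φ.open_target⟩) hx (φ.map_source hx)
  rw [← L.germ_cent hx Set.Subset.rfl hx' i]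
  refine L.germ_mem_vanFil _ _ _ ?_
  refine Asymptotics.IsBigO.of_bound 1 ?_
  filter_upwards [φ.open_target.mem_nhds hx'.2] with z hz
  rw [Holo.extend_of_mem _ hz, one_mul, pow_one, norm_norm]
  exact norm_le_pi_norm (z - φ x) i

/-- The Grassmann algebra is generated by the odd coordinates, and a derivation that kills
generators kills the algebra they generate. -/
theorem homDer_grassGerm {j : ZMod 2} {δ : Module.End ℂ (𝒪.stalk x)}
    (hδ : δ ∈ homDer (𝒪.par x) j) (h : ∀ c, δ (L.crd hx c) = 0) (ω : Grass m) :
    δ (L.grassGerm hx ω) = 0 := by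
  have hone : δ 1 = 0 := by
    have := hδ.2 0 1 (SetLike.GradedOne.one_mem) 1
    rw [mul_one, mul_one, one_mul] at this
    simpa [sgn] using this
  have hι : ∀ v, δ (L.grassGerm hx (ExteriorAlgebra.ι ℂ v)) = 0 := by
    intro v
    have : (δ ∘ₗ (L.grassGerm hx).toLinearMap ∘ₗ ExteriorAlgebra.ι ℂ) = 0 := by
      refine (Pi.basisFun ℂ (Fin m)).ext fun k => ?_
      rw [Pi.basisFun_apply]
      exact h (Sum.inr k)
    exact LinearMap.congr_fun this v
  induction ω using CliffordAlgebra.left_induction with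
  | algebraMap r =>
    rw [AlgHom.commutes, Algebra.algebraMap_eq_smul_one, map_smul, hone, smul_zero]
  | add a b ha hb => rw [map_add, map_add, ha, hb, add_zero]
  | ι_mul a v ha =>
    have hp : L.grassGerm hx (ExteriorAlgebra.ι ℂ v) ∈ 𝒪.par x 1 :=
      L.germ_tmul_par _ _ _ (CliffordAlgebra.ι_mem_evenOdd_one _ v)
    rw [map_mul]
    refine (hδ.2 1 _ hp _).trans ?_
    rw [ha, mul_zero, smul_zero, add_zero]
    exact (congrArg (· * _) (hι v)).trans (zero_mul _)

/-- Write `f = f(x) + ∑ (zᵢ - xᵢ) gᵢ` by Hadamard's lemma. As `δ` kills constants and coordinates,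
`δ f = ∑ (zᵢ - xᵢ) δ gᵢ`, and every application of this identity gains one order of vanishing. This
replaces a continuity assumption on `δ`. -/
theorem homDer_germ_mem_vanFil {j : ZMod 2} {δ : Module.End ℂ (𝒪.stalk x)}
    (hδ : δ ∈ homDer (𝒪.par x) j) (h : ∀ c, δ (L.crd hx c) = 0) (k : ℕ) :
    ∀ {W : Opens (Fin n → ℂ)} (hW : (W : Set (Fin n → ℂ)) ⊆ φ.target)
      (hx' : x ∈ chartPreimage φ W) (f : Holo W), δ (L.germ hW hx' (f ⊗ₜ 1)) ∈ L.vanFil k := by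
  have hone : δ 1 = 0 := by
    have := L.homDer_grassGerm hx hδ h 1
    rwa [map_one] at this
  induction k with
  | zero => intro W hW hx' f; rw [L.vanFil_zero hx]; trivial
  | succ k ih =>
    intro W hW hx' f
    obtain ⟨R, hR, B, -, hRW, hB⟩ := exists_ball_bound W.isOpen (Holo.differentiableOn f) hx'.2
    obtain ⟨h4, hx4, g, -, hg⟩ := L.germ_hadamard hx hR hW hx' hRW f hB
    rw [hg, map_add, map_smul, map_one, hone, smul_zero, zero_add, map_sum]
    refine sum_mem fun i _ => ?_
    have hp : L.cent hx i ∈ 𝒪.par x 0 :=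
      sub_mem (L.crd_mem_par hx (Sum.inl i)) (SetLike.algebraMap_mem_graded _ _)
    have hc : δ (L.cent hx i) = 0 := by
      rw [cent, map_sub, h, Algebra.algebraMap_eq_smul_one, map_smul, hone, smul_zero, sub_zero]
    rw [hδ.2 0 _ hp, hc, zero_mul, zero_add]
    refine Submodule.smul_mem _ _ ?_
    have := L.vanFil_mul (x := x) 1 k (Submodule.mul_mem_mul (L.cent_mem_vanFil hx i) (ih h4 hx4 (g i)))
    rwa [add_comm] at this

theorem homDer_eq_zero {j : ZMod 2} {δ : Module.End ℂ (𝒪.stalk x)}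
    (hδ : δ ∈ homDer (𝒪.par x) j) (h : ∀ c, δ (L.crd hx c) = 0) : δ = 0 := by
  ext a
  induction a using L.stalk_induction hx with
  | zero => rw [map_zero, map_zero]
  | add a b ha hb => rw [map_add, map_add, ha, hb]
  | tmul W hW hxW f ω =>
    have hp : L.germ hW (mem_chartPreimage hx hxW) (f ⊗ₜ 1) ∈ 𝒪.par x 0 :=
      L.germ_tmul_par _ _ _ (Submodule.one_le.1 (CliffordAlgebra.one_le_evenOdd_zero _))
    rw [L.germ_tmul_eq hx, hδ.2 0 _ hp, L.homDer_grassGerm hx hδ h, mul_zero, smul_zero, add_zero,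
      L.eq_zero_of_mem_vanFil hx fun k => L.homDer_germ_mem_vanFil hx hδ h k hW _ f, zero_mul]
    rfl

theorem superDer_eq_zero {δ : Module.End ℂ (𝒪.stalk x)} (hδ : δ ∈ superDer (𝒪.par x))
    (h : ∀ c, δ (L.crd hx c) = 0) : δ = 0 := by
  rw [← sum_endPart (𝒪.par x) δ]
  refine Finset.sum_eq_zero fun i _ => L.homDer_eq_zero hx (endPart_mem (𝒪.par x) i hδ) fun c => ?_
  rw [endPart_apply_of_mem i δ (L.crd_mem_par hx c), h, map_zero]

/-- A superderivation is determined by its values on the coordinates. -/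
theorem superDer_eq_sum
    (hcomm : ∀ i j : ZMod 2, ∀ a ∈ 𝒪.par x i, ∀ b ∈ 𝒪.par x j, a * b = sgn i j • (b * a))
    {δ : Module.End ℂ (𝒪.stalk x)} (hδ : δ ∈ superDer (𝒪.par x)) :
    δ = ∑ c, LinearMap.mulLeft ℂ (δ (L.crd hx c)) ∘ₗ L.der hx c := by
  -- Supercommutativity makes the right-hand side a superderivation, and the partial derivatives are
  -- dual to the coordinates, so the difference kills every coordinate.
  refine sub_eq_zero.1 (L.superDer_eq_zero hx (sub_mem hδ (sum_mem fun c _ =>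
    mulLeft_mem_superDer hcomm _ (homDer_le _ _ (L.der_mem_homDer hx c)))) fun c => ?_)
  rw [LinearMap.sub_apply, LinearMap.sum_apply, Finset.sum_eq_single c]
  · rw [LinearMap.comp_apply, der_crd, if_pos rfl, LinearMap.mulLeft_apply, mul_one, sub_self]
  · intro c' _ hc'
    rw [LinearMap.comp_apply, der_crd, if_neg hc', map_zero]
  · simp

end LocalModelIso

end SuperGeom

end

noncomputable section
namespace SuperGeom

/-! ### Functionals vanishing on powers of the character ideal -/

open Filter Topology
open scoped TensorProduct

namespace LocalModelIso

variable {M : Type u} [TopologicalSpace M] {𝒪 : SuperSheaf.{u, v} M} {n m : ℕ}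
  {φ : OpenPartialHomeomorph M (Fin n → ℂ)} (L : LocalModelIso 𝒪 n m φ) {x : M} (hx : x ∈ φ.source)

/-- Suppose a character takes the value `c` on the `i`-th coordinate, with `c` different from the
value of the coordinate at `x`. Then `zᵢ - c` is invertible near `x`, hence in the stalk, while the
character sends it to zero. -/
theorem cent_mem_charIdeal (i : Fin n) : L.cent hx i ∈ charIdeal (𝒪.stalk x) := by
  refine mem_charIdeal.2 fun χ => ?_
  rw [cent, map_sub, AlgHom.commutes, Algebra.algebraMap_self_apply]
  by_contra hne
  set c := χ (L.crd hx (Sum.inl i)) with hc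
  have hcx : φ x i ≠ c := fun h => hne (by rw [h, sub_self])
  let W : Opens (Fin n → ℂ) := ⟨φ.target ∩ {z | z i ≠ c},
    φ.open_target.inter (isOpen_ne.preimage (continuous_apply i))⟩
  have hW : (W : Set (Fin n → ℂ)) ⊆ φ.target := fun z hz => hz.1
  have hx' : x ∈ chartPreimage φ W := mem_chartPreimage hx ⟨φ.map_source hx, hcx⟩
  let g : Holo W := Holo.of (fun z => (z i - c)⁻¹) (DifferentiableOn.inv (by fun_prop)
    fun z hz => sub_ne_zero.2 hz.2)
  have h1 : (Holo.coord i W - algebraMap ℂ _ c) * g = 1 :=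
    Subtype.ext (funext fun z => mul_inv_cancel₀ (sub_ne_zero.2 z.2.2))
  have h2 : (L.crd hx (Sum.inl i) - algebraMap ℂ _ c) * L.germ hW hx' (g ⊗ₜ 1) = 1 := by
    have h3 : L.germ hW hx' ((Holo.coord i W - algebraMap ℂ _ c) ⊗ₜ 1) =
        L.crd hx (Sum.inl i) - algebraMap ℂ _ c := by
      rw [TensorProduct.sub_tmul, map_sub, ← L.germ_crd hx hW hx']
      congr 1
      exact AlgHom.commutes (L.germ hW hx') _
    rw [← h3, ← map_mul, Algebra.TensorProduct.tmul_mul_tmul, h1, one_mul]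
    exact map_one _
  have h4 := congrArg χ h2
  rw [map_mul, map_sub, AlgHom.commutes, Algebra.algebraMap_self_apply, ← hc, sub_self, zero_mul,
    map_one] at h4
  exact zero_ne_one h4

/-- Evaluation of holomorphic functions. -/
def _root_.SuperGeom.Holo.eval {W : Opens (Fin n → ℂ)} {z : Fin n → ℂ} (hz : z ∈ W) :
    Holo W →ₐ[ℂ] ℂ := (Pi.evalAlgHom ℂ (fun _ : W => ℂ) ⟨z, hz⟩).comp (Holo W).val

/-- Evaluation of sections of the model superspace. -/
def _root_.SuperGeom.ModelSec.eval (m : ℕ) {W : Opens (Fin n → ℂ)} {z : Fin n → ℂ} (hz : z ∈ W) :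
    ModelSec n m W →ₐ[ℂ] ℂ :=
  Algebra.TensorProduct.productMap (Holo.eval hz) ExteriorAlgebra.algebraMapInv

theorem _root_.SuperGeom.ModelSec.eval_res {W W' : Opens (Fin n → ℂ)} (h : W' ≤ W)
    {z : Fin n → ℂ} (hz : z ∈ W') (t : ModelSec n m W) :
    ModelSec.eval m hz (ModelSec.res m h t) = ModelSec.eval m (h hz) t := by
  induction t using TensorProduct.induction_on with
  | zero => simp only [map_zero]
  | add s t hs ht => simp only [map_add, hs, ht]
  | tmul f ω => rfl

/-- The value of a germ at the point. -/
def value : 𝒪.stalk x →ₗ[ℂ] ℂ :=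
  L.lift hx (fun _ _ hxW => (ModelSec.eval m hxW).toLinearMap) fun _ _ _ _ h hxW' t =>
    ModelSec.eval_res h hxW' t

theorem value_germ {W : Opens (Fin n → ℂ)} (hW : (W : Set (Fin n → ℂ)) ⊆ φ.target)
    (hx' : x ∈ chartPreimage φ W) (t : ModelSec n m W) :
    L.value hx (L.germ hW hx' t) = ModelSec.eval m hx'.2 t := L.lift_germ hx _ _ hW hx' t

/-- The value of a germ at the point, as a character. -/
def valueHom : 𝒪.stalk x →ₐ[ℂ] ℂ :=
  AlgHom.ofLinearMap (L.value hx)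
    (by
      have hx' := mem_chartPreimage (W := ⟨φ.target, φ.open_target⟩) hx (φ.map_source hx)
      rw [← map_one (L.germ Set.Subset.rfl hx'), value_germ, map_one])
    (fun a b => by
      obtain ⟨W, hW, hxW, s, t, -, rfl, rfl⟩ := L.exists_germ_eq₂ hx a b (Opens.mem_top _)
      rw [← map_mul, value_germ, value_germ, value_germ, map_mul])

theorem grassGerm_sub_mem_oddIdeal (ω : Grass m) :
    L.grassGerm hx ω - algebraMap ℂ _ (ExteriorAlgebra.algebraMapInv ω) ∈ oddIdeal (𝒪.par x) := by
  induction ω using CliffordAlgebra.left_induction with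
  | algebraMap r =>
    rw [AlgHom.commutes, AlgHom.commutes, Algebra.algebraMap_self_apply, sub_self]
    exact zero_mem _
  | add a b ha hb =>
    rw [map_add, map_add, map_add, add_sub_add_comm]
    exact add_mem ha hb
  | ι_mul a v ha =>
    have h0 : ExteriorAlgebra.algebraMapInv (CliffordAlgebra.ι (0 : QuadraticForm ℂ (Fin m → ℂ)) v * a) = 0 := by
      rw [map_mul]
      have : ExteriorAlgebra.algebraMapInv (CliffordAlgebra.ι (0 : QuadraticForm ℂ (Fin m → ℂ)) v) = 0 := by
        exact ExteriorAlgebra.lift_ι_apply ℂ _ _ _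
      rw [this, zero_mul]
    rw [h0, map_zero, sub_zero, map_mul]
    refine Submodule.subset_span ⟨1, L.grassGerm hx (ExteriorAlgebra.ι ℂ v), ?_, _, by rw [one_mul]⟩
    exact L.germ_tmul_par _ _ _ (CliffordAlgebra.ι_mem_evenOdd_one _ v)

/-- For `a = f ω` the difference is `(f - f(x)) ω + f(x) (ω - ω₀)`, where `ω₀` is the constant term
of `ω`. The first summand vanishes to order one and the second lies in the odd ideal. -/
theorem sub_value_mem (a : 𝒪.stalk x) :
    a - algebraMap ℂ _ (L.value hx a) ∈ L.vanFil 1 ⊔ oddIdeal (𝒪.par x) := by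
  induction a using L.stalk_induction hx with
  | zero => rw [map_zero, map_zero, sub_zero]; exact zero_mem _
  | add a b ha hb =>
    rw [map_add, map_add, add_sub_add_comm]
    exact add_mem ha hb
  | tmul W hW hxW f ω =>
    have h1 : L.germ hW (mem_chartPreimage hx hxW) ((f - algebraMap ℂ _ (Holo.eval hxW f)) ⊗ₜ ω) ∈
        L.vanFil (x := x) 1 := by
      refine L.germ_mem_vanFil _ _ _ ?_
      simp only [pow_one]
      refine (Holo.differentiableAt f hxW).isBigO_sub.congr' ?_ (EventuallyEq.refl _ _) |>.norm_right
      filter_upwards [W.isOpen.mem_nhds hxW] with z hz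
      rw [Holo.extend_of_mem _ hz, Holo.extend_of_mem _ hz, Holo.extend_of_mem _ hxW]
      rfl
    have h2 : L.germ hW (mem_chartPreimage hx hxW) (f ⊗ₜ ω) -
        algebraMap ℂ _ (L.value hx (L.germ hW (mem_chartPreimage hx hxW) (f ⊗ₜ ω))) =
        L.germ hW (mem_chartPreimage hx hxW) ((f - algebraMap ℂ _ (Holo.eval hxW f)) ⊗ₜ ω) +
        Holo.eval hxW f • (L.grassGerm hx ω -
          algebraMap ℂ _ (ExteriorAlgebra.algebraMapInv ω)) := by
      have h3 : ModelSec.eval m hxW (f ⊗ₜ ω) =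
          Holo.eval hxW f * ExteriorAlgebra.algebraMapInv ω := rfl
      rw [value_germ, h3, TensorProduct.sub_tmul, map_sub,
        Algebra.algebraMap_eq_smul_one (A := Holo W), ← TensorProduct.smul_tmul', map_smul, ← L.grassGerm_eq hx hW, smul_sub,
        Algebra.algebraMap_eq_smul_one, Algebra.algebraMap_eq_smul_one, smul_smul]
      abel
    rw [h2]
    exact add_mem (Submodule.mem_sup_left h1) (Submodule.mem_sup_right
      (Submodule.smul_mem _ _ (L.grassGerm_sub_mem_oddIdeal hx ω)))

include hx in
theorem charIdeal_le : charIdeal (𝒪.stalk x) ≤ L.vanFil 1 ⊔ oddIdeal (𝒪.par x) := by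
  intro a ha
  have h1 : L.value hx a = 0 := mem_charIdeal.1 ha (L.valueHom hx)
  have h2 := L.sub_value_mem hx a
  rwa [h1, map_zero, sub_zero] at h2

-- The germs vanishing to order one form a two-sided ideal, which absorbs every mixed term.
include hx in
theorem vanFil_one_sup_pow_le (j : ℕ) : (L.vanFil (x := x) 1 ⊔ oddIdeal (𝒪.par x)) ^ j ≤
    L.vanFil 1 ⊔ oddIdeal (𝒪.par x) ^ j := by
  have hl : ⊤ * L.vanFil (x := x) 1 ≤ L.vanFil (x := x) 1 := by
    have := L.vanFil_mul (x := x) 0 1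
    rwa [L.vanFil_zero hx, zero_add] at this
  have hr : L.vanFil (x := x) 1 * ⊤ ≤ L.vanFil (x := x) 1 := by
    have := L.vanFil_mul (x := x) 1 0
    rwa [L.vanFil_zero hx, add_zero] at this
  induction j with
  | zero => rw [pow_zero, pow_zero]; exact le_sup_right
  | succ j ih =>
    rw [pow_succ, pow_succ]
    refine (mul_le_mul_left ih _).trans ?_
    rw [Submodule.sup_mul, Submodule.mul_sup, Submodule.mul_sup]
    refine sup_le (sup_le ?_ ?_) (sup_le ?_ ?_)
    · exact ((mul_le_mul_right le_top _).trans hr).trans le_sup_left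
    · exact ((mul_le_mul_right le_top _).trans hr).trans le_sup_left
    · exact ((mul_le_mul_left le_top _).trans hl).trans le_sup_left
    · exact le_sup_right

include hx in
theorem vanFil_one_pow_le (k : ℕ) : L.vanFil (x := x) 1 ^ k ≤ L.vanFil (x := x) k := by
  induction k with
  | zero => rw [L.vanFil_zero hx]; exact le_top
  | succ k ih =>
    rw [pow_succ]
    exact (mul_le_mul_left ih _).trans (L.vanFil_mul k 1)

-- The ideal defined by the characters lies in the sum of the germs vanishing at the point and the
-- odd ideal, since evaluation at the point is a character. The odd ideal has zero `(m + 1)`-st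
-- power, so `m + 1` factors yield one order of vanishing.
include hx in
theorem charPow_le_vanFil (k : ℕ) : charPow (𝒪.stalk x) ((m + 1) * k) ≤ L.vanFil k := by
  have h0 : oddIdeal (𝒪.par x) ^ (m + 1) = ⊥ := by
    rw [← oddPow_natCast_succ]
    exact (L.splitting hx).oddPow_eq_bot
  have h1 : charIdeal (𝒪.stalk x) ^ (m + 1) ≤ L.vanFil 1 := by
    refine (pow_le_pow_left' (L.charIdeal_le hx) _).trans
      ((L.vanFil_one_sup_pow_le hx (m + 1)).trans ?_)
    rw [h0, sup_bot_eq]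
  rw [charPow, pow_mul]
  refine (mul_le_mul_left ((pow_le_pow_left' h1 k).trans (L.vanFil_one_pow_le hx k)) _).trans ?_
  have := L.vanFil_mul (x := x) k 0
  rwa [L.vanFil_zero hx, add_zero] at this

include L hx in
/-- A germ is determined by its values under the linear functionals vanishing on the powers of
`charIdeal`. -/
theorem eq_zero_of_functional_eq_zero {a : 𝒪.stalk x}
    (h : ∀ (k : ℕ) (ℓ : 𝒪.stalk x →ₗ[ℂ] ℂ), (∀ b ∈ charPow (𝒪.stalk x) k, ℓ b = 0) → ℓ a = 0) :
    a = 0 := by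
  refine L.eq_zero_of_mem_vanFil hx fun k => L.charPow_le_vanFil hx k ?_
  by_contra hne
  -- Separation of a vector from a subspace by pure linear algebra; no topology on the stalk is
  -- involved.
  obtain ⟨ℓ, hℓ, hle⟩ := Submodule.exists_le_ker_of_notMem hne
  exact hℓ (h _ ℓ fun b hb => hle hb)

include hx in
/-- Continuity of the linear functionals vanishing on the powers of `charIdeal`. -/
theorem exists_functional_bound_tmul (k : ℕ) (ω : Grass m) :
    ∀ (ℓ : 𝒪.stalk x →ₗ[ℂ] ℂ), (∀ b ∈ charPow (𝒪.stalk x) k, ℓ b = 0) → ∀ R > 0,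
    ∃ C, 0 ≤ C ∧ ∀ (B : ℝ) (W : Opens (Fin n → ℂ)) (hW : (W : Set (Fin n → ℂ)) ⊆ φ.target)
      (hx' : x ∈ chartPreimage φ W) (_ : ballOpens (φ x) R ≤ W) (f : Holo W),
      (∀ z ∈ ballOpens (φ x) R, ‖Holo.extend f z‖ ≤ B) → ‖ℓ (L.germ hW hx' (f ⊗ₜ ω))‖ ≤ C * B := by
  induction k with
  | zero =>
    intro ℓ hℓ R hR
    refine ⟨0, le_rfl, fun B W hW hx' _ f hB => ?_⟩
    rw [hℓ _ (by rw [charPow_zero]; trivial), norm_zero, zero_mul]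
  | succ k ih =>
    intro ℓ hℓ R hR
    -- Centred coordinates lie in the ideal defined by the characters, so `b ↦ ℓ ((zᵢ - xᵢ) b)`
    -- vanishes on one power less, and the induction hypothesis applies to the Hadamard quotients.
    have h1 : ∀ i, ∀ b ∈ charPow (𝒪.stalk x) k, (ℓ ∘ₗ LinearMap.mulLeft ℂ (L.cent hx i)) b = 0 :=
      fun i b hb => hℓ _ (mul_mem_charPow_succ (L.cent_mem_charIdeal hx i) hb)
    choose C hC0 hC using fun i => ih _ (h1 i) (R / 4) (by positivity)
    -- The first term comes from the value of `f` at the point. The others come from the quotients,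
    -- which are bounded by `4 * B / R` on the ball of radius `R / 4`.
    refine ⟨‖ℓ (L.grassGerm hx ω)‖ + ∑ i, C i * (4 / R),
      add_nonneg (norm_nonneg _) (Finset.sum_nonneg fun i _ => by have := hC0 i; positivity),
      fun B W hW hx' hWR f hB => ?_⟩
    obtain ⟨h4, hx4, g, hg, hf⟩ := L.germ_hadamard hx hR hW hx' hWR f hB
    rw [hf, map_add, map_smul, map_sum, add_mul, Finset.sum_mul]
    refine (norm_add_le _ _).trans (add_le_add ?_ ((norm_sum_le _ _).trans
      (Finset.sum_le_sum fun i _ => ?_)))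
    · rw [norm_smul, mul_comm]
      exact mul_le_mul_of_nonneg_left (hB _ (Metric.mem_ball_self hR)) (norm_nonneg _)
    · refine (hC i (4 * B / R) _ h4 hx4 le_rfl (g i) (hg i)).trans (le_of_eq ?_)
      ring

include hx in
theorem exists_functional_bound {k : ℕ} {ℓ : 𝒪.stalk x →ₗ[ℂ] ℂ}
    (hℓ : ∀ b ∈ charPow (𝒪.stalk x) k, ℓ b = 0) {R : ℝ} (hR : 0 < R) :
    ∃ C, 0 ≤ C ∧ ∀ (B : ℝ) (W : Opens (Fin n → ℂ)) (hW : (W : Set (Fin n → ℂ)) ⊆ φ.target)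
      (hx' : x ∈ chartPreimage φ W) (_ : ballOpens (φ x) R ≤ W) (t : ModelSec n m W),
      (∀ I, ∀ z ∈ ballOpens (φ x) R, ‖Holo.extend (ModelSec.coef W I t) z‖ ≤ B) →
        ‖ℓ (L.germ hW hx' t)‖ ≤ C * B := by
  choose C hC0 hC using fun I : Finset (Fin m) =>
    L.exists_functional_bound_tmul hx k (grassBasis m I) ℓ hℓ R hR
  refine ⟨∑ I, C I, Finset.sum_nonneg fun I _ => hC0 I, fun B W hW hx' hWR t hB => ?_⟩
  conv_lhs => rw [← ModelSec.sum_coef t, map_sum, map_sum]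
  rw [Finset.sum_mul]
  exact (norm_sum_le _ _).trans (Finset.sum_le_sum fun I _ => hC I B W hW hx' hWR _ (hB I))

end LocalModelIso

end SuperGeom

end

noncomputable section
namespace SuperGeom

/-! ### Coefficients of vector fields -/

open Filter Topology BoundedContinuousFunction
open scoped TensorProduct

/-- A vector space with two embeddings as a closed subspace of a Banach space is finite-dimensional
if the identity is a compact operator between the two induced norms. -/
theorem finiteDimensional_of_isCompact {X E E' : Type*} [AddCommGroup X] [Module ℂ X]
    [NormedAddCommGroup E] [NormedSpace ℂ E] [CompleteSpace E]
    [NormedAddCommGroup E'] [NormedSpace ℂ E'] [CompleteSpace E']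
    (e : X →ₗ[ℂ] E) (e' : X →ₗ[ℂ] E') (he' : Function.Injective e') (hle : ∀ x, ‖e' x‖ ≤ ‖e x‖)
    (hc : IsClosed (LinearMap.range e : Set E)) (hc' : IsClosed (LinearMap.range e' : Set E'))
    {K : Set E'} (hK : IsCompact K) (h : ∀ x, ‖e x‖ ≤ 1 → e' x ∈ K) : FiniteDimensional ℂ X := by
  have he : Function.Injective e := (injective_iff_map_eq_zero e).2 fun x hx =>
    (injective_iff_map_eq_zero e').1 he' x
      (norm_le_zero_iff.1 ((hle x).trans (by rw [hx, norm_zero])))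
  have := hc.completeSpace_coe
  have := hc'.completeSpace_coe
  let i := LinearEquiv.ofInjective e he
  let i' := LinearEquiv.ofInjective e' he'
  have hr : Continuous (i.symm.trans i') := by
    refine AddMonoidHomClass.continuous_of_bound (i.symm.trans i') 1 fun y => ?_
    obtain ⟨x, rfl⟩ := i.surjective y
    rw [LinearEquiv.trans_apply, LinearEquiv.symm_apply_apply, one_mul]
    exact hle x
  -- Both ranges are Banach spaces, so the continuous bijection between them has a continuous
  -- inverse and the two norms on `X` are equivalent.
  let r := (i.symm.trans i').toContinuousLinearEquivOfContinuous hr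
  obtain ⟨C, hC0, hC⟩ := (r.symm : LinearMap.range e' →L[ℂ] LinearMap.range e).bound
  have hC' : ∀ x, ‖e x‖ ≤ C * ‖e' x‖ := by
    intro x
    have h1 : r.symm (i' x) = i x := by
      rw [ContinuousLinearEquiv.symm_apply_eq]
      exact (congrArg i' (i.symm_apply_apply x)).symm
    have h2 := hC (i' x)
    have h3 : ‖(r.symm : LinearMap.range e' →L[ℂ] LinearMap.range e) (i' x)‖ = ‖e x‖ :=
      congrArg norm h1
    rw [h3] at h2
    exact h2
  have : FiniteDimensional ℂ (LinearMap.range e') := by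
    -- Elements of norm at most `C⁻¹` in the weaker norm have norm at most `1` in the stronger one
    -- and therefore lie in `K`. Riesz's theorem applies to this compact ball.
    refine FiniteDimensional.of_isCompact_closedBall₀ ℂ (inv_pos.2 hC0) ?_
    refine (hc'.isClosedEmbedding_subtypeVal.isCompact_preimage hK).of_isClosed_subset
      Metric.isClosed_closedBall fun y hy => ?_
    obtain ⟨x, rfl⟩ := i'.surjective y
    refine h x ((hC' x).trans ?_)
    rw [mem_closedBall_zero_iff] at hy
    calc C * ‖e' x‖ ≤ C * C⁻¹ := mul_le_mul_of_nonneg_left hy hC0.le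
      _ = 1 := mul_inv_cancel₀ hC0.ne'
  exact Module.Finite.equiv i'.symm

/-! ### Coefficients as bounded functions on balls -/

section Holo

variable {n : ℕ} {W : Opens (Fin n → ℂ)} {a : Fin n → ℂ} {ρ : ℝ}

theorem Holo.exists_bound (hW : Metric.closedBall a ρ ⊆ W) (f : Holo W) :
    ∃ C, ∀ z ∈ Metric.closedBall a ρ, ‖Holo.extend f z‖ ≤ C :=
  (isCompact_closedBall a ρ).exists_bound_of_continuousOn
    ((Holo.differentiableOn f).continuousOn.mono hW)

/-- Restriction of holomorphic functions to a relatively compact ball. -/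
def Holo.toBCF (hW : Metric.closedBall a ρ ⊆ W) : Holo W →ₗ[ℂ] (Metric.ball a ρ →ᵇ ℂ) where
  toFun f := ofNormedAddCommGroup (fun z => Holo.extend f z)
    (((Holo.differentiableOn f).continuousOn.mono
      (Metric.ball_subset_closedBall.trans hW)).domRestrict)
    (Holo.exists_bound hW f).choose
    fun z => (Holo.exists_bound hW f).choose_spec z (Metric.ball_subset_closedBall z.2)
  map_add' f g := by
    ext z
    exact congrFun (Holo.extend_add f g) z
  map_smul' c f := by
    ext z
    exact congrFun (Holo.extend_smul c f) z

end Holo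

namespace LocalModelIso

variable {M : Type u} [TopologicalSpace M] {𝒪 : SuperSheaf.{u, v} M} {n m : ℕ}
  {φ : OpenPartialHomeomorph M (Fin n → ℂ)} (L : LocalModelIso 𝒪 n m φ)

/-- The values of a vector field on the coordinates. -/
def derCrd (c : Fin n ⊕ Fin m) : Der 𝒪 ⊤ →ₗ[ℂ] ModelSec n m ⟨φ.target, φ.open_target⟩ where
  toFun D := L.iso ⟨φ.target, φ.open_target⟩ Set.Subset.rfl
    (𝒪.mkSec (fun y => (D.1 ⟨y, trivial⟩).1 (L.crd y.2.1 c))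
      (D.2 _ le_top _ (L.germ_sec Set.Subset.rfl (ModelSec.crd _ c))))
  map_add' D D' := by
    rw [← map_add]
    rfl
  map_smul' r D := by
    rw [← map_smul]
    rfl

theorem germ_derCrd (c : Fin n ⊕ Fin m) (D : Der 𝒪 ⊤) {x : M} (hx : x ∈ φ.source) {W : Opens (Fin n → ℂ)}
    (hW : (W : Set (Fin n → ℂ)) ⊆ φ.target) (hle : W ≤ ⟨φ.target, φ.open_target⟩)
    (hx' : x ∈ chartPreimage φ W) :
    L.germ hW hx' (ModelSec.res m hle (L.derCrd c D)) =
      (D.1 ⟨x, trivial⟩).1 (L.crd hx c) :=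
  (L.germ_res (W := ⟨φ.target, φ.open_target⟩) Set.Subset.rfl hW hx' _).trans
    (L.germ_iso _ _ _)

/-- The coefficients of a vector field on a relatively compact ball in a chart. -/
def derBCF {a : Fin n → ℂ} {ρ : ℝ} (h : Metric.closedBall a ρ ⊆ φ.target)
    (p : (Fin n ⊕ Fin m) × Finset (Fin m)) : Der 𝒪 ⊤ →ₗ[ℂ] (Metric.ball a ρ →ᵇ ℂ) :=
  Holo.toBCF h ∘ₗ ModelSec.coef _ p.2 ∘ₗ L.derCrd p.1

theorem derBCF_apply {a : Fin n → ℂ} {ρ : ℝ} (h : Metric.closedBall a ρ ⊆ φ.target)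
    (p : (Fin n ⊕ Fin m) × Finset (Fin m)) (D : Der 𝒪 ⊤) (z : Metric.ball a ρ) :
    L.derBCF h p D z = Holo.extend (ModelSec.coef _ p.2 (L.derCrd p.1 D)) z := rfl

theorem der_eq_zero_of_derBCF {a : Fin n → ℂ} {ρ : ℝ} (h : Metric.closedBall a ρ ⊆ φ.target)
    {D : Der 𝒪 ⊤} (hD : ∀ p, L.derBCF h p D = 0) {x : M}
    (hx : x ∈ chartPreimage φ (ballOpens a ρ)) : D.1 ⟨x, trivial⟩ = 0 := by
  have hW : ((ballOpens a ρ : Opens (Fin n → ℂ)) : Set (Fin n → ℂ)) ⊆ φ.target :=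
    Metric.ball_subset_closedBall.trans h
  have hle : ballOpens a ρ ≤ ⟨φ.target, φ.open_target⟩ := hW
  refine Subtype.ext (L.superDer_eq_zero hx.1 (D.1 ⟨x, trivial⟩).2 fun c => ?_)
  rw [← L.germ_derCrd c D hx.1 hW hle hx, ← ModelSec.sum_coef (ModelSec.res m hle (L.derCrd c D)),
    map_sum]
  refine Finset.sum_eq_zero fun I _ => ?_
  have h0 : ModelSec.coef (ballOpens a ρ) I (ModelSec.res m hle (L.derCrd c D)) = 0 := by
    rw [ModelSec.coef_res]
    refine Holo.ext_extend fun z hz => ?_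
    rw [Holo.extend_res _ _ hz, ← L.derBCF_apply h (c, I) D ⟨z, hz⟩, hD, Holo.extend_of_mem _ hz]
    rfl
  rw [h0, TensorProduct.zero_tmul, map_zero]

end LocalModelIso

end SuperGeom

end

noncomputable section
namespace SuperGeom

/-! ### Vector fields with given coefficients -/

open Filter Topology BoundedContinuousFunction
open scoped TensorProduct

theorem ModelSec.coef_sum_tmul {n m : ℕ} {W : Opens (Fin n → ℂ)} (g : Finset (Fin m) → Holo W)
    (I : Finset (Fin m)) : ModelSec.coef W I (∑ K, g K ⊗ₜ[ℂ] grassBasis m K) = g I := by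
  rw [map_sum, Finset.sum_eq_single I]
  · rw [ModelSec.coef_tmul, Module.Basis.coord_apply, Module.Basis.repr_self,
      Finsupp.single_eq_same, one_smul]
  · intro K _ hK
    rw [ModelSec.coef_tmul, Module.Basis.coord_apply, Module.Basis.repr_self,
      Finsupp.single_eq_of_ne (Ne.symm hK), zero_smul]
  · simp

namespace LocalModelIso

variable {M : Type u} [TopologicalSpace M] {𝒪 : SuperSheaf.{u, v} M} {n m : ℕ}
  {φ : OpenPartialHomeomorph M (Fin n → ℂ)} (L : LocalModelIso 𝒪 n m φ)

/-! ### Vector fields on a chart with prescribed coefficients -/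

section LocDer

variable {W : Opens (Fin n → ℂ)} (hW : (W : Set (Fin n → ℂ)) ⊆ φ.target)
  (g : Fin n ⊕ Fin m → ModelSec n m W) {x : M} (hx : x ∈ chartPreimage φ W)

/-- The germs of the vector field on a chart with given values on the coordinates. -/
def locDer : Module.End ℂ (𝒪.stalk x) :=
  ∑ c, LinearMap.mulLeft ℂ (L.germ hW hx (g c)) ∘ₗ L.der hx.1 c

theorem locDer_apply (s : 𝒪.stalk x) :
    L.locDer hW g hx s = ∑ c, L.germ hW hx (g c) * L.der hx.1 c s := by
  rw [locDer, LinearMap.sum_apply]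
  rfl

theorem locDer_mem_superDer
    (hcomm : ∀ i j : ZMod 2, ∀ a ∈ 𝒪.par x i, ∀ b ∈ 𝒪.par x j, a * b = sgn i j • (b * a)) :
    L.locDer hW g hx ∈ superDer (𝒪.par x) :=
  sum_mem fun c _ => mulLeft_mem_superDer hcomm _ (homDer_le _ _ (L.der_mem_homDer hx.1 c))

theorem locDer_crd (c : Fin n ⊕ Fin m) :
    L.locDer hW g hx (L.crd hx.1 c) = L.germ hW hx (g c) := by
  rw [locDer_apply, Finset.sum_eq_single c]
  · rw [der_crd, if_pos rfl, mul_one]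
  · intro c' _ hc'
    rw [der_crd, if_neg hc', mul_zero]
  · simp

theorem locDer_sec {V : Opens M} (hV : V ≤ chartPreimage φ W) (f : ∀ y : V, 𝒪.stalk y)
    (hf : f ∈ 𝒪.sec V) : (fun y : V => L.locDer hW g (hV y.2) (f y)) ∈ 𝒪.sec V := by
  have : (fun y : V => L.locDer hW g (hV y.2) (f y)) = ∑ c,
      (fun y : V => L.germ hW (hV y.2) (g c)) * fun y : V => L.der (hV y.2).1 c (f y) := by
    funext y
    rw [locDer_apply, Finset.sum_apply]
    rfl
  rw [this]
  exact sum_mem fun c _ => mul_mem (𝒪.res_mem _ V hV _ (L.germ_sec hW (g c)))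
    (L.stalkOp_sec _ (fun y hy => (hV hy).1) f hf)

/-- On a germ `s` the two fields differ by the sum over the coordinates of (difference of
coefficients) times `∂_c s`. Multiplying by `∂_c s` on the right preserves the condition on `ℓ`, so
the bound for functionals gives a constant that depends on `ℓ` and `s` but not on `D`. -/
theorem exists_locDer_bound
    (hcomm : ∀ i j : ZMod 2, ∀ a ∈ 𝒪.par x i, ∀ b ∈ 𝒪.par x j, a * b = sgn i j • (b * a))
    (hle : W ≤ ⟨φ.target, φ.open_target⟩) {k : ℕ}
    {ℓ : 𝒪.stalk x →ₗ[ℂ] ℂ} (hℓ : ∀ b ∈ charPow (𝒪.stalk x) k, ℓ b = 0) (s : 𝒪.stalk x) :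
    ∃ C, ∀ (B : ℝ) (D : Der 𝒪 ⊤), (∀ c I, ∀ z ∈ W,
      ‖Holo.extend (ModelSec.coef _ I (L.derCrd c D)) z - Holo.extend (ModelSec.coef W I (g c)) z‖ ≤
        B) → ‖ℓ ((D.1 ⟨x, trivial⟩).1 s) - ℓ (L.locDer hW g hx s)‖ ≤ C * B := by
  obtain ⟨R, hR, hRW⟩ := Metric.isOpen_iff.1 W.isOpen _ hx.2
  have h1 : ∀ c, ∀ b ∈ charPow (𝒪.stalk x) k,
      (ℓ ∘ₗ LinearMap.mulRight ℂ (L.der hx.1 c s)) b = 0 :=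
    fun c b hb => hℓ _ (mul_mem_charPow hb _)
  choose C hC0 hC using fun c => L.exists_functional_bound hx.1 (h1 c) hR
  refine ⟨∑ c, C c, fun B D hD => ?_⟩
  have h2 : (D.1 ⟨x, trivial⟩).1 s - L.locDer hW g hx s =
      ∑ c, L.germ hW hx (ModelSec.res m hle (L.derCrd c D) - g c) * L.der hx.1 c s := by
    rw [locDer_apply]
    have := LinearMap.congr_fun (L.superDer_eq_sum hx.1 hcomm (D.1 ⟨x, trivial⟩).2) s
    rw [LinearMap.sum_apply] at this
    rw [this, ← Finset.sum_sub_distrib]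
    refine Finset.sum_congr rfl fun c _ => ?_
    rw [map_sub, sub_mul, L.germ_derCrd c D hx.1 hW hle hx]
    rfl
  rw [← map_sub, h2, map_sum, Finset.sum_mul]
  refine (norm_sum_le _ _).trans (Finset.sum_le_sum fun c _ => hC c B W hW hx hRW _ fun I z hz => ?_)
  rw [(map_sub _ _ _ : ModelSec.coef W I (ModelSec.res m hle (L.derCrd c D) - g c) = _),
    ModelSec.coef_res, sub_eq_add_neg, ← neg_one_smul ℂ, Holo.extend_add, Holo.extend_smul,
    Pi.add_apply, Holo.extend_res _ _ (hRW hz), neg_one_smul, Pi.neg_apply, ← sub_eq_add_neg]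
  exact hD c I z (hRW hz)

end LocDer

variable {a : Fin n → ℂ} {ρ : ℝ}

/-- Convergence in the sup norm is uniform convergence on the ball, which preserves holomorphy. -/
theorem exists_holo_of_tendsto (h : Metric.closedBall a ρ ⊆ φ.target)
    (p : (Fin n ⊕ Fin m) × Finset (Fin m)) (D : ℕ → Der 𝒪 ⊤) (G : Metric.ball a ρ →ᵇ ℂ)
    (hG : Tendsto (fun ν => L.derBCF h p (D ν)) atTop (𝓝 G)) :
    ∃ g : Holo (ballOpens a ρ), ∀ z : Metric.ball a ρ, Holo.extend g z = G z := by
  classical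
  let G' : (Fin n → ℂ) → ℂ := fun z => if hz : z ∈ Metric.ball a ρ then G ⟨z, hz⟩ else 0
  have hG' : ∀ z : Metric.ball a ρ, G' z = G z := fun z => dif_pos z.2
  have h1 : TendstoUniformlyOn
      (fun ν => Holo.extend (ModelSec.coef _ p.2 (L.derCrd p.1 (D ν)))) G' atTop
      (Metric.ball a ρ) := by
    rw [tendstoUniformlyOn_iff_tendstoUniformly_comp_coe]
    have := tendsto_iff_tendstoUniformly.1 hG
    have h2 : G' ∘ ((↑) : Metric.ball a ρ → _) = G := funext hG'
    rw [h2]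
    exact this
  have h2 : DifferentiableOn ℂ G' (Metric.ball a ρ) := by
    refine differentiableOn_of_tendstoUniformlyOn Metric.isOpen_ball (fun ν =>
      (Holo.differentiableOn _).mono (Metric.ball_subset_closedBall.trans h)) h1
  exact ⟨Holo.of G' h2, fun z => (Holo.extend_of G' h2 z.2).trans (hG' z)⟩

end LocalModelIso

/-! ### Closedness of the space of coefficients of global vector fields -/

section Global

variable {M : Type u} [TopologicalSpace M] {𝒪 : SuperSheaf.{u, v} M} {n m : ℕ}
  {J : Type*} [Fintype J] {φ : J → OpenPartialHomeomorph M (Fin n → ℂ)}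
  (L : ∀ j, LocalModelIso 𝒪 n m (φ j)) {a : J → Fin n → ℂ} {ρ : J → ℝ}
  (h : ∀ j, Metric.closedBall (a j) (ρ j) ⊆ (φ j).target)

/-- The coefficients of a vector field on relatively compact balls in finitely many charts. -/
def derCoefs : Der 𝒪 ⊤ →ₗ[ℂ]
    ∀ (j : J) (_ : (Fin n ⊕ Fin m) × Finset (Fin m)), (Metric.ball (a j) (ρ j) →ᵇ ℂ) :=
  LinearMap.pi fun j => LinearMap.pi fun p => (L j).derBCF (h j) p

variable (hcov : ∀ x : M, ∃ j, x ∈ chartPreimage (φ j) (ballOpens (a j) (ρ j)))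

include hcov in
omit [Fintype J] in
theorem derCoefs_injective : Function.Injective (derCoefs L h) := by
  refine (injective_iff_map_eq_zero _).2 fun D hD => SectionSheaf.ext fun x => ?_
  obtain ⟨j, hj⟩ := hcov x
  exact (L j).der_eq_zero_of_derBCF (h j) (fun p => congrFun (congrFun hD j) p) hj

-- A limit of coefficient families gives holomorphic coefficients on each ball, hence local vector
-- fields. It remains to show that these agree on overlaps, which is done by testing with the
-- functionals attached to the characters of the stalk, since these functionals do not depend on the
-- chart.
include hcov in
theorem isClosed_range_derCoefs
    (hcomm : ∀ (x : M) (i j : ZMod 2), ∀ a ∈ 𝒪.par x i, ∀ b ∈ 𝒪.par x j, a * b = sgn i j • (b * a)) :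
    IsClosed (LinearMap.range (derCoefs L h) : Set (∀ (j : J)
      (_ : (Fin n ⊕ Fin m) × Finset (Fin m)), (Metric.ball (a j) (ρ j) →ᵇ ℂ))) := by
  refine isClosed_of_closure_subset fun G hG => ?_
  obtain ⟨u, hu, huG⟩ := mem_closure_iff_seq_limit.1 hG
  choose D hD using hu
  have hDG : Tendsto (fun ν => derCoefs L h (D ν)) atTop (𝓝 G) := by
    rwa [show (fun ν => derCoefs L h (D ν)) = u from funext hD]
  have hb : ∀ j, ((ballOpens (a j) (ρ j) : Opens (Fin n → ℂ)) : Set (Fin n → ℂ)) ⊆ (φ j).target :=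
    fun j => Metric.ball_subset_closedBall.trans (h j)
  have hle : ∀ j, ballOpens (a j) (ρ j) ≤ ⟨(φ j).target, (φ j).open_target⟩ := hb
  choose g hg using fun j p => (L j).exists_holo_of_tendsto (h j) p D (G j p)
    (tendsto_pi_nhds.1 (tendsto_pi_nhds.1 hDG j) p)
  let t : ∀ j, Fin n ⊕ Fin m → ModelSec n m (ballOpens (a j) (ρ j)) :=
    fun j c => ∑ I, g j (c, I) ⊗ₜ grassBasis m I
  have ht : ∀ j c I, ModelSec.coef _ I (t j c) = g j (c, I) :=
    fun j c I => ModelSec.coef_sum_tmul _ I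
  -- In every chart separately, the functionals applied to the approximating fields converge to
  -- their values on the local limit field.
  have hlim : ∀ j x (hx : x ∈ chartPreimage (φ j) (ballOpens (a j) (ρ j))) (k : ℕ)
      (ℓ : 𝒪.stalk x →ₗ[ℂ] ℂ), (∀ b ∈ charPow (𝒪.stalk x) k, ℓ b = 0) → ∀ s,
      Tendsto (fun ν => ℓ (((D ν).1 ⟨x, trivial⟩).1 s)) atTop
        (𝓝 (ℓ ((L j).locDer (hb j) (t j) hx s))) := by
    intro j x hx k ℓ hℓ s
    obtain ⟨C, hC⟩ := (L j).exists_locDer_bound (hb j) (t j) hx (hcomm x) (hle j) hℓ s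
    have h0 : Tendsto (fun ν => C * ‖derCoefs L h (D ν) - G‖) atTop (𝓝 0) := by
      have := (tendsto_iff_norm_sub_tendsto_zero.1 hDG).const_mul C
      rwa [mul_zero] at this
    refine tendsto_iff_norm_sub_tendsto_zero.2 (squeeze_zero (fun _ => norm_nonneg _)
      (fun ν => hC _ (D ν) fun c I z hz => ?_) h0)
    rw [ht, hg j (c, I) ⟨z, hz⟩, ← (L j).derBCF_apply (h j) (c, I) (D ν) ⟨z, hz⟩]
    exact ((((L j).derBCF (h j) (c, I) (D ν) - G j (c, I)).norm_coe_le_norm ⟨z, hz⟩).trans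
      (norm_le_pi_norm ((derCoefs L h (D ν) - G) j) (c, I))).trans
      (norm_le_pi_norm (derCoefs L h (D ν) - G) j)
  -- The approximating sequence and the functional are the same in both charts, so uniqueness of
  -- limits identifies the values on the two local fields, and the functionals separate germs.
  have hagree : ∀ j j' x (hx : x ∈ chartPreimage (φ j) (ballOpens (a j) (ρ j)))
      (hx' : x ∈ chartPreimage (φ j') (ballOpens (a j') (ρ j'))),
      (L j).locDer (hb j) (t j) hx = (L j').locDer (hb j') (t j') hx' := by
    intro j j' x hx hx'
    refine LinearMap.ext fun s => sub_eq_zero.1 ((L j).eq_zero_of_functional_eq_zero hx.1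
      fun k ℓ hℓ => ?_)
    rw [map_sub, sub_eq_zero]
    exact tendsto_nhds_unique (hlim j x hx k ℓ hℓ s) (hlim j' x hx' k ℓ hℓ s)
  -- At each point any ball containing it may be used, because the local fields agree. Near a given
  -- point the resulting family is therefore a single local field and maps sections to sections.
  choose c hc using hcov
  let δ : ∀ x : (⊤ : Opens M), SDer (𝒪.par x) := fun x =>
    (⟨_, (L (c x)).locDer_mem_superDer (hb _) (t _) (hc x) (hcomm x)⟩ : superDer (𝒪.par x))
  have hδ : ∀ j x (hx : x ∈ chartPreimage (φ j) (ballOpens (a j) (ρ j))),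
      (δ ⟨x, trivial⟩).1 = (L j).locDer (hb j) (t j) hx := fun j x hx => hagree _ _ _ _ _
  have hsec : δ ∈ (derSheaf 𝒪).sec ⊤ := by
    intro V _ f hf
    refine 𝒪.glue _ _ fun x => ⟨V ⊓ chartPreimage (φ (c x)) (ballOpens (a _) (ρ _)), inf_le_left,
      ⟨x.2, hc x⟩, ?_⟩
    have := (L (c x)).locDer_sec (hb _) (t _) inf_le_right _
      (𝒪.res_mem V (V ⊓ chartPreimage (φ (c x)) (ballOpens (a _) (ρ _))) inf_le_left f hf)
    convert this using 1
    funext y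
    exact LinearMap.congr_fun (hδ (c x) y y.2.2) _
  obtain ⟨E, hE⟩ : ∃ E : Der 𝒪 ⊤, E.1 = δ := ⟨(⟨δ, hsec⟩ : (derSheaf 𝒪).sec ⊤), rfl⟩
  refine ⟨E, funext fun j => funext fun p => ?_⟩
  refine BoundedContinuousFunction.ext fun z => ?_
  -- The coefficients of the glued field are compared with the limit at the point of `M` lying over
  -- `z`. There the field and the local limit take the same values on the coordinates, and equal
  -- germs have equal coefficients.
  have hz : φ j ((φ j).symm z) = z := (φ j).right_inv (hb j z.2)
  have hx : (φ j).symm z ∈ chartPreimage (φ j) (ballOpens (a j) (ρ j)) :=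
    mem_chartPreimage ((φ j).map_target (hb j z.2)) (by rw [hz]; exact z.2)
  have h1 : (L j).germ (hb j) hx (ModelSec.res m (hle j) ((L j).derCrd p.1 E)) = (L j).germ (hb j) hx (t j p.1) := by
    rw [(L j).germ_derCrd p.1 _ hx.1 (hb j) (hle j) hx, ← (L j).locDer_crd (hb j) (t j) hx, hE]
    exact LinearMap.congr_fun (hδ j _ hx) _
  have h2 := ((L j).coef_eventuallyEq (hb j) (hb j) hx hx h1 p.2).eq_of_nhds
  rw [hz, ModelSec.coef_res, Holo.extend_res _ _ z.2, ht, hg] at h2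
  exact h2

end Global

end SuperGeom

end

noncomputable section
namespace SuperGeom

/-! ### Compact supermanifolds -/

open Filter Topology BoundedContinuousFunction

/-- The vector fields on a compact complex supermanifold form a finite-dimensional space. -/
theorem finiteDimensional_der {M : Type u} [TopologicalSpace M] [CompactSpace M]
    {𝒪 : SuperSheaf.{u, v} M} {n m : ℕ} (h𝒪 : IsComplexSupermanifold 𝒪 n m) :
    FiniteDimensional ℂ (Der 𝒪 ⊤) := by
  choose φ hφ hL using h𝒪.locally_model
  choose R hR hRt using fun x =>
    Metric.nhds_basis_closedBall.mem_iff.1 ((φ x).open_target.mem_nhds ((φ x).map_source (hφ x)))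
  -- The half balls must already cover `M`, so that the coefficients on them determine a vector
  -- field. The coefficients on the full balls then control a compact family on the half balls.
  obtain ⟨T, hT⟩ := isCompact_univ.elim_finite_subcover
    (fun x => (chartPreimage (φ x) (ballOpens (φ x x) (R x / 2)) : Set M))
    (fun x => (chartPreimage (φ x) (ballOpens (φ x x) (R x / 2))).isOpen) fun x _ =>
      Set.mem_iUnion.2 ⟨x, mem_chartPreimage (hφ x) (Metric.mem_ball_self (half_pos (hR x)))⟩
  have hcov : ∀ x, ∃ j : T, x ∈ chartPreimage (φ j) (ballOpens (φ j j) (R j / 2)) := fun x => by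
    obtain ⟨j, hj, hx⟩ := Set.mem_iUnion₂.1 (hT (Set.mem_univ x))
    exact ⟨⟨j, hj⟩, hx⟩
  have hhalf : ∀ j, R j / 2 ≤ R j := fun j => (half_lt_self (hR j)).le
  have hcov' : ∀ x, ∃ j : T, x ∈ chartPreimage (φ j) (ballOpens (φ j j) (R j)) := fun x => by
    obtain ⟨j, hj⟩ := hcov x
    exact ⟨j, hj.1, Metric.ball_subset_ball (hhalf j) hj.2⟩
  let L : ∀ j : T, LocalModelIso 𝒪 n m (φ j) := fun j => (hL j).some
  have h1 : ∀ j : T, Metric.closedBall (φ j j) (R j) ⊆ (φ j).target := fun j => hRt j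
  have h2 : ∀ j : T, Metric.closedBall (φ j j) (R j / 2) ⊆ (φ j).target := fun j =>
    (Metric.closedBall_subset_closedBall (hhalf j)).trans (hRt j)
  choose K hK hKf using fun j : T => exists_isCompact_restrict (φ j j) (hR j)
  -- Montel's theorem gives compactness for functions on the closed half ball, whereas coefficients
  -- are recorded on the open one. Restriction is continuous and carries the compact sets over.
  let r : ∀ j : T, C(Metric.ball (φ j j) (R j / 2), Metric.closedBall (φ j j) (R j / 2)) :=
    fun j => ⟨Set.inclusion Metric.ball_subset_closedBall, continuous_inclusion _⟩
  have hK' : IsCompact (Set.univ.pi fun j => Set.univ.pi fun _ : (Fin n ⊕ Fin m) × Finset (Fin m) =>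
      (fun f => BoundedContinuousFunction.compContinuous f (r j)) '' K j) :=
    isCompact_univ_pi fun j => isCompact_univ_pi fun _ =>
      (hK j).image (BoundedContinuousFunction.continuous_compContinuous (r j))
  refine finiteDimensional_of_isCompact (derCoefs L h1) (derCoefs L h2)
    (derCoefs_injective L h2 hcov) (fun D => ?_)
    (isClosed_range_derCoefs L h1 hcov' h𝒪.supercommutative)
    (isClosed_range_derCoefs L h2 hcov h𝒪.supercommutative) hK' fun D hD => ?_
  · refine (pi_norm_le_iff_of_nonneg (norm_nonneg _)).2 fun j =>
      (pi_norm_le_iff_of_nonneg (norm_nonneg _)).2 fun p =>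
        (norm_le (norm_nonneg _)).2 fun z => ?_
    exact ((((L j).derBCF (h1 j) p D).norm_coe_le_norm
      ⟨z, Metric.ball_subset_ball (hhalf j) z.2⟩).trans
      (norm_le_pi_norm (derCoefs L h1 D j) p)).trans (norm_le_pi_norm (derCoefs L h1 D) j)
  · refine fun j _ p _ => ?_
    let g := Holo.extend (ModelSec.coef _ p.2 ((L j).derCrd p.1 D))
    have hg : DifferentiableOn ℂ g (φ j).target := Holo.differentiableOn _
    refine ⟨mkOfCompact ⟨fun z => g z, (hg.continuousOn.mono (h2 j)).domRestrict⟩,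
      hKf j _ ⟨g, hg.mono (Metric.ball_subset_closedBall.trans (h1 j)), fun z hz => ?_,
        fun _ => rfl⟩, rfl⟩
    exact ((((L j).derBCF (h1 j) p D).norm_coe_le_norm ⟨z, hz⟩).trans
      (norm_le_pi_norm (derCoefs L h1 D j) p)).trans
      ((norm_le_pi_norm (derCoefs L h1 D) j).trans hD)

end SuperGeom

end


theorem mainTheorem6 {M : Type u} [TopologicalSpace M] (𝒪 : SuperSheaf.{u, v} M) (n m : ℕ)
    (h𝒪 : IsComplexSupermanifold 𝒪 n m) :
    (∀ U : Opens M, IsFilteredLieSuperalgebra (derPar 𝒪 U) (derBr 𝒪 U) (derFil 𝒪 U)) ∧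
    (∀ (U V : Opens M) (h : V ≤ U),
      (∀ i, ∀ δ ∈ derPar 𝒪 U i, (derSheaf 𝒪).res h δ ∈ derPar 𝒪 V i) ∧
      (∀ p, ∀ δ ∈ derFil 𝒪 U p, (derSheaf 𝒪).res h δ ∈ derFil 𝒪 V p) ∧
      ∀ δ η, (derSheaf 𝒪).res h (derBr 𝒪 U δ η) =
        derBr 𝒪 V ((derSheaf 𝒪).res h δ) ((derSheaf 𝒪).res h η)) ∧
    (∀ U : Opens M,
      IsGradedLieSuperalgebra (grDerPar 𝒪 U) (grDerBr 𝒪 U) (grDerDeg 𝒪 U) ∧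
      IsGradedLieSuperalgebra (derPar 𝒪.gr U) (derBr 𝒪.gr U) (derGrDeg 𝒪 U)) ∧
    (∃! Φ : ∀ U : Opens M, GrDer 𝒪 U ≃ₗ[ℂ] Der 𝒪.gr U,
      (∀ (U V : Opens M) (h : V ≤ U) (s : GrDer 𝒪 U),
        Φ V ((grDerSheaf 𝒪).res h s) = (derSheaf 𝒪.gr).res h (Φ U s)) ∧
      (∀ U : Opens M, IsGradedLieHom (grDerPar 𝒪 U) (grDerBr 𝒪 U) (grDerDeg 𝒪 U)
        (derPar 𝒪.gr U) (derBr 𝒪.gr U) (derGrDeg 𝒪 U) (Φ U).toLinearMap) ∧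
      (∀ (U : Opens M) (p : ℤ) (δ : derFil 𝒪 U p),
        IsInducedBy 𝒪 U p δ.1 (Φ U (toGrDer 𝒪 U (Gr.cl _ p δ))))) ∧
    IsGradedLieSuperalgebra (grOfDerPar 𝒪 ⊤) (grOfDerBr 𝒪 ⊤) (grOfDerDeg 𝒪 ⊤) ∧
    (∃! Ψ : GrOfDer 𝒪 ⊤ →ₗ[ℂ] Der 𝒪.gr ⊤,
      Function.Injective Ψ ∧
      IsGradedLieHom (grOfDerPar 𝒪 ⊤) (grOfDerBr 𝒪 ⊤) (grOfDerDeg 𝒪 ⊤)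
        (derPar 𝒪.gr ⊤) (derBr 𝒪.gr ⊤) (derGrDeg 𝒪 ⊤) Ψ ∧
      (∀ (p : ℤ) (δ : derFil 𝒪 ⊤ p), IsInducedBy 𝒪 ⊤ p δ.1 (Ψ (Gr.cl _ p δ)))) ∧
    (CompactSpace M → FiniteDimensional ℂ (Der 𝒪 ⊤)) := by
  have h := h𝒪.locallySplit
  refine ⟨isFilteredLieSuperalgebra_der 𝒪, der_res 𝒪, fun U =>
    ⟨isGradedLieSuperalgebra_grDer h U, isGradedLieSuperalgebra_derGr h U⟩,
    existsUnique_grDerEquiv h, isGradedLieSuperalgebra_grOfDer h ⊤, existsUnique_grOfDerHom h ⊤,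
    fun _ => finiteDimensional_der h𝒪⟩
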